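/- Let $A$ be a finite abelian group with a nondegenerate quadratic form $q(\lambda)=\lambda^2/2\in\mathbb Q/\mathbb Z$ and bilinear form $(\cdot,\cdot)$ (a discriminant form). Write $e(x)=e^{2\pi i x}$. Let $N$ be its level (the least positive integer with $Nq(\lambda)=0$ for all $\lambda\in A$). For an integer $d$ put $g_d(A)=\sum_{\lambda\in A}e(d\,q(\lambda))$ and $g(A)=g_1(A)$, and let $\operatorname{sig}(A)\in\mathbb Z/8\mathbb Z$ be the signature, determined by Milgram's formula $g(A)=\sqrt{|A|}\,e(\operatorname{sig}(A)/8)$. Let $\mathbb H$ be the upper half plane and $\Gamma=\mathrm{SL}_2(\mathbb Z)$. The metaplectic cover of $\mathrm{GL}_2^+(\mathbb Q)$ consists of pairs $(M,\phi)$ with $M=\begin{pmatrix}a&b\\c&d\end{pmatrix}$ and $\phi$ holomorphic on $\mathbb H$, $\phi(\tau)^2=c\tau+d$, with product $(M,\phi)(M',\phi')=(MM',\phi(M'\tau)\phi'(\tau))$; let $\tilde\Gamma$ be the inverse image of $\Gamma$ in it. Let $\rho_A$ be the Weil representation of $\tilde\Gamma$ on $\mathbb C[A]=\bigoplus_{\lambda}\mathbb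 C\mathfrak e_\lambda$, determined by $$\rho_A(T)\mathfrak e_\lambda=e(q(\lambda))\mathfrak e_\lambda,\qquad \rho_A(S)\mathfrak e_\lambda=\frac{e(-\operatorname{sig}(A)/8)}{\sqrt{|A|}}\sum_{\mu\in A}e(-(\lambda,\mu))\mathfrak e_\mu ,$$ where $T=\left(\begin{pmatrix}1&1\\0&1\end{pmatrix},1\right)$ and $S=\left(\begin{pmatrix}0&-1\\1&0\end{pmatrix},\sqrt\tau\right)$. For $k\in\frac12\mathbb Z$ let $M_{k,A}$ be the space of holomorphic $f:\mathbb H\to\mathbb C[A]$ with $f(M\tau)=\phi(\tau)^{2k}\rho_A(M,\phi)f(\tau)$ for all $(M,\phi)\in\tilde\Gamma$ that are holomorphic at $\infty$, let $S_{k,A}$ be the subspace of cusp forms, and let $(f,g)=\int_{\Gamma\backslash\mathbb H}\langle f,g\rangle\,y^k\,\frac{dx\,dy}{y^2}$ be the Petersson scalar product, which is defined when $f$ or $g$ is a cusp form. For a positive integer $m$ coprime to $N$ let $\alpha_m=\begin{pmatrix}m^2&0\\0&1\end{pmatrix}$ and define $T(m^2)^*$ on $M_{k,A}$ as follows. (a)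 $\operatorname{sig}(A)$ even. ($M_{k,A}=0$ unless $k\in\mathbb Z$.) For $M\in\mathrm{GL}_2^+(\mathbb Q)$ integral at $N$ and $r\in(\mathbb Z/N)^\times$ with $\det M\equiv r^2\pmod N$ put $\rho_A(M,r)=\frac{g(A)}{g_r(A)}\rho_A(\gamma)$, where $\gamma\in\Gamma$ is any element with $\gamma\equiv r^{-1}M\pmod N$ (for even signature $\rho_A$ factors through $\mathrm{SL}_2(\mathbb Z/N)$), and let $f|_{k,A}(M,r)(\tau)=\det(M)^{k/2}(c\tau+d)^{-k}\rho_A(M,r)^{-1}f(M\tau)$. Then $$f\mid T(m^2)^*=\det(\alpha_m)^{k/2-1}\sum_{\gamma\in\Gamma\backslash\Gamma\alpha_m\Gamma}f|_{k,A}(\gamma,m).$$ (b) $\operatorname{sig}(A)$ odd. In the group of triples $((M,\phi),r,u)$ with $(M,\phi)$ in the metaplectic cover, $r\in(\mathbb Z/N)^\times$ and $u\in\mathrm{GL}(\mathbb C[A])$, let $\Delta=\{(\gamma,1,\rho_A(\gamma)):\gamma\in\tilde\Gamma\}$ and $\xi_m=((\alpha_m,1),m,u_m)$ with $u_m\mathfrak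 e_\lambda=\mathfrak e_{m^{-1}\lambda}$, and let $f|_{k,A}((M,\phi),r,u)(\tau)=\det(M)^{k/2}\phi(\tau)^{-2k}u^{-1}f(M\tau)$. Then $$f\mid T(m^2)^*=\det(\alpha_m)^{k/2-1}\sum_{\xi\in\Delta\backslash\Delta\xi_m\Delta}f|_{k,A}\xi.$$ Theorem. For every positive integer $m$ coprime to $N$, $T(m^2)^*$ is a linear endomorphism of $M_{k,A}$. The operators $T(m^2)^*$ ($m$ coprime to $N$) generate a commutative $\mathbb C$-subalgebra of $\operatorname{End}(M_{k,A})$, and this subalgebra is already generated by the operators $T(p^2)^*$ for primes $p$ not dividing $N$. The operators $T(m^2)^*$ map cusp forms to cusp forms, and they are self-adjoint for the Petersson scalar product: if $f,g\in M_{k,A}$ and $f$ or $g$ is a cusp form, then the integrals defining $(f\mid T(m^2)^*,g)$ and $(f,g\mid T(m^2)^*)$ converge absolutely and are equal. -/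

import Mathlib

open scoped MatrixGroups UpperHalfPlane Manifold

noncomputable section

namespace VVHecke

/-! ### The group `GL₂⁺(ℚ)`, its action on `ℍ`, and its metaplectic cover -/

/-- The inclusion `GL₂⁺(ℚ) → GL₂(ℝ)`. -/
def toGLReal : GL(2, ℚ)⁺ →* GL (Fin 2) ℝ :=
  (Matrix.GeneralLinearGroup.map (algebraMap ℚ ℝ)).comp (Matrix.GLPos (Fin 2) ℚ).subtype

/-- The inclusion of `Γ = SL₂(ℤ)` into `GL₂⁺(ℚ)`. -/
def ofSL : SL(2, ℤ) →* GL(2, ℚ)⁺ :=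
  Matrix.SpecialLinearGroup.toGLPos.comp
    (Matrix.SpecialLinearGroup.map (Int.castRingHom ℚ))

/-- The underlying matrix of an element of `GL₂⁺(ℚ)`. -/
def mat (M : GL(2, ℚ)⁺) : Matrix (Fin 2) (Fin 2) ℚ := M.1.1

/-- The determinant of an element of `GL₂⁺(ℚ)`. -/
def detQ (M : GL(2, ℚ)⁺) : ℚ := (mat M).det

/-- The Möbius action `τ ↦ (aτ + b) / (cτ + d)`. -/
def moebius (M : GL(2, ℚ)⁺) (τ : ℍ) : ℍ := toGLReal M • τ

/-- The automorphy factor `j(M, τ) = cτ + d`. -/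
def autJ (M : GL(2, ℚ)⁺) (τ : ℍ) : ℂ := UpperHalfPlane.denom (toGLReal M) τ

lemma detQ_pos (M : GL(2, ℚ)⁺) : 0 < detQ M := M.2

lemma toGLReal_det_pos (M : GL(2, ℚ)⁺) : 0 < (toGLReal M).det.val := by
  have h : (toGLReal M).det.val = ((detQ M : ℚ) : ℝ) := by
    simp [toGLReal, detQ, mat, Matrix.det_fin_two]
  rw [h]
  exact_mod_cast detQ_pos M

lemma autJ_eq (M : GL(2, ℚ)⁺) (τ : ℍ) :
    autJ M τ = (mat M 1 0 : ℂ) * τ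
      + (mat M 1 1 : ℂ) := by
  simp [autJ, UpperHalfPlane.denom, toGLReal, mat]

lemma autJ_ne_zero (M : GL(2, ℚ)⁺) (τ : ℍ) : autJ M τ ≠ 0 :=
  UpperHalfPlane.denom_ne_zero _ τ

lemma autJ_one (τ : ℍ) : autJ 1 τ = 1 := by simp [autJ]

lemma moebius_one (τ : ℍ) : moebius 1 τ = τ := by simp [moebius]

lemma moebius_mul (M M' : GL(2, ℚ)⁺) (τ : ℍ) :
    moebius (M * M') τ = moebius M (moebius M' τ) := by
  simp [moebius, mul_smul]

lemma autJ_mul (M M' : GL(2, ℚ)⁺) (τ : ℍ) :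
    autJ (M * M') τ = autJ M (moebius M' τ) * autJ M' τ := by
  have h := UpperHalfPlane.denom_cocycle_σ (toGLReal M) (toGLReal M') τ
  rw [UpperHalfPlane.σ, if_pos (toGLReal_det_pos M')] at h
  simpa [autJ, moebius] using h

lemma mdifferentiable_autJ (M : GL(2, ℚ)⁺) : MDifferentiable 𝓘(ℂ) 𝓘(ℂ) (autJ M) :=
  UpperHalfPlane.mdifferentiable_denom _

lemma mdifferentiable_moebius (M : GL(2, ℚ)⁺) : MDifferentiable 𝓘(ℂ) 𝓘(ℂ) (moebius M) :=
  UpperHalfPlane.mdifferentiable_smul (toGLReal_det_pos M)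

/-- The metaplectic two-fold cover of `GL₂⁺(ℚ)`: pairs `(M, φ)` with `φ` holomorphic on `ℍ` and
`φ(τ)² = cτ + d`. -/
@[ext]
structure Mp where
  M : GL(2, ℚ)⁺
  φ : ℍ → ℂ
  holo : MDifferentiable 𝓘(ℂ) 𝓘(ℂ) φ
  sq : ∀ τ, φ τ ^ 2 = autJ M τ

namespace Mp

lemma φ_ne_zero (g : Mp) (τ : ℍ) : g.φ τ ≠ 0 := fun h =>
  autJ_ne_zero g.M τ (by rw [← g.sq, h]; simp)

instance : Mul Mp where
  mul g g' :=
    { M := g.M * g'.M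
      φ := fun τ => g.φ (moebius g'.M τ) * g'.φ τ
      holo := (g.holo.comp (mdifferentiable_moebius g'.M)).mul g'.holo
      sq := fun τ => by rw [mul_pow, g.sq, g'.sq, autJ_mul] }

instance : One Mp where
  one :=
    { M := 1
      φ := fun _ => 1
      holo := mdifferentiable_const
      sq := fun τ => by rw [autJ_one]; simp }

lemma mdifferentiable_inv_comp (g : Mp) :
    MDifferentiable 𝓘(ℂ) 𝓘(ℂ) (fun τ => (g.φ (moebius g.M⁻¹ τ))⁻¹) := by
  have h : MDifferentiable 𝓘(ℂ) 𝓘(ℂ) (fun τ => g.φ (moebius g.M⁻¹ τ)) :=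
    g.holo.comp (mdifferentiable_moebius g.M⁻¹)
  rw [UpperHalfPlane.mdifferentiable_iff] at h ⊢
  exact h.inv fun z _ => g.φ_ne_zero _

instance : Inv Mp where
  inv g :=
    { M := g.M⁻¹
      φ := fun τ => (g.φ (moebius g.M⁻¹ τ))⁻¹
      holo := g.mdifferentiable_inv_comp
      sq := fun τ => by
        have h := autJ_mul g.M g.M⁻¹ τ
        rw [mul_inv_cancel, autJ_one] at h
        rw [inv_pow, g.sq]
        exact (eq_inv_of_mul_eq_one_right h.symm).symm }

lemma mul_M (g h : Mp) : (g * h).M = g.M * h.M := rfl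
lemma mul_φ (g h : Mp) (τ : ℍ) : (g * h).φ τ = g.φ (moebius h.M τ) * h.φ τ := rfl
lemma one_M : (1 : Mp).M = 1 := rfl
lemma one_φ (τ : ℍ) : (1 : Mp).φ τ = 1 := rfl
lemma inv_M (g : Mp) : (g⁻¹).M = g.M⁻¹ := rfl
lemma inv_φ (g : Mp) (τ : ℍ) : (g⁻¹).φ τ = (g.φ (moebius g.M⁻¹ τ))⁻¹ := rfl

instance : Group Mp :=
  Group.ofLeftAxioms
    (fun a b c => by
      ext τ
      · simp only [mul_M, mul_assoc]
      · simp only [mul_φ, mul_M, moebius_mul, mul_assoc])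
    (fun a => by
      ext τ
      · simp only [mul_M, one_M, one_mul]
      · simp only [mul_φ, one_φ, one_mul])
    (fun a => by
      ext τ
      · simp only [mul_M, inv_M, one_M, inv_mul_cancel]
      · simp only [mul_φ, inv_φ, one_φ]
        rw [← moebius_mul, inv_mul_cancel, moebius_one]
        exact inv_mul_cancel₀ (a.φ_ne_zero τ))

/-- The projection `(M, φ) ↦ M`. -/
def proj : Mp →* GL(2, ℚ)⁺ where
  toFun := Mp.M
  map_one' := rfl
  map_mul' _ _ := rfl

lemma mdifferentiable_sqrt_autJ (M : GL(2, ℚ)⁺) :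
    MDifferentiable 𝓘(ℂ) 𝓘(ℂ) (fun τ => autJ M τ ^ (1 / 2 : ℂ)) := by
  by_cases hc : mat M 1 0 = 0
  · have : (fun τ => autJ M τ ^ (1 / 2 : ℂ)) =
        fun _ => (mat M 1 1 : ℂ) ^ (1 / 2 : ℂ) := by
      funext τ
      rw [autJ_eq, hc]
      simp
    rw [this]
    exact mdifferentiable_const
  · have h := mdifferentiable_autJ M
    rw [UpperHalfPlane.mdifferentiable_iff] at h ⊢
    refine DifferentiableOn.cpow_const h fun z _ => ?_
    refine Or.inr ?_
    simp only [autJ_eq]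
    have h1 : (UpperHalfPlane.ofComplex z).im ≠ 0 := (UpperHalfPlane.ofComplex z).im_ne_zero
    simpa using ⟨hc, h1⟩

/-- The lift `(M, √(cτ + d))` with the principal branch of the square root. -/
def principal (M : GL(2, ℚ)⁺) : Mp where
  M := M
  φ := fun τ => autJ M τ ^ (1 / 2 : ℂ)
  holo := mdifferentiable_sqrt_autJ M
  sq := fun τ => by
    rw [← Complex.cpow_nat_mul]
    simp

end Mp

/-- The integral metaplectic group `Γ̃`, the inverse image of `SL₂(ℤ)` in `Mp`. -/
def MpZ : Subgroup Mp := ofSL.range.comap Mp.proj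

/-- The principal lift `(γ, √(cτ + d)) ∈ Γ̃` of `γ ∈ SL₂(ℤ)`. -/
def liftSL (γ : SL(2, ℤ)) : MpZ := ⟨Mp.principal (ofSL γ), ⟨γ, rfl⟩⟩

/-- `T = ((1 1; 0 1), 1)`. -/
def mpT : MpZ := liftSL ModularGroup.T

/-- `S = ((0 -1; 1 0), √τ)`. -/
def mpS : MpZ := liftSL ModularGroup.S

/-! ### Discriminant forms and the Weil representation -/

/-- A discriminant form on an abelian group `A` (taken finite throughout): a nondegenerate
quadratic form `q(x) = x²/2` with values in `ℚ/ℤ`. -/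
structure DiscriminantForm (A : Type*) [AddCommGroup A] where
  q : QuadraticMap ℤ A (AddCircle (1 : ℚ))
  nondegenerate : ∀ x, (∀ y, QuadraticMap.polar q x y = 0) → x = 0

/-- `e(x) = exp(2πix)` on `ℚ/ℤ`. -/
def e : AddCircle (1 : ℚ) → ℂ :=
  Function.Periodic.lift (f := fun x : ℚ => Complex.exp (2 * Real.pi * Complex.I * (x : ℂ)))
    (c := 1) (fun x => by
      rw [Complex.exp_eq_exp_iff_exists_int]
      exact ⟨1, by push_cast; ring⟩)

/-- The reduction modulo `N` of a rational number whose denominator is prime to `N`. -/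
def ratMod (N : ℕ) (x : ℚ) : ZMod N := (x.num : ZMod N) * (x.den : ZMod N)⁻¹

/-- The reduction modulo `N` of the matrix `M`. -/
def redMod (N : ℕ) (M : GL(2, ℚ)⁺) : Matrix (Fin 2) (Fin 2) (ZMod N) :=
  (mat M).map (ratMod N)

/-- `diag(m², 1) ∈ GL₂⁺(ℚ)` for a positive integer `m`. -/
def diagSq (m : ℕ) (hm : 0 < m) : GL(2, ℚ)⁺ :=
  ⟨Matrix.GeneralLinearGroup.mkOfDetNeZero !![(m : ℚ) ^ 2, 0; 0, 1]
      (by simp [Matrix.det_fin_two, hm.ne']),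
    by
      have h : (0 : ℚ) < Matrix.det !![(m : ℚ) ^ 2, 0; 0, 1] := by
        have : (0 : ℚ) < m := by exact_mod_cast hm
        simpa [Matrix.det_fin_two] using pow_pos this 2
      exact h⟩

namespace DiscriminantForm

variable {A : Type*} [AddCommGroup A] [Fintype A] (D : DiscriminantForm A)

/-- The level: the smallest positive integer `N` with `N · x²/2 ∈ ℤ` for all `x`. -/
def level : ℕ := sInf {n : ℕ | 0 < n ∧ ∀ x, n • D.q x = 0}

/-- The Gauss sum `g_d(A) = ∑_λ e(d λ²/2)`. -/
def gauss (d : ℕ) : ℂ := ∑ x : A, e (d • D.q x)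

open Classical in
/-- The signature in `ℤ/8ℤ`, determined by Milgram's formula
`∑_λ e(λ²/2) = √|A| · e(sig/8)`. -/
def signature : ZMod 8 :=
  if h : ∃ s : ZMod 8, D.gauss 1 =
      (Real.sqrt (Fintype.card A) : ℂ) * Complex.exp (2 * Real.pi * Complex.I * (s.val : ℂ) / 8)
  then h.choose else 0

/-- `ρ_A(T) 𝔢_λ = e(λ²/2) 𝔢_λ`. The group algebra `ℂ[A]` is the space of functions `a : A → ℂ`,
with `a` standing for `∑_λ a(λ) 𝔢_λ`. -/
def weilT : Module.End ℂ (A → ℂ) :=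
  LinearMap.pi fun x => (e (D.q x)) • LinearMap.proj x

/-- `ρ_A(S) 𝔢_λ = e(-sig(A)/8) / √|A| · ∑_μ e(-(λ,μ)) 𝔢_μ`. -/
def weilS : Module.End ℂ (A → ℂ) :=
  (Complex.exp (-(2 * Real.pi * Complex.I * (D.signature.val : ℂ) / 8)) /
      (Real.sqrt (Fintype.card A) : ℂ)) •
    Matrix.mulVecLin (Matrix.of fun y x : A => e (-(QuadraticMap.polar D.q x y)))

open Classical in
/-- The Weil representation `ρ_A`: the unique representation of `Γ̃` on `ℂ[A]` with the above values
on the generators `T` and `S`. -/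
def weil : MpZ →* LinearMap.GeneralLinearGroup ℂ (A → ℂ) :=
  if h : ∃ ρ : MpZ →* LinearMap.GeneralLinearGroup ℂ (A → ℂ),
      (ρ mpT : Module.End ℂ (A → ℂ)) = D.weilT ∧ (ρ mpS : Module.End ℂ (A → ℂ)) = D.weilS
  then h.choose else 1

/-! ### Modular forms; the weight is `k = κ/2` with `κ` an integer -/

/-- The space `M_{k,A}` of modular forms of weight `k = κ/2` and type `ρ_A` for `Γ̃`. -/
def modularForms (κ : ℤ) : Submodule ℂ (ℍ → A → ℂ) where
  carrier := {f | MDifferentiable 𝓘(ℂ) 𝓘(ℂ, A → ℂ) f ∧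
    (∀ (g : MpZ) (τ : ℍ), f (moebius g.1.M τ) =
      (g.1.φ τ ^ κ) • (D.weil g : Module.End ℂ (A → ℂ)) (f τ)) ∧
    UpperHalfPlane.IsBoundedAtImInfty f}
  zero_mem' := by
    refine ⟨mdifferentiable_const, fun g τ => by simp, ?_⟩
    exact Filter.const_boundedAtFilter _ (0 : A → ℂ)
  add_mem' := by
    rintro f f' ⟨h1, h2, h3⟩ ⟨h1', h2', h3'⟩
    refine ⟨h1.add h1', fun g τ => ?_, Filter.BoundedAtFilter.add h3 h3'⟩
    simp only [Pi.add_apply, h2, h2', map_add, smul_add]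
  smul_mem' := by
    rintro c f ⟨h1, h2, h3⟩
    refine ⟨h1.const_smul c, fun g τ => ?_, Filter.BoundedAtFilter.smul c h3⟩
    simp only [Pi.smul_apply, h2, map_smul]
    rw [smul_comm]

/-- The subspace `S_{k,A}` of cusp forms in `M_{k,A}`. -/
def cuspForms (κ : ℤ) : Submodule ℂ (D.modularForms κ) where
  carrier := {f | UpperHalfPlane.IsZeroAtImInfty (f : ℍ → A → ℂ)}
  zero_mem' := Filter.zero_zeroAtFilter _
  add_mem' := fun hf hg => Filter.ZeroAtFilter.add hf hg
  smul_mem' := fun c _ hf => Filter.ZeroAtFilter.smul c hf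

/-- The integrand `⟨f, g⟩ y^k` of the Petersson scalar product, `k = κ/2`. -/
def peterssonIntegrand (κ : ℤ) (f g : ℍ → A → ℂ) (τ : ℍ) : ℂ :=
  (∑ x : A, f τ x * starRingEnd ℂ (g τ x)) * ((τ.im ^ ((κ : ℝ) / 2) : ℝ) : ℂ)

/-- The Petersson scalar product `(f, g) = ∫_{Γ̃\ℍ} ⟨f, g⟩ y^k dx dy / y²`, computed on the standard
fundamental domain; the measure `volume` on `ℍ` is `dx dy / y²`. -/
def petersson (κ : ℤ) (f g : ℍ → A → ℂ) : ℂ :=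
  ∫ τ in ModularGroup.fd, peterssonIntegrand κ f g τ

/-! ### Hecke operators in even signature -/

open Classical in
/-- The extension of the Weil representation to `Q(N)`, pulled back to pairs `(M, r)` with `M` in
`GL₂⁺(ℚ)` integral at `N`, `r` a unit modulo `N` and `det M ≡ r² (mod N)`: as
`(M, r) = (γ, 1) · (diag(r, r), r)` in `Q(N)` with `γ ∈ SL₂(ℤ/N)`, it is the product of
`ρ_A(γ)` (via any lift of `γ` to `SL₂(ℤ)`) and the scalar `ρ_A(r) = g(A) / g_r(A)`. -/
def weilQ (M : GL(2, ℚ)⁺) (r : (ZMod D.level)ˣ) : Module.End ℂ (A → ℂ) :=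
  if h : ∃ γ : SL(2, ℤ), (γ : Matrix (Fin 2) (Fin 2) ℤ).map (Int.cast : ℤ → ZMod D.level) =
      ((r⁻¹ : (ZMod D.level)ˣ) : ZMod D.level) • redMod D.level M
  then (D.gauss 1 / D.gauss (r : ZMod D.level).val) •
    (D.weil (liftSL h.choose) : Module.End ℂ (A → ℂ))
  else 0

/-- The slash operator `f ∣_{k,A} (M, r)` in integral weight `k`: it is
`det(M)^{k/2} j(M,τ)^{-k} ρ_A(M, r)⁻¹ f(Mτ)`. -/
def slashEven (k : ℤ) (f : ℍ → A → ℂ) (M : GL(2, ℚ)⁺) (r : (ZMod D.level)ˣ) : ℍ → A → ℂ :=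
  fun τ => ((((detQ M : ℝ) ^ ((k : ℝ) / 2) : ℝ) : ℂ) * autJ M τ ^ (-k)) •
    Ring.inverse (D.weilQ M r) (f (moebius M τ))

/-- The Hecke operator `f ∣ T(M, r) = det(M)^{k/2-1} ∑ f ∣_{k,A} (γ, r)` of integral weight `k`, the
sum running over representatives `γ` of `Γ \ Γ M Γ`. -/
def heckeEven (k : ℤ) (M : GL(2, ℚ)⁺) (r : (ZMod D.level)ˣ) (f : ℍ → A → ℂ) : ℍ → A → ℂ :=
  (((detQ M : ℝ) ^ ((k : ℝ) / 2 - 1) : ℝ) : ℂ) •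
    ∑ᶠ c ∈ (Quotient.mk (QuotientGroup.rightRel ofSL.range)) ''
        DoubleCoset.doubleCoset M (ofSL.range : Set GL(2, ℚ)⁺) ofSL.range,
      D.slashEven k f (Quotient.out c) r

/-! ### Hecke operators in odd signature -/

/-- The group of tuples `((M, φ), r, u)` with `u` an automorphism of `ℂ[A]`. The group `𝒬₂(N)` of
tuples `(M, φ, r, t)`, `t = ±1`, with the multiplication twisted by the cocycle of a choice of lifts
`ρ̃_A(M, r)` of the projective Weil representation, embeds in it as a subgroup by
`(M, φ, r, t) ↦ ((M, φ), r, t ρ̃_A(M, r))`, and `ρ_A` becomes the third projection. In this form the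
group does not depend on the choice of lifts. -/
abbrev TripleGroup : Type _ :=
  Mp × (ZMod D.level)ˣ × LinearMap.GeneralLinearGroup ℂ (A → ℂ)

/-- The section `L(γ) = (γ, 1, ρ_A(γ))` over `Γ̃`. -/
def sectionL : MpZ →* D.TripleGroup :=
  MonoidHom.prod MpZ.subtype (MonoidHom.prod 1 D.weil)

/-- The slash operator `f ∣_{k,A} ξ` of weight `k = κ/2` for `ξ = ((M, φ), r, u)`: it is
`det(M)^{k/2} φ(τ)^{-2k} u⁻¹ f(Mτ)`. -/
def slashOdd (κ : ℤ) (f : ℍ → A → ℂ) (ξ : D.TripleGroup) : ℍ → A → ℂ :=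
  fun τ => ((((detQ ξ.1.M : ℝ) ^ ((κ : ℝ) / 4) : ℝ) : ℂ) * ξ.1.φ τ ^ (-κ)) •
    ((ξ.2.2⁻¹ : LinearMap.GeneralLinearGroup ℂ (A → ℂ)) : Module.End ℂ (A → ℂ))
      (f (moebius ξ.1.M τ))

/-- The Hecke operator `f ∣ T(ξ) = det(ξ)^{k/2-1} ∑ f ∣_{k,A} ξᵢ` of weight `k = κ/2`, the sum
running over representatives of `Δ \ Δ ξ Δ`, where `Δ = L(Γ̃)`. -/
def heckeOdd (κ : ℤ) (ξ : D.TripleGroup) (f : ℍ → A → ℂ) : ℍ → A → ℂ :=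
  (((detQ ξ.1.M : ℝ) ^ ((κ : ℝ) / 4 - 1) : ℝ) : ℂ) •
    ∑ᶠ c ∈ (Quotient.mk (QuotientGroup.rightRel D.sectionL.range)) ''
        DoubleCoset.doubleCoset ξ (D.sectionL.range : Set D.TripleGroup) D.sectionL.range,
      D.slashOdd κ f (Quotient.out c)

/-! ### The operators `T(m²)*` -/

lemma level_spec (x : A) : D.level • D.q x = 0 := by
  have hne : {n : ℕ | 0 < n ∧ ∀ x, n • D.q x = 0}.Nonempty := by
    refine ⟨Fintype.card A * Fintype.card A, Nat.mul_pos Fintype.card_pos Fintype.card_pos,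
      fun x => ?_⟩
    have h := D.q.map_smul (Fintype.card A : ℤ) x
    rw [natCast_zsmul, card_nsmul_eq_zero, map_zero] at h
    rw [← natCast_zsmul, Nat.cast_mul]
    exact h.symm
  exact (Nat.sInf_mem hne).2 x

lemma level_smul (x : A) : D.level • x = 0 := by
  refine D.nondegenerate _ fun y => ?_
  have h : QuadraticMap.polar D.q (D.level • x) y = D.level • QuadraticMap.polar D.q x y := by
    have := QuadraticMap.polar_smul_left D.q (D.level : ℤ) x y
    simpa only [natCast_zsmul] using this
  rw [h, QuadraticMap.polar, smul_sub, smul_sub]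
  simp only [level_spec, sub_zero]

lemma mul_bijective {m : ℕ} (hm : m.Coprime D.level) :
    Function.Bijective (fun x : A => m • x) := by
  rw [← Finite.injective_iff_bijective]
  have key : ∀ x : A, m • x = 0 → x = 0 := fun x hx => by
    have h : addOrderOf x ∣ Nat.gcd m D.level :=
      Nat.dvd_gcd (addOrderOf_dvd_of_nsmul_eq_zero hx)
        (addOrderOf_dvd_of_nsmul_eq_zero (D.level_smul x))
    rw [hm] at h
    exact AddMonoid.addOrderOf_eq_one_iff.mp (Nat.dvd_one.mp h)
  intro x y hxy
  have := key (x - y) (by rw [smul_sub]; exact sub_eq_zero.mpr hxy)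
  exact sub_eq_zero.mp this

/-- The automorphism `𝔢_λ ↦ 𝔢_{m⁻¹λ}` of `ℂ[A]` for `m` coprime to the level; on functions it is
`a ↦ (λ ↦ a(mλ))`. -/
def dilation {m : ℕ} (hm : m.Coprime D.level) : LinearMap.GeneralLinearGroup ℂ (A → ℂ) :=
  LinearMap.GeneralLinearGroup.ofLinearEquiv
    (LinearEquiv.funCongrLeft ℂ ℂ (Equiv.ofBijective _ (D.mul_bijective hm)))

/-- The positive integers coprime to the level. -/
abbrev CoprimeIndex : Type := {m : ℕ // 0 < m ∧ m.Coprime D.level}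

open Classical in
/-- The Hecke operator `T(m²)*` of weight `k = κ/2`: it is `T(diag(m², 1), m)` if the signature is
even, and `T((diag(m², 1), 1), m, ρ̃)` with `ρ̃ : 𝔢_λ ↦ 𝔢_{m⁻¹λ}` if the signature is odd. In even
signature nonzero modular forms exist only for even `κ`, so there `k` is the integer `κ / 2`. -/
def heckeSq (κ : ℤ) (m : D.CoprimeIndex) (f : ℍ → A → ℂ) : ℍ → A → ℂ :=
  if Even D.signature then
    D.heckeEven (κ / 2) (diagSq m.1 m.2.1) (ZMod.unitOfCoprime m.1 m.2.2) f
  else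
    D.heckeOdd κ (Mp.principal (diagSq m.1 m.2.1), ZMod.unitOfCoprime m.1 m.2.2,
      D.dilation m.2.2) f

end DiscriminantForm

end VVHecke

end

/-!
# Hecke operators on vector valued modular forms

Write `L : Γ̃ → 𝒬` for the section `γ ↦ (γ, 1, ρ_A(γ))` into the group `𝒬` of triples, `Δ` for its
image and `ξ_m` for `(diag(m², 1), m, 𝔢_λ ↦ 𝔢_{m⁻¹λ})`. The slash operator is a right action of `𝒬` on
functions, modular forms are the `Δ`-invariant functions with the usual analytic conditions, and
`T(m²)*` is a nonzero real multiple of the mean value `f ↦ f ∣ [Δ ξ_m Δ]` of `f ∣ ξ_m y` over `y ∈ Δ`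
(`cosetMean`, `heckeSq_eq`). Working with mean values makes all multiplicities disappear: the
composition law is `cosetMean_cosetMean`, with no counting of cosets.

*The fundamental identity.* If `diag(m², 1) γ = γ' diag(m², 1)` in the metaplectic cover, then
`ξ_m L(γ) = L(γ') ξ_m` (`xi_mul_sectionL`), that is, `dil m ∘ ρ_A(γ) = ρ_A(γ') ∘ dil m`
(`Killed.dil_mul_weil`). Both sides normalise the Heisenberg group of `A` in the same way, so by
Schur's lemma (`exists_smul`) they agree up to a scalar, and the scalar is read off from the coefficient
`⟨𝔢_0, ρ_A(g) ∑ 𝔢_λ⟩` (`coef`). For `g` over a matrix with lower row `(c, d)`, `d > 0` prime to the level,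
this coefficient is `jac(c, d) g_d(A) / g(A)`, where `jac` is trivial in even and the Jacobi symbol in odd
signature (`Killed.coef_liftSL`). The latter is proved by splitting `A` into its primary parts. On a
primary part the behaviour of Gauss sums under Galois conjugation gives the multiplicativity of
`d ↦ g_d(A) / g(A)` up to the factor needed to run the Euclidean algorithm on `(c, d)`.

*Commutativity and generation.* Every double coset `Δ ξ_m y ξ_n Δ` with `m`, `n` coprime is that of
`ξ_m ξ_n = ξ_{mn}`, since `y` is a product of an element that can be moved past `ξ_m` and one that can be
moved past `ξ_n`. For powers of a prime `p` three kinds of `y` occur, distinguished by the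
divisibility of their lower left and right entries, and the central relation
`ξ_p L(S) ξ_p = (p², …) L(S)` (`xi_mul_S_mul_xi`) turns them into a three-term recursion with nonzero
leading coefficient (`heckeMean_recursion`). Hence every operator is a polynomial in those of prime index,
and the latter commute (`adjoin_of_recursion`).

*Self-adjointness.* The slash operators of `ξ_m` and of `Δ` are unitary for the pointwise Hermitian form,
so `⟨f ∣ ξ, g⟩ y^k` and `⟨f, g ∣ ξ⁻¹⟩ y^k` are exchanged by the action of `ξ` on `ℍ`. The sums of their
translates over `Δ / (Δ ∩ ξ⁻¹Δξ)` and `Δ / (Δ ∩ ξΔξ⁻¹)` have the same integral over a fundamental domain of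
`Δ` (`finsum_integral_eq`), because both are the integral of one `Δ ∩ ξ⁻¹Δξ`-invariant function against
two weights with the same sum over orbits. By the central relation `ξ_m⁻¹` defines the same operator as
`ξ_m` (`heckeMean_xi_inv`). Convergence comes from the exponential decay of cusp forms.

*Even signature.* There `ρ_A` factors through `SL₂(ℤ/N)`, its value at an element congruent to
`diag(m, m⁻¹)` is `(g_m(A) / g(A)) dil m`, and so the scalar in the definition of `ρ_A(M, r)` turns the
operator of the double coset of `(diag(m², 1), m)` into that of `ξ_m` (`EvenSig.heckeEven_eq`).
-/

open scoped MatrixGroups UpperHalfPlane Manifold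

set_option linter.unusedSectionVars false

noncomputable section

namespace VVHecke

/-! ### The character `e` and finite Fourier analysis on a discriminant form -/

lemma e_coe (x : ℚ) : e (x : AddCircle (1 : ℚ)) = Complex.exp (2 * Real.pi * Complex.I * (x : ℂ)) :=
  rfl

lemma e_add (x y : AddCircle (1 : ℚ)) : e (x + y) = e x * e y := by
  induction x using QuotientAddGroup.induction_on with | _ x =>
  induction y using QuotientAddGroup.induction_on with | _ y =>
  rw [← AddCircle.coe_add, e_coe, e_coe, e_coe, ← Complex.exp_add]
  push_cast
  ring_nf

@[simp] lemma e_zero : e 0 = 1 := by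
  have := e_coe 0
  simpa using this

lemma e_ne_zero (x : AddCircle (1 : ℚ)) : e x ≠ 0 := by
  intro h
  have := e_add x (-x)
  rw [h] at this
  simp at this

lemma e_neg (x : AddCircle (1 : ℚ)) : e (-x) = (e x)⁻¹ := by
  refine eq_inv_of_mul_eq_one_left ?_
  rw [← e_add]; simp

lemma e_eq_one_iff (x : AddCircle (1 : ℚ)) : e x = 1 ↔ x = 0 := by
  induction x using QuotientAddGroup.induction_on with | _ x =>
  refine ⟨fun h => ?_, fun h => by rw [h, e_zero]⟩
  rw [e_coe, Complex.exp_eq_one_iff] at h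
  obtain ⟨n, hn⟩ := h
  have hpi : (2 * Real.pi * Complex.I : ℂ) ≠ 0 := Complex.two_pi_I_ne_zero
  have h2 : (x : ℂ) = n := by
    apply mul_left_cancel₀ hpi
    rw [hn]; ring
  have h3 : x = n := by exact_mod_cast h2
  refine (AddCircle.coe_eq_zero_iff (1 : ℚ)).mpr ⟨n, ?_⟩
  simp [h3]

lemma norm_e (x : AddCircle (1 : ℚ)) : ‖e x‖ = 1 := by
  induction x using QuotientAddGroup.induction_on with | _ x =>
  rw [e_coe, Complex.norm_exp]
  simp

lemma conj_e (x : AddCircle (1 : ℚ)) : starRingEnd ℂ (e x) = e (-x) := by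
  rw [e_neg, Complex.inv_eq_conj (norm_e x)]

lemma e_nsmul (n : ℕ) (x : AddCircle (1 : ℚ)) : e (n • x) = e x ^ n := by
  induction n with
  | zero => simp
  | succ n ih => rw [succ_nsmul, e_add, ih, pow_succ]

lemma e_sub (x y : AddCircle (1 : ℚ)) : e (x - y) = e x * (e y)⁻¹ := by
  rw [sub_eq_add_neg, e_add, e_neg]

namespace DiscriminantForm

variable {A : Type*} [AddCommGroup A] [Fintype A] (D : DiscriminantForm A)

/-- The bilinear form `(x, y) = q(x + y) - q(x) - q(y)`. -/
abbrev bil (x y : A) : AddCircle (1 : ℚ) := QuadraticMap.polar D.q x y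

lemma q_add (x y : A) : D.q (x + y) = D.q x + D.q y + D.bil x y := by
  simp [bil, QuadraticMap.polar]

lemma q_zsmul (n : ℤ) (x : A) : D.q (n • x) = (n * n) • D.q x := D.q.map_smul n x

lemma bil_comm (x y : A) : D.bil x y = D.bil y x := QuadraticMap.polar_comm _ _ _

lemma bil_add_left (x y z : A) : D.bil (x + y) z = D.bil x z + D.bil y z :=
  QuadraticMap.polar_add_left _ _ _ _

lemma bil_add_right (x y z : A) : D.bil x (y + z) = D.bil x y + D.bil x z :=
  QuadraticMap.polar_add_right _ _ _ _

lemma bil_zsmul_left (n : ℤ) (x y : A) : D.bil (n • x) y = n • D.bil x y :=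
  QuadraticMap.polar_smul_left _ _ _ _

lemma bil_zsmul_right (n : ℤ) (x y : A) : D.bil x (n • y) = n • D.bil x y :=
  QuadraticMap.polar_smul_right _ _ _ _

lemma bil_zero_right (x : A) : D.bil x 0 = 0 := by simp [bil, QuadraticMap.polar]

lemma bil_zero_left (x : A) : D.bil 0 x = 0 := by simp [bil, QuadraticMap.polar]

lemma bil_neg_left (x y : A) : D.bil (-x) y = -D.bil x y := by
  simp

lemma bil_neg_right (x y : A) : D.bil x (-y) = -D.bil x y := by
  simp

lemma bil_self (x : A) : D.bil x x = (2 : ℤ) • D.q x := by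
  have h := D.q_zsmul 2 x
  rw [two_zsmul, q_add] at h
  have : D.bil x x = (2 * 2 : ℤ) • D.q x - D.q x - D.q x := by rw [← h]; abel
  rw [this]; module

open Classical in
/-- Orthogonality of characters for the pairing `(x, y) ↦ e((x, y))`. -/
lemma sum_e_bil (x : A) : ∑ y, e (D.bil x y) = if x = 0 then (Fintype.card A : ℂ) else 0 := by
  let ψ : AddChar A ℂ :=
    { toFun := fun y => e (D.bil x y)
      map_zero_eq_one' := by rw [bil_zero_right, e_zero]
      map_add_eq_mul' := fun y z => by rw [bil_add_right, e_add] }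
  have h := AddChar.sum_eq_ite ψ
  have h2 : ψ = 0 ↔ x = 0 := by
    constructor
    · intro h0
      refine D.nondegenerate x fun y => ?_
      rw [← e_eq_one_iff]
      exact DFunLike.congr_fun h0 y
    · rintro rfl
      ext y
      change e (D.bil 0 y) = 1
      rw [bil_zero_left, e_zero]
  simp only [h2] at h
  exact h

/-! ### Gauss sums -/

/-- The Gauss sum `∑_x e(d q(x))` for an integer `d`. -/
def gz (d : ℤ) : ℂ := ∑ x : A, e (d • D.q x)

lemma gauss_eq_gz (d : ℕ) : D.gauss d = D.gz d := by simp [gauss, gz]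

/-- `N` annihilates the quadratic form; equivalently, the level divides `N`. -/
def Killed (N : ℕ) : Prop := ∀ x, N • D.q x = 0

lemma killed_level : D.Killed D.level := D.level_spec

lemma level_pos : 0 < D.level := by
  have hne : {n : ℕ | 0 < n ∧ ∀ x, n • D.q x = 0}.Nonempty := by
    refine ⟨Fintype.card A * Fintype.card A, Nat.mul_pos Fintype.card_pos Fintype.card_pos,
      fun x => ?_⟩
    have h := D.q.map_smul (Fintype.card A : ℤ) x
    rw [natCast_zsmul, card_nsmul_eq_zero, map_zero] at h
    rw [← natCast_zsmul, Nat.cast_mul]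
    exact h.symm
  exact (Nat.sInf_mem hne).1

variable {D}

lemma Killed.bil {N : ℕ} (hN : D.Killed N) (x y : A) : (N : ℤ) • D.bil x y = 0 := by
  have h1 := hN (x + y)
  rw [q_add, smul_add, smul_add, hN x, hN y] at h1
  rw [natCast_zsmul]
  simpa using h1

lemma Killed.smul {N : ℕ} (hN : D.Killed N) (x : A) : (N : ℤ) • x = 0 := by
  refine D.nondegenerate _ fun y => ?_
  change D.bil _ _ = 0
  rw [bil_zsmul_left, hN.bil]

lemma Killed.q_congr {N : ℕ} (hN : D.Killed N) {a b : ℤ} (h : a ≡ b [ZMOD N]) (x : A) :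
    a • D.q x = b • D.q x := by
  obtain ⟨k, hk⟩ := h.dvd
  have : b = a + k * N := by linarith
  rw [this, add_smul, mul_smul, natCast_zsmul, hN x]; simp

lemma Killed.bil_congr {N : ℕ} (hN : D.Killed N) {a b : ℤ} (h : a ≡ b [ZMOD N]) (x y : A) :
    a • D.bil x y = b • D.bil x y := by
  obtain ⟨k, hk⟩ := h.dvd
  have : b = a + k * N := by linarith
  rw [this, add_smul, mul_smul, hN.bil]; simp

lemma Killed.smul_congr {N : ℕ} (hN : D.Killed N) {a b : ℤ} (h : a ≡ b [ZMOD N]) (x : A) :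
    a • x = b • x := by
  obtain ⟨k, hk⟩ := h.dvd
  have : b = a + k * N := by linarith
  rw [this, add_smul, mul_smul, hN.smul]; simp

lemma Killed.gz_congr {N : ℕ} (hN : D.Killed N) {a b : ℤ} (h : a ≡ b [ZMOD N]) :
    D.gz a = D.gz b :=
  Finset.sum_congr rfl fun x _ => by rw [hN.q_congr h]

lemma Killed.smul_injective {N : ℕ} (hN : D.Killed N) {u : ℤ} (hu : IsCoprime u N) {x : A}
    (h : u • x = 0) : x = 0 := by
  obtain ⟨a, b, hab⟩ := hu
  have : x = (a * u + b * N) • x := by rw [hab, one_smul]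
  rw [this, add_smul, mul_smul, mul_smul, h, hN.smul]; simp

lemma conj_gz (d : ℤ) : starRingEnd ℂ (D.gz d) = D.gz (-d) := by
  simp only [gz, map_sum, conj_e, neg_smul]

/-- `|g_u(A)|² = |A|` for `u` prime to the level. -/
lemma Killed.gz_mul_conj {N : ℕ} (hN : D.Killed N) {u : ℤ} (hu : IsCoprime u N) :
    D.gz u * D.gz (-u) = Fintype.card A := by
  classical
  have h1 : D.gz u * D.gz (-u) = ∑ h : A, e (u • D.q h) * ∑ y, e (D.bil (u • h) y) := by
    unfold gz
    rw [Finset.sum_mul_sum, Finset.sum_comm]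
    simp_rw [Finset.mul_sum]
    rw [Finset.sum_comm (f := fun h y => e (u • D.q h) * e (D.bil (u • h) y))]
    refine Finset.sum_congr rfl fun y _ => ?_
    rw [← Equiv.sum_comp (Equiv.addRight y)]
    refine Finset.sum_congr rfl fun h _ => ?_
    simp only [Equiv.coe_addRight, ← e_add]
    congr 1
    rw [q_add, bil_zsmul_left]
    module
  rw [h1, Finset.sum_eq_single 0]
  · simp
  · intro h _ hh
    rw [sum_e_bil, if_neg, mul_zero]
    exact fun h0 => hh (hN.smul_injective hu h0)
  · simp

lemma Killed.gz_ne_zero {N : ℕ} (hN : D.Killed N) {u : ℤ} (hu : IsCoprime u N) : D.gz u ≠ 0 := by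
  intro h
  have := hN.gz_mul_conj hu
  rw [h, zero_mul] at this
  have h2 : (Fintype.card A : ℂ) ≠ 0 := by exact_mod_cast Fintype.card_ne_zero
  exact h2 this.symm

variable (D)

lemma gz_one_mul_conj : D.gz 1 * D.gz (-1) = Fintype.card A :=
  D.killed_level.gz_mul_conj isCoprime_one_left

lemma gz_one_ne_zero : D.gz 1 ≠ 0 := D.killed_level.gz_ne_zero isCoprime_one_left

lemma q_lin2 (a b : ℤ) (x y : A) :
    D.q (a • x + b • y) = (a * a) • D.q x + (b * b) • D.q y + (a * b) • D.bil x y := by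
  rw [q_add, q_zsmul, q_zsmul, bil_zsmul_left, bil_zsmul_right, smul_smul]

lemma q_lin4 (a b c d : ℤ) (x y z w : A) :
    D.q (a • x + b • y + c • z + d • w) =
      (a * a) • D.q x + (b * b) • D.q y + (c * c) • D.q z + (d * d) • D.q w
      + (a * b) • D.bil x y + (a * c) • D.bil x z + (a * d) • D.bil x w
      + (b * c) • D.bil y z + (b * d) • D.bil y w + (c * d) • D.bil z w := by
  simp only [q_add, q_zsmul, bil_zsmul_left, bil_zsmul_right, bil_add_left, smul_smul]
  module

variable {D}

/-- If `n = a² + b²` is prime to the level, then `(x, y) ↦ (ax - by, bx + ay)` is a similitude of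
`A²` of norm `n`, whence `g_{un}² = g_u²`. -/
lemma Killed.gz_mul_pow_two {N : ℕ} (hN : D.Killed N) {a b : ℤ}
    (h : IsCoprime (a ^ 2 + b ^ 2) (N : ℤ)) (u : ℤ) :
    D.gz (u * (a ^ 2 + b ^ 2)) ^ 2 = D.gz u ^ 2 := by
  have expand : ∀ v : ℤ, D.gz v ^ 2 = ∑ p : A × A, e (v • (D.q p.1 + D.q p.2)) := by
    intro v
    rw [sq, gz, Finset.sum_mul_sum, Fintype.sum_prod_type]
    simp only [← e_add, smul_add]
  let M : A × A → A × A := fun p => (a • p.1 + (-b) • p.2, b • p.1 + a • p.2)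
  have hM : Function.Bijective M := by
    rw [← Finite.injective_iff_bijective]
    rintro ⟨x, y⟩ ⟨x', y'⟩ hxy
    simp only [M, Prod.mk.injEq] at hxy
    obtain ⟨h1, h2⟩ := hxy
    have e1 : a • (x - x') + (-b) • (y - y') = 0 := by
      rw [← sub_eq_zero] at h1; rw [← h1]; module
    have e2 : b • (x - x') + a • (y - y') = 0 := by
      rw [← sub_eq_zero] at h2; rw [← h2]; module
    have f1 : (a ^ 2 + b ^ 2) • (x - x') = 0 := by
      have : (a ^ 2 + b ^ 2) • (x - x') = a • (a • (x - x') + (-b) • (y - y'))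
          + b • (b • (x - x') + a • (y - y')) := by module
      rw [this, e1, e2]; simp
    have f2 : (a ^ 2 + b ^ 2) • (y - y') = 0 := by
      have : (a ^ 2 + b ^ 2) • (y - y') = (-b) • (a • (x - x') + (-b) • (y - y'))
          + a • (b • (x - x') + a • (y - y')) := by module
      rw [this, e1, e2]; simp
    exact Prod.ext (sub_eq_zero.mp (hN.smul_injective h f1))
      (sub_eq_zero.mp (hN.smul_injective h f2))
  rw [expand, expand]
  conv_rhs => rw [← hM.sum_comp]
  refine Finset.sum_congr rfl fun p _ => ?_
  simp only [M, q_lin2]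
  congr 1
  module

/-- If `n` is a sum of four squares prime to the level, then left multiplication by a quaternion of
norm `n` is a similitude of `A⁴` of norm `n`, whence `g_{un}⁴ = g_u⁴`. -/
lemma Killed.gz_mul_pow_four {N : ℕ} (hN : D.Killed N) {a b c d : ℤ}
    (h : IsCoprime (a ^ 2 + b ^ 2 + c ^ 2 + d ^ 2) (N : ℤ)) (u : ℤ) :
    D.gz (u * (a ^ 2 + b ^ 2 + c ^ 2 + d ^ 2)) ^ 4 = D.gz u ^ 4 := by
  have expand : ∀ v : ℤ, D.gz v ^ 4 =
      ∑ p : A × A × A × A, e (v • (D.q p.1 + D.q p.2.1 + D.q p.2.2.1 + D.q p.2.2.2)) := by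
    intro v
    simp only [Fintype.sum_prod_type, smul_add, e_add, ← Finset.mul_sum, ← Finset.sum_mul]
    simp only [gz]
    ring
  let M : A × A × A × A → A × A × A × A := fun p =>
    (a • p.1 + (-b) • p.2.1 + (-c) • p.2.2.1 + (-d) • p.2.2.2,
     b • p.1 + a • p.2.1 + (-d) • p.2.2.1 + c • p.2.2.2,
     c • p.1 + d • p.2.1 + a • p.2.2.1 + (-b) • p.2.2.2,
     d • p.1 + (-c) • p.2.1 + b • p.2.2.1 + a • p.2.2.2)
  have hM : Function.Bijective M := by
    rw [← Finite.injective_iff_bijective]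
    rintro ⟨x, y, z, w⟩ ⟨x', y', z', w'⟩ hxy
    simp only [M, Prod.mk.injEq] at hxy
    obtain ⟨h1, h2, h3, h4⟩ := hxy
    rw [← sub_eq_zero] at h1 h2 h3 h4
    have key : ∀ (p q r s : ℤ) (t t' : A), (a ^ 2 + b ^ 2 + c ^ 2 + d ^ 2) • (t - t') =
        p • (a • x + (-b) • y + (-c) • z + (-d) • w -
          (a • x' + (-b) • y' + (-c) • z' + (-d) • w')) +
        q • (b • x + a • y + (-d) • z + c • w - (b • x' + a • y' + (-d) • z' + c • w')) +
        r • (c • x + d • y + a • z + (-b) • w - (c • x' + d • y' + a • z' + (-b) • w')) +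
        s • (d • x + (-c) • y + b • z + a • w - (d • x' + (-c) • y' + b • z' + a • w')) →
        t = t' := by
      intro p q r s t t' ht
      rw [h1, h2, h3, h4] at ht
      refine sub_eq_zero.mp (hN.smul_injective h ?_)
      rw [ht]; simp
    have e1 : x = x' := key a b c d x x' (by module)
    have e2 : y = y' := key (-b) a d (-c) y y' (by module)
    have e3 : z = z' := key (-c) (-d) a b z z' (by module)
    have e4 : w = w' := key (-d) c (-b) a w w' (by module)
    rw [e1, e2, e3, e4]
  rw [expand, expand]
  conv_rhs => rw [← hM.sum_comp]
  refine Finset.sum_congr rfl fun p _ => ?_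
  simp only [M, q_lin4]
  congr 1
  module

/-- The fourth power is a Gauss sum in four variables, on which the norm of a quaternion acts trivially; and `-1`
is a sum of four squares modulo the level. -/
lemma conj_gz_one_pow_four : starRingEnd ℂ (D.gz 1) ^ 4 = D.gz 1 ^ 4 := by
  have hN := D.killed_level
  -- a natural number congruent to `-1` modulo the level
  obtain ⟨a, b, c, d, h⟩ := Nat.sum_four_squares (2 * D.level - 1)
  have hpos := D.level_pos
  have h' : (a ^ 2 + b ^ 2 + c ^ 2 + d ^ 2 : ℤ) = 2 * D.level - 1 := by
    have : ((a ^ 2 + b ^ 2 + c ^ 2 + d ^ 2 : ℕ) : ℤ) = ((2 * D.level - 1 : ℕ) : ℤ) := by rw [h]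
    push_cast [Nat.cast_sub (show 1 ≤ 2 * D.level by omega)] at this
    exact this
  have hcop : IsCoprime (a ^ 2 + b ^ 2 + c ^ 2 + d ^ 2 : ℤ) D.level := by
    rw [h']
    exact ⟨-1, 2, by ring⟩
  rw [conj_gz, ← hN.gz_mul_pow_four hcop 1, h']
  congr 1
  refine hN.gz_congr ?_
  rw [Int.modEq_iff_dvd]
  exact ⟨2, by ring⟩

lemma conj_gz_one : starRingEnd ℂ (D.gz 1) = D.gz (-1) := conj_gz 1

/-- `g(A)⁸ = |A|⁴`. -/
lemma gz_one_pow_eight : D.gz 1 ^ 8 = (Fintype.card A : ℂ) ^ 4 := by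
  have h1 := conj_gz_one_pow_four (D := D)
  have h2 := D.gz_one_mul_conj
  rw [conj_gz_one] at h1
  calc D.gz 1 ^ 8 = D.gz 1 ^ 4 * D.gz (-1) ^ 4 := by rw [h1]; ring
    _ = (D.gz 1 * D.gz (-1)) ^ 4 := by ring
    _ = _ := by rw [h2]

variable (D)

/-- Even signature, in the form `g(A)⁴ = |A|²`. -/
def EvenSig : Prop := D.gz 1 ^ 4 = (Fintype.card A : ℂ) ^ 2

lemma not_evenSig (h : ¬ D.EvenSig) : D.gz 1 ^ 4 = -(Fintype.card A : ℂ) ^ 2 := by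
  have h1 := gz_one_pow_eight (D := D)
  have h2 : (D.gz 1 ^ 4) ^ 2 = ((Fintype.card A : ℂ) ^ 2) ^ 2 := by
    rw [← pow_mul, ← pow_mul]; exact h1
  exact (sq_eq_sq_iff_eq_or_eq_neg.mp h2).resolve_left h

/-- Milgram's formula `g(A) = √|A| e(sig(A)/8)`. -/
lemma signature_spec : D.gz 1 = (Real.sqrt (Fintype.card A) : ℂ) *
    Complex.exp (2 * Real.pi * Complex.I * (D.signature.val : ℂ) / 8) := by
  have hs : ((Real.sqrt (Fintype.card A) : ℝ) : ℂ) ^ 2 = (Fintype.card A : ℂ) := by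
    rw [← Complex.ofReal_pow, Real.sq_sqrt (by positivity)]; simp
  have hs0 : ((Real.sqrt (Fintype.card A) : ℝ) : ℂ) ≠ 0 := by
    intro h
    rw [h] at hs
    have h2 : (Fintype.card A : ℂ) ≠ 0 := by exact_mod_cast Fintype.card_ne_zero
    exact h2 (by rw [← hs]; simp)
  have hex : ∃ s : ZMod 8, D.gauss 1 = (Real.sqrt (Fintype.card A) : ℂ) *
      Complex.exp (2 * Real.pi * Complex.I * (s.val : ℂ) / 8) := by
    have h8 : (D.gauss 1 / (Real.sqrt (Fintype.card A) : ℂ)) ^ 8 = 1 := by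
      rw [div_pow, gauss_eq_gz, Nat.cast_one, gz_one_pow_eight, div_eq_one_iff_eq (pow_ne_zero _ hs0),
        ← hs]
      ring
    obtain ⟨i, hi, hi2⟩ := (Complex.isPrimitiveRoot_exp 8 (by norm_num)).eq_pow_of_pow_eq_one h8
    refine ⟨(i : ZMod 8), ?_⟩
    rw [ZMod.val_natCast, Nat.mod_eq_of_lt hi]
    rw [eq_div_iff hs0] at hi2
    rw [← hi2, ← Complex.exp_nat_mul, mul_comm]
    congr 2
    push_cast
    ring
  have h0 : D.gz 1 = D.gauss 1 := by rw [gauss_eq_gz, Nat.cast_one]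
  rw [h0, signature, dif_pos hex]
  exact hex.choose_spec

lemma evenSig_iff : D.EvenSig ↔ Even D.signature := by
  have h := D.signature_spec
  have hs : ((Real.sqrt (Fintype.card A) : ℝ) : ℂ) ^ 2 = (Fintype.card A : ℂ) := by
    rw [← Complex.ofReal_pow, Real.sq_sqrt (by positivity)]; simp
  have h2 : (Fintype.card A : ℂ) ≠ 0 := by exact_mod_cast Fintype.card_ne_zero
  have h4 : D.gz 1 ^ 4 = (Fintype.card A : ℂ) ^ 2 * (-1) ^ D.signature.val := by
    rw [h, mul_pow, ← hs, ← Complex.exp_nat_mul, ← Complex.exp_pi_mul_I, ← Complex.exp_nat_mul]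
    have : (((4 : ℕ) : ℂ) * (2 * Real.pi * Complex.I * (D.signature.val : ℂ) / 8)) =
        (D.signature.val : ℂ) * (Real.pi * Complex.I) := by push_cast; ring
    rw [this]; ring
  have hdec : ∀ s : ZMod 8, Even s ↔ Even s.val := by
    intro s
    rw [Nat.even_iff]
    change (∃ r, s = r + r) ↔ _
    revert s
    decide
  rw [EvenSig, h4, hdec]
  constructor
  · intro h5
    have h6 : ((-1 : ℂ)) ^ D.signature.val = 1 := by
      have := mul_left_cancel₀ (pow_ne_zero 2 h2) (h5.trans (mul_one _).symm)
      exact this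
    by_contra hodd
    rw [Nat.not_even_iff_odd] at hodd
    rw [hodd.neg_one_pow] at h6
    norm_num at h6
  · intro he
    rw [he.neg_one_pow, mul_one]

/-! ### Galois conjugation of Gauss sums -/

/-- A polynomial relation with integer coefficients satisfied by a primitive `N`-th root of unity is
satisfied by its powers prime to `N`. -/
lemma aeval_pow_eq_zero {N : ℕ} {ζ : ℂ} (hζ : IsPrimitiveRoot ζ N) (hN : 0 < N)
    {P : Polynomial ℤ} (hP : Polynomial.aeval ζ P = 0) {u : ℕ} (hu : u.Coprime N) :
    Polynomial.aeval (ζ ^ u) P = 0 := by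
  have h1 := minpoly.isIntegrallyClosed_dvd (hζ.isIntegral hN) hP
  rw [hζ.minpoly_eq_pow_coprime hu] at h1
  obtain ⟨Q, hQ⟩ := h1
  rw [hQ, map_mul, minpoly.aeval, zero_mul]

lemma exists_exponents {N : ℕ} (hN : D.Killed N) (hpos : 0 < N) {ζ : ℂ} (hζ : IsPrimitiveRoot ζ N) :
    ∃ n : A → ℕ, ∀ x, e (D.q x) = ζ ^ n x := by
  have : ∀ x, ∃ i, e (D.q x) = ζ ^ i := by
    intro x
    have : NeZero N := ⟨hpos.ne'⟩
    obtain ⟨i, -, hi⟩ := hζ.eq_pow_of_pow_eq_one (ξ := e (D.q x)) (by rw [← e_nsmul, hN x, e_zero])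
    exact ⟨i, hi.symm⟩
  choose n hn using this
  exact ⟨n, hn⟩

/-- If a polynomial relation `P(ζ, g_v, g_w) = 0` linear or quadratic in the Gauss sums holds, so does
its Galois conjugate; stated for `P = g_v^k - c ζ^j g_w^l`. -/
lemma gz_conjugate {N : ℕ} (hN : D.Killed N) (hpos : 0 < N) {ζ : ℂ} (hζ : IsPrimitiveRoot ζ N)
    {v w k j l : ℕ} {c : ℤ} (h : D.gz v ^ k = c * ζ ^ j * D.gz w ^ l) {u : ℕ} (hu : u.Coprime N) :
    D.gz (v * u) ^ k = c * (ζ ^ j) ^ u * D.gz (w * u) ^ l := by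
  obtain ⟨n, hn⟩ := D.exists_exponents hN hpos hζ
  let G : ℕ → Polynomial ℤ := fun v => ∑ x : A, Polynomial.X ^ (n x * v)
  have hG : ∀ v u : ℕ, Polynomial.aeval (ζ ^ u) (G v) = D.gz (v * u : ℕ) := by
    intro v u
    simp only [G, map_sum, map_pow, Polynomial.aeval_X, gz, natCast_zsmul, e_nsmul, hn]
    refine Finset.sum_congr rfl fun x _ => ?_
    rw [← pow_mul, ← pow_mul]
    congr 1; ring
  have hG1 : ∀ v : ℕ, Polynomial.aeval ζ (G v) = D.gz v := by
    intro v
    have := hG v 1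
    rwa [pow_one, mul_one] at this
  let P : Polynomial ℤ := G v ^ k - Polynomial.C c * Polynomial.X ^ j * G w ^ l
  have hP : Polynomial.aeval ζ P = 0 := by
    simp only [P, map_sub, map_mul, map_pow, Polynomial.aeval_X, hG1, h]
    simp
  have := aeval_pow_eq_zero hζ hpos hP hu
  simp only [P, map_sub, map_mul, map_pow, Polynomial.aeval_X, hG, sub_eq_zero] at this
  push_cast at this
  rw [this, ← pow_mul, ← pow_mul, mul_comm u j]
  simp

/-- The normalised Gauss sum `g_u(A) / g(A)`. -/
def psi (u : ℤ) : ℂ := D.gz u / D.gz 1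

lemma psi_one : D.psi 1 = 1 := div_self D.gz_one_ne_zero

variable {D}

lemma Killed.psi_congr {N : ℕ} (hN : D.Killed N) {a b : ℤ} (h : a ≡ b [ZMOD N]) :
    D.psi a = D.psi b := by rw [psi, psi, hN.gz_congr h]

lemma exists_nat_modEq {N : ℕ} (hpos : 0 < N) {u : ℤ} (hu : IsCoprime u N) :
    ∃ n : ℕ, (n : ℤ) ≡ u [ZMOD N] ∧ n.Coprime N := by
  have h0 : (0 : ℤ) < N := by exact_mod_cast hpos
  refine ⟨(u % N).toNat, ?_, ?_⟩
  · rw [Int.toNat_of_nonneg (Int.emod_nonneg _ h0.ne')]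
    exact Int.mod_modEq _ _
  · rw [← Nat.isCoprime_iff_coprime, Int.toNat_of_nonneg (Int.emod_nonneg _ h0.ne')]
    have : u % N = u + N * (-(u / N)) := by
      have := Int.emod_add_mul_ediv u N
      linarith
    rw [this]
    exact hu.add_mul_left_left _

lemma EvenSig.exists_sign (h : D.EvenSig) : ∃ η : ℤ, D.gz 1 ^ 2 = η * (Fintype.card A : ℂ) := by
  have h2 : (D.gz 1 ^ 2) ^ 2 = (Fintype.card A : ℂ) ^ 2 := by rw [← pow_mul]; exact h
  rcases sq_eq_sq_iff_eq_or_eq_neg.mp h2 with h3 | h3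
  · exact ⟨1, by rw [h3]; simp⟩
  · exact ⟨-1, by rw [h3]; simp⟩

lemma EvenSig.gz_sq (h : D.EvenSig) {N : ℕ} (hN : D.Killed N) (hpos : 0 < N) {u : ℕ}
    (hu : u.Coprime N) : D.gz u ^ 2 = D.gz 1 ^ 2 := by
  obtain ⟨η, hη⟩ := h.exists_sign
  have := D.gz_conjugate hN hpos (Complex.isPrimitiveRoot_exp N hpos.ne') (v := 1) (w := 1) (k := 2)
    (j := 0) (l := 0) (c := η * Fintype.card A) (by push_cast; rw [hη]; ring) hu
  push_cast at this
  rw [one_mul] at this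
  rw [this, hη]
  ring

/-- In even signature the normalised Gauss sums take the values `±1`. -/
lemma EvenSig.psi_sq (h : D.EvenSig) {N : ℕ} (hN : D.Killed N) (hpos : 0 < N) {u : ℤ}
    (hu : IsCoprime u N) : D.psi u ^ 2 = 1 := by
  obtain ⟨n, hn, hnc⟩ := exists_nat_modEq hpos hu
  rw [← hN.psi_congr hn, psi, div_pow, h.gz_sq hN hpos hnc,
    div_self (pow_ne_zero _ D.gz_one_ne_zero)]

/-- In even signature `u ↦ g_u(A) / g(A)` is a character modulo the level. -/
lemma EvenSig.psi_mul (h : D.EvenSig) {N : ℕ} (hN : D.Killed N) (hpos : 0 < N) {u v : ℤ}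
    (hu : IsCoprime u N) (hv : IsCoprime v N) : D.psi (u * v) = D.psi u * D.psi v := by
  obtain ⟨m, hm, hmc⟩ := exists_nat_modEq hpos hu
  obtain ⟨n, hn, hnc⟩ := exists_nat_modEq hpos hv
  rw [← hN.psi_congr hm, ← hN.psi_congr hn, ← hN.psi_congr (hm.mul hn)]
  have hsq := h.gz_sq hN hpos hnc
  have hτ : ∃ τ : ℤ, D.gz n = τ * D.gz 1 := by
    rcases sq_eq_sq_iff_eq_or_eq_neg.mp hsq with h3 | h3
    · exact ⟨1, by rw [h3]; simp⟩
    · exact ⟨-1, by rw [h3]; simp⟩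
  obtain ⟨τ, hτ⟩ := hτ
  have := D.gz_conjugate hN hpos (Complex.isPrimitiveRoot_exp N hpos.ne') (v := n) (w := 1) (k := 1)
    (j := 0) (l := 1) (c := τ) (by push_cast; rw [hτ]; ring) hmc
  push_cast at this
  have hg := D.gz_one_ne_zero
  rw [psi, psi, psi, hτ, mul_comm (m : ℤ)]
  rw [one_mul, pow_one, pow_one, pow_zero, one_pow, mul_one] at this
  rw [this]
  field_simp

lemma exists_fourth_root {N : ℕ} (hpos : 0 < N) (h4 : 4 ∣ N) :
    ∃ (ζ : ℂ) (j : ℕ), IsPrimitiveRoot ζ N ∧ (ζ ^ j) ^ 2 = -1 := by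
  obtain ⟨k, rfl⟩ := h4
  have hζ := Complex.isPrimitiveRoot_exp (4 * k) hpos.ne'
  refine ⟨_, k, hζ, ?_⟩
  have h4 : IsPrimitiveRoot (Complex.exp (2 * Real.pi * Complex.I / ((4 * k : ℕ) : ℂ)) ^ k) 4 :=
    hζ.pow hpos (by ring)
  have h2 := h4.pow (by norm_num) (show 4 = 2 * 2 by norm_num)
  exact h2.eq_neg_one_of_two_right

lemma pow_of_mod_four {ι : ℂ} (hι : ι ^ 2 = -1) {u : ℕ} :
    (u % 4 = 1 → ι ^ u = ι) ∧ (u % 4 = 3 → ι ^ u = -ι) := by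
  have h4 : ι ^ 4 = 1 := by
    rw [show ι ^ 4 = (ι ^ 2) ^ 2 by ring, hι]; norm_num
  constructor <;> intro h <;> rw [← Nat.div_add_mod u 4, h, pow_add, pow_mul, h4, one_pow, one_mul]
  · simp
  · rw [pow_succ, hι]; ring

/-- The sign `±1` with `i^u = ± i` for odd `u`. -/
def chi4 (u : ℤ) : ℂ := if u % 4 = 1 then 1 else -1

/-- In odd signature `g(A)²` is an integer multiple of a fourth root of unity `ζ ^ j`, which gives the
action of Galois conjugation on it. -/
lemma gz_odd_aux (h : ¬ D.EvenSig) {N : ℕ} (hN : D.Killed N) (hpos : 0 < N) (h4 : 4 ∣ N) :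
    ∃ (ζ : ℂ) (j : ℕ) (c : ℤ), IsPrimitiveRoot ζ N ∧ (ζ ^ j) ^ 2 = -1 ∧
      D.gz 1 ^ 2 = c * ζ ^ j ∧
      ∀ u : ℕ, u.Coprime N → (ζ ^ j) ^ u = chi4 u * ζ ^ j ∧ D.gz u ^ 2 = chi4 u * D.gz 1 ^ 2 := by
  obtain ⟨ζ, j, hζ, hι⟩ := exists_fourth_root hpos h4
  have h1 := D.not_evenSig h
  have hc : ∃ c : ℤ, D.gz 1 ^ 2 = c * ζ ^ j := by
    have h2 : (D.gz 1 ^ 2) ^ 2 = ((Fintype.card A : ℂ) * ζ ^ j) ^ 2 := by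
      rw [mul_pow, hι, ← pow_mul, h1]; ring
    rcases sq_eq_sq_iff_eq_or_eq_neg.mp h2 with h3 | h3
    · exact ⟨Fintype.card A, by rw [h3]; simp⟩
    · exact ⟨-Fintype.card A, by rw [h3]; push_cast; ring⟩
  obtain ⟨c, hc⟩ := hc
  refine ⟨ζ, j, c, hζ, hι, hc, fun u hu => ?_⟩
  have hpow : (ζ ^ j) ^ u = chi4 u * ζ ^ j := by
    have hodd : u % 2 = 1 := by
      have h2 : Nat.Coprime u 2 := hu.coprime_dvd_right (dvd_trans (by norm_num) h4)
      exact Nat.odd_iff.mp (Nat.coprime_two_right.mp h2)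
    obtain ⟨p1, p2⟩ := pow_of_mod_four hι (u := u)
    unfold chi4
    split_ifs with h5
    · rw [p1 (by omega), one_mul]
    · rw [p2 (by omega)]; ring
  refine ⟨hpow, ?_⟩
  have := D.gz_conjugate hN hpos hζ (v := 1) (w := 1) (k := 2)
    (j := j) (l := 0) (c := c) (by push_cast; rw [hc]; ring) hu
  push_cast at this
  rw [one_mul] at this
  rw [this, hpow, hc]
  ring

lemma chi4_congr {N : ℕ} (h4 : 4 ∣ N) {a b : ℤ} (h : a ≡ b [ZMOD N]) : chi4 a = chi4 b := by
  have h5 : a ≡ b [ZMOD 4] := h.of_dvd (by exact_mod_cast h4)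
  have h6 : a % 4 = b % 4 := h5
  unfold chi4
  rw [h6]

/-- In odd signature the normalised Gauss sum `g_u(A) / g(A)` is `±1` for `u ≡ 1 (mod 4)` and `±i`
for `u ≡ 3 (mod 4)`. -/
lemma psi_sq_of_not_evenSig (h : ¬ D.EvenSig) {N : ℕ} (hN : D.Killed N) (hpos : 0 < N) (h4 : 4 ∣ N)
    {u : ℤ} (hu : IsCoprime u N) : D.psi u ^ 2 = chi4 u := by
  obtain ⟨m, hm, hmc⟩ := exists_nat_modEq hpos hu
  obtain ⟨ζ, j, c, hζ, hι, hc, H⟩ := gz_odd_aux h hN hpos h4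
  rw [← hN.psi_congr hm, ← chi4_congr h4 hm, psi, div_pow, (H m hmc).2, mul_div_assoc,
    div_self (pow_ne_zero _ D.gz_one_ne_zero), mul_one]

/-- In odd signature `u ↦ g_u(A) / g(A)` is multiplicative up to an explicit sign. -/
lemma psi_mul_of_not_evenSig (h : ¬ D.EvenSig) {N : ℕ} (hN : D.Killed N) (hpos : 0 < N)
    (h4 : 4 ∣ N) {u v : ℤ} (hu : IsCoprime u N) (hv : IsCoprime v N) :
    D.psi (u * v) = D.psi u * D.psi v * (if v % 4 = 1 then 1 else chi4 u) := by
  obtain ⟨m, hm, hmc⟩ := exists_nat_modEq hpos hu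
  obtain ⟨n, hn, hnc⟩ := exists_nat_modEq hpos hv
  obtain ⟨ζ, j, c, hζ, hι, hc, H⟩ := gz_odd_aux h hN hpos h4
  have hv4 : v % 4 = (n : ℤ) % 4 := (hn.symm.of_dvd (by exact_mod_cast h4) : v ≡ n [ZMOD 4])
  rw [← hN.psi_congr hm, ← hN.psi_congr hn, ← hN.psi_congr (hm.mul hn), hv4, ← chi4_congr h4 hm]
  have hg := D.gz_one_ne_zero
  have hsq := (H n hnc).2
  by_cases hn4 : (n : ℤ) % 4 = 1
  · rw [if_pos hn4]
    rw [chi4, if_pos hn4, one_mul] at hsq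
    have hτ : ∃ τ : ℤ, D.gz n = τ * D.gz 1 := by
      rcases sq_eq_sq_iff_eq_or_eq_neg.mp hsq with h3 | h3
      · exact ⟨1, by rw [h3]; simp⟩
      · exact ⟨-1, by rw [h3]; simp⟩
    obtain ⟨τ, hτ⟩ := hτ
    have := D.gz_conjugate hN hpos hζ (v := n) (w := 1) (k := 1)
      (j := 0) (l := 1) (c := τ) (by push_cast; rw [hτ]; ring) hmc
    push_cast at this
    rw [one_mul, pow_one, pow_one, pow_zero, one_pow, mul_one] at this
    rw [psi, psi, psi, hτ, mul_comm (m : ℤ), this]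
    field_simp
  · rw [if_neg hn4]
    rw [chi4, if_neg hn4] at hsq
    have hτ : ∃ τ : ℤ, D.gz n = τ * ζ ^ j * D.gz 1 := by
      have h2 : D.gz n ^ 2 = (ζ ^ j * D.gz 1) ^ 2 := by rw [mul_pow, hι, hsq]
      rcases sq_eq_sq_iff_eq_or_eq_neg.mp h2 with h3 | h3
      · exact ⟨1, by rw [h3]; simp⟩
      · exact ⟨-1, by rw [h3]; push_cast; ring⟩
    obtain ⟨τ, hτ⟩ := hτ
    have := D.gz_conjugate hN hpos hζ (v := n) (w := 1) (k := 1)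
      (j := j) (l := 1) (c := τ) (by push_cast; rw [hτ]; ring) hmc
    push_cast at this
    rw [one_mul, pow_one, pow_one, (H m hmc).1] at this
    rw [psi, psi, psi, hτ, mul_comm (m : ℤ), this]
    field_simp

/-- A discriminant form of odd level has even signature: by Dirichlet's theorem there is a prime
`p ≡ -1` modulo the level which is a sum of two squares. -/
lemma Killed.evenSig_of_odd {N : ℕ} (hN : D.Killed N) (hodd : Odd N) : D.EvenSig := by
  have hpos : 0 < N := hodd.pos
  have hcop : Nat.Coprime 4 N := by
    have : Nat.Coprime 2 N := Nat.coprime_two_left.mpr hodd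
    exact Nat.Coprime.pow_left 2 this
  obtain ⟨r, hr1, hr2⟩ := Nat.chineseRemainder hcop 1 (2 * N - 1)
  have hrN : (r : ℤ) ≡ -1 [ZMOD N] := by
    have h1 := (Int.natCast_modEq_iff.mpr hr2)
    refine h1.trans ?_
    rw [Nat.cast_sub (by omega)]
    rw [Int.modEq_iff_dvd]
    exact ⟨-2, by push_cast; ring⟩
  have hru : IsUnit (r : ZMod (4 * N)) := by
    rw [ZMod.isUnit_iff_coprime]
    refine Nat.Coprime.mul_right ?_ ?_
    · have : r % 4 = 1 := hr1
      rw [← Nat.isCoprime_iff_coprime]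
      refine ⟨1, -((r / 4 : ℕ) : ℤ), ?_⟩
      have h2 := Nat.div_add_mod r 4
      push_cast; omega
    · rw [← Nat.isCoprime_iff_coprime]
      obtain ⟨k, hk⟩ := hrN.dvd
      exact ⟨-1, -k, by linarith⟩
  have : NeZero (4 * N) := ⟨by omega⟩
  obtain ⟨p, -, hp, hpr⟩ := Nat.forall_exists_prime_gt_and_eq_mod hru 0
  have hpr' : p ≡ r [MOD 4 * N] := (ZMod.natCast_eq_natCast_iff _ _ _).mp hpr
  have hp4 : p % 4 = 1 := (hpr'.of_dvd (dvd_mul_right 4 N)).trans hr1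
  have hpN : (p : ℤ) ≡ -1 [ZMOD N] :=
    (Int.natCast_modEq_iff.mpr (hpr'.of_dvd (dvd_mul_left N 4))).trans hrN
  have : Fact p.Prime := ⟨hp⟩
  obtain ⟨a, b, hab⟩ := Nat.Prime.sq_add_sq (p := p) (by omega)
  have hab' : (a ^ 2 + b ^ 2 : ℤ) = p := by exact_mod_cast hab
  have h1 := hN.gz_mul_pow_two (a := a) (b := b) (by
    rw [hab']
    obtain ⟨k, hk⟩ := hpN.dvd
    exact ⟨-1, -k, by linarith⟩) 1
  rw [hab', one_mul, hN.gz_congr hpN] at h1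
  have h2 := D.gz_one_mul_conj
  calc D.gz 1 ^ 4 = D.gz 1 ^ 2 * D.gz (-1) ^ 2 := by rw [h1]; ring
    _ = (D.gz 1 * D.gz (-1)) ^ 2 := by ring
    _ = _ := by rw [h2]

lemma Killed.evenSig_of_two (hN : D.Killed 2) : D.EvenSig := by
  have h1 : D.gz (-1) = D.gz 1 := hN.gz_congr (by decide)
  have h2 := D.gz_one_mul_conj
  rw [h1] at h2
  rw [EvenSig, ← h2]; ring

end DiscriminantForm

/-! ### The integral metaplectic group -/

lemma mat_ofSL (γ : SL(2, ℤ)) (i j : Fin 2) : mat (ofSL γ) i j = (γ i j : ℚ) := rfl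

lemma mat_mul (M M' : GL(2, ℚ)⁺) : mat (M * M') = mat M * mat M' := rfl

lemma mat_injective : Function.Injective mat := fun _ _ h => Subtype.ext (Units.ext h)

lemma ofSL_injective : Function.Injective ofSL := by
  intro γ γ' h
  ext i j
  have : mat (ofSL γ) i j = mat (ofSL γ') i j := by rw [h]
  rw [mat_ofSL, mat_ofSL] at this
  exact_mod_cast this

lemma autJ_ofSL (γ : SL(2, ℤ)) (τ : ℍ) : autJ (ofSL γ) τ = (γ 1 0 : ℂ) * τ + (γ 1 1 : ℂ) := by
  rw [autJ_eq, mat_ofSL, mat_ofSL]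
  simp

lemma moebius_ofSL (γ : SL(2, ℤ)) (τ : ℍ) : moebius (ofSL γ) τ = γ • τ := by
  apply UpperHalfPlane.ext
  rw [UpperHalfPlane.specialLinearGroup_apply]
  rw [moebius, UpperHalfPlane.coe_smul_of_det_pos (toGLReal_det_pos _)]
  simp [UpperHalfPlane.num, UpperHalfPlane.denom, toGLReal, ofSL]

/-- The projection `Γ̃ → SL₂(ℤ)`. -/
def toSL : MpZ →* SL(2, ℤ) :=
  (MonoidHom.ofInjective ofSL_injective).symm.toMonoidHom.comp
    ((Mp.proj.comp MpZ.subtype).codRestrict ofSL.range fun g => g.2)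

lemma ofSL_toSL (g : MpZ) : ofSL (toSL g) = g.1.M := by
  have := (MonoidHom.ofInjective ofSL_injective).apply_symm_apply
    (((Mp.proj.comp MpZ.subtype).codRestrict ofSL.range fun g => g.2) g)
  exact congrArg Subtype.val this

lemma toSL_liftSL (γ : SL(2, ℤ)) : toSL (liftSL γ) = γ := ofSL_injective (ofSL_toSL _)

lemma toSL_mpS : toSL mpS = ModularGroup.S := toSL_liftSL _

lemma toSL_mpT : toSL mpT = ModularGroup.T := toSL_liftSL _

lemma liftSL_φ (γ : SL(2, ℤ)) (τ : ℍ) :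
    (liftSL γ).1.φ τ = ((γ 1 0 : ℂ) * τ + (γ 1 1 : ℂ)) ^ (1 / 2 : ℂ) := by
  rw [← autJ_ofSL]; rfl

lemma mpT_φ (τ : ℍ) : mpT.1.φ τ = 1 := by
  rw [mpT, liftSL_φ]
  simp [ModularGroup.T]

lemma mpS_φ (τ : ℍ) : mpS.1.φ τ = (τ : ℂ) ^ (1 / 2 : ℂ) := by
  rw [mpS, liftSL_φ]
  simp [ModularGroup.S]

/-- Two elements of the metaplectic group over the same matrix differ by a sign. -/
lemma Mp.eq_or_neg {g h : Mp} (hM : g.M = h.M) :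
    (∀ τ, g.φ τ = h.φ τ) ∨ (∀ τ, g.φ τ = -h.φ τ) := by
  have := (isPreconnected_univ (α := ℍ)).eq_or_eq_neg_of_sq_eq (f := g.φ) (g := h.φ)
    g.holo.continuous.continuousOn h.holo.continuous.continuousOn
    (fun τ _ => by simp [g.sq, h.sq, hM]) (fun _ => h.φ_ne_zero _)
  rcases this with h1 | h1
  · exact Or.inl fun τ => h1 (Set.mem_univ τ)
  · exact Or.inr fun τ => h1 (Set.mem_univ τ)

lemma MpZ_ext {g h : MpZ} (hM : toSL g = toSL h) (hφ : g.1.φ UpperHalfPlane.I = h.1.φ UpperHalfPlane.I) :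
    g = h := by
  have h1 : g.1.M = h.1.M := by rw [← ofSL_toSL, ← ofSL_toSL, hM]
  refine Subtype.ext (Mp.ext h1 (funext ?_))
  rcases Mp.eq_or_neg h1 with h2 | h2
  · exact h2
  · exfalso
    have h3 := h2 UpperHalfPlane.I
    rw [hφ] at h3
    exact h.1.φ_ne_zero _ (self_eq_neg.mp h3)

lemma MpZ_mul_φ (g h : MpZ) (τ : ℍ) : (g * h).1.φ τ = g.1.φ (toSL h • τ) * h.1.φ τ := by
  change g.1.φ (moebius h.1.M τ) * h.1.φ τ = _
  rw [← ofSL_toSL, moebius_ofSL]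

lemma MpZ_φ_sq (g : MpZ) (τ : ℍ) :
    g.1.φ τ ^ 2 = ((toSL g) 1 0 : ℂ) * τ + ((toSL g) 1 1 : ℂ) := by
  rw [g.1.sq, ← ofSL_toSL, autJ_ofSL]

lemma sqrt_quadrant {z : ℂ} (hz : 0 < z.im) :
    0 < (z ^ (1 / 2 : ℂ)).re ∧ 0 < (z ^ (1 / 2 : ℂ)).im := by
  have h1 : 0 < z.arg := by
    rcases (Complex.arg_nonneg_iff.mpr hz.le).lt_or_eq with h | h
    · exact h
    · have := (Complex.arg_eq_zero_iff.mp h.symm).2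
      exact absurd this hz.ne'
  have h2 : z.arg < Real.pi := by
    rcases (Complex.arg_le_pi z).lt_or_eq with h | h
    · exact h
    · exact absurd (Complex.arg_eq_pi_iff.mp h).2 hz.ne'
  have hz0 : z ≠ 0 := by rintro rfl; simp at hz
  have hn : 0 < ‖z‖ ^ (1 / 2 : ℝ) := Real.rpow_pos_of_pos (norm_pos_iff.mpr hz0) _
  have hre := Complex.cpow_ofReal_re z (1 / 2)
  have him := Complex.cpow_ofReal_im z (1 / 2)
  push_cast at hre him
  rw [hre, him]
  have hpi := Real.pi_pos
  exact ⟨mul_pos hn (Real.cos_pos_of_mem_Ioo ⟨by linarith, by linarith⟩),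
    mul_pos hn (Real.sin_pos_of_pos_of_lt_pi (by linarith) (by linarith))⟩

lemma eq_I_or_eq_neg_I {z : ℂ} (h : z ^ 2 = -1) : z = Complex.I ∨ z = -Complex.I := by
  rw [← Complex.I_sq] at h
  exact sq_eq_sq_iff_eq_or_eq_neg.mp h

lemma toSL_mpS_sq : toSL (mpS * mpS) = -1 := by
  rw [map_mul, toSL_mpS]
  decide

lemma mpS_sq_φ (τ : ℍ) : (mpS * mpS).1.φ τ = Complex.I := by
  have hsq : (mpS * mpS).1.φ τ ^ 2 = -1 := by
    rw [MpZ_φ_sq, toSL_mpS_sq]; simp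
  have h1 := sqrt_quadrant (ModularGroup.S • τ).im_pos
  have h2 := sqrt_quadrant τ.im_pos
  have h3 : 0 < ((mpS * mpS).1.φ τ).im := by
    rw [MpZ_mul_φ, mpS_φ, mpS_φ, toSL_mpS, Complex.mul_im]
    have := mul_pos h1.1 h2.2
    have := mul_pos h1.2 h2.1
    exact add_pos ‹_› ‹_›
  rcases eq_I_or_eq_neg_I hsq with h | h
  · exact h
  · rw [h] at h3; norm_num at h3

lemma mpST_φ (τ : ℍ) : (mpS * mpT).1.φ τ = ((ModularGroup.T • τ : ℍ) : ℂ) ^ (1 / 2 : ℂ) := by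
  rw [MpZ_mul_φ, mpT_φ, mpS_φ, toSL_mpT, mul_one]

/-- The relation `(ST)³ = S²` in the metaplectic group. -/
lemma mpST_cube : mpS * mpT * (mpS * mpT) * (mpS * mpT) = mpS * mpS := by
  have hSL : toSL (mpS * mpT * (mpS * mpT) * (mpS * mpT)) = -1 := by
    simp only [map_mul, toSL_mpS, toSL_mpT]
    decide
  refine MpZ_ext (by rw [hSL, toSL_mpS_sq]) ?_
  rw [mpS_sq_φ]
  have hsq := MpZ_φ_sq (mpS * mpT * (mpS * mpT) * (mpS * mpT)) UpperHalfPlane.I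
  rw [hSL] at hsq
  have hsq' : (mpS * mpT * (mpS * mpT) * (mpS * mpT)).1.φ UpperHalfPlane.I ^ 2 = -1 := by
    rw [hsq]; simp
  rcases eq_I_or_eq_neg_I hsq' with h | h
  · exact h
  · exfalso
    -- three factors in the open first quadrant cannot have product `-i`
    rw [MpZ_mul_φ, MpZ_mul_φ, mpST_φ, mpST_φ, mpST_φ] at h
    set a := ((ModularGroup.T • (toSL (mpS * mpT)) • (toSL (mpS * mpT)) • UpperHalfPlane.I : ℍ) : ℂ)
      ^ (1 / 2 : ℂ)
    set b := ((ModularGroup.T • (toSL (mpS * mpT)) • UpperHalfPlane.I : ℍ) : ℂ) ^ (1 / 2 : ℂ)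
    set c := ((ModularGroup.T • UpperHalfPlane.I : ℍ) : ℂ) ^ (1 / 2 : ℂ)
    have ha : 0 < a.re ∧ 0 < a.im := sqrt_quadrant (UpperHalfPlane.im_pos _)
    have hb : 0 < b.re ∧ 0 < b.im := sqrt_quadrant (UpperHalfPlane.im_pos _)
    have hc : 0 < c.re ∧ 0 < c.im := sqrt_quadrant (UpperHalfPlane.im_pos _)
    have hab : 0 < (a * b).im := by
      rw [Complex.mul_im]
      exact add_pos (mul_pos ha.1 hb.2) (mul_pos ha.2 hb.1)
    have hre := congrArg Complex.re h
    have him := congrArg Complex.im h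
    rw [Complex.mul_re] at hre
    rw [Complex.mul_im] at him
    simp only [Complex.neg_re, Complex.neg_im, Complex.I_re, Complex.I_im, neg_zero] at hre him
    have h5 : 0 < (a * b).re := by
      by_contra hneg
      push Not at hneg
      have := mul_pos hab hc.2
      nlinarith [mul_nonneg (neg_nonneg.mpr hneg) hc.1.le]
    nlinarith [mul_pos h5 hc.2, mul_pos hab hc.1]

/-- The central element `(1, -1)` of the metaplectic group. -/
def mpNeg : MpZ := mpS * mpS * (mpS * mpS)

lemma toSL_mpNeg : toSL mpNeg = 1 := by
  rw [mpNeg, map_mul, toSL_mpS_sq]; simp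

lemma mpNeg_φ (τ : ℍ) : mpNeg.1.φ τ = -1 := by
  rw [mpNeg, MpZ_mul_φ, mpS_sq_φ, mpS_sq_φ, Complex.I_mul_I]

lemma mpNeg_mul_self : mpNeg * mpNeg = 1 := by
  refine MpZ_ext (by rw [map_mul, toSL_mpNeg]; simp) ?_
  rw [MpZ_mul_φ, mpNeg_φ, mpNeg_φ]
  change _ = (1 : ℂ)
  norm_num

/-- An element of `Γ̃` is determined by its matrix up to the central element `(1, -1)`. -/
lemma eq_or_eq_mpNeg_mul {g h : MpZ} (hM : toSL g = toSL h) : g = h ∨ g = mpNeg * h := by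
  have h1 : g.1.M = h.1.M := by rw [← ofSL_toSL, ← ofSL_toSL, hM]
  rcases Mp.eq_or_neg h1 with h2 | h2
  · exact Or.inl (MpZ_ext hM (h2 _))
  · refine Or.inr (MpZ_ext (by rw [map_mul, toSL_mpNeg, one_mul, hM]) ?_)
    rw [h2, MpZ_mul_φ, mpNeg_φ, neg_one_mul]

lemma closure_mpS_mpT : Subgroup.closure {mpS, mpT} = ⊤ := by
  rw [eq_top_iff]
  intro g _
  have h1 : toSL g ∈ Subgroup.closure {ModularGroup.S, ModularGroup.T} := by
    rw [SpecialLinearGroup.SL2Z_generators]; trivial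
  have h2 : Subgroup.closure {ModularGroup.S, ModularGroup.T} =
      (Subgroup.closure {mpS, mpT}).map toSL := by
    rw [MonoidHom.map_closure, Set.image_pair, toSL_mpS, toSL_mpT]
  rw [h2] at h1
  obtain ⟨g', hg', he⟩ := h1
  have hS : mpS ∈ Subgroup.closure {mpS, mpT} := Subgroup.subset_closure (by simp)
  rcases eq_or_eq_mpNeg_mul he.symm with h3 | h3
  · rw [h3]; exact hg'
  · rw [h3]
    exact mul_mem (mul_mem (mul_mem hS hS) (mul_mem hS hS)) hg'

/-! ### Normal forms in a group generated by `s`, `u` with `s² = u³` -/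

/-- In a group generated by `s` and `u` with `s² = u³ = z`, every element has the form
`zⁱ u^ε w s^δ` with `w` in the monoid generated by `su` and `su²`. -/
lemma exists_normal_form {G : Type*} [Group G] {s u : G} (h : s * s = u * u * u) {x : G}
    (hx : x ∈ Subgroup.closure {s, u}) :
    ∃ (i : ℤ) (ε δ : ℕ) (w : G), ε < 3 ∧ δ < 2 ∧ w ∈ Submonoid.closure {s * u, s * (u * u)} ∧
      x = (s * s) ^ i * (u ^ ε * w * s ^ δ) := by
  have zs : Commute (s * s) s := by simp [Commute, SemiconjBy, mul_assoc]
  have zu : Commute (s * s) u := by rw [h]; simp [Commute, SemiconjBy, mul_assoc]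
  let P : G → Prop := fun x => ∃ (i : ℤ) (ε δ : ℕ) (w : G), ε < 3 ∧ δ < 2 ∧
    w ∈ Submonoid.closure {s * u, s * (u * u)} ∧ x = (s * s) ^ i * (u ^ ε * w * s ^ δ)
  have m1 : s * u ∈ Submonoid.closure {s * u, s * (u * u)} := Submonoid.subset_closure (by simp)
  have m2 : s * (u * u) ∈ Submonoid.closure {s * u, s * (u * u)} :=
    Submonoid.subset_closure (by simp)
  have hz : ∀ (k : ℤ) x, P x → P ((s * s) ^ k * x) := by
    rintro k x ⟨i, ε, δ, w, hε, hδ, hw, rfl⟩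
    exact ⟨k + i, ε, δ, w, hε, hδ, hw, by rw [zpow_add]; simp only [mul_assoc]⟩
  have hu : ∀ x, P x → P (u * x) := by
    rintro x ⟨i, ε, δ, w, hε, hδ, hw, rfl⟩
    have e1 : u * ((s * s) ^ i * (u ^ ε * w * s ^ δ)) =
        (s * s) ^ i * (u ^ (ε + 1) * w * s ^ δ) := by
      rw [← mul_assoc, ← (zu.zpow_left i).eq, pow_succ']
      simp only [mul_assoc]
    rw [e1]
    by_cases h3 : ε + 1 < 3
    · exact hz i _ ⟨0, ε + 1, δ, w, h3, hδ, hw, by simp⟩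
    · have : ε + 1 = 3 := by omega
      refine hz i _ ⟨1, 0, δ, w, by norm_num, hδ, hw, ?_⟩
      rw [this, zpow_one, h, pow_succ, pow_two]
      simp [mul_assoc]
  have hs : ∀ x, P x → P (s * x) := by
    rintro x ⟨i, ε, δ, w, hε, hδ, hw, rfl⟩
    have e1 : s * ((s * s) ^ i * (u ^ ε * w * s ^ δ)) =
        (s * s) ^ i * (s * (u ^ ε * w * s ^ δ)) := by
      rw [← mul_assoc, ← (zs.zpow_left i).eq]; simp only [mul_assoc]
    rw [e1]
    refine hz i _ ?_
    interval_cases ε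
    · -- here the leading letter of `w` absorbs `s`
      induction hw using Submonoid.closure_induction_left with
      | one =>
        interval_cases δ
        · exact ⟨0, 0, 1, 1, by norm_num, by norm_num, one_mem _, by simp⟩
        · exact ⟨1, 0, 0, 1, by norm_num, by norm_num, one_mem _, by simp⟩
      | mul_left a ha b hb ih =>
        rcases ha with rfl | rfl
        · exact ⟨1, 1, δ, b, by norm_num, hδ, hb, by simp [mul_assoc]⟩
        · exact ⟨1, 2, δ, b, by norm_num, hδ, hb, by simp [mul_assoc, pow_two]⟩
    · exact ⟨0, 0, δ, s * u * w, by norm_num, hδ, mul_mem m1 hw, by simp [mul_assoc]⟩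
    · exact ⟨0, 0, δ, s * (u * u) * w, by norm_num, hδ, mul_mem m2 hw, by simp [mul_assoc, pow_two]⟩
  have h1 : P 1 := ⟨0, 0, 0, 1, by norm_num, by norm_num, one_mem _, by simp⟩
  change P x
  induction hx using Subgroup.closure_induction_left with
  | one => exact h1
  | mul_left a ha b hb ih =>
    rcases ha with rfl | rfl
    · exact hs _ ih
    · exact hu _ ih
  | inv_mul_cancel a ha b hb ih =>
    rcases ha with rfl | rfl
    · have : a⁻¹ * b = (a * a) ^ (-1 : ℤ) * (a * b) := by simp [mul_assoc]
      rw [this]; exact hz _ _ (hs _ ih)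
    · have : a⁻¹ * b = (s * s) ^ (-1 : ℤ) * (a * (a * b)) := by rw [h]; simp [mul_assoc]
      rw [this]; exact hz _ _ (hu _ (hu _ ih))

/-! ### Existence of the Weil representation -/

lemma SL_ext {g h : SL(2, ℤ)} (h00 : g 0 0 = h 0 0) (h01 : g 0 1 = h 0 1) (h10 : g 1 0 = h 1 0)
    (h11 : g 1 1 = h 1 1) : g = h := by
  ext i j; fin_cases i <;> fin_cases j <;> assumption

lemma SL_mul_apply (g h : SL(2, ℤ)) (i j : Fin 2) :
    (g * h) i j = g i 0 * h 0 j + g i 1 * h 1 j := by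
  simp [Matrix.mul_apply, Fin.sum_univ_two]

/-- The submonoid generated by `T` and `V` up to sign consists of matrices with nonnegative entries;
apart from `1` they are not diagonal. -/
lemma nonneg_of_mem_closure {G : Type*} [Group G] (π : G →* SL(2, ℤ)) {x y : G}
    (hx : π x = -ModularGroup.T)
    (hy : π y = -(ModularGroup.T * ModularGroup.S * ModularGroup.T))
    {w : G} (hw : w ∈ Submonoid.closure {x, y}) :
    w = 1 ∨ ∃ η : ℤ, (η = 1 ∨ η = -1) ∧ 0 ≤ η * π w 0 0 ∧ 0 ≤ η * π w 0 1 ∧ 0 ≤ η * π w 1 0 ∧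
      0 ≤ η * π w 1 1 ∧ 0 < η * (π w 0 1 + π w 1 0) := by
  have hT : ∀ i j, (-ModularGroup.T) i j = (!![-1, -1; 0, -1] : Matrix (Fin 2) (Fin 2) ℤ) i j := by
    intro i j; fin_cases i <;> fin_cases j <;> rfl
  have hV : ∀ i j, (-(ModularGroup.T * ModularGroup.S * ModularGroup.T)) i j =
      (!![-1, 0; -1, -1] : Matrix (Fin 2) (Fin 2) ℤ) i j := by
    intro i j; fin_cases i <;> fin_cases j <;> rfl
  induction hw using Submonoid.closure_induction_left with
  | one => exact Or.inl rfl
  | mul_left a ha b hb ih =>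
    right
    rcases ha with rfl | rfl
    · rw [map_mul, hx]
      simp only [SL_mul_apply, hT]
      rcases ih with rfl | ⟨η, hη, h1, h2, h3, h4, h5⟩
      · exact ⟨-1, Or.inr rfl, by simp⟩
      · refine ⟨-η, by rcases hη with rfl | rfl <;> simp, ?_⟩
        simp
        refine ⟨?_, ?_, ?_, ?_, ?_⟩ <;> nlinarith
    · rw [map_mul, hy]
      simp only [SL_mul_apply, hV]
      rcases ih with rfl | ⟨η, hη, h1, h2, h3, h4, h5⟩
      · exact ⟨-1, Or.inr rfl, by simp⟩
      · refine ⟨-η, by rcases hη with rfl | rfl <;> simp, ?_⟩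
        simp
        refine ⟨?_, ?_, ?_, ?_, ?_⟩ <;> nlinarith

/-- If `s² = (st)³`, then the kernel on `⟨s, t⟩` of a homomorphism to `SL₂(ℤ)` mapping `s`, `t` to `S`,
`T` consists of powers of `s²`: this is the presentation of `PSL₂(ℤ)`. -/
lemma eq_zpow_of_map_eq_one {G : Type*} [Group G] (π : G →* SL(2, ℤ)) {s t : G}
    (hs : π s = ModularGroup.S) (ht : π t = ModularGroup.T)
    (h : s * s = (s * t) * (s * t) * (s * t)) {x : G} (hx : x ∈ Subgroup.closure {s, t})
    (h1 : π x = 1) : ∃ i : ℤ, x = (s * s) ^ i := by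
  have hx' : x ∈ Subgroup.closure {s, s * t} := by
    refine (Subgroup.closure_le _).mpr ?_ hx
    rintro y (rfl | rfl)
    · exact Subgroup.subset_closure (by simp)
    · have m1 : s ∈ Subgroup.closure {s, s * y} := Subgroup.subset_closure (by simp)
      have m2 : s * y ∈ Subgroup.closure {s, s * y} := Subgroup.subset_closure (by simp)
      have := mul_mem (inv_mem m1) m2
      simpa using this
  obtain ⟨i, ε, δ, w, hε, hδ, hw, rfl⟩ := exists_normal_form h hx'
  refine ⟨i, ?_⟩
  have hz : π (s * s) = -1 := by rw [map_mul, hs]; decide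
  have hzi : π ((s * s) ^ i) = 1 ∨ π ((s * s) ^ i) = -1 := by
    rw [map_zpow, hz]
    rcases Int.even_or_odd i with he | ho
    · exact Or.inl he.neg_one_zpow
    · exact Or.inr ho.neg_one_zpow
  have hu : π (s * t) = ModularGroup.S * ModularGroup.T := by rw [map_mul, hs, ht]
  have hmain : π w = (π (s * t) ^ ε)⁻¹ * (π s ^ δ)⁻¹ ∨ π w = -((π (s * t) ^ ε)⁻¹ * (π s ^ δ)⁻¹) := by
    rw [map_mul, map_mul, map_mul, map_pow, map_pow] at h1
    have e1 : π w = (π (s * t) ^ ε)⁻¹ * (π ((s * s) ^ i))⁻¹ * (π s ^ δ)⁻¹ := by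
      rw [eq_mul_inv_iff_mul_eq, eq_inv_mul_iff_mul_eq, ← mul_assoc, eq_comm]
      exact inv_eq_of_mul_eq_one_right h1
    rcases hzi with h2 | h2
    · left; rw [e1, h2]; simp
    · right; rw [e1, h2]; simp
  rw [hu, hs] at hmain
  have hx1 : π (s * (s * t)) = -ModularGroup.T := by rw [map_mul, hs, hu]; decide
  have hy1 : π (s * (s * t * (s * t))) = -(ModularGroup.T * ModularGroup.S * ModularGroup.T) := by
    rw [map_mul, map_mul, hs, hu]; decide
  rcases nonneg_of_mem_closure π hx1 hy1 hw with rfl | ⟨η, hη, k1, k2, k3, k4, k5⟩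
  · rw [map_one] at hmain
    have : ε = 0 ∧ δ = 0 := by
      interval_cases ε <;> interval_cases δ <;> revert hmain <;> decide
    rw [this.1, this.2]; simp
  · exfalso
    have key : ∀ (m : SL(2, ℤ)), (π w = m ∨ π w = -m) → m 0 1 + m 1 0 = 0 ∨
        m 0 1 * m 1 0 < 0 ∨ m 0 0 * m 0 1 < 0 ∨ m 0 0 * m 1 0 < 0 → False := by
      intro m hm hneg
      have hη2 : η * η = 1 := by rcases hη with rfl | rfl <;> norm_num
      obtain ⟨τ, hτ, e00, e01, e10⟩ : ∃ τ : ℤ, τ * τ = 1 ∧ π w 0 0 = τ * m 0 0 ∧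
          π w 0 1 = τ * m 0 1 ∧ π w 1 0 = τ * m 1 0 := by
        rcases hm with hm | hm
        · exact ⟨1, by norm_num, by simp [hm]⟩
        · exact ⟨-1, by norm_num, by simp [hm]⟩
      rw [e01, e10] at k5
      rw [e00] at k1
      rw [e01] at k2
      rw [e10] at k3
      have hητ : (η * τ) * (η * τ) = 1 := by linear_combination η * η * hτ + hη2
      have mul' : ∀ a b : ℤ, 0 ≤ η * (τ * a) → 0 ≤ η * (τ * b) → 0 ≤ a * b := by
        intro a b ha hb
        have := mul_nonneg ha hb
        have e : η * (τ * a) * (η * (τ * b)) = (η * τ) * (η * τ) * (a * b) := by ring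
        rw [e, hητ, one_mul] at this
        exact this
      rcases hneg with h0 | h0 | h0 | h0
      · have : η * (τ * m 0 1 + τ * m 1 0) = η * τ * (m 0 1 + m 1 0) := by ring
        rw [this, h0] at k5; simp at k5
      · exact absurd (mul' _ _ k2 k3) (not_le.mpr h0)
      · exact absurd (mul' _ _ k1 k2) (not_le.mpr h0)
      · exact absurd (mul' _ _ k1 k3) (not_le.mpr h0)
    refine key _ hmain ?_
    interval_cases ε <;> interval_cases δ <;> decide

namespace DiscriminantForm

variable {A : Type*} [AddCommGroup A] [Fintype A] (D : DiscriminantForm A)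

lemma weilT_apply (a : A → ℂ) (x : A) : D.weilT a x = e (D.q x) * a x := rfl

lemma weilS_apply (a : A → ℂ) (y : A) :
    D.weilS a y = (D.gz 1)⁻¹ * ∑ x, e (-D.bil x y) * a x := by
  have h : (Complex.exp (-(2 * Real.pi * Complex.I * (D.signature.val : ℂ) / 8)) /
      (Real.sqrt (Fintype.card A) : ℂ)) = (D.gz 1)⁻¹ := by
    rw [D.signature_spec, mul_inv, Complex.exp_neg, div_eq_mul_inv, mul_comm]
  simp only [weilS, h, LinearMap.smul_apply, Pi.smul_apply, smul_eq_mul]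
  rfl

lemma weilS_sq_apply (a : A → ℂ) (y : A) :
    D.weilS (D.weilS a) y = Fintype.card A / D.gz 1 ^ 2 * a (-y) := by
  classical
  simp only [weilS_apply]
  have h1 : ∑ x, e (-D.bil x y) * ((D.gz 1)⁻¹ * ∑ z, e (-D.bil z x) * a z) =
      (D.gz 1)⁻¹ * ∑ z, a z * ∑ x, e (D.bil (-(z + y)) x) := by
    simp only [Finset.mul_sum]
    rw [Finset.sum_comm]
    refine Finset.sum_congr rfl fun z _ => Finset.sum_congr rfl fun x _ => ?_
    have : e (D.bil (-(z + y)) x) = e (-D.bil x y) * e (-D.bil z x) := by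
      rw [← e_add, bil_neg_left, bil_add_left, bil_comm D y x]; congr 1; abel
    rw [this]; ring
  rw [h1, Finset.sum_eq_single (-y)]
  · rw [sum_e_bil, if_pos (by simp)]
    have := D.gz_one_ne_zero
    field_simp
  · intro z _ hz
    rw [sum_e_bil, if_neg, mul_zero]
    intro h; apply hz
    rw [neg_eq_zero] at h
    exact eq_neg_of_add_eq_zero_left h
  · simp

lemma weilS_pow_four : D.weilS * D.weilS * (D.weilS * D.weilS) =
    ((Fintype.card A / D.gz 1 ^ 2) ^ 2 : ℂ) • 1 := by
  ext1 a
  funext y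
  change D.weilS (D.weilS (D.weilS (D.weilS a))) y = _ * a y
  rw [weilS_sq_apply, weilS_sq_apply, neg_neg]
  ring

lemma weilS_pow_eight : D.weilS ^ 8 = 1 := by
  have h : D.weilS ^ 8 = (D.weilS * D.weilS * (D.weilS * D.weilS)) *
      (D.weilS * D.weilS * (D.weilS * D.weilS)) := by
    simp only [pow_succ, pow_zero, one_mul, mul_assoc]
  have h2 : (Fintype.card A : ℂ) ≠ 0 := by exact_mod_cast Fintype.card_ne_zero
  rw [h, weilS_pow_four, smul_mul_smul_comm, one_mul]
  have : ((Fintype.card A / D.gz 1 ^ 2) ^ 2 * (Fintype.card A / D.gz 1 ^ 2) ^ 2 : ℂ) = 1 := by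
    have h8 := gz_one_pow_eight (D := D)
    have hg := D.gz_one_ne_zero
    field_simp
    rw [h8]
  rw [this, one_smul]

lemma weilT_pow (n : ℕ) (a : A → ℂ) (x : A) : (D.weilT ^ n) a x = e (n • D.q x) * a x := by
  induction n with
  | zero => simp
  | succ n ih =>
    rw [pow_succ', Module.End.mul_apply, weilT_apply, ih, succ_nsmul, e_add]; ring

lemma weilT_pow_level : D.weilT ^ D.level = 1 := by
  ext1 a
  funext x
  rw [weilT_pow, level_spec, e_zero]; simp

/-- `weilT` as an automorphism. -/
def unitT : LinearMap.GeneralLinearGroup ℂ (A → ℂ) :=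
  Units.ofPowEqOne D.weilT D.level D.weilT_pow_level D.level_pos.ne'

/-- `weilS` as an automorphism. -/
def unitS : LinearMap.GeneralLinearGroup ℂ (A → ℂ) :=
  Units.ofPowEqOne D.weilS 8 D.weilS_pow_eight (by norm_num)

/-- `TSTST = S` for the operators defining the Weil representation: completing the square. -/
lemma weil_braid : D.weilT * (D.weilS * (D.weilT * (D.weilS * D.weilT))) = D.weilS := by
  ext1 a
  funext y
  simp only [Module.End.mul_apply]
  rw [weilT_apply, weilS_apply, weilS_apply]
  have hg := D.gz_one_ne_zero
  have h1 : ∑ x, e (-D.bil x y) * D.weilT (D.weilS (D.weilT a)) x =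
      (D.gz 1)⁻¹ * ∑ z, a z * (e (D.q z) * ∑ x, e (D.q x - D.bil x (y + z))) := by
    simp only [weilT_apply, weilS_apply, Finset.mul_sum]
    rw [Finset.sum_comm]
    refine Finset.sum_congr rfl fun z _ => Finset.sum_congr rfl fun x _ => ?_
    have : e (D.q x - D.bil x (y + z)) = e (D.q x) * e (-D.bil x y) * e (-D.bil z x) := by
      rw [← e_add, ← e_add, bil_add_right, bil_comm D z x]; congr 1; abel
    rw [this]; ring
  have h2 : ∀ v, ∑ x, e (D.q x - D.bil x v) = D.gz 1 * e (-D.q v) := by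
    intro v
    rw [gz, Finset.sum_mul, ← Equiv.sum_comp (Equiv.addRight v)]
    refine Finset.sum_congr rfl fun x _ => ?_
    rw [← e_add, Equiv.coe_addRight, q_add, bil_add_left, bil_self, one_smul]
    congr 1
    module
  rw [h1]
  simp only [h2, Finset.mul_sum]
  refine Finset.sum_congr rfl fun z _ => ?_
  have : e (-D.q (y + z)) = (e (D.q y))⁻¹ * (e (D.q z))⁻¹ * e (-D.bil z y) := by
    rw [← e_neg, ← e_neg, ← e_add, ← e_add, q_add, bil_comm D z y]; congr 1; abel
  rw [this]
  have hy := e_ne_zero (D.q y)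
  have hz := e_ne_zero (D.q z)
  field_simp

lemma unit_relation : D.unitS * D.unitS =
    (D.unitS * D.unitT) * (D.unitS * D.unitT) * (D.unitS * D.unitT) := by
  ext1
  change D.weilS * D.weilS = (D.weilS * D.weilT) * (D.weilS * D.weilT) * (D.weilS * D.weilT)
  simp only [mul_assoc]
  rw [weil_braid]

/-- The Weil representation exists. -/
theorem exists_weil : ∃ ρ : MpZ →* LinearMap.GeneralLinearGroup ℂ (A → ℂ),
    (ρ mpT : Module.End ℂ (A → ℂ)) = D.weilT ∧ (ρ mpS : Module.End ℂ (A → ℂ)) = D.weilS := by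
  -- the graph of `ρ_A` is generated by the pairs `(S, ρ_A(S))` and `(T, ρ_A(T))`
  let s : MpZ × LinearMap.GeneralLinearGroup ℂ (A → ℂ) := (mpS, D.unitS)
  let t : MpZ × LinearMap.GeneralLinearGroup ℂ (A → ℂ) := (mpT, D.unitT)
  let H := Subgroup.closure {s, t}
  have hrel : s * s = (s * t) * (s * t) * (s * t) :=
    Prod.ext mpST_cube.symm D.unit_relation
  have hz4 : (s * s) ^ (4 : ℤ) = 1 := by
    refine Prod.ext ?_ ?_
    · change (mpS * mpS) ^ (4 : ℤ) = 1
      have : (mpS * mpS) ^ (4 : ℤ) = mpNeg * mpNeg := by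
        rw [mpNeg, zpow_ofNat]; simp only [pow_succ, pow_zero, one_mul, mul_assoc]
      rw [this, mpNeg_mul_self]
    · change (D.unitS * D.unitS) ^ (4 : ℤ) = 1
      have : (D.unitS * D.unitS) ^ (4 : ℤ) = D.unitS ^ 8 := by
        rw [zpow_ofNat]; simp only [pow_succ, pow_zero, one_mul, mul_assoc]
      rw [this]
      ext1
      exact D.weilS_pow_eight
  let p : H →* MpZ := (MonoidHom.fst _ _).comp H.subtype
  have hinj : Function.Injective p := by
    rw [injective_iff_map_eq_one]
    rintro ⟨x, hx⟩ hx1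
    have hx1' : x.1 = 1 := hx1
    obtain ⟨i, hi⟩ := eq_zpow_of_map_eq_one (toSL.comp (MonoidHom.fst MpZ
      (LinearMap.GeneralLinearGroup ℂ (A → ℂ)))) (s := s) (t := t) toSL_mpS toSL_mpT hrel hx
      (by simp [hx1'])
    have hi1 : (mpS * mpS) ^ i = 1 := by
      have := congrArg Prod.fst hi
      rw [hx1'] at this
      exact this.symm
    -- `S²` has order four
    have h4 : (4 : ℤ) ∣ i := by
      have ho : orderOf (mpS * mpS) = 2 ^ (1 + 1) := by
        refine orderOf_eq_prime_pow ?_ ?_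
        · intro h
          have h2 := mpNeg_φ UpperHalfPlane.I
          have h3 : mpNeg = 1 := by rw [← h, mpNeg]; simp [pow_two]
          rw [h3] at h2
          have h5 : (1 : ℂ) = -1 := h2
          norm_num at h5
        · have h3 : (mpS * mpS) ^ 2 ^ (1 + 1) = mpNeg * mpNeg := by
            rw [mpNeg, show 2 ^ (1 + 1) = 4 by norm_num]
            simp only [pow_succ, pow_zero, one_mul, mul_assoc]
          rw [h3, mpNeg_mul_self]
      have := orderOf_dvd_iff_zpow_eq_one.mpr hi1
      rw [ho] at this
      exact_mod_cast this
    obtain ⟨k, rfl⟩ := h4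
    rw [zpow_mul, hz4, one_zpow] at hi
    exact Subtype.ext hi
  have hsurj : Function.Surjective p := by
    rw [← MonoidHom.range_eq_top, MonoidHom.range_comp, Subgroup.range_subtype,
      MonoidHom.map_closure, Set.image_pair]
    exact closure_mpS_mpT
  let E := MulEquiv.ofBijective p ⟨hinj, hsurj⟩
  have hE : ∀ x : H, E.symm x.1.1 = x := fun x => E.symm_apply_apply x
  refine ⟨(MonoidHom.snd _ _).comp (H.subtype.comp E.symm.toMonoidHom), ?_, ?_⟩
  · have := hE ⟨t, Subgroup.subset_closure (by simp)⟩
    change ((E.symm mpT).1.2 : Module.End ℂ (A → ℂ)) = _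
    rw [this]; rfl
  · have := hE ⟨s, Subgroup.subset_closure (by simp)⟩
    change ((E.symm mpS).1.2 : Module.End ℂ (A → ℂ)) = _
    rw [this]; rfl

lemma weil_mpT : (D.weil mpT : Module.End ℂ (A → ℂ)) = D.weilT := by
  rw [weil, dif_pos D.exists_weil]
  exact D.exists_weil.choose_spec.1

lemma weil_mpS : (D.weil mpS : Module.End ℂ (A → ℂ)) = D.weilS := by
  rw [weil, dif_pos D.exists_weil]
  exact D.exists_weil.choose_spec.2

end DiscriminantForm

namespace DiscriminantForm

variable {A : Type*} [AddCommGroup A] [Fintype A] (D : DiscriminantForm A)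

/-! ### Heisenberg operators and Schur's lemma -/

/-- The Heisenberg operator `e(pq q(x)) X_{qx} Z_{px}` with `X_v 𝔢_λ = 𝔢_{λ+v}` and
`Z_w 𝔢_λ = e((λ, w)) 𝔢_λ`, for integers `p`, `q` and `x ∈ A`. -/
def heis (x : A) (p q : ℤ) : Module.End ℂ (A → ℂ) :=
  LinearMap.pi fun l => (e (p • D.bil l x - (p * q) • D.q x)) • LinearMap.proj (l - q • x)

lemma heis_apply (x : A) (p q : ℤ) (a : A → ℂ) (l : A) :
    D.heis x p q a l = e (p • D.bil l x - (p * q) • D.q x) * a (l - q • x) := rfl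

variable {D} in
lemma Killed.heis_congr {N : ℕ} (hN : D.Killed N) {p q p' q' : ℤ} (hp : p ≡ p' [ZMOD N])
    (hq : q ≡ q' [ZMOD N]) (x : A) : D.heis x p q = D.heis x p' q' := by
  ext1 a
  funext l
  rw [heis_apply, heis_apply, hN.bil_congr hp, hN.q_congr (hp.mul hq), hN.smul_congr hq]

/-- `U` implements the action of the integral matrix `m` on the Heisenberg operators. -/
def Intertwines (U : Module.End ℂ (A → ℂ)) (m : Matrix (Fin 2) (Fin 2) ℤ) : Prop :=
  ∀ (x : A) (p q : ℤ),
    U * D.heis x p q = D.heis x (m 0 0 * p + m 0 1 * q) (m 1 0 * p + m 1 1 * q) * U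

variable {D}

lemma Intertwines.mul {U V : Module.End ℂ (A → ℂ)} {m n : Matrix (Fin 2) (Fin 2) ℤ}
    (hU : D.Intertwines U m) (hV : D.Intertwines V n) : D.Intertwines (U * V) (m * n) := by
  intro x p q
  rw [mul_assoc, hV, ← mul_assoc, hU, mul_assoc]
  congr 2 <;> simp only [Matrix.mul_apply, Fin.sum_univ_two] <;> ring

lemma Intertwines.inv {U : LinearMap.GeneralLinearGroup ℂ (A → ℂ)} {γ : SL(2, ℤ)}
    (hU : D.Intertwines U γ.1) : D.Intertwines (U⁻¹ : LinearMap.GeneralLinearGroup ℂ (A → ℂ))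
      (γ⁻¹ : SL(2, ℤ)).1 := by
  intro x p q
  have h := hU x ((γ⁻¹).1 0 0 * p + (γ⁻¹).1 0 1 * q) ((γ⁻¹).1 1 0 * p + (γ⁻¹).1 1 1 * q)
  have hd := γ.2
  rw [Matrix.det_fin_two] at hd
  have e1 : γ.1 0 0 * ((γ⁻¹).1 0 0 * p + (γ⁻¹).1 0 1 * q) +
      γ.1 0 1 * ((γ⁻¹).1 1 0 * p + (γ⁻¹).1 1 1 * q) = p := by
    rw [Matrix.SpecialLinearGroup.SL2_inv_expl]; simp
    linear_combination p * hd
  have e2 : γ.1 1 0 * ((γ⁻¹).1 0 0 * p + (γ⁻¹).1 0 1 * q) +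
      γ.1 1 1 * ((γ⁻¹).1 1 0 * p + (γ⁻¹).1 1 1 * q) = q := by
    rw [Matrix.SpecialLinearGroup.SL2_inv_expl]; simp
    linear_combination q * hd
  rw [e1, e2] at h
  rw [Units.inv_mul_eq_iff_eq_mul, ← mul_assoc, h, mul_assoc, Units.mul_inv, mul_one]

lemma Killed.intertwines_congr {N : ℕ} (hN : D.Killed N) {U : Module.End ℂ (A → ℂ)}
    {m n : Matrix (Fin 2) (Fin 2) ℤ} (h : ∀ i j, m i j ≡ n i j [ZMOD N])
    (hU : D.Intertwines U m) : D.Intertwines U n := by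
  intro x p q
  rw [hU, hN.heis_congr (((h 0 0).mul_right p).add ((h 0 1).mul_right q))
    (((h 1 0).mul_right p).add ((h 1 1).mul_right q))]

/-- Schur's lemma for the Heisenberg group. -/
lemma exists_smul_of_commute {U : Module.End ℂ (A → ℂ)}
    (h : ∀ (x : A) (p q : ℤ), U * D.heis x p q = D.heis x p q * U) : ∃ c : ℂ, U = c • 1 := by
  classical
  refine ⟨U (Pi.single 0 1) 0, ?_⟩
  have h0 : U (Pi.single 0 1) = (U (Pi.single 0 1) 0) • Pi.single 0 1 := by
    funext l
    by_cases hl : l = 0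
    · subst hl; simp
    · have hw : ∃ w, e (D.bil l w) ≠ 1 := by
        by_contra hcon
        push Not at hcon
        exact hl (D.nondegenerate l fun w => (e_eq_one_iff _).mp (hcon w))
      obtain ⟨w, hw⟩ := hw
      have h1 := congrFun (LinearMap.congr_fun (h w 1 0) (Pi.single 0 1)) l
      have h2 : D.heis w 1 0 (Pi.single 0 1) = Pi.single 0 1 := by
        funext m
        rw [heis_apply]
        by_cases hm : m = 0
        · subst hm; simp
        · simp [hm]
      simp only [Module.End.mul_apply] at h1
      rw [h2, heis_apply] at h1
      simp only [one_smul, mul_zero, zero_smul, sub_zero] at h1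
      have h3 : (e (D.bil l w) - 1) * U (Pi.single 0 1) l = 0 := by
        rw [sub_mul, ← h1]; ring
      rcases mul_eq_zero.mp h3 with h4 | h4
      · exact absurd (sub_eq_zero.mp h4) hw
      · simp [h4, hl]
  refine LinearMap.pi_ext' fun v => LinearMap.ext_ring ?_
  have h1 := LinearMap.congr_fun (h v 0 1) (Pi.single 0 1)
  have h2 : D.heis v 0 1 (Pi.single 0 1) = Pi.single v 1 := by
    funext m
    rw [heis_apply]
    by_cases hm : m = v
    · subst hm; simp
    · have : m - v ≠ 0 := sub_ne_zero.mpr hm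
      simp [hm, this]
  simp only [Module.End.mul_apply] at h1
  rw [h2, h0, map_smul, h2] at h1
  simpa using h1

/-- Two automorphisms with the same action on the Heisenberg operators are proportional. -/
lemma Intertwines.exists_smul {U K : LinearMap.GeneralLinearGroup ℂ (A → ℂ)}
    {m : Matrix (Fin 2) (Fin 2) ℤ} (hU : D.Intertwines U m) (hK : D.Intertwines K m) :
    ∃ c : ℂ, (U : Module.End ℂ (A → ℂ)) = c • (K : Module.End ℂ (A → ℂ)) := by
  have : ∀ (x : A) (p q : ℤ), ((K⁻¹ * U : LinearMap.GeneralLinearGroup ℂ (A → ℂ)) :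
      Module.End ℂ (A → ℂ)) * D.heis x p q = D.heis x p q *
      ((K⁻¹ * U : LinearMap.GeneralLinearGroup ℂ (A → ℂ)) : Module.End ℂ (A → ℂ)) := by
    intro x p q
    rw [Units.val_mul, mul_assoc, Units.inv_mul_eq_iff_eq_mul, hU, ← mul_assoc, ← mul_assoc, hK,
      mul_assoc _ (K : Module.End ℂ (A → ℂ)), Units.mul_inv, mul_one]
  obtain ⟨c, hc⟩ := exists_smul_of_commute this
  refine ⟨c, ?_⟩
  rw [Units.val_mul, Units.inv_mul_eq_iff_eq_mul] at hc
  rw [hc]; simp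

variable (D)

lemma intertwines_weilT : D.Intertwines D.weilT ModularGroup.T.1 := by
  intro x p q
  have t00 : ModularGroup.T.1 0 0 = 1 := rfl
  have t01 : ModularGroup.T.1 0 1 = 1 := rfl
  have t10 : ModularGroup.T.1 1 0 = 0 := rfl
  have t11 : ModularGroup.T.1 1 1 = 1 := rfl
  rw [t00, t01, t10, t11, one_mul, one_mul, zero_mul, zero_add]
  ext1 a
  funext l
  simp only [Module.End.mul_apply]
  rw [weilT_apply, heis_apply, heis_apply, weilT_apply, ← mul_assoc, ← mul_assoc, ← e_add, ← e_add]
  have : D.q (l - q • x) = D.q l + (q * q) • D.q x - q • D.bil l x := by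
    have h : l - q • x = l + (-q) • x := by module
    rw [h, q_add, q_zsmul, bil_zsmul_right]
    module
  rw [this]
  congr 2
  module

lemma intertwines_weilS : D.Intertwines D.weilS ModularGroup.S.1 := by
  intro x p q
  have t00 : ModularGroup.S.1 0 0 = 0 := rfl
  have t01 : ModularGroup.S.1 0 1 = -1 := rfl
  have t10 : ModularGroup.S.1 1 0 = 1 := rfl
  have t11 : ModularGroup.S.1 1 1 = 0 := rfl
  rw [t00, t01, t10, t11, one_mul, zero_mul, zero_mul, zero_add, add_zero]
  ext1 a
  funext y
  simp only [Module.End.mul_apply]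
  rw [weilS_apply, heis_apply, weilS_apply, mul_left_comm]
  congr 1
  rw [Finset.mul_sum, ← Equiv.sum_comp (Equiv.addRight (q • x))]
  refine Finset.sum_congr rfl fun l _ => ?_
  rw [Equiv.coe_addRight, heis_apply, ← mul_assoc, ← mul_assoc, ← e_add, ← e_add,
    add_sub_cancel_right]
  congr 2
  rw [sub_eq_add_neg y, bil_add_right, bil_neg_right, bil_zsmul_right, bil_add_left, bil_add_left,
    bil_zsmul_left, bil_zsmul_left, bil_self, bil_comm D y x]
  module

/-- The Weil representation implements the action of `SL₂(ℤ)` on the Heisenberg operators. -/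
lemma intertwines_weil (g : MpZ) : D.Intertwines (D.weil g) (toSL g).1 := by
  have hg : g ∈ Subgroup.closure {mpS, mpT} := by rw [closure_mpS_mpT]; trivial
  induction hg using Subgroup.closure_induction with
  | mem x hx =>
    rcases hx with rfl | rfl
    · rw [weil_mpS, toSL_mpS]; exact D.intertwines_weilS
    · rw [weil_mpT, toSL_mpT]; exact D.intertwines_weilT
  | one =>
    rw [map_one, map_one]
    intro x p q
    simp
  | mul x y _ _ hx hy =>
    rw [map_mul, map_mul]
    exact hx.mul hy
  | inv x _ hx =>
    rw [map_inv, map_inv]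
    exact hx.inv

/-- The operator `a ↦ (λ ↦ a(mλ))`, that is `𝔢_λ ↦ 𝔢_{λ/m}` for `m` prime to the level. -/
def dil (m : ℤ) : Module.End ℂ (A → ℂ) := LinearMap.funLeft ℂ ℂ fun x : A => m • x

lemma dil_apply (m : ℤ) (a : A → ℂ) (x : A) : (dil m : Module.End ℂ (A → ℂ)) a x = a (m • x) := rfl

variable {D}

lemma Killed.dil_mul_dil {N : ℕ} (hN : D.Killed N) {m m' : ℤ} (h : m * m' ≡ 1 [ZMOD N]) :
    (dil m : Module.End ℂ (A → ℂ)) * dil m' = 1 := by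
  ext1 a
  funext x
  simp only [Module.End.mul_apply, dil_apply, smul_smul]
  rw [mul_comm, hN.smul_congr h]; simp

/-- `dil m` as an automorphism. -/
def Killed.unitDil {N : ℕ} (hN : D.Killed N) {m m' : ℤ} (h : m * m' ≡ 1 [ZMOD N]) :
    LinearMap.GeneralLinearGroup ℂ (A → ℂ) where
  val := dil m
  inv := dil m'
  val_inv := hN.dil_mul_dil h
  inv_val := hN.dil_mul_dil (by rwa [mul_comm])

lemma Killed.intertwines_dil {N : ℕ} (hN : D.Killed N) {m m' : ℤ} (h : m * m' ≡ 1 [ZMOD N]) :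
    D.Intertwines (dil m) !![m, 0; 0, m'] := by
  intro x p q
  ext1 a
  funext l
  simp only [Module.End.mul_apply]
  rw [dil_apply, heis_apply, heis_apply, dil_apply]
  have h1 : (m * (m' * q)) ≡ q [ZMOD N] := by
    have := h.mul_right q
    rw [one_mul, mul_assoc] at this; exact this
  have h2 : (m * p) * (m' * q) ≡ p * q [ZMOD N] := by
    have := h1.mul_right p
    have e1 : (m * p) * (m' * q) = m * (m' * q) * p := by ring
    rw [e1, mul_comm p q]; exact this
  simp only [Matrix.of_apply, Matrix.cons_val', Matrix.cons_val_zero, Matrix.cons_val_one,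
    Matrix.cons_val_fin_one, zero_mul, add_zero, zero_add]
  rw [hN.q_congr h2, smul_sub, smul_smul, hN.smul_congr h1, bil_zsmul_left, smul_smul, mul_comm p m]

lemma dilation_eq_dil {m : ℕ} (hm : m.Coprime D.level) :
    (D.dilation hm : Module.End ℂ (A → ℂ)) = dil (m : ℤ) := by
  ext1 a
  funext x
  rw [dil_apply, natCast_zsmul]
  rfl

end DiscriminantForm

open ModularGroup in
/-- `V = (1 0; 1 1)`. -/
def matV : SL(2, ℤ) := S * T⁻¹ * S⁻¹

lemma matV_apply (i j : Fin 2) : matV i j = (!![1, 0; 1, 1] : Matrix (Fin 2) (Fin 2) ℤ) i j := by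
  fin_cases i <;> fin_cases j <;> rfl

lemma matT_apply (i j : Fin 2) :
    ModularGroup.T i j = (!![1, 1; 0, 1] : Matrix (Fin 2) (Fin 2) ℤ) i j := by
  fin_cases i <;> fin_cases j <;> rfl

lemma matT_inv_apply (i j : Fin 2) :
    (ModularGroup.T⁻¹) i j = (!![1, -1; 0, 1] : Matrix (Fin 2) (Fin 2) ℤ) i j := by
  fin_cases i <;> fin_cases j <;> rfl

/-- The element `(V, √(τ + 1))` of `Γ̃`. -/
def mpV : MpZ := mpS * mpT⁻¹ * mpS⁻¹

lemma toSL_mpV : toSL mpV = matV := by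
  rw [mpV, map_mul, map_mul, map_inv, map_inv, toSL_mpS, toSL_mpT]; rfl

/-- Elements over the same matrix whose automorphy factors are not opposite are equal. -/
lemma MpZ_ext_of_re {g h : MpZ} (hM : toSL g = toSL h) (τ : ℍ)
    (hφ : (0 < (g.1.φ τ).re ∧ 0 < (h.1.φ τ).re) ∨ (0 < (g.1.φ τ).im ∧ 0 < (h.1.φ τ).im)) :
    g = h := by
  have h1 : g.1.M = h.1.M := by rw [← ofSL_toSL, ← ofSL_toSL, hM]
  rcases Mp.eq_or_neg h1 with h2 | h2
  · exact MpZ_ext hM (h2 _)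
  · exfalso
    have := h2 τ
    rw [this] at hφ
    simp only [Complex.neg_re, Complex.neg_im] at hφ
    rcases hφ with h3 | h3 <;> linarith [h3.1, h3.2]

lemma sqrt_quadrant_neg {z : ℂ} (hz : z.im < 0) :
    0 < (z ^ (1 / 2 : ℂ)).re ∧ (z ^ (1 / 2 : ℂ)).im < 0 := by
  have h0 : z.arg ≠ Real.pi := by
    intro h
    exact absurd (Complex.arg_eq_pi_iff.mp h).2 hz.ne
  have h1 := sqrt_quadrant (z := starRingEnd ℂ z) (by simpa using hz)
  rw [Complex.conj_cpow _ _ h0] at h1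
  have e1 : (starRingEnd ℂ) (1 / 2 : ℂ) = 1 / 2 := by
    have : (1 / 2 : ℂ) = ((1 / 2 : ℝ) : ℂ) := by push_cast; rfl
    rw [this, Complex.conj_ofReal]
  rw [e1] at h1
  simpa using h1

lemma denom_im (γ : SL(2, ℤ)) (τ : ℍ) : ((γ 1 0 : ℂ) * τ + (γ 1 1 : ℂ)).im = γ 1 0 * τ.im := by
  simp

lemma liftSL_V : liftSL matV = mpV := by
  refine MpZ_ext_of_re (by rw [toSL_liftSL, toSL_mpV]) UpperHalfPlane.I (Or.inl ⟨?_, ?_⟩)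
  · rw [liftSL_φ, matV_apply, matV_apply]
    refine (sqrt_quadrant ?_).1
    simp
  · have h1 : (mpV * mpS).1.φ UpperHalfPlane.I = (mpS * mpT⁻¹).1.φ UpperHalfPlane.I := by
      rw [mpV, inv_mul_cancel_right]
    have hI : ModularGroup.S • UpperHalfPlane.I = UpperHalfPlane.I := by
      rw [ModularGroup.stabilizer_I]; simp
    rw [MpZ_mul_φ, MpZ_mul_φ, toSL_mpS, hI, mpS_φ, mpS_φ] at h1
    have hT : (mpT⁻¹).1.φ UpperHalfPlane.I = 1 := by
      have : (mpT⁻¹).1.φ UpperHalfPlane.I = (mpT.1.φ _)⁻¹ := rfl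
      rw [this, mpT_φ, inv_one]
    rw [hT, mul_one] at h1
    have q1 := sqrt_quadrant (z := (UpperHalfPlane.I : ℂ)) (UpperHalfPlane.im_pos _)
    have q2 := sqrt_quadrant (z := (toSL mpT⁻¹ • UpperHalfPlane.I : ℍ)) (UpperHalfPlane.im_pos _)
    rw [← h1] at q2
    by_contra hneg
    push Not at hneg
    obtain ⟨q3, q4⟩ := q2
    rw [Complex.mul_re] at q3
    rw [Complex.mul_im] at q4
    have a1 : (mpV.1.φ UpperHalfPlane.I).im < 0 := by
      by_contra hi
      push Not at hi
      nlinarith [mul_nonneg hi q1.2.le, mul_nonneg (neg_nonneg.mpr hneg) q1.1.le]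
    nlinarith [mul_pos (neg_pos.mpr a1) q1.1, mul_nonneg (neg_nonneg.mpr hneg) q1.2.le]

/-- The principal lifts are compatible with right multiplication by `V` on matrices with positive
lower right entry. -/
lemma liftSL_mul_V {γ : SL(2, ℤ)} (hd : 0 < γ 1 1) : liftSL (γ * matV) = liftSL γ * mpV := by
  rw [← liftSL_V]
  have hM : toSL (liftSL (γ * matV)) = toSL (liftSL γ * liftSL matV) := by
    rw [toSL_liftSL, map_mul, toSL_liftSL, toSL_liftSL]
  have e10 : (γ * matV) 1 0 = γ 1 0 + γ 1 1 := by
    rw [SL_mul_apply, matV_apply, matV_apply]; simp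
  have e11 : (γ * matV) 1 1 = γ 1 1 := by rw [SL_mul_apply, matV_apply, matV_apply]; simp
  let τ := UpperHalfPlane.I
  have hτ : τ.im = 1 := UpperHalfPlane.I_im
  have qV : 0 < ((liftSL matV).1.φ τ).re ∧ 0 < ((liftSL matV).1.φ τ).im := by
    rw [liftSL_φ]
    refine sqrt_quadrant ?_
    rw [denom_im, matV_apply, hτ]; simp
  have hprod : (liftSL γ * liftSL matV).1.φ τ =
      (liftSL γ).1.φ (matV • τ) * (liftSL matV).1.φ τ := by
    rw [MpZ_mul_φ, toSL_liftSL]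
  have hτ' := (matV • τ).im_pos
  rcases lt_trichotomy (γ 1 0) 0 with hc | hc | hc
  · refine MpZ_ext_of_re hM τ (Or.inl ⟨?_, ?_⟩)
    · rw [liftSL_φ]
      by_cases h0 : (γ * matV) 1 0 = 0
      · rw [h0, e11]
        have : ((0 : ℤ) : ℂ) * (τ : ℂ) + ((γ 1 1 : ℤ) : ℂ) = ((γ 1 1 : ℝ) : ℂ) := by simp
        rw [this]
        have h2 := Complex.ofReal_cpow (x := (γ 1 1 : ℝ)) (by exact_mod_cast hd.le) (1 / 2)
        push_cast at h2 ⊢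
        rw [← h2]
        have : (0 : ℝ) < γ 1 1 := by exact_mod_cast hd
        exact_mod_cast Real.rpow_pos_of_pos this _
      · rcases lt_or_gt_of_ne h0 with h1 | h1
        · refine (sqrt_quadrant_neg ?_).1
          rw [denom_im, hτ, mul_one]; exact_mod_cast h1
        · refine (sqrt_quadrant ?_).1
          rw [denom_im, hτ, mul_one]; exact_mod_cast h1
    · have q : 0 < ((liftSL γ).1.φ (matV • τ)).re ∧ ((liftSL γ).1.φ (matV • τ)).im < 0 := by
        rw [liftSL_φ]
        refine sqrt_quadrant_neg ?_
        rw [denom_im]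
        exact mul_neg_of_neg_of_pos (by exact_mod_cast hc) hτ'
      rw [hprod, Complex.mul_re]
      nlinarith [mul_pos q.1 qV.1, mul_pos (neg_pos.mpr q.2) qV.2]
  all_goals
    have hpos : 0 < (γ * matV) 1 0 := by rw [e10]; omega
    refine MpZ_ext_of_re hM τ (Or.inr ⟨?_, ?_⟩)
    · rw [liftSL_φ]
      refine (sqrt_quadrant ?_).2
      rw [denom_im, hτ, mul_one]; exact_mod_cast hpos
  · have : ((0 : ℤ) : ℂ) * ((matV • τ : ℍ) : ℂ) + ((γ 1 1 : ℤ) : ℂ) = ((γ 1 1 : ℝ) : ℂ) := by simp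
    rw [hprod, liftSL_φ, hc, this]
    have h2 := Complex.ofReal_cpow (x := (γ 1 1 : ℝ)) (by exact_mod_cast hd.le) (1 / 2)
    push_cast at h2 ⊢
    rw [← h2, Complex.im_ofReal_mul]
    have : (0 : ℝ) < γ 1 1 := by exact_mod_cast hd
    exact mul_pos (Real.rpow_pos_of_pos this _) qV.2
  · have q : 0 < ((liftSL γ).1.φ (matV • τ)).re ∧ 0 < ((liftSL γ).1.φ (matV • τ)).im := by
      rw [liftSL_φ]
      refine sqrt_quadrant ?_
      rw [denom_im]
      exact mul_pos (by exact_mod_cast hc) hτ'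
    rw [hprod, Complex.mul_im]
    nlinarith [mul_pos q.1 qV.2, mul_pos q.2 qV.1]

/-- The principal lifts are compatible with right multiplication by `T`. -/
lemma liftSL_mul_T (γ : SL(2, ℤ)) : liftSL (γ * ModularGroup.T) = liftSL γ * mpT := by
  refine MpZ_ext (by rw [map_mul, toSL_liftSL, toSL_liftSL, toSL_mpT]) ?_
  rw [MpZ_mul_φ, mpT_φ, mul_one, toSL_mpT, liftSL_φ, liftSL_φ, SL_mul_apply, SL_mul_apply]
  congr 1
  have : ((ModularGroup.T • UpperHalfPlane.I : ℍ) : ℂ) = UpperHalfPlane.I + 1 := by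
    have := ModularGroup.coe_T_zpow_smul_eq UpperHalfPlane.I (n := 1)
    simpa using this
  rw [this]
  simp only [matT_apply]
  simp
  ring

lemma liftSL_mul_T_inv (γ : SL(2, ℤ)) :
    liftSL (γ * ModularGroup.T⁻¹) = liftSL γ * mpT⁻¹ := by
  rw [eq_mul_inv_iff_mul_eq, ← liftSL_mul_T, inv_mul_cancel_right]

lemma liftSL_T_mul (γ : SL(2, ℤ)) : liftSL (ModularGroup.T * γ) = mpT * liftSL γ := by
  refine MpZ_ext (by rw [map_mul, toSL_liftSL, toSL_liftSL, toSL_mpT]) ?_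
  rw [MpZ_mul_φ, mpT_φ, one_mul, liftSL_φ, liftSL_φ, SL_mul_apply, SL_mul_apply]
  simp only [matT_apply]
  simp

lemma liftSL_T_zpow_mul (γ : SL(2, ℤ)) (k : ℤ) :
    liftSL (ModularGroup.T ^ k * γ) = mpT ^ k * liftSL γ := by
  induction k using Int.induction_on with
  | zero => simp
  | succ n ih =>
    rw [add_comm, zpow_add, zpow_add, zpow_one, zpow_one, mul_assoc, liftSL_T_mul, ih, mul_assoc]
  | pred n ih =>
    have h := liftSL_T_mul (ModularGroup.T ^ (-(n : ℤ) - 1) * γ)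
    rw [← mul_assoc, ← zpow_one_add] at h
    rw [eq_comm, sub_eq_neg_add, zpow_add, zpow_neg_one, mul_assoc, inv_mul_eq_iff_eq_mul, ← ih]
    rw [show -(n : ℤ) = 1 + (-n - 1) by ring, h]
    congr 3
    ring_nf

lemma SL_mul_V_apply (γ : SL(2, ℤ)) :
    (γ * matV) 1 0 = γ 1 0 + γ 1 1 ∧ (γ * matV) 1 1 = γ 1 1 := by
  constructor <;> rw [SL_mul_apply, matV_apply, matV_apply] <;> simp

lemma liftSL_mul_V_zpow {γ : SL(2, ℤ)} (hd : 0 < γ 1 1) (k : ℤ) :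
    liftSL (γ * matV ^ k) = liftSL γ * mpV ^ k ∧ (γ * matV ^ k) 1 1 = γ 1 1 ∧
      (γ * matV ^ k) 1 0 = γ 1 0 + k * γ 1 1 := by
  induction k using Int.induction_on with
  | zero => simp
  | succ n ih =>
    obtain ⟨h1, h2, h3⟩ := ih
    have h4 := SL_mul_V_apply (γ * matV ^ (n : ℤ))
    rw [zpow_add, zpow_add, zpow_one, zpow_one, ← mul_assoc]
    refine ⟨?_, ?_, ?_⟩
    · rw [liftSL_mul_V (by rw [h2]; exact hd), h1, mul_assoc]
    · rw [h4.2, h2]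
    · rw [h4.1, h2, h3]; ring
  | pred n ih =>
    obtain ⟨h1, h2, h3⟩ := ih
    have e : γ * matV ^ (-(n : ℤ)) = γ * matV ^ (-(n : ℤ) - 1) * matV := by
      rw [mul_assoc, ← zpow_add_one]; congr 2; ring
    have h4 := SL_mul_V_apply (γ * matV ^ (-(n : ℤ) - 1))
    rw [← e, h2, h3] at h4
    refine ⟨?_, h4.2.symm, ?_⟩
    · rw [e, liftSL_mul_V (by rw [← h4.2]; exact hd)] at h1
      rw [eq_mul_inv_of_mul_eq h1, mul_assoc, zpow_sub_one]
    · linarith [h4.1, h4.2]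

namespace DiscriminantForm

variable {A : Type*} [AddCommGroup A] [Fintype A] (D : DiscriminantForm A)

/-! ### The distinguished matrix coefficient of the Weil representation -/

/-- The operator `ρ_A(g)`. -/
abbrev weilEnd (g : MpZ) : Module.End ℂ (A → ℂ) := (D.weil g : Module.End ℂ (A → ℂ))

lemma weilEnd_mul (g h : MpZ) : D.weilEnd (g * h) = D.weilEnd g * D.weilEnd h := by
  rw [weilEnd, map_mul, Units.val_mul]

lemma weilEnd_mul_apply (g h : MpZ) (a : A → ℂ) :
    D.weilEnd (g * h) a = D.weilEnd g (D.weilEnd h a) := by rw [weilEnd_mul]; rfl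

lemma weilEnd_inv_apply {g : MpZ} {a b : A → ℂ} (h : D.weilEnd g a = b) :
    D.weilEnd g⁻¹ b = a := by
  rw [← h, ← weilEnd_mul_apply, inv_mul_cancel, weilEnd, map_one]; rfl

lemma weilEnd_T_zpow (k : ℤ) (a : A → ℂ) :
    D.weilEnd (mpT ^ k) a = fun x => e (k • D.q x) * a x := by
  have h1 : ∀ a : A → ℂ, D.weilEnd mpT a = fun x => e (D.q x) * a x := by
    intro a; rw [weilEnd, weil_mpT]; rfl
  have h2 : ∀ a : A → ℂ, D.weilEnd mpT⁻¹ a = fun x => (e (D.q x))⁻¹ * a x := by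
    intro a
    refine D.weilEnd_inv_apply ?_
    rw [h1]; funext x
    rw [← mul_assoc, mul_inv_cancel₀ (e_ne_zero _), one_mul]
  induction k using Int.induction_on generalizing a with
  | zero => rw [zpow_zero, weilEnd, map_one]; funext x; simp
  | succ n ih =>
    rw [zpow_add_one, weilEnd_mul_apply, h1, ih]; funext x
    rw [add_smul, one_smul, e_add]; ring
  | pred n ih =>
    rw [zpow_sub_one, weilEnd_mul_apply, h2, ih]; funext x
    rw [sub_smul, one_smul, e_sub]; ring

lemma weilEnd_S (a : A → ℂ) :
    D.weilEnd mpS a = fun y => (D.gz 1)⁻¹ * ∑ x, e (-D.bil x y) * a x := by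
  rw [weilEnd, weil_mpS]; funext y; exact D.weilS_apply a y

lemma mpV_zpow (z : ℤ) : mpV ^ z = mpS * mpT ^ (-z) * mpS⁻¹ := by
  rw [mpV, conj_zpow, inv_zpow']

/-- The matrix coefficient `⟨𝔢_0, ρ_A(g) ∑_λ 𝔢_λ⟩`. -/
def coef (g : MpZ) : ℂ := D.weilEnd g (fun _ => 1) 0

lemma coef_one : D.coef 1 = 1 := by
  rw [coef, weilEnd, map_one]; rfl

lemma coef_T_zpow_mul (k : ℤ) (g : MpZ) : D.coef (mpT ^ k * g) = D.coef g := by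
  rw [coef, weilEnd_mul_apply, weilEnd_T_zpow]; simp [coef]

lemma weilEnd_S_single [DecidableEq A] :
    D.weilEnd mpS (Pi.single 0 1) = fun _ => (D.gz 1)⁻¹ := by
  rw [weilEnd_S]
  funext y
  rw [Finset.sum_eq_single 0 (fun x _ hx => by simp [hx]) (by simp)]
  simp

lemma weilEnd_V_one (k : ℤ) : D.weilEnd (mpV ^ k) (fun _ => 1) = fun _ => 1 := by
  classical
  have h1 : D.weilEnd mpS⁻¹ (fun _ => 1) = D.gz 1 • Pi.single 0 1 := by
    refine D.weilEnd_inv_apply ?_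
    rw [map_smul, weilEnd_S_single]
    funext x
    simp [D.gz_one_ne_zero]
  have h2 : D.weilEnd (mpT ^ (-k)) (D.gz 1 • Pi.single 0 1) = D.gz 1 • Pi.single 0 1 := by
    rw [map_smul, weilEnd_T_zpow]
    congr 1
    funext x
    by_cases hx : x = 0
    · subst hx; simp
    · simp [hx]
  rw [mpV_zpow, weilEnd_mul_apply, weilEnd_mul_apply, h1, h2, map_smul, weilEnd_S_single]
  funext x
  simp [D.gz_one_ne_zero]

lemma coef_mul_V (g : MpZ) (k : ℤ) : D.coef (g * mpV ^ k) = D.coef g := by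
  rw [coef, weilEnd_mul_apply, weilEnd_V_one]; rfl

lemma sum_gaussian (t : ℤ) (y : A) (ht : t = 1 ∨ t = -1) :
    ∑ x, e (-D.bil x y) * e (t • D.q x) = D.gz t * e (-(t • D.q y)) := by
  rw [gz, Finset.sum_mul, ← Equiv.sum_comp (Equiv.addRight (t • y))]
  refine Finset.sum_congr rfl fun x _ => ?_
  rw [← e_add, ← e_add, Equiv.coe_addRight, q_add, q_zsmul, bil_zsmul_right, bil_add_left,
    bil_zsmul_left, bil_self]
  congr 1
  rcases ht with rfl | rfl
  · module
  · module

lemma coef_V_mul_T_inv (z : ℤ) : D.coef (mpV ^ z * mpT⁻¹) = D.psi (1 - z) := by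
  have h1 : D.weilEnd mpS⁻¹ (fun x => e ((-1 : ℤ) • D.q x)) = fun x => e (D.q x) := by
    refine D.weilEnd_inv_apply ?_
    rw [weilEnd_S]
    funext y
    have := D.sum_gaussian 1 y (Or.inl rfl)
    simp only [one_smul] at this
    rw [this, ← mul_assoc, inv_mul_cancel₀ D.gz_one_ne_zero, one_mul, neg_one_smul]
  rw [coef, weilEnd_mul_apply, ← zpow_neg_one, weilEnd_T_zpow, mpV_zpow, weilEnd_mul_apply,
    weilEnd_mul_apply]
  simp only [mul_one]
  have h2 : ∑ x, e (-D.bil x 0) * (e (-z • D.q x) * e (D.q x)) = D.gz (1 - z) := by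
    rw [gz]
    refine Finset.sum_congr rfl fun x _ => ?_
    rw [bil_zero_right, neg_zero, e_zero, one_mul, ← e_add]
    congr 1; module
  rw [h1, weilEnd_T_zpow, weilEnd_S, psi]
  beta_reduce
  rw [h2, div_eq_inv_mul]

lemma coef_V_mul_T (z : ℤ) : D.coef (mpV ^ z * mpT) = starRingEnd ℂ (D.psi (1 + z)) := by
  have hg := D.gz_one_ne_zero
  have hg' : D.gz (-1) ≠ 0 := by
    rw [← conj_gz]; simpa using hg
  have h1 : D.weilEnd mpS⁻¹ (fun x => e ((1 : ℤ) • D.q x)) =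
      (D.gz 1 * (D.gz (-1))⁻¹) • fun x => e ((-1 : ℤ) • D.q x) := by
    refine D.weilEnd_inv_apply ?_
    rw [map_smul, weilEnd_S]
    funext y
    rw [Pi.smul_apply, D.sum_gaussian (-1) y (Or.inr rfl), smul_eq_mul]
    field_simp
    simp
  have h0 : D.coef (mpV ^ z * mpT) = D.coef (mpV ^ z * mpT ^ (1 : ℤ)) := by rw [zpow_one]
  rw [h0, coef, weilEnd_mul_apply, weilEnd_T_zpow, mpV_zpow, weilEnd_mul_apply,
    weilEnd_mul_apply]
  simp only [mul_one]
  rw [h1, map_smul, map_smul, weilEnd_T_zpow, weilEnd_S, psi, map_div₀, conj_gz, conj_gz, Pi.smul_apply,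
    smul_eq_mul]
  have h2 : ∑ x, e (-D.bil x 0) * (e (-z • D.q x) * e ((-1 : ℤ) • D.q x)) = D.gz (-(1 + z)) := by
    rw [gz]
    refine Finset.sum_congr rfl fun x _ => ?_
    rw [bil_zero_right, neg_zero, e_zero, one_mul, ← e_add]
    congr 1; module
  rw [h2]
  field_simp

variable {D}

/-- If the lower right entry `d` is prime to the level then, modulo the level,
`(a b; c d) = (1 b/d; 0 1) (1/d 0; 0 d) (1 0; c/d 1)`, and `ρ_A` decomposes accordingly. -/
lemma Killed.weilEnd_eq {N : ℕ} (hN : D.Killed N) (g : MpZ) {d' y z : ℤ}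
    (hd : d' * toSL g 1 1 ≡ 1 [ZMOD N]) (hy : y * toSL g 1 1 ≡ toSL g 0 1 [ZMOD N])
    (hz : z * toSL g 1 1 ≡ toSL g 1 0 [ZMOD N]) :
    D.weilEnd g = D.coef g • (D.weilEnd (mpT ^ y) * dil d' * D.weilEnd (mpV ^ z)) := by
  set a := toSL g 0 0
  set b := toSL g 0 1
  set c := toSL g 1 0
  set d := toSL g 1 1
  have hdet : a * d - b * c = 1 := by
    have := (toSL g).2
    rwa [Matrix.det_fin_two] at this
  have hT : ∀ k : ℤ, (ModularGroup.T ^ k).1 = !![1, k; 0, 1] := fun k => ModularGroup.coe_T_zpow k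
  have hV : ∀ k : ℤ, (matV ^ k).1 0 0 = 1 ∧ (matV ^ k).1 0 1 = 0 ∧ (matV ^ k).1 1 0 = k ∧
      (matV ^ k).1 1 1 = 1 := by
    intro k
    have h1 := liftSL_mul_V_zpow (γ := 1) (by simp) k
    rw [one_mul] at h1
    have h2 : (matV ^ k) = ModularGroup.S * ModularGroup.T ^ (-k) * ModularGroup.S⁻¹ := by
      rw [matV, conj_zpow, inv_zpow']
    have hS : ∀ i j, ModularGroup.S⁻¹ i j = (!![0, 1; -1, 0] : Matrix (Fin 2) (Fin 2) ℤ) i j := by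
      intro i j; fin_cases i <;> fin_cases j <;> rfl
    have hS' : ∀ i j, ModularGroup.S i j = (!![0, -1; 1, 0] : Matrix (Fin 2) (Fin 2) ℤ) i j := by
      intro i j; fin_cases i <;> fin_cases j <;> rfl
    have hTk : ∀ i j, (ModularGroup.T ^ (-k)) i j =
      (!![1, -k; 0, 1] : Matrix (Fin 2) (Fin 2) ℤ) i j := by
      intro i j; rw [← hT]
    have h3 : ∀ i j, (matV ^ k) i j = (ModularGroup.S * ModularGroup.T ^ (-k) * ModularGroup.S⁻¹) i j := by
      intro i j; rw [h2]
    simp only [SL_mul_apply, hS, hS', hTk] at h3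
    refine ⟨?_, ?_, ?_, ?_⟩
    · exact (h3 0 0).trans (by simp)
    · exact (h3 0 1).trans (by simp)
    · exact (h3 1 0).trans (by simp)
    · exact (h3 1 1).trans (by simp)
  have hd2 : d' * d ≡ 1 [ZMOD N] := hd
  let K : LinearMap.GeneralLinearGroup ℂ (A → ℂ) :=
    D.weil (mpT ^ y) * hN.unitDil hd2 * D.weil (mpV ^ z)
  have hK : D.Intertwines K (toSL g).1 := by
    have h1 : D.Intertwines K ((ModularGroup.T ^ y).1 * !![d', 0; 0, d] * (matV ^ z).1) := by
      have hT' := D.intertwines_weil (mpT ^ y)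
      have hV' := D.intertwines_weil (mpV ^ z)
      have eT : toSL (mpT ^ y) = ModularGroup.T ^ y := by rw [map_zpow, toSL_mpT]
      have eV : toSL (mpV ^ z) = matV ^ z := by rw [map_zpow, toSL_mpV]
      rw [eT] at hT'
      rw [eV] at hV'
      exact (hT'.mul (hN.intertwines_dil hd2)).mul hV'
    refine hN.intertwines_congr ?_ h1
    obtain ⟨v00, v01, v10, v11⟩ := hV z
    have hyz : d' + y * d * z ≡ a [ZMOD N] := by
      -- `d' + (yd) z ≡ d' (1 + bc) = d' d a`
      have e1 : d' + y * d * z ≡ d' + b * (z * (d' * d)) [ZMOD N] := by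
        refine Int.ModEq.add_left _ ?_
        have h3 : y * d * z ≡ b * z [ZMOD N] := hy.mul_right z
        have h4 : b * z * 1 ≡ b * z * (d' * d) [ZMOD N] := (hd2.symm).mul_left _
        rw [mul_one] at h4
        have e2 : b * (z * (d' * d)) = b * z * (d' * d) := by ring
        rw [e2]
        exact h3.trans h4
      have e3 : d' + b * (z * (d' * d)) = d' + d' * b * (z * d) := by ring
      rw [e3] at e1
      have e4 : d' + d' * b * (z * d) ≡ d' + d' * b * c [ZMOD N] := (hz.mul_left _).add_left _
      have e5 : d' + d' * b * c = d' * d * a := by linear_combination (-d') * hdet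
      rw [e5] at e4
      have e6 : d' * d * a ≡ 1 * a [ZMOD N] := hd2.mul_right a
      rw [one_mul] at e6
      exact e1.trans (e4.trans e6)
    intro i j
    rw [hT]
    fin_cases i <;> fin_cases j <;>
      simp [Matrix.mul_apply, Fin.sum_univ_two, v00, v01, v10, v11]
    · exact hyz
    · exact hy
    · rw [mul_comm]; exact hz
    · exact Int.ModEq.refl _
  obtain ⟨χ, hχ⟩ := (D.intertwines_weil g).exists_smul hK
  have hχ' : D.weilEnd g = χ • (D.weilEnd (mpT ^ y) * dil d' * D.weilEnd (mpV ^ z)) := hχ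
  have : D.coef g = χ := by
    rw [coef, hχ', LinearMap.smul_apply, Module.End.mul_apply, Module.End.mul_apply, weilEnd_V_one,
      weilEnd_T_zpow, Pi.smul_apply, dil_apply]
    simp
  rw [this, hχ']

/-- Up to the scalar `coef g`, evaluation at `0` is preserved by all factors of `ρ_A(g)` except `V ^ z`, where
`z = c/d` modulo the level. -/
lemma Killed.coef_mul {N : ℕ} (hN : D.Killed N) (g h : MpZ) {z : ℤ}
    (hd : IsCoprime (toSL g 1 1) N) (hz : z * toSL g 1 1 ≡ toSL g 1 0 [ZMOD N]) :
    D.coef (g * h) = D.coef g * D.coef (mpV ^ z * h) := by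
  obtain ⟨d', k, hd'⟩ := hd
  have h1 : d' * toSL g 1 1 ≡ 1 [ZMOD N] := by
    rw [Int.modEq_iff_dvd]
    exact ⟨k, by linear_combination -hd'⟩
  have h2 : (toSL g 0 1 * d') * toSL g 1 1 ≡ toSL g 0 1 [ZMOD N] := by
    have := h1.mul_left (toSL g 0 1)
    rwa [mul_one, ← mul_assoc] at this
  have hR : D.coef (mpV ^ z * h) = D.weilEnd (mpV ^ z) (D.weilEnd h fun _ => 1) 0 := by
    rw [coef, weilEnd_mul_apply]
  rw [hR, coef, weilEnd_mul_apply, hN.weilEnd_eq g h1 h2 hz,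
    LinearMap.smul_apply, Module.End.mul_apply, Module.End.mul_apply, Pi.smul_apply, weilEnd_T_zpow]
  simp [dil_apply]

end DiscriminantForm

/-! ### The distinguished coefficient as a Jacobi symbol times a Gauss sum -/

lemma jacobiSym_sub_right {d e : ℕ} (hd : d % 2 = 1) (he : e % 2 = 1) :
    jacobiSym ((d : ℤ) - e) d =
      jacobiSym ((d : ℤ) - e) e * (if e % 4 = d % 4 then 1 else if d % 4 = 1 then 1 else -1) := by
  have h1 : jacobiSym ((d : ℤ) - e) d = jacobiSym (-e) d := by
    apply jacobiSym.mod_left'; rw [show (d : ℤ) - e = -e + d by ring, Int.add_emod_right]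
  have h2 : jacobiSym ((d : ℤ) - e) e = jacobiSym d e := by
    apply jacobiSym.mod_left'; exact Int.sub_emod_right _ _
  rw [h1, h2, jacobiSym.neg _ (Nat.odd_iff.mpr hd), jacobiSym.quadratic_reciprocity_if he hd |>.symm,
    ZMod.χ₄_nat_eq_if_mod_four, if_neg (by omega)]
  have a1 : d % 4 = 1 ∨ d % 4 = 3 := by omega
  have a2 : e % 4 = 1 ∨ e % 4 = 3 := by omega
  rcases a1 with a1 | a1 <;> rcases a2 with a2 | a2 <;> simp [a1, a2]

lemma jacobiSym_sub_left {c d : ℕ} (hc : c % 2 = 1) (hd : d % 2 = 1) :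
    jacobiSym ((c : ℤ) - d) c =
      jacobiSym c d * (if c % 4 = d % 4 then 1 else if d % 4 = 1 then -1 else 1) := by
  have h1 : jacobiSym ((c : ℤ) - d) c = jacobiSym (-d) c := by
    apply jacobiSym.mod_left'; rw [show (c : ℤ) - d = -d + c by ring, Int.add_emod_right]
  rw [h1, jacobiSym.neg _ (Nat.odd_iff.mpr hc), jacobiSym.quadratic_reciprocity_if hd hc |>.symm,
    ZMod.χ₄_nat_eq_if_mod_four, if_neg (by omega)]
  have a1 : d % 4 = 1 ∨ d % 4 = 3 := by omega
  have a2 : c % 4 = 1 ∨ c % 4 = 3 := by omega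
  rcases a1 with a1 | a1 <;> rcases a2 with a2 | a2 <;> simp [a1, a2]

namespace DiscriminantForm

variable {A : Type*} [AddCommGroup A] [Fintype A] (D : DiscriminantForm A)

open Classical in
/-- The sign `1` in even signature and the Jacobi symbol `(c/d)` in odd signature. -/
def jac (c : ℤ) (d : ℕ) : ℂ := if D.EvenSig then 1 else (jacobiSym c d : ℂ)

variable {D}

lemma EvenSig.jac (h : D.EvenSig) (c : ℤ) (d : ℕ) : D.jac c d = 1 := by
  rw [DiscriminantForm.jac, if_pos h]

lemma jac_of_not (h : ¬ D.EvenSig) (c : ℤ) (d : ℕ) : D.jac c d = (jacobiSym c d : ℂ) := by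
  rw [DiscriminantForm.jac, if_neg h]

lemma jac_congr {c c' : ℤ} {d : ℕ} (h : c ≡ c' [ZMOD d]) : D.jac c d = D.jac c' d := by
  rw [DiscriminantForm.jac, DiscriminantForm.jac, jacobiSym.mod_left' h]

lemma Killed.psi_mul_conj {N : ℕ} (hN : D.Killed N) {u : ℤ} (hu : IsCoprime u N) :
    D.psi u * starRingEnd ℂ (D.psi u) = 1 := by
  have h0 : (Fintype.card A : ℂ) ≠ 0 := by exact_mod_cast Fintype.card_ne_zero
  rw [psi, map_div₀, div_mul_div_comm, conj_gz, conj_gz, hN.gz_mul_conj hu, gz_one_mul_conj,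
    div_self h0]

lemma isCoprime_of_modEq {N : ℕ} {a b : ℤ} (h : a ≡ b [ZMOD N]) (ha : IsCoprime a N) :
    IsCoprime b N := by
  obtain ⟨k, hk⟩ := h.dvd
  have : b = a + N * k := by linear_combination hk
  rw [this]
  exact ha.add_mul_left_left k

lemma mod_four_cases {d c : ℕ} {w : ℤ} (hd : (d : ℤ) % 2 = 1) (hw : w % 2 = 1)
    (h : (d : ℤ) * w % 4 = c % 4) :
    (w % 4 = 1 ∧ d % 4 = 1 ∧ c % 4 = 1) ∨ (w % 4 = 1 ∧ d % 4 = 3 ∧ c % 4 = 3) ∨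
      (w % 4 = 3 ∧ d % 4 = 1 ∧ c % 4 = 3) ∨ (w % 4 = 3 ∧ d % 4 = 3 ∧ c % 4 = 1) := by
  have a1 : (d : ℤ) % 4 = 1 ∨ (d : ℤ) % 4 = 3 := by omega
  have a3 : w % 4 = 1 ∨ w % 4 = 3 := by omega
  rw [Int.mul_emod] at h
  rcases a1 with a1 | a1 <;> rcases a3 with a3 | a3 <;> rw [a1, a3] at h <;> omega

lemma chi4_mul_self (u : ℤ) : chi4 u * chi4 u = 1 := by
  unfold chi4; split_ifs <;> norm_num

lemma odd_of_isCoprime {N : ℕ} (h4 : 4 ∣ N) {u : ℤ} (hu : IsCoprime u N) : u % 2 = 1 := by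
  have h2 : IsCoprime u 2 := hu.of_isCoprime_of_dvd_right
    ((by exact_mod_cast (dvd_trans (by norm_num : 2 ∣ 4) h4)))
  rcases Int.emod_two_eq_zero_or_one u with h | h
  · have := h2.isUnit_of_dvd' (Int.dvd_of_emod_eq_zero h) dvd_rfl
    exact absurd this (by decide)
  · exact h

lemma Killed.jac_mul_psi_sub_right {N : ℕ} (hN : D.Killed N) (hpos : 0 < N)
    (hD : D.EvenSig ∨ 4 ∣ N) {d e : ℕ} {w : ℤ} (hd : IsCoprime (d : ℤ) N)
    (hw : IsCoprime w N) (h : d * w ≡ e [ZMOD N]) :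
    D.jac (d - e) e * D.psi e = D.jac (d - e) d * D.psi d * D.psi w := by
  have he : IsCoprime (e : ℤ) N := isCoprime_of_modEq h (hd.mul_left hw)
  rw [← hN.psi_congr h]
  by_cases hev : D.EvenSig
  · rw [hev.jac, hev.jac, hev.psi_mul hN hpos hd hw]; ring
  · have h4 := hD.resolve_left hev
    have o1 := odd_of_isCoprime h4 hd
    have o2 := odd_of_isCoprime h4 he
    have o3 := odd_of_isCoprime h4 hw
    have h' : (d : ℤ) * w % 4 = e % 4 := h.of_dvd (by exact_mod_cast h4)
    rw [psi_mul_of_not_evenSig hev hN hpos h4 hd hw, jac_of_not hev, jac_of_not hev,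
      jacobiSym_sub_right (d := d) (e := e) (by omega) (by omega), chi4]
    have b4 : (d : ℤ) % 4 = (d % 4 : ℕ) := (Int.natCast_mod d 4).symm
    rcases mod_four_cases o1 o3 h' with ⟨b1, b2, b3⟩ | ⟨b1, b2, b3⟩ | ⟨b1, b2, b3⟩ | ⟨b1, b2, b3⟩ <;>
      simp [b1, b2, b3, b4] <;> ring

lemma Killed.jac_mul_psi_sub_left {N : ℕ} (hN : D.Killed N) (hpos : 0 < N)
    (hD : D.EvenSig ∨ 4 ∣ N) {d c : ℕ} {w : ℤ} (hd : IsCoprime (d : ℤ) N)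
    (hw : IsCoprime w N) (h : d * w ≡ c [ZMOD N]) :
    D.jac (c - d) c * D.psi c = D.jac c d * D.psi d * starRingEnd ℂ (D.psi w) := by
  have hc : IsCoprime (c : ℤ) N := isCoprime_of_modEq h (hd.mul_left hw)
  have hcj := hN.psi_mul_conj hw
  have hw0 : D.psi w ≠ 0 := left_ne_zero_of_mul_eq_one hcj
  rw [← hN.psi_congr h]
  by_cases hev : D.EvenSig
  · have h1 := hev.psi_sq hN hpos hw
    have h2 : starRingEnd ℂ (D.psi w) = D.psi w := by
      apply mul_left_cancel₀ hw0; rw [hcj, ← h1]; ring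
    rw [hev.jac, hev.jac, hev.psi_mul hN hpos hd hw, h2]; ring
  · have h4 := hD.resolve_left hev
    have o1 := odd_of_isCoprime h4 hd
    have o2 := odd_of_isCoprime h4 hc
    have o3 := odd_of_isCoprime h4 hw
    have h1 := psi_sq_of_not_evenSig hev hN hpos h4 hw
    have h2 : starRingEnd ℂ (D.psi w) = chi4 w * D.psi w := by
      apply mul_left_cancel₀ hw0
      rw [hcj, ← chi4_mul_self w, ← h1]; ring
    have h' : (d : ℤ) * w % 4 = c % 4 := h.of_dvd (by exact_mod_cast h4)
    rw [psi_mul_of_not_evenSig hev hN hpos h4 hd hw, jac_of_not hev, jac_of_not hev,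
      jacobiSym_sub_left (d := d) (c := c) (by omega) (by omega), h2, chi4, chi4]
    have b4 : (d : ℤ) % 4 = (d % 4 : ℕ) := (Int.natCast_mod d 4).symm
    rcases mod_four_cases o1 o3 h' with ⟨b1, b2, b3⟩ | ⟨b1, b2, b3⟩ | ⟨b1, b2, b3⟩ | ⟨b1, b2, b3⟩ <;>
      simp [b1, b2, b3, b4] <;> ring

lemma exists_mul_modEq {N : ℕ} {d : ℤ} (hd : IsCoprime d N) (c : ℤ) :
    ∃ z, z * d ≡ c [ZMOD N] := by
  obtain ⟨u, v, h⟩ := hd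
  refine ⟨c * u, ?_⟩
  rw [Int.modEq_iff_dvd]
  exact ⟨c * v, by linear_combination (-c) * h⟩

lemma isCoprime_of_mul_modEq {N : ℕ} {w d c : ℤ} (h : d * w ≡ c [ZMOD N]) (hc : IsCoprime c N) :
    IsCoprime w N :=
  (isCoprime_of_modEq h.symm hc).of_mul_left_right

/-- The distinguished coefficient at a level `N` such that one of `x`, `y` is a unit modulo `N`
whenever `x + y` is. A descent on the lower right entry `d`: after reducing `c` modulo `d` by a power
of `(1 0; 1 1)`, one passes to the lower row `(c, d - c)` or `(c - d, c)`, whichever has its last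
entry prime to `N`. -/
lemma Killed.coef_liftSL_local {N : ℕ} (hN : D.Killed N) (hpos : 0 < N)
    (hD : D.EvenSig ∨ 4 ∣ N)
    (hloc : ∀ x y : ℤ, IsCoprime (x + y) N → IsCoprime x N ∨ IsCoprime y N) (n : ℕ) :
    ∀ γ : SL(2, ℤ), γ 1 1 = n → 0 < n → IsCoprime (n : ℤ) N →
      D.coef (liftSL γ) = D.jac (γ 1 0) n * D.psi n := by
  induction n using Nat.strong_induction_on with
  | _ n ih =>
  intro γ₀ hγ₀ hn0 hn
  obtain ⟨v1, v2, v3⟩ := liftSL_mul_V_zpow (γ := γ₀) (by rw [hγ₀]; exact_mod_cast hn0)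
    (-(γ₀ 1 0 / n))
  set γ := γ₀ * matV ^ (-(γ₀ 1 0 / n)) with hγ
  have hc : γ 1 0 = γ₀ 1 0 % n := by
    rw [v3, hγ₀, Int.emod_def]; ring
  have hd : γ 1 1 = n := by rw [v2, hγ₀]
  have hred : D.coef (liftSL γ) = D.jac (γ 1 0) n * D.psi n →
      D.coef (liftSL γ₀) = D.jac (γ₀ 1 0) n * D.psi n := by
    intro h
    rw [v1, coef_mul_V, hc, jac_congr (Int.mod_modEq _ _)] at h
    exact h
  apply hred
  have hc0 : 0 ≤ γ 1 0 := by rw [hc]; exact Int.emod_nonneg _ (by exact_mod_cast hn0.ne')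
  have hcn : γ 1 0 < n := by rw [hc]; exact Int.emod_lt_of_pos _ (by exact_mod_cast hn0)
  clear_value γ
  clear hred v1 v2 v3 hc hγ₀
  have hdet : γ 0 0 * n - γ 0 1 * γ 1 0 = 1 := by
    have := γ.2
    rw [Matrix.det_fin_two] at this
    rw [← hd]; exact this
  obtain ⟨c, hcc⟩ := Int.eq_ofNat_of_zero_le hc0
  have hcn' : c < n := by rw [hcc] at hcn; exact_mod_cast hcn
  rw [hcc] at hdet ⊢
  rcases Nat.lt_or_ge 1 n with hn1 | hn1
  · have hcpos : 0 < c := by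
      rcases Nat.eq_zero_or_pos c with h | h
      · rw [h, Nat.cast_zero, mul_zero, sub_zero] at hdet
        have := Int.eq_one_or_neg_one_of_mul_eq_one' hdet
        omega
      · exact h
    have hadd : IsCoprime ((n - c : ℕ) : ℤ) N ∨ IsCoprime (c : ℤ) N :=
      hloc _ _ (by rw [Nat.cast_sub hcn'.le, sub_add_cancel]; exact hn)
    obtain ⟨z, hz⟩ := exists_mul_modEq hn c
    have hnz : D.psi n ≠ 0 := left_ne_zero_of_mul_eq_one (hN.psi_mul_conj hn)
    rcases hadd with he | hcN
    · set e := n - c with hedef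
      have hec : (e : ℤ) = n - c := Nat.cast_sub hcn'.le
      have hw : (n : ℤ) * (1 - z) ≡ e [ZMOD N] := by
        rw [hec]
        have := (Int.ModEq.refl (n : ℤ)).sub hz
        convert this using 1; ring
      have hwc := isCoprime_of_mul_modEq hw he
      have h1 : D.coef (liftSL (γ * ModularGroup.T⁻¹)) = D.coef (liftSL γ) * D.psi (1 - z) := by
        rw [liftSL_mul_T_inv, ← coef_V_mul_T_inv, hN.coef_mul]
        · rw [toSL_liftSL, hd]; exact hn
        · rw [toSL_liftSL, hd, hcc]; exact hz
      have g10 : (γ * ModularGroup.T⁻¹) 1 0 = (c : ℤ) := by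
        rw [SL_mul_apply, matT_inv_apply, matT_inv_apply, hcc]; simp
      have g11 : (γ * ModularGroup.T⁻¹) 1 1 = (e : ℤ) := by
        rw [SL_mul_apply, matT_inv_apply, matT_inv_apply, hcc, hd, hec]; simp; ring
      have h2 := ih e (by omega) _ g11 (by omega) he
      rw [g10, h1] at h2
      have h3 := hN.jac_mul_psi_sub_right hpos hD hn hwc hw
      rw [show (n : ℤ) - e = c by rw [hec]; ring] at h3
      have hw0 : D.psi (1 - z) ≠ 0 := left_ne_zero_of_mul_eq_one (hN.psi_mul_conj hwc)
      exact mul_right_cancel₀ hw0 (h2.trans h3)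
    · have hw : (n : ℤ) * z ≡ c [ZMOD N] := by rw [mul_comm]; exact hz
      have hwc := isCoprime_of_mul_modEq hw hcN
      obtain ⟨v1, v2, v3⟩ := liftSL_mul_V_zpow (γ := γ) (by rw [hd]; exact_mod_cast hn0) (-1)
      rw [hd] at v2 v3
      rw [hcc] at v3
      set γ₁ := γ * matV ^ (-1 : ℤ)
      have h1 : D.coef (liftSL (γ₁ * ModularGroup.T)) =
          D.coef (liftSL γ) * starRingEnd ℂ (D.psi z) := by
        have e1 : D.psi z = D.psi (1 + (z - 1)) := by rw [add_sub_cancel]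
        rw [liftSL_mul_T, e1, ← coef_V_mul_T, ← D.coef_mul_V (liftSL γ) (-1), ← v1, hN.coef_mul]
        · rw [toSL_liftSL, v2]; exact hn
        · rw [toSL_liftSL, v2, v3]
          have := hz.sub (Int.ModEq.refl (n : ℤ))
          convert this using 1 <;> ring
      have g10 : (γ₁ * ModularGroup.T) 1 0 = (c : ℤ) - n := by
        rw [SL_mul_apply, matT_apply, matT_apply, v3]; simp; ring
      have g11 : (γ₁ * ModularGroup.T) 1 1 = (c : ℤ) := by
        rw [SL_mul_apply, matT_apply, matT_apply, v2, v3]; simp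
      have h2 := ih c hcn' _ g11 hcpos hcN
      rw [g10, h1] at h2
      have h3 := hN.jac_mul_psi_sub_left hpos hD hn hwc hw
      have hw0 : starRingEnd ℂ (D.psi z) ≠ 0 :=
        right_ne_zero_of_mul_eq_one (hN.psi_mul_conj hwc)
      exact mul_right_cancel₀ hw0 (h2.trans h3)
  · have hn1' : n = 1 := by omega
    have hc1 : c = 0 := by omega
    subst hn1' hc1
    have hT : γ = ModularGroup.T ^ (γ 0 1) * 1 := by
      rw [mul_one]
      apply SL_ext
      all_goals rw [ModularGroup.coe_T_zpow]
      all_goals simp_all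
    rw [hT, liftSL_T_zpow_mul, coef_T_zpow_mul, DiscriminantForm.jac]
    have : liftSL 1 = 1 := by
      refine MpZ_ext (by rw [toSL_liftSL, map_one]) ?_
      rw [liftSL_φ]; simp [Mp.one_φ]
    rw [this, coef_one, Nat.cast_one, psi_one, jacobiSym.one_right]
    simp

end DiscriminantForm

namespace DiscriminantForm

/-! ### Orthogonal decompositions -/

section Orthogonal

variable {A B C : Type*} [AddCommGroup A] [Fintype A] [AddCommGroup B] [Fintype B]
  [AddCommGroup C] [Fintype C] {D : DiscriminantForm A} {E : DiscriminantForm B}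
  {F : DiscriminantForm C}

/-- An isomorphism of `A` with the orthogonal direct sum of `B` and `C`. -/
structure OrthogonalSum (D : DiscriminantForm A) (E : DiscriminantForm B)
    (F : DiscriminantForm C) where
  equiv : B × C ≃+ A
  q_equiv : ∀ x, D.q (equiv x) = E.q x.1 + F.q x.2

namespace OrthogonalSum

lemma bil_equiv (φ : OrthogonalSum D E F) (x y : B × C) :
    D.bil (φ.equiv x) (φ.equiv y) = E.bil x.1 y.1 + F.bil x.2 y.2 := by
  simp only [bil, QuadraticMap.polar, ← map_add, φ.q_equiv, Prod.fst_add, Prod.snd_add]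
  abel

lemma card_eq (φ : OrthogonalSum D E F) : Fintype.card A = Fintype.card B * Fintype.card C := by
  rw [← Fintype.card_prod, Fintype.card_congr φ.equiv.toEquiv]

lemma gz_eq (φ : OrthogonalSum D E F) (d : ℤ) : D.gz d = E.gz d * F.gz d := by
  rw [gz, gz, gz, Finset.sum_mul_sum, ← Finset.sum_product', ← φ.equiv.toEquiv.sum_comp]
  refine Finset.sum_congr rfl fun x _ => ?_
  have := φ.q_equiv x
  rw [← e_add, ← smul_add, ← this]; rfl

lemma psi_eq (φ : OrthogonalSum D E F) (d : ℤ) : D.psi d = E.psi d * F.psi d := by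
  rw [psi, psi, psi, φ.gz_eq, φ.gz_eq, mul_div_mul_comm]

/-- The tensor product of functions on the two summands. -/
def tens (φ : OrthogonalSum D E F) (f : B → ℂ) (h : C → ℂ) : A → ℂ := fun x => f (φ.equiv.symm x).1 * h (φ.equiv.symm x).2

/-- The Weil representation of an orthogonal sum is the tensor product of those of the summands. -/
lemma weil_tens (φ : OrthogonalSum D E F) (g : MpZ) : ∀ (f : B → ℂ) (h : C → ℂ),
    D.weilEnd g (φ.tens f h) = φ.tens (E.weilEnd g f) (F.weilEnd g h) := by
  have hg : g ∈ Subgroup.closure {mpS, mpT} := by rw [closure_mpS_mpT]; trivial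
  induction hg using Subgroup.closure_induction with
  | mem g hg =>
    intro f h
    rcases hg with rfl | rfl
    · rw [weilEnd_S, weilEnd_S, weilEnd_S]
      funext y
      rw [tens, φ.gz_eq, mul_inv, mul_mul_mul_comm, Finset.sum_mul_sum, ← Finset.sum_product',
        ← φ.equiv.toEquiv.sum_comp]
      congr 1
      refine Finset.sum_congr rfl fun x _ => ?_
      have h1 := φ.bil_equiv x (φ.equiv.symm y)
      rw [AddEquiv.apply_symm_apply] at h1
      rw [mul_mul_mul_comm, ← e_add, ← neg_add, ← h1]
      simp [tens]
    · have h1 := fun a => D.weilEnd_T_zpow 1 a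
      have h2 := fun a => E.weilEnd_T_zpow 1 a
      have h3 := fun a => F.weilEnd_T_zpow 1 a
      rw [zpow_one] at h1 h2 h3
      rw [h1, h2, h3]
      funext y
      have h4 := φ.q_equiv (φ.equiv.symm y)
      rw [AddEquiv.apply_symm_apply] at h4
      rw [tens, tens, h4, smul_add, e_add]
      ring
  | one => intro f h; simp [weilEnd]
  | mul a b _ _ ha hb =>
    intro f h
    rw [weilEnd_mul_apply, weilEnd_mul_apply, weilEnd_mul_apply, hb, ha]
  | inv a _ ha =>
    intro f h
    apply weilEnd_inv_apply
    rw [ha, ← weilEnd_mul_apply, ← weilEnd_mul_apply, mul_inv_cancel]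
    simp [weilEnd]

lemma coef_eq (φ : OrthogonalSum D E F) (g : MpZ) : D.coef g = E.coef g * F.coef g := by
  have h1 : (fun _ => 1 : A → ℂ) = φ.tens (fun _ => 1) (fun _ => 1) := by
    funext x; simp [tens]
  rw [coef, h1, weil_tens]
  simp [tens, coef]

lemma evenSig_iff' (φ : OrthogonalSum D E F) : D.EvenSig ↔ (E.EvenSig ↔ F.EvenSig) := by
  have hB : (Fintype.card B : ℂ) ≠ 0 := by exact_mod_cast Fintype.card_ne_zero
  have hC : (Fintype.card C : ℂ) ≠ 0 := by exact_mod_cast Fintype.card_ne_zero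
  have hne : -((Fintype.card B : ℂ) ^ 2 * (Fintype.card C : ℂ) ^ 2) ≠
      (Fintype.card B : ℂ) ^ 2 * (Fintype.card C : ℂ) ^ 2 := by
    intro h
    have : (Fintype.card B : ℂ) ^ 2 * (Fintype.card C : ℂ) ^ 2 = 0 := by
      linear_combination (-1 / 2 : ℂ) * h
    simp [hB, hC] at this
  have key : D.gz 1 ^ 4 = E.gz 1 ^ 4 * F.gz 1 ^ 4 := by rw [φ.gz_eq, mul_pow]
  unfold EvenSig at *
  rw [key, φ.card_eq, Nat.cast_mul, mul_pow]
  by_cases hE : E.EvenSig <;> by_cases hF : F.EvenSig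
  · simp [show E.gz 1 ^ 4 = _ from hE, show F.gz 1 ^ 4 = _ from hF]
  · have h1 := F.not_evenSig hF
    simp only [show E.gz 1 ^ 4 = _ from hE, h1, mul_neg, true_iff]
    exact iff_of_false hne (h1 ▸ hF)
  · have h1 := E.not_evenSig hE
    simp only [show F.gz 1 ^ 4 = _ from hF, h1, neg_mul, iff_true]
    exact iff_of_false hne (h1 ▸ hE)
  · have h1 := E.not_evenSig hE
    have h2 := F.not_evenSig hF
    have h1' : ¬ (E.gz 1 ^ 4 = _) := hE
    have h2' : ¬ (F.gz 1 ^ 4 = _) := hF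
    exact iff_of_true (by rw [h1, h2]; ring) (iff_of_false h1' h2')

lemma jac_eq (φ : OrthogonalSum D E F) {c : ℤ} {d : ℕ} (h : c.gcd d = 1) : D.jac c d = E.jac c d * F.jac c d := by
  have hsq : (jacobiSym c d : ℂ) * (jacobiSym c d : ℂ) = 1 := by
    exact_mod_cast (pow_two (jacobiSym c d) ▸ jacobiSym.sq_one h :)
  have h1 := φ.evenSig_iff'
  by_cases hE : E.EvenSig <;> by_cases hF : F.EvenSig <;> simp only [hE, hF, iff_true, iff_false, not_true_eq_false] at h1 <;>
    simp [jac, hE, hF, h1, hsq]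

end OrthogonalSum

end Orthogonal

/-- The restriction of a discriminant form to a subgroup `H` with an orthogonal complement. -/
def restrict {A : Type*} [AddCommGroup A] (D : DiscriminantForm A) (H K : AddSubgroup A)
    (hsup : ∀ x, ∃ h ∈ H, ∃ k ∈ K, x = h + k) (horth : ∀ h ∈ H, ∀ k ∈ K, D.bil h k = 0) :
    DiscriminantForm H where
  q := D.q.comp H.subtype.toIntLinearMap
  nondegenerate x hx := by
    refine Subtype.ext (D.nondegenerate x.1 fun y => ?_)
    obtain ⟨h, hh, k, hk, rfl⟩ := hsup y
    rw [QuadraticMap.polar_add_right]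
    rw [show QuadraticMap.polar D.q x.1 k = 0 from horth _ x.2 _ hk, add_zero]
    exact hx ⟨h, hh⟩

variable {A : Type*} [AddCommGroup A] [Fintype A] {D : DiscriminantForm A}

lemma Killed.restrict_torsion {a b : ℕ} (hN : D.Killed (a * b)) (hab : a.Coprime b)
    {H K : AddSubgroup A} {hsup : ∀ x, ∃ h ∈ H, ∃ k ∈ K, x = h + k}
    {horth : ∀ h ∈ H, ∀ k ∈ K, D.bil h k = 0} (hH : ∀ x ∈ H, a • x = 0) [Fintype H] :
    (D.restrict H K hsup horth).Killed a := by
  intro x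
  change a • D.q x.1 = 0
  have h1 := hN x.1
  have h2 : (a * a : ℤ) • D.q x.1 = 0 := by
    rw [← q_zsmul, natCast_zsmul, hH _ x.2, map_zero]
  have h3 := Nat.gcd_eq_gcd_ab a b
  rw [hab] at h3
  have h4 : (a : ℤ) = (a * a : ℤ) * a.gcdA b + (a * b : ℕ) * a.gcdB b := by
    push_cast; push_cast at h3; linear_combination (a : ℤ) * h3
  rw [← natCast_zsmul, h4, add_smul, mul_comm (a * a : ℤ), mul_smul, h2, mul_comm _ (a.gcdB b),
    mul_smul, natCast_zsmul, h1, smul_zero, smul_zero, add_zero]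

/-- The value of the distinguished coefficient on a principal lift. -/
theorem Killed.coef_liftSL (N : ℕ) : ∀ {A : Type*} [AddCommGroup A] [Fintype A]
    {D : DiscriminantForm A} (_ : D.Killed N) (_ : 0 < N) (γ : SL(2, ℤ)) (n : ℕ), γ 1 1 = n →
    0 < n → IsCoprime (n : ℤ) N → D.coef (liftSL γ) = D.jac (γ 1 0) n * D.psi n := by
  induction N using Nat.recOnPosPrimePosCoprime with
  | zero => intros; omega
  | one =>
    intro A _ _ D hN hpos γ n h1 h2 h3
    exact hN.coef_liftSL_local hpos (Or.inl (hN.evenSig_of_odd odd_one))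
      (fun x y _ => Or.inl (by simpa using isCoprime_one_right)) n γ h1 h2 h3
  | prime_pow p k hp hk =>
    intro A _ _ D hN hpos γ n h1 h2 h3
    refine hN.coef_liftSL_local hpos ?_ ?_ n γ h1 h2 h3
    · rcases hp.eq_two_or_odd' with rfl | ho
      · rcases Nat.lt_or_ge 1 k with h | h
        · exact Or.inr (pow_dvd_pow 2 h)
        · obtain rfl : k = 1 := by omega
          rw [pow_one] at hN
          exact Or.inl (Killed.evenSig_of_two hN)
      · exact Or.inl (hN.evenSig_of_odd ho.pow)
    · intro x y hxy
      have hpi : Prime (p : ℤ) := Nat.prime_iff_prime_int.mp hp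
      push_cast at hxy ⊢
      rw [IsCoprime.pow_right_iff hk] at hxy ⊢
      rw [IsCoprime.pow_right_iff hk]
      by_contra! hcon
      have e1 : (p : ℤ) ∣ x := by
        by_contra h; exact hcon.1 ((hpi.coprime_iff_not_dvd.mpr h).symm)
      have e2 : (p : ℤ) ∣ y := by
        by_contra h; exact hcon.2 ((hpi.coprime_iff_not_dvd.mpr h).symm)
      exact hpi.coprime_iff_not_dvd.mp hxy.symm (dvd_add e1 e2)
  | coprime a b ha hb hab iha ihb =>
    intro A _ _ D hN hpos γ n h1 h2 h3
    classical
    let H : AddSubgroup A := (nsmulAddMonoidHom a).ker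
    let K : AddSubgroup A := (nsmulAddMonoidHom b).ker
    have hH : ∀ x ∈ H, a • x = 0 := fun x hx => hx
    have hK : ∀ x ∈ K, b • x = 0 := fun x hx => hx
    have hgcd := Nat.gcd_eq_gcd_ab a b
    rw [hab] at hgcd
    push_cast at hgcd
    have hsm : ∀ x : A, (a * b : ℕ) • x = 0 := fun x => by
      have := hN.smul x
      rwa [natCast_zsmul] at this
    have hsup : ∀ x : A, ∃ h ∈ H, ∃ k ∈ K, x = h + k := by
      intro x
      refine ⟨(b * a.gcdB b : ℤ) • x, ?_, (a * a.gcdA b : ℤ) • x, ?_, ?_⟩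
      · change a • ((b * a.gcdB b : ℤ) • x) = 0
        rw [← natCast_zsmul, ← mul_smul, show (a : ℤ) * (b * a.gcdB b) =
          a.gcdB b * ((a * b : ℕ) : ℤ) by push_cast; ring, mul_smul, natCast_zsmul, hsm, smul_zero]
      · change b • ((a * a.gcdA b : ℤ) • x) = 0
        rw [← natCast_zsmul, ← mul_smul, show (b : ℤ) * (a * a.gcdA b) =
          a.gcdA b * ((a * b : ℕ) : ℤ) by push_cast; ring, mul_smul, natCast_zsmul, hsm, smul_zero]
      · rw [← add_smul, add_comm, ← hgcd, one_smul]
    have hsup' : ∀ x : A, ∃ k ∈ K, ∃ h ∈ H, x = k + h := fun x => by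
      obtain ⟨h, hh, k, hk, e⟩ := hsup x
      exact ⟨k, hk, h, hh, e.trans (add_comm _ _)⟩
    have hz : ∀ x : AddCircle (1 : ℚ), a • x = 0 → b • x = 0 → x = 0 := by
      intro x hx hx'
      rw [← one_zsmul x, hgcd, add_smul, mul_comm, mul_smul, mul_comm (b : ℤ), mul_smul,
        natCast_zsmul, natCast_zsmul, hx, hx', smul_zero, smul_zero, add_zero]
    have horth : ∀ h ∈ H, ∀ k ∈ K, D.bil h k = 0 := by
      intro h hh k hk
      apply hz
      · rw [← natCast_zsmul, ← bil_zsmul_left, natCast_zsmul, hH h hh, bil_zero_left]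
      · rw [← natCast_zsmul, ← bil_zsmul_right, natCast_zsmul, hK k hk, bil_zero_right]
    have horth' : ∀ k ∈ K, ∀ h ∈ H, D.bil k h = 0 := fun k hk h hh => by
      rw [bil_comm, horth h hh k hk]
    let φ : OrthogonalSum D (D.restrict H K hsup horth) (D.restrict K H hsup' horth') :=
      { equiv := AddEquiv.ofBijective (H.subtype.coprod K.subtype) (by
          constructor
          · rw [injective_iff_map_eq_zero]
            rintro ⟨⟨x, hx⟩, ⟨y, hy⟩⟩ hxy
            change x + y = 0 at hxy
            have hy' : y = -x := by rw [eq_neg_iff_add_eq_zero, add_comm]; exact hxy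
            have hx' : b • x = 0 := by
              have := hK y hy
              rwa [hy', smul_neg, neg_eq_zero] at this
            have hx0 : x = 0 := by
              rw [← one_zsmul x, hgcd, add_smul, mul_comm, mul_smul, mul_comm (b : ℤ), mul_smul,
                natCast_zsmul, natCast_zsmul, hH x hx, hx', smul_zero, smul_zero, add_zero]
            subst hx0
            rw [neg_zero] at hy'
            subst hy'
            rfl
          · intro x
            obtain ⟨h, hh, k, hk, e⟩ := hsup x
            exact ⟨(⟨h, hh⟩, ⟨k, hk⟩), e.symm⟩)
        q_equiv := by
          rintro ⟨⟨x, hx⟩, ⟨y, hy⟩⟩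
          change D.q (x + y) = D.q x + D.q y
          rw [q_add, horth x hx y hy, add_zero] }
    have hNa : (D.restrict H K hsup horth).Killed a := hN.restrict_torsion hab hH
    have hNb : (D.restrict K H hsup' horth').Killed b :=
      Killed.restrict_torsion (by rwa [mul_comm] at hN) hab.symm hK
    push_cast at h3
    have c1 := iha hNa (by omega) γ n h1 h2 h3.of_mul_right_left
    have c2 := ihb hNb (by omega) γ n h1 h2 h3.of_mul_right_right
    have hco : (γ 1 0).gcd n = 1 := by
      rw [← Int.isCoprime_iff_gcd_eq_one]
      have := γ.2
      rw [Matrix.det_fin_two, show γ.1 1 1 = n from h1] at this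
      exact ⟨-γ 0 1, γ 0 0, by linear_combination this⟩
    rw [φ.coef_eq, c1, c2, φ.jac_eq hco, φ.psi_eq]
    ring

end DiscriminantForm

/-! ### Conjugation by `diag(m², 1)` -/

/-- The element `(diag(m², 1), 1)` of the metaplectic cover. -/
def mpDiag (m : ℕ) (hm : 0 < m) : Mp := Mp.principal (diagSq m hm)

lemma mat_diagSq {m : ℕ} (hm : 0 < m) : mat (diagSq m hm) = !![(m : ℚ) ^ 2, 0; 0, 1] := rfl

lemma autJ_diagSq {m : ℕ} (hm : 0 < m) (τ : ℍ) : autJ (diagSq m hm) τ = 1 := by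
  rw [autJ_eq, mat_diagSq]; simp

lemma mpDiag_M {m : ℕ} (hm : 0 < m) : (mpDiag m hm).M = diagSq m hm := rfl

lemma mpDiag_φ {m : ℕ} (hm : 0 < m) (τ : ℍ) : (mpDiag m hm).φ τ = 1 := by
  change autJ (diagSq m hm) τ ^ (1 / 2 : ℂ) = 1
  rw [autJ_diagSq, Complex.one_cpow]

lemma diagSq_mul_iff {m : ℕ} (hm : 0 < m) {γ γ' : SL(2, ℤ)} :
    diagSq m hm * ofSL γ = ofSL γ' * diagSq m hm ↔
      γ' 0 0 = γ 0 0 ∧ γ' 0 1 = m ^ 2 * γ 0 1 ∧ γ 1 0 = m ^ 2 * γ' 1 0 ∧ γ' 1 1 = γ 1 1 := by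
  have hm' : (m : ℚ) ≠ 0 := by exact_mod_cast hm.ne'
  rw [← mat_injective.eq_iff, mat_mul, mat_mul, mat_diagSq]
  constructor
  · intro h
    have h00 := congrFun (congrFun h 0) 0
    have h01 := congrFun (congrFun h 0) 1
    have h10 := congrFun (congrFun h 1) 0
    have h11 := congrFun (congrFun h 1) 1
    simp only [Matrix.mul_apply, Fin.sum_univ_two, mat_ofSL] at h00 h01 h10 h11
    simp at h00 h01 h10 h11
    refine ⟨?_, ?_, ?_, ?_⟩
    · rw [mul_comm] at h00
      exact (mul_right_cancel₀ (pow_ne_zero 2 hm') (by exact_mod_cast h00) :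
        (γ 0 0 : ℚ) = γ' 0 0) |> fun h => by exact_mod_cast h.symm
    · exact_mod_cast h01.symm
    · rw [mul_comm] at h10; exact_mod_cast h10
    · exact_mod_cast h11.symm
  · rintro ⟨h1, h2, h3, h4⟩
    ext i j
    simp only [Matrix.mul_apply, Fin.sum_univ_two, mat_ofSL]
    fin_cases i <;> fin_cases j <;> simp [h1, h2, h3, h4] <;> ring

lemma exists_mpDiag_mul {m : ℕ} (hm : 0 < m) (g : MpZ) (hc : (m ^ 2 : ℤ) ∣ toSL g 1 0) :
    ∃ h : MpZ, mpDiag m hm * g.1 = h.1 * mpDiag m hm := by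
  obtain ⟨c, hc⟩ := hc
  have hdet := (toSL g).2
  rw [Matrix.det_fin_two] at hdet
  let γ' : SL(2, ℤ) := ⟨!![toSL g 0 0, m ^ 2 * toSL g 0 1; c, toSL g 1 1], by
    have : (toSL g).1 1 0 = m ^ 2 * c := hc
    rw [Matrix.det_fin_two_of]
    linear_combination hdet + (toSL g).1 0 1 * this⟩
  have hrel : diagSq m hm * ofSL (toSL g) = ofSL γ' * diagSq m hm :=
    (diagSq_mul_iff hm).mpr ⟨rfl, rfl, hc, rfl⟩
  refine ⟨⟨mpDiag m hm * g.1 * (mpDiag m hm)⁻¹, γ', ?_⟩, ?_⟩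
  · change ofSL γ' = diagSq m hm * g.1.M * (diagSq m hm)⁻¹
    rw [← ofSL_toSL, hrel, mul_inv_cancel_right]
  · change _ = mpDiag m hm * g.1 * (mpDiag m hm)⁻¹ * mpDiag m hm
    rw [inv_mul_cancel_right]

lemma exists_mul_mpDiag {m : ℕ} (hm : 0 < m) (h : MpZ) (hb : (m ^ 2 : ℤ) ∣ toSL h 0 1) :
    ∃ g : MpZ, mpDiag m hm * g.1 = h.1 * mpDiag m hm := by
  obtain ⟨b, hb⟩ := hb
  have hdet := (toSL h).2
  rw [Matrix.det_fin_two] at hdet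
  let γ : SL(2, ℤ) := ⟨!![toSL h 0 0, b; m ^ 2 * toSL h 1 0, toSL h 1 1], by
    have : (toSL h).1 0 1 = m ^ 2 * b := hb
    rw [Matrix.det_fin_two_of]
    linear_combination hdet + (toSL h).1 1 0 * this⟩
  have hrel : diagSq m hm * ofSL γ = ofSL (toSL h) * diagSq m hm :=
    (diagSq_mul_iff hm).mpr ⟨rfl, hb, rfl, rfl⟩
  refine ⟨⟨(mpDiag m hm)⁻¹ * h.1 * mpDiag m hm, γ, ?_⟩, ?_⟩
  · change ofSL γ = (diagSq m hm)⁻¹ * h.1.M * diagSq m hm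
    rw [← ofSL_toSL, mul_assoc, ← hrel, inv_mul_cancel_left]
  · change mpDiag m hm * ((mpDiag m hm)⁻¹ * h.1 * mpDiag m hm) = _
    rw [mul_assoc, mul_inv_cancel_left]

lemma mpDiag_rel_entries {m : ℕ} {hm : 0 < m} {g h : MpZ}
    (H : mpDiag m hm * g.1 = h.1 * mpDiag m hm) :
    toSL h 0 0 = toSL g 0 0 ∧ toSL h 0 1 = m ^ 2 * toSL g 0 1 ∧
      toSL g 1 0 = m ^ 2 * toSL h 1 0 ∧ toSL h 1 1 = toSL g 1 1 := by
  have := congrArg Mp.M H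
  rw [Mp.mul_M, Mp.mul_M, ← ofSL_toSL, ← ofSL_toSL, mpDiag_M] at this
  exact (diagSq_mul_iff hm).mp this

lemma mpDiag_mul_liftSL {m : ℕ} (hm : 0 < m) {γ γ' : SL(2, ℤ)}
    (H : diagSq m hm * ofSL γ = ofSL γ' * diagSq m hm) :
    mpDiag m hm * (liftSL γ).1 = (liftSL γ').1 * mpDiag m hm := by
  refine Mp.ext H (funext fun τ => ?_)
  have h1 := autJ_mul (diagSq m hm) (ofSL γ) τ
  rw [H, autJ_mul, autJ_diagSq, autJ_diagSq, one_mul, mul_one] at h1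
  rw [Mp.mul_φ, Mp.mul_φ, mpDiag_φ, mpDiag_φ, one_mul, mul_one]
  change autJ (ofSL γ) τ ^ (1 / 2 : ℂ) = autJ (ofSL γ') (moebius (diagSq m hm) τ) ^ (1 / 2 : ℂ)
  rw [h1]

lemma exists_add_mul_isCoprime {c d : ℤ} {N : ℕ} (hc : 0 < c) (hN : 0 < N) (h : IsCoprime d c) :
    ∃ k : ℤ, 0 < d + k * c ∧ IsCoprime (d + k * c) N := by
  lift c to ℕ using hc.le
  have hc' : 0 < c := by exact_mod_cast hc
  have : NeZero (c * N) := ⟨(Nat.mul_pos hc' hN).ne'⟩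
  obtain ⟨u, hu⟩ := ZMod.unitsMap_surjective (Nat.dvd_mul_right c N)
    (ZMod.unitOfIsCoprime d h)
  have h1 : ((u : ZMod (c * N)).val : ZMod c) = d := by
    have := congrArg Units.val hu
    rw [ZMod.coe_unitOfIsCoprime] at this
    rw [← this, ZMod.unitsMap_val, ZMod.natCast_val]
  have h2 : ((u : ZMod (c * N)).val : ℤ) ≡ d [ZMOD c] := by
    rw [← ZMod.intCast_eq_intCast_iff]
    push_cast; exact h1
  have h3 : Nat.Coprime (u : ZMod (c * N)).val (c * N) := ZMod.val_coe_unit_coprime u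
  set v := (u : ZMod (c * N)).val + c * N
  have h4 : (v : ℤ) ≡ d [ZMOD c] := by
    have : ((v : ℕ) : ℤ) = (u : ZMod (c * N)).val + c * N := by simp [v]
    rw [this]
    have h5 : ((u : ZMod (c * N)).val : ℤ) + c * N ≡ d + 0 [ZMOD c] :=
      h2.add (Int.modEq_zero_iff_dvd.mpr (dvd_mul_right _ _))
    rwa [add_zero] at h5
  obtain ⟨k, hk⟩ := h4.symm.dvd
  have hv : d + k * c = v := by linear_combination -hk
  refine ⟨k, ?_, ?_⟩
  · rw [hv]; have : 0 < v := Nat.add_pos_right _ (Nat.mul_pos hc' hN)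
    exact_mod_cast this
  · rw [hv, Nat.isCoprime_iff_coprime]
    have : Nat.Coprime v (c * N) := by simpa [v] using h3
    exact this.coprime_mul_left_right

namespace DiscriminantForm

variable {A : Type*} [AddCommGroup A] [Fintype A] {D : DiscriminantForm A}

lemma Killed.coef_ne_zero {N : ℕ} (hN : D.Killed N) (hpos : 0 < N) {γ : SL(2, ℤ)} {n : ℕ}
    (hn : γ 1 1 = n) (hn0 : 0 < n) (hc : IsCoprime (n : ℤ) N) : D.coef (liftSL γ) ≠ 0 := by
  rw [Killed.coef_liftSL N hN hpos γ n hn hn0 hc]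
  refine mul_ne_zero ?_ (left_ne_zero_of_mul_eq_one (hN.psi_mul_conj hc))
  rw [jac]
  split_ifs
  · exact one_ne_zero
  · have hco : (γ 1 0).gcd n = 1 := by
      rw [← Int.isCoprime_iff_gcd_eq_one]
      have := γ.2
      rw [Matrix.det_fin_two, show γ.1 1 1 = n from hn] at this
      exact ⟨-γ 0 1, γ 0 0, by linear_combination this⟩
    exact_mod_cast jacobiSym.ne_zero hco

lemma exists_inv_modEq {m N : ℕ} (h : m.Coprime N) : ∃ m' : ℤ, (m : ℤ) * m' ≡ 1 [ZMOD N] := by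
  obtain ⟨u, v, huv⟩ := Nat.isCoprime_iff_coprime.mpr h
  refine ⟨u, ?_⟩
  rw [Int.modEq_iff_dvd]
  exact ⟨v, by linear_combination -huv⟩

/-- The comparison for principal lifts whose lower right entry is positive and prime to the level:
both sides intertwine the same Heisenberg operators, hence agree up to a scalar, which the
distinguished coefficients identify as `(c/m² | d) / (c | d) = 1`. -/
lemma Killed.dil_mul_weil_liftSL {N : ℕ} (hN : D.Killed N) (hpos : 0 < N) {m : ℕ} {hm : 0 < m}
    (hmN : m.Coprime N) {γ γ' : SL(2, ℤ)}
    (H : diagSq m hm * ofSL γ = ofSL γ' * diagSq m hm) {n : ℕ}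
    (hn : γ 1 1 = n) (hn0 : 0 < n) (hc : IsCoprime (n : ℤ) N) :
    dil m * D.weilEnd (liftSL γ) = D.weilEnd (liftSL γ') * dil m := by
  obtain ⟨m', hm'⟩ := exists_inv_modEq hmN
  have hm'' : m' * (m : ℤ) ≡ 1 [ZMOD N] := by rw [mul_comm]; exact hm'
  obtain ⟨e00, e01, e10, e11⟩ := (diagSq_mul_iff hm).mp H
  let U : LinearMap.GeneralLinearGroup ℂ (A → ℂ) :=
    hN.unitDil hm' * D.weil (liftSL γ) * hN.unitDil hm''
  have hU : D.Intertwines U γ'.1 := by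
    have h1 := ((hN.intertwines_dil hm').mul (D.intertwines_weil (liftSL γ))).mul
      (hN.intertwines_dil hm'')
    rw [toSL_liftSL] at h1
    refine hN.intertwines_congr ?_ h1
    have key : (m : ℤ) * m' ≡ 1 [ZMOD N] := hm'
    intro i j
    fin_cases i <;> fin_cases j <;>
      simp only [Matrix.mul_apply, Fin.sum_univ_two] <;> simp
    · rw [show γ'.1 0 0 = γ.1 0 0 from e00]
      have := key.mul_right (γ.1 0 0)
      rw [one_mul] at this
      convert this using 1; ring
    · rw [show γ'.1 0 1 = m ^ 2 * γ.1 0 1 from e01]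
      rw [show (m : ℤ) * γ.1 0 1 * m = m ^ 2 * γ.1 0 1 by ring]
    · rw [show γ.1 1 0 = m ^ 2 * γ'.1 1 0 from e10]
      have := (key.mul key).mul_right (γ'.1 1 0)
      rw [one_mul, one_mul] at this
      convert this using 1; ring
    · rw [show γ'.1 1 1 = γ.1 1 1 from e11]
      have := key.mul_right (γ.1 1 1)
      rw [one_mul] at this
      convert this using 1; ring
  have hγ' := D.intertwines_weil (liftSL γ')
  rw [toSL_liftSL] at hγ'
  obtain ⟨χ, hχ⟩ := Intertwines.exists_smul hγ' hU
  have hχ' : D.weilEnd (liftSL γ') = χ • (dil m * D.weilEnd (liftSL γ) * dil m') := hχ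
  have h1 : D.coef (liftSL γ') = χ * D.coef (liftSL γ) := by
    rw [coef, hχ', LinearMap.smul_apply, Module.End.mul_apply, Module.End.mul_apply, Pi.smul_apply,
      dil_apply, smul_zero, coef]
    rfl
  have h2 : D.jac (γ 1 0) n = D.jac (γ' 1 0) n := by
    rw [e10, jac, jac]
    have hmn : (m : ℤ).gcd n = 1 := by
      rw [← Int.isCoprime_iff_gcd_eq_one]
      have := γ.2
      rw [Matrix.det_fin_two, show γ.1 1 1 = n from hn,
        show γ.1 1 0 = m ^ 2 * γ'.1 1 0 from e10] at this
      exact ⟨-γ.1 0 1 * m * γ'.1 1 0, γ.1 0 0, by linear_combination this⟩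
    rw [jacobiSym.mul_left, jacobiSym.sq_one' hmn, one_mul]
  have h3 := hN.coef_ne_zero hpos hn hn0 hc
  have h4 : D.coef (liftSL γ') = D.coef (liftSL γ) := by
    rw [Killed.coef_liftSL N hN hpos γ n hn hn0 hc,
      Killed.coef_liftSL N hN hpos γ' n (e11.trans hn) hn0 hc, h2]
  have h5 : χ = 1 := by
    rw [h4] at h1
    exact mul_right_cancel₀ h3 (by rw [← h1, one_mul])
  rw [hχ', h5, one_smul, mul_assoc, hN.dil_mul_dil hm'', mul_one]

lemma dil_mul_weil_of_mul {m : ℕ} {t t' : MpZ}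
    (htD : dil m * D.weilEnd t = D.weilEnd t' * dil m) {g h : MpZ}
    (hD : dil m * D.weilEnd (g * t) = D.weilEnd (h * t') * dil m) :
    dil m * D.weilEnd g = D.weilEnd h * dil m := by
  rw [weilEnd_mul, weilEnd_mul, mul_assoc, ← htD, ← mul_assoc, ← mul_assoc] at hD
  have hinv : D.weilEnd t * D.weilEnd t⁻¹ = 1 := by
    rw [← weilEnd_mul, mul_inv_cancel, weilEnd, map_one, Units.val_one]
  have := congrArg (· * D.weilEnd t⁻¹) hD
  simp only [mul_assoc, hinv, mul_one] at this
  exact this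

lemma mpDiag_mul_of_mul {m : ℕ} {hm : 0 < m} {t t' g h : MpZ}
    (ht : mpDiag m hm * t.1 = t'.1 * mpDiag m hm) (H : mpDiag m hm * g.1 = h.1 * mpDiag m hm) :
    mpDiag m hm * (g * t).1 = (h * t').1 * mpDiag m hm := by
  rw [Subgroup.coe_mul, Subgroup.coe_mul, ← mul_assoc, H, mul_assoc, ht, mul_assoc]

lemma mpDiag_mul_T_zpow {m : ℕ} {hm : 0 < m} (k : ℤ) :
    mpDiag m hm * (mpT ^ k).1 = (mpT ^ ((m : ℤ) ^ 2 * k)).1 * mpDiag m hm := by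
  have h1 : ∀ k : ℤ, mpT ^ k = liftSL (ModularGroup.T ^ k) := fun k => by
    have := liftSL_T_zpow_mul 1 k
    rw [mul_one] at this
    rw [this]
    have h2 : liftSL 1 = 1 := MpZ_ext (by rw [toSL_liftSL, map_one]) (by
      rw [liftSL_φ]; simp [Mp.one_φ])
    rw [h2, mul_one]
  rw [h1, h1]
  apply mpDiag_mul_liftSL
  rw [diagSq_mul_iff]
  have hT : ∀ (k : ℤ) (i j : Fin 2), (ModularGroup.T ^ k) i j =
      (!![1, k; 0, 1] : Matrix (Fin 2) (Fin 2) ℤ) i j := fun k i j => by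
    rw [← ModularGroup.coe_T_zpow]
  simp [hT]

lemma dil_mul_weil_T_zpow (m : ℕ) (k : ℤ) :
    dil m * D.weilEnd (mpT ^ k) = D.weilEnd (mpT ^ ((m : ℤ) ^ 2 * k)) * dil m := by
  refine LinearMap.ext fun a => ?_
  rw [Module.End.mul_apply, Module.End.mul_apply, weilEnd_T_zpow, weilEnd_T_zpow]
  funext x
  rw [dil_apply, dil_apply, q_zsmul, smul_smul]
  congr 3; ring

lemma mpDiag_mul_S_sq {m : ℕ} {hm : 0 < m} :
    mpDiag m hm * (mpS * mpS).1 = (mpS * mpS).1 * mpDiag m hm := by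
  refine Mp.ext ?_ (funext fun τ => ?_)
  · rw [Mp.mul_M, Mp.mul_M, ← ofSL_toSL, toSL_mpS_sq, mpDiag_M, diagSq_mul_iff]
    simp
  · rw [Mp.mul_φ, Mp.mul_φ, mpDiag_φ, mpDiag_φ, mpS_sq_φ, mpS_sq_φ, one_mul, mul_one]

lemma exists_weilEnd_S_sq : ∃ c : ℂ, ∀ (a : A → ℂ), D.weilEnd (mpS * mpS) a = fun x => c * a (-x) := by
  refine ⟨Fintype.card A / D.gz 1 ^ 2, fun a => ?_⟩
  rw [weilEnd_mul_apply, weilEnd, weil_mpS]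
  funext x
  rw [weilS_sq_apply]

lemma dil_mul_weil_S_sq (m : ℕ) :
    dil m * D.weilEnd (mpS * mpS) = D.weilEnd (mpS * mpS) * dil m := by
  obtain ⟨c, hc⟩ := D.exists_weilEnd_S_sq
  refine LinearMap.ext fun a => ?_
  rw [Module.End.mul_apply, Module.End.mul_apply, hc, hc]
  funext x
  rw [dil_apply, dil_apply, smul_neg]

lemma dil_mul_weil_mpNeg (m : ℕ) :
    dil m * D.weilEnd mpNeg = D.weilEnd mpNeg * dil m := by
  rw [mpNeg, weilEnd_mul, ← mul_assoc, dil_mul_weil_S_sq, mul_assoc, dil_mul_weil_S_sq, mul_assoc]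

/-- `ρ_A` intertwines conjugation by `diag(m², 1)` with conjugation by the dilation
`𝔢_λ ↦ 𝔢_{m⁻¹λ}`. -/
theorem Killed.dil_mul_weil {N : ℕ} (hN : D.Killed N) (hpos : 0 < N) {m : ℕ} {hm : 0 < m}
    (hmN : m.Coprime N) {g h : MpZ} (H : mpDiag m hm * g.1 = h.1 * mpDiag m hm) :
    dil m * D.weilEnd g = D.weilEnd h * dil m := by
  have hNeg : mpDiag m hm * mpNeg.1 = mpNeg.1 * mpDiag m hm := by
    have := mpDiag_mul_of_mul (mpDiag_mul_S_sq (m := m) (hm := hm)) mpDiag_mul_S_sq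
    exact this
  -- the lower row may be multiplied by `-1` and translated
  have step1 : ∀ {g h : MpZ}, mpDiag m hm * g.1 = h.1 * mpDiag m hm →
      0 < toSL g 1 1 → IsCoprime (toSL g 1 1) N →
      dil m * D.weilEnd g = D.weilEnd h * dil m := by
    intro g h H h0 hco
    obtain ⟨n, hn⟩ := Int.eq_ofNat_of_zero_le h0.le
    have hn0 : 0 < n := by rw [hn] at h0; exact_mod_cast h0
    have hrel : diagSq m hm * ofSL (toSL g) = ofSL (toSL h) * diagSq m hm := by
      have := congrArg Mp.M H
      rwa [Mp.mul_M, Mp.mul_M, ← ofSL_toSL, ← ofSL_toSL, mpDiag_M] at this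
    have main := hN.dil_mul_weil_liftSL hpos hmN hrel hn hn0 (by rw [← hn]; exact hco)
    have hl := mpDiag_mul_liftSL hm hrel
    have unique : ∀ {g h h' : MpZ}, mpDiag m hm * g.1 = h.1 * mpDiag m hm →
        mpDiag m hm * g.1 = h'.1 * mpDiag m hm → h = h' := fun e e' =>
      Subtype.ext (mul_right_cancel (e.symm.trans e'))
    rcases eq_or_eq_mpNeg_mul (g := g) (h := liftSL (toSL g)) (by rw [toSL_liftSL]) with e | e
    · have : h = liftSL (toSL h) := unique (g := g) H (by conv_lhs => rw [e]; exact hl)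
      rw [this, e]
      exact main
    · have hl' : mpDiag m hm * (mpNeg * liftSL (toSL g)).1 =
          (mpNeg * liftSL (toSL h)).1 * mpDiag m hm := mpDiag_mul_of_mul hl hNeg
      have : h = mpNeg * liftSL (toSL h) := unique (g := g) H (by conv_lhs => rw [e]; exact hl')
      rw [this, e, weilEnd_mul, weilEnd_mul, ← mul_assoc, dil_mul_weil_mpNeg, mul_assoc,
        main, mul_assoc]
  have step2 : ∀ {g h : MpZ}, mpDiag m hm * g.1 = h.1 * mpDiag m hm → 0 < toSL g 1 0 →
      dil m * D.weilEnd g = D.weilEnd h * dil m := by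
    intro g h H hc
    have hco : IsCoprime (toSL g 1 1) (toSL g 1 0) := by
      have := (toSL g).2
      rw [Matrix.det_fin_two] at this
      exact ⟨toSL g 0 0, -toSL g 0 1, by linear_combination this⟩
    obtain ⟨k, hk0, hk⟩ := exists_add_mul_isCoprime hc hpos hco
    have e11 : toSL (g * mpT ^ k) 1 1 = toSL g 1 1 + k * toSL g 1 0 := by
      have hT : ∀ (i j : Fin 2), (ModularGroup.T ^ k) i j =
        (!![1, k; 0, 1] : Matrix (Fin 2) (Fin 2) ℤ) i j := fun i j => by
          rw [← ModularGroup.coe_T_zpow]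
      rw [map_mul, map_zpow, toSL_mpT, SL_mul_apply, hT, hT]
      simp; ring
    refine dil_mul_weil_of_mul (dil_mul_weil_T_zpow m k) ?_
    exact step1 (mpDiag_mul_of_mul (mpDiag_mul_T_zpow k) H) (by rw [e11]; exact hk0)
      (by rw [e11]; exact hk)
  have hneg : ∀ (g : MpZ) (i j : Fin 2), toSL (g * (mpS * mpS)) i j = -toSL g i j := by
    intro g i j
    rw [map_mul, toSL_mpS_sq, mul_neg, mul_one]
    rfl
  rcases lt_trichotomy (toSL g 1 0) 0 with hc | hc | hc
  · refine dil_mul_weil_of_mul (dil_mul_weil_S_sq m) ?_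
    exact step2 (mpDiag_mul_of_mul mpDiag_mul_S_sq H) (by rw [hneg]; omega)
  · have hdet := (toSL g).2
    rw [Matrix.det_fin_two, show (toSL g).1 1 0 = 0 from hc, mul_zero, sub_zero] at hdet
    rcases Int.eq_one_or_neg_one_of_mul_eq_one' hdet with ⟨_, hd⟩ | ⟨_, hd⟩
    · have hd' : toSL g 1 1 = 1 := hd
      exact step1 H (by rw [hd']; norm_num) (by rw [hd']; exact isCoprime_one_left)
    · have hd' : toSL (g * (mpS * mpS)) 1 1 = 1 := by
        rw [hneg, show toSL g 1 1 = -1 from hd]; norm_num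
      refine dil_mul_weil_of_mul (dil_mul_weil_S_sq m) ?_
      exact step1 (mpDiag_mul_of_mul mpDiag_mul_S_sq H) (by rw [hd']; norm_num)
        (by rw [hd']; exact isCoprime_one_left)
  · exact step2 H hc

end DiscriminantForm

/-! ### Averages over cosets of finite index subgroups -/

section Mean

variable {Γ : Type*} [Group Γ] {V : Type*} [AddCommGroup V] [Module ℂ V]

/-- The mean value over `Γ / L` of a function on `Γ` that is right invariant under the finite index
subgroup `L`. -/
def mean (L : Subgroup Γ) (F : Γ → V) : V := (L.index : ℂ)⁻¹ • ∑ᶠ c : Γ ⧸ L, F (Quotient.out c)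

lemma apply_out {L : Subgroup Γ} {F : Γ → V} (hF : ∀ y, ∀ l ∈ L, F (y * l) = F y) (y : Γ) :
    F (Quotient.out (y : Γ ⧸ L)) = F y := by
  have h : y⁻¹ * Quotient.out (y : Γ ⧸ L) ∈ L := by
    rw [← QuotientGroup.eq]; exact (Quotient.out_eq _).symm
  have := hF y _ h
  rwa [mul_inv_cancel_left] at this

/-- The mean value does not depend on the subgroup. -/
lemma mean_eq_of_le {L K : Subgroup Γ} [L.FiniteIndex] (hLK : L ≤ K) {F : Γ → V}
    (hF : ∀ y, ∀ l ∈ K, F (y * l) = F y) : mean L F = mean K F := by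
  classical
  have hK : K.FiniteIndex := Subgroup.finiteIndex_of_le hLK
  have := Fintype.ofFinite (Γ ⧸ K)
  have := Fintype.ofFinite (Γ ⧸ L)
  have := Fintype.ofFinite (K ⧸ L.subgroupOf K)
  have hF' : ∀ y, ∀ l ∈ L, F (y * l) = F y := fun y l hl => hF y l (hLK hl)
  have h1 : ∀ c : Γ ⧸ L, F c.out = F ((Subgroup.quotientEquivProdOfLE hLK c).1).out := by
    intro c
    induction c using QuotientGroup.induction_on with
    | H y => exact (apply_out hF' y).trans (apply_out hF y).symm
  rw [mean, mean, finsum_eq_sum_of_fintype, finsum_eq_sum_of_fintype]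
  have h2 : ∑ c : Γ ⧸ L, F c.out = (L.relIndex K : ℂ) • ∑ c : Γ ⧸ K, F c.out := by
    rw [Finset.sum_congr rfl fun c _ => h1 c,
      (Subgroup.quotientEquivProdOfLE hLK).sum_comp fun p => F p.1.out, Fintype.sum_prod_type,
      Finset.smul_sum]
    refine Finset.sum_congr rfl fun c _ => ?_
    simp only [Finset.sum_const, Finset.card_univ, ← Nat.cast_smul_eq_nsmul ℂ]
    rw [Subgroup.relIndex, Subgroup.index_eq_card, Nat.card_eq_fintype_card]
  have h3 : (K.index : ℂ) ≠ 0 := by exact_mod_cast Subgroup.FiniteIndex.index_ne_zero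
  have h4 : (L.index : ℂ) ≠ 0 := by exact_mod_cast Subgroup.FiniteIndex.index_ne_zero
  have h5 := Subgroup.relIndex_mul_index hLK
  rw [h2, smul_smul]
  congr 1
  rw [← h5] at h4 ⊢
  push_cast at h4 ⊢
  have := left_ne_zero_of_mul h4
  field_simp

lemma mean_smul (L : Subgroup Γ) [L.FiniteIndex] (c : ℂ) (F : Γ → V) :
    mean L (fun y => c • F y) = c • mean L F := by
  have := Fintype.ofFinite (Γ ⧸ L)
  rw [mean, mean, finsum_eq_sum_of_fintype, finsum_eq_sum_of_fintype, ← Finset.smul_sum, smul_comm]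

lemma mean_const (L : Subgroup Γ) [L.FiniteIndex] (v : V) : mean L (fun _ => v) = v := by
  have := Fintype.ofFinite (Γ ⧸ L)
  have h4 : (L.index : ℂ) ≠ 0 := by exact_mod_cast Subgroup.FiniteIndex.index_ne_zero
  rw [mean, finsum_eq_sum_of_fintype, Finset.sum_const, Finset.card_univ, ← Nat.cast_smul_eq_nsmul ℂ,
    ← Nat.card_eq_fintype_card, ← Subgroup.index_eq_card, smul_smul, inv_mul_cancel₀ h4, one_smul]

lemma map_mean {W : Type*} [AddCommGroup W] [Module ℂ W] (L : Subgroup Γ) [L.FiniteIndex]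
    (φ : V →ₗ[ℂ] W) (F : Γ → V) : φ (mean L F) = mean L fun y => φ (F y) := by
  have := Fintype.ofFinite (Γ ⧸ L)
  rw [mean, mean, finsum_eq_sum_of_fintype, finsum_eq_sum_of_fintype, map_smul, map_sum]

lemma mean_comm (L K : Subgroup Γ) [L.FiniteIndex] [K.FiniteIndex] (F : Γ → Γ → V) :
    mean L (fun y => mean K fun x => F y x) = mean K (fun x => mean L fun y => F y x) := by
  have := Fintype.ofFinite (Γ ⧸ L)
  have := Fintype.ofFinite (Γ ⧸ K)
  simp only [mean, finsum_eq_sum_of_fintype]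
  rw [← Finset.smul_sum, ← Finset.smul_sum, smul_comm, Finset.sum_comm]

/-- The mean value is invariant under left translation. -/
lemma mean_mul_left {L : Subgroup Γ} [L.FiniteIndex] {F : Γ → V}
    (hF : ∀ y, ∀ l ∈ L, F (y * l) = F y) (g : Γ) : mean L (fun y => F (g * y)) = mean L F := by
  have := Fintype.ofFinite (Γ ⧸ L)
  rw [mean, mean, finsum_eq_sum_of_fintype, finsum_eq_sum_of_fintype,
    ← Equiv.sum_comp (MulAction.toPerm g : Γ ⧸ L ≃ Γ ⧸ L) fun c => F c.out]
  congr 1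
  refine Finset.sum_congr rfl fun c _ => ?_
  induction c using QuotientGroup.induction_on with
  | H y =>
    have h1 := apply_out (F := fun y => F (g * y)) (fun y l hl => by rw [← mul_assoc, hF _ l hl]) y
    have h2 := apply_out hF (g * y)
    exact h1.trans h2.symm

end Mean

/-! ### Hecke operators of double cosets -/

section Hecke

variable {G : Type*} [Group G] {V : Type*} [AddCommGroup V] [Module ℂ V]

/-- The subgroup `Δ ∩ ζ⁻¹Δζ` of `Δ`. -/
def stab (Δ : Subgroup G) (ζ : G) : Subgroup Δ :=
  (Δ.comap (MulAut.conj ζ).toMonoidHom).subgroupOf Δ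

lemma mem_stab {Δ : Subgroup G} {ζ : G} {y : Δ} : y ∈ stab Δ ζ ↔ ζ * y * ζ⁻¹ ∈ Δ := Iff.rfl

/-- `Δ ∩ ζ⁻¹Δζ` has finite index in `Δ`, i.e. `ΔζΔ` is a finite union of cosets `Δζ'`. -/
abbrev FinCoset (Δ : Subgroup G) (ζ : G) : Prop := (stab Δ ζ).FiniteIndex

lemma FinCoset.mul {Δ : Subgroup G} {η ξ : G} (hη : FinCoset Δ η) (hξ : FinCoset Δ ξ) :
    FinCoset Δ (η * ξ) := by
  let φ : stab Δ ξ →* Δ :=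
    { toFun := fun y => ⟨ξ * y.1 * ξ⁻¹, y.2⟩
      map_one' := by ext; simp
      map_mul' := fun a b => by ext; simp [mul_assoc] }
  have h1 : ((stab Δ η).comap φ).FiniteIndex := by
    rw [Subgroup.finiteIndex_iff, Subgroup.index_comap]
    exact (Subgroup.instFiniteIndex_subgroupOf (stab Δ η) φ.range).index_ne_zero
  have h2 : (((stab Δ η).comap φ).map (stab Δ ξ).subtype).FiniteIndex := by
    rw [Subgroup.finiteIndex_iff, Subgroup.index_map_subtype]
    exact mul_ne_zero h1.index_ne_zero hξ.index_ne_zero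
  refine Subgroup.finiteIndex_of_le (H := ((stab Δ η).comap φ).map (stab Δ ξ).subtype) ?_
  rintro _ ⟨y, hy, rfl⟩
  have : η * (ξ * y.1 * ξ⁻¹) * η⁻¹ ∈ Δ := hy
  rw [mem_stab]
  simpa [mul_assoc] using this

lemma finCoset_of_mem {Δ : Subgroup G} {δ : G} (hδ : δ ∈ Δ) : FinCoset Δ δ := by
  have : stab Δ δ = ⊤ := by
    rw [eq_top_iff]
    intro y _
    exact Δ.mul_mem (Δ.mul_mem hδ y.2) (Δ.inv_mem hδ)
  rw [FinCoset, this]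
  infer_instance

variable (s : Gᵐᵒᵖ →* Module.End ℂ V) (Δ : Subgroup G)

/-- The right action of `G` on `V`. -/
abbrev ract (ζ : G) : Module.End ℂ V := s (.op ζ)

lemma ract_mul (ζ η : G) (f : V) : ract s (ζ * η) f = ract s η (ract s ζ f) := by
  rw [ract, MulOpposite.op_mul, map_mul]; rfl

/-- The vectors invariant under `Δ`. -/
def invariants : Submodule ℂ V where
  carrier := {f | ∀ δ ∈ Δ, ract s δ f = f}
  zero_mem' := fun _ _ => map_zero _
  add_mem' := fun h h' δ hδ => by rw [map_add, h δ hδ, h' δ hδ]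
  smul_mem' := fun c f h δ hδ => by rw [map_smul, h δ hδ]

/-- The operator `f ↦ ∑ f ∣ ζᵢ` with `ζᵢ` running over representatives of `Δ \ ΔζΔ`. -/
def cosetSum (ζ : G) (f : V) : V :=
  ∑ᶠ c ∈ (Quotient.mk (QuotientGroup.rightRel Δ)) '' DoubleCoset.doubleCoset ζ (Δ : Set G) Δ,
    ract s (Quotient.out c) f

/-- The mean value of `f ∣ ζy` over `y ∈ Δ`, a normalisation of `cosetSum`. -/
def cosetMean (ζ : G) (f : V) : V := mean (stab Δ ζ) fun y => ract s (ζ * (y⁻¹ : Δ)) f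

variable {s Δ}

lemma ract_mul_inv {ζ : G} {f : V} (hf : f ∈ invariants s Δ) (y l : Δ) (hl : l ∈ stab Δ ζ) :
    ract s (ζ * ((y * l)⁻¹ : Δ)) f = ract s (ζ * (y⁻¹ : Δ)) f := by
  have h1 : ζ * ((y * l)⁻¹ : Δ) = (ζ * l * ζ⁻¹)⁻¹ * (ζ * (y⁻¹ : Δ)) := by
    push_cast; group
  have h2 : (ζ * l * ζ⁻¹)⁻¹ ∈ Δ := Δ.inv_mem hl
  rw [h1, ract_mul, hf _ h2]

lemma ract_out {f : V} (hf : f ∈ invariants s Δ) (x : G) :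
    ract s (Quotient.out (Quotient.mk (QuotientGroup.rightRel Δ) x)) f = ract s x f := by
  have h1 : (QuotientGroup.rightRel Δ) x
      (Quotient.out (Quotient.mk (QuotientGroup.rightRel Δ) x)) :=
    Quotient.exact (Quotient.out_eq _).symm
  rw [QuotientGroup.rightRel_apply] at h1
  set x' := Quotient.out (Quotient.mk (QuotientGroup.rightRel Δ) x)
  have h2 : x' = x' * x⁻¹ * x := by group
  rw [h2, ract_mul, hf _ h1]

variable (Δ) in
/-- The cosets in `Δ \ ΔζΔ` correspond to `Δ / (Δ ∩ ζ⁻¹Δζ)`. -/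
def cosetMap (ζ : G) : Δ ⧸ stab Δ ζ → Quotient (QuotientGroup.rightRel Δ) :=
  fun c => Quotient.mk _ (ζ * ((Quotient.out c)⁻¹ : Δ))

lemma cosetMap_injective (ζ : G) : Function.Injective (cosetMap Δ ζ) := by
  intro c c' h
  have h1 := Quotient.exact h
  rw [← Quotient.out_eq c, ← Quotient.out_eq c']
  apply QuotientGroup.eq.mpr
  change (QuotientGroup.rightRel Δ) _ _ at h1
  rw [QuotientGroup.rightRel_apply] at h1
  rw [mem_stab]
  have h2 := Δ.inv_mem h1
  push_cast at h2 ⊢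
  convert h2 using 1
  group

lemma range_cosetMap (ζ : G) : Set.range (cosetMap Δ ζ) =
    (Quotient.mk (QuotientGroup.rightRel Δ)) '' DoubleCoset.doubleCoset ζ (Δ : Set G) Δ := by
  ext q
  constructor
  · rintro ⟨c, rfl⟩
    refine ⟨_, ?_, rfl⟩
    rw [DoubleCoset.mem_doubleCoset]
    exact ⟨1, Δ.one_mem, _, ((Quotient.out c)⁻¹ : Δ).2, by rw [one_mul]⟩
  · rintro ⟨x, hx, rfl⟩
    rw [DoubleCoset.mem_doubleCoset] at hx
    obtain ⟨a, ha, b, hb, rfl⟩ := hx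
    let y : Δ := ⟨b⁻¹, Δ.inv_mem hb⟩
    refine ⟨(y : Δ ⧸ stab Δ ζ), ?_⟩
    apply Quotient.sound
    change (QuotientGroup.rightRel Δ) _ _
    rw [QuotientGroup.rightRel_apply]
    have h1 : (Quotient.out (y : Δ ⧸ stab Δ ζ))⁻¹ * y ∈ stab Δ ζ := by
      rw [← QuotientGroup.eq]; exact Quotient.out_eq _
    rw [mem_stab] at h1
    have h2 := Δ.mul_mem ha (Δ.inv_mem h1)
    convert h2 using 1
    simp [y, mul_assoc]

/-- The number of cosets in `Δ \ ΔζΔ`. -/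
lemma ncard_cosets (ζ : G) : ((Quotient.mk (QuotientGroup.rightRel Δ)) ''
    DoubleCoset.doubleCoset ζ (Δ : Set G) Δ).ncard = (stab Δ ζ).index := by
  rw [← range_cosetMap, ← Nat.card_coe_set_eq, Nat.card_range_of_injective (cosetMap_injective ζ),
    Subgroup.index_eq_card]

lemma cosetSum_eq {ζ : G} (hζ : FinCoset Δ ζ) {f : V} (hf : f ∈ invariants s Δ) :
    cosetSum s Δ ζ f = ((stab Δ ζ).index : ℂ) • cosetMean s Δ ζ f := by
  have h4 : ((stab Δ ζ).index : ℂ) ≠ 0 := by exact_mod_cast hζ.index_ne_zero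
  rw [cosetSum, ← range_cosetMap, finsum_mem_range (cosetMap_injective ζ), cosetMean, mean,
    smul_inv_smul₀ h4]
  exact finsum_congr fun c => ract_out hf _

lemma cosetMean_eq {ζ : G} {L : Subgroup Δ} [L.FiniteIndex] (hL : L ≤ stab Δ ζ) {f : V}
    (hf : f ∈ invariants s Δ) :
    cosetMean s Δ ζ f = mean L fun y => ract s (ζ * (y⁻¹ : Δ)) f :=
  (mean_eq_of_le hL fun y l hl => ract_mul_inv hf y l hl).symm

lemma stab_index_of_mem {ζ ζ' : G} (h : ζ' ∈ DoubleCoset.doubleCoset ζ (Δ : Set G) Δ) :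
    (stab Δ ζ').index = (stab Δ ζ).index := by
  rw [← ncard_cosets, ← ncard_cosets, DoubleCoset.doubleCoset_eq_of_mem h]

lemma FinCoset.of_mem {ζ ζ' : G} (hζ : FinCoset Δ ζ)
    (h : ζ' ∈ DoubleCoset.doubleCoset ζ (Δ : Set G) Δ) : FinCoset Δ ζ' := by
  rw [FinCoset, Subgroup.finiteIndex_iff, stab_index_of_mem h]
  exact hζ.index_ne_zero

lemma cosetMean_of_mem {ζ ζ' : G} (hζ : FinCoset Δ ζ)
    (h : ζ' ∈ DoubleCoset.doubleCoset ζ (Δ : Set G) Δ) {f : V} (hf : f ∈ invariants s Δ) :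
    cosetMean s Δ ζ' f = cosetMean s Δ ζ f := by
  have h1 : cosetSum s Δ ζ' f = cosetSum s Δ ζ f := by
    rw [cosetSum, cosetSum, DoubleCoset.doubleCoset_eq_of_mem h]
  have h4 : ((stab Δ ζ).index : ℂ) ≠ 0 := by exact_mod_cast hζ.index_ne_zero
  rw [cosetSum_eq hζ hf, cosetSum_eq (hζ.of_mem h) hf, stab_index_of_mem h] at h1
  exact smul_right_injective V h4 h1

/-- The mean value depends on a group element only through its action on the given invariant vector. -/
lemma cosetMean_of_ract_eq {ζ ζ' : G} (hζ : FinCoset Δ ζ) (hζ' : FinCoset Δ ζ') {f : V}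
    (hf : f ∈ invariants s Δ) {c : ℂ} (h : ract s ζ' f = c • ract s ζ f) :
    cosetMean s Δ ζ' f = c • cosetMean s Δ ζ f := by
  rw [cosetMean_eq (L := stab Δ ζ ⊓ stab Δ ζ') inf_le_left hf,
    cosetMean_eq (L := stab Δ ζ ⊓ stab Δ ζ') inf_le_right hf, ← mean_smul]
  congr 1
  funext y
  rw [ract_mul, ract_mul, h, map_smul]

lemma cosetMean_mem {ζ : G} (hζ : FinCoset Δ ζ) {f : V} (hf : f ∈ invariants s Δ) :
    cosetMean s Δ ζ f ∈ invariants s Δ := by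
  intro δ hδ
  have h1 := mean_mul_left (L := stab Δ ζ) (F := fun y : Δ => ract s (ζ * (y⁻¹ : Δ)) f)
    (fun y l hl => ract_mul_inv hf y l hl) (⟨δ, hδ⟩⁻¹ : Δ)
  rw [cosetMean, map_mean]
  refine Eq.trans ?_ h1
  congr 1
  funext y
  rw [← ract_mul]
  congr 2
  simp [mul_assoc]

/-- The composition law: `f ∣ [ΔηΔ] ∣ [ΔξΔ]` is the mean value of the `f ∣ [ΔηyξΔ]`. -/
lemma cosetMean_cosetMean {ξ η : G} (hξ : FinCoset Δ ξ) (hη : FinCoset Δ η) {f : V}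
    (hf : f ∈ invariants s Δ) :
    cosetMean s Δ ξ (cosetMean s Δ η f) =
      mean (stab Δ η) fun x => cosetMean s Δ (η * (x⁻¹ : Δ) * ξ) f := by
  have hfin : ∀ x : Δ, FinCoset Δ (η * x * ξ) := fun x =>
    (hη.mul (finCoset_of_mem x.2)).mul hξ
  let L : Subgroup Δ := stab Δ ξ ⊓ ⨅ c : Δ ⧸ stab Δ η, stab Δ (η * ((Quotient.out c)⁻¹ : Δ) * ξ)
  have : (⨅ c : Δ ⧸ stab Δ η, stab Δ (η * ((Quotient.out c)⁻¹ : Δ) * ξ)).FiniteIndex :=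
    Subgroup.finiteIndex_iInf fun c => hfin _
  have hL : L.FiniteIndex := by infer_instance
  rw [cosetMean_eq (L := L) inf_le_left (cosetMean_mem hη hf)]
  have h1 : ∀ y : Δ, ract s (ξ * (y⁻¹ : Δ)) (cosetMean s Δ η f) =
      mean (stab Δ η) fun x => ract s (η * (x⁻¹ : Δ) * ξ * (y⁻¹ : Δ)) f := fun y => by
    rw [cosetMean, map_mean]
    congr 1
    funext x
    rw [← ract_mul, mul_assoc (η * _)]
  simp only [h1]
  rw [mean_comm]
  unfold mean
  congr 1
  refine finsum_congr fun c => ?_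
  exact (cosetMean_eq (L := L) (inf_le_right.trans (iInf_le _ c)) hf).symm

end Hecke

/-! ### The slash operator as a right action -/

lemma detQ_mul (M M' : GL(2, ℚ)⁺) : detQ (M * M') = detQ M * detQ M' := by
  rw [detQ, mat_mul, Matrix.det_mul]; rfl

lemma detQ_one : detQ 1 = 1 := by
  change Matrix.det (1 : Matrix (Fin 2) (Fin 2) ℚ) = 1
  exact Matrix.det_one

lemma detQ_ofSL (γ : SL(2, ℤ)) : detQ (ofSL γ) = 1 := by
  have h := γ.2
  rw [Matrix.det_fin_two] at h
  rw [detQ, Matrix.det_fin_two]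
  simp only [mat_ofSL]
  exact_mod_cast h

lemma detQ_diagSq {m : ℕ} (hm : 0 < m) : detQ (diagSq m hm) = (m : ℚ) ^ 2 := by
  rw [detQ, mat_diagSq, Matrix.det_fin_two_of]; ring

namespace DiscriminantForm

variable {A : Type*} [AddCommGroup A] [Fintype A] (D : DiscriminantForm A)

lemma slashOdd_one (κ : ℤ) (f : ℍ → A → ℂ) : D.slashOdd κ f 1 = f := by
  funext τ
  rw [slashOdd]
  change ((((detQ 1 : ℝ) ^ ((κ : ℝ) / 4) : ℝ) : ℂ) * (1 : Mp).φ τ ^ (-κ)) •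
    (((1 : LinearMap.GeneralLinearGroup ℂ (A → ℂ))⁻¹ : LinearMap.GeneralLinearGroup ℂ (A → ℂ)) :
      Module.End ℂ (A → ℂ)) (f (moebius 1 τ)) = _
  rw [detQ_one, Mp.one_φ, moebius_one, inv_one]
  simp

lemma slashOdd_mul (κ : ℤ) (f : ℍ → A → ℂ) (ξ η : D.TripleGroup) :
    D.slashOdd κ f (ξ * η) = D.slashOdd κ (D.slashOdd κ f ξ) η := by
  funext τ
  simp only [slashOdd]
  rw [Prod.fst_mul, Prod.snd_mul, Prod.snd_mul, Mp.mul_M, Mp.mul_φ, detQ_mul, moebius_mul,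
    mul_inv_rev, Units.val_mul, Module.End.mul_apply, map_smul, smul_smul, mul_zpow]
  have h1 : (0 : ℝ) ≤ detQ ξ.1.M := by exact_mod_cast (detQ_pos _).le
  have h2 : (0 : ℝ) ≤ detQ η.1.M := by exact_mod_cast (detQ_pos _).le
  rw [Rat.cast_mul, Real.mul_rpow h1 h2]
  push_cast
  congr 1
  ring

/-- The slash operator of weight `κ/2` as a right action of the group of triples. -/
def slash (κ : ℤ) : D.TripleGroupᵐᵒᵖ →* Module.End ℂ (ℍ → A → ℂ) where
  toFun ξ :=
    { toFun := fun f => D.slashOdd κ f ξ.unop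
      map_add' := fun f g => by
        funext τ; simp only [slashOdd, Pi.add_apply, map_add, smul_add]
      map_smul' := fun c f => by
        funext τ; simp only [slashOdd, Pi.smul_apply, map_smul, RingHom.id_apply]
        rw [smul_comm] }
  map_one' := LinearMap.ext fun f => D.slashOdd_one κ f
  map_mul' ξ η := LinearMap.ext fun f => D.slashOdd_mul κ f η.unop ξ.unop

lemma ract_slash (κ : ℤ) (f : ℍ → A → ℂ) (ξ : D.TripleGroup) :
    ract (D.slash κ) ξ f = D.slashOdd κ f ξ := rfl

/-- The group `Δ = L(Γ̃)`. -/
abbrev Del : Subgroup D.TripleGroup := D.sectionL.range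

lemma heckeOdd_eq (κ : ℤ) (ξ : D.TripleGroup) (f : ℍ → A → ℂ) :
    D.heckeOdd κ ξ f = (((detQ ξ.1.M : ℝ) ^ ((κ : ℝ) / 4 - 1) : ℝ) : ℂ) •
      cosetSum (D.slash κ) D.Del ξ f := rfl

lemma slashOdd_sectionL (κ : ℤ) (f : ℍ → A → ℂ) (g : MpZ) (τ : ℍ) :
    D.slashOdd κ f (D.sectionL g) τ =
      g.1.φ τ ^ (-κ) • D.weilEnd g⁻¹ (f (moebius g.1.M τ)) := by
  rw [slashOdd]
  change ((((detQ g.1.M : ℝ) ^ ((κ : ℝ) / 4) : ℝ) : ℂ) * g.1.φ τ ^ (-κ)) •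
    (((D.weil g)⁻¹ : LinearMap.GeneralLinearGroup ℂ (A → ℂ)) : Module.End ℂ (A → ℂ))
      (f (moebius g.1.M τ)) = _
  have h1 : D.weilEnd g⁻¹ = ((D.weil g)⁻¹ : LinearMap.GeneralLinearGroup ℂ (A → ℂ)) := by
    rw [weilEnd, map_inv]
  rw [← ofSL_toSL, detQ_ofSL, h1]
  simp

lemma mem_invariants_iff {κ : ℤ} {f : ℍ → A → ℂ} :
    f ∈ invariants (D.slash κ) D.Del ↔ ∀ (g : MpZ) (τ : ℍ), f (moebius g.1.M τ) =
      (g.1.φ τ ^ κ) • (D.weil g : Module.End ℂ (A → ℂ)) (f τ) := by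
  have key : ∀ (g : MpZ) (τ : ℍ) (a b : A → ℂ), g.1.φ τ ^ (-κ) • D.weilEnd g⁻¹ a = b ↔
      a = (g.1.φ τ ^ κ) • D.weilEnd g b := by
    intro g τ a b
    have h0 : g.1.φ τ ^ κ ≠ 0 := zpow_ne_zero _ (g.1.φ_ne_zero τ)
    constructor
    · rintro rfl
      rw [map_smul, smul_smul, zpow_neg, mul_inv_cancel₀ h0, one_smul, ← weilEnd_mul_apply,
        mul_inv_cancel]
      simp [weilEnd]
    · rintro rfl
      rw [map_smul, smul_smul, zpow_neg, inv_mul_cancel₀ h0, one_smul, ← weilEnd_mul_apply,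
        inv_mul_cancel]
      simp [weilEnd]
  constructor
  · intro h g τ
    have := congrFun (h (D.sectionL g) ⟨g, rfl⟩) τ
    rw [ract_slash, slashOdd_sectionL] at this
    exact (key g τ _ _).mp this
  · rintro h _ ⟨g, rfl⟩
    funext τ
    rw [ract_slash, slashOdd_sectionL]
    exact (key g τ _ _).mpr (h g τ)

lemma mem_modularForms_iff {κ : ℤ} {f : ℍ → A → ℂ} :
    f ∈ D.modularForms κ ↔ MDifferentiable 𝓘(ℂ) 𝓘(ℂ, A → ℂ) f ∧
      f ∈ invariants (D.slash κ) D.Del ∧ UpperHalfPlane.IsBoundedAtImInfty f := by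
  rw [mem_invariants_iff]; rfl

/-! ### The elements `ξ_m` -/

/-- `ξ_m = ((diag(m², 1), 1), m, 𝔢_λ ↦ 𝔢_{m⁻¹λ})`. -/
def xi (m : D.CoprimeIndex) : D.TripleGroup :=
  (mpDiag m.1 m.2.1, ZMod.unitOfCoprime m.1 m.2.2, D.dilation m.2.2)

lemma dilation_val (m : D.CoprimeIndex) :
    (D.dilation m.2.2 : Module.End ℂ (A → ℂ)) = dil m.1 := dilation_eq_dil m.2.2

/-- The fundamental identity: a relation between `diag(m², 1)` and two elements of the metaplectic group lifts
to the group of triples. -/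
lemma xi_mul_sectionL (m : D.CoprimeIndex) {g h : MpZ}
    (H : mpDiag m.1 m.2.1 * g.1 = h.1 * mpDiag m.1 m.2.1) :
    D.xi m * D.sectionL g = D.sectionL h * D.xi m := by
  refine Prod.ext H (Prod.ext ?_ ?_)
  · exact mul_comm _ (1 : (ZMod D.level)ˣ)
  · refine Units.ext ?_
    change (D.dilation m.2.2 : Module.End ℂ (A → ℂ)) * D.weilEnd g =
      D.weilEnd h * (D.dilation m.2.2 : Module.End ℂ (A → ℂ))
    rw [dilation_val]
    exact D.killed_level.dil_mul_weil D.level_pos m.2.2 H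

/-- Multiplication of indices. -/
instance : Mul D.CoprimeIndex where
  mul m n := ⟨m.1 * n.1, Nat.mul_pos m.2.1 n.2.1, Nat.Coprime.mul_left m.2.2 n.2.2⟩

lemma index_mul_val (m n : D.CoprimeIndex) : (m * n).1 = m.1 * n.1 := rfl

lemma xi_mul_xi (m n : D.CoprimeIndex) : D.xi m * D.xi n = D.xi (m * n) := by
  refine Prod.ext ?_ (Prod.ext ?_ ?_)
  · refine Mp.ext ?_ (funext fun τ => ?_)
    · change diagSq m.1 m.2.1 * diagSq n.1 n.2.1 = diagSq (m.1 * n.1) (m * n).2.1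
      rw [← mat_injective.eq_iff, mat_mul, mat_diagSq, mat_diagSq, mat_diagSq]
      ext i j
      fin_cases i <;> fin_cases j <;> simp [Matrix.mul_apply, Fin.sum_univ_two, mul_pow]
    · change (mpDiag m.1 m.2.1 * mpDiag n.1 n.2.1).φ τ = (mpDiag (m.1 * n.1) (m * n).2.1).φ τ
      rw [Mp.mul_φ, mpDiag_φ, mpDiag_φ, mpDiag_φ, mul_one]
  · refine Units.ext ?_
    change (m.1 : ZMod D.level) * (n.1 : ZMod D.level) = ((m.1 * n.1 : ℕ) : ZMod D.level)
    push_cast; rfl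
  · refine Units.ext ?_
    change (D.dilation m.2.2 : Module.End ℂ (A → ℂ)) * (D.dilation n.2.2 : Module.End ℂ (A → ℂ)) =
      (D.dilation (m * n).2.2 : Module.End ℂ (A → ℂ))
    rw [dilation_val, dilation_val, dilation_val]
    refine LinearMap.ext fun a => funext fun x => ?_
    rw [Module.End.mul_apply, dil_apply, dil_apply, dil_apply, smul_smul, index_mul_val]
    push_cast
    rw [mul_comm]

lemma finCoset_xi (m : D.CoprimeIndex) : FinCoset D.Del (D.xi m) := by
  have hne : NeZero (m.1 ^ 2) := ⟨pow_ne_zero 2 m.2.1.ne'⟩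
  have hsurj : Function.Surjective D.sectionL.rangeRestrict := D.sectionL.rangeRestrict_surjective
  have h1 : ((stab D.Del (D.xi m)).comap D.sectionL.rangeRestrict).FiniteIndex := by
    have h2 : ((CongruenceSubgroup.Gamma0 (m.1 ^ 2)).comap toSL).FiniteIndex := by
      rw [Subgroup.finiteIndex_iff, Subgroup.index_comap]
      exact (Subgroup.instFiniteIndex_subgroupOf _ toSL.range).index_ne_zero
    refine Subgroup.finiteIndex_of_le (H := (CongruenceSubgroup.Gamma0 (m.1 ^ 2)).comap toSL) ?_
    intro g hg
    have hc : ((m.1 : ℤ) ^ 2) ∣ toSL g 1 0 := by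
      have h3 : ((toSL g 1 0 : ℤ) : ZMod (m.1 ^ 2)) = 0 := CongruenceSubgroup.Gamma0_mem.mp hg
      rw [ZMod.intCast_zmod_eq_zero_iff_dvd] at h3
      exact_mod_cast h3
    obtain ⟨h, hh⟩ := exists_mpDiag_mul m.2.1 g hc
    have h4 := D.xi_mul_sectionL m hh
    change D.xi m * D.sectionL g * (D.xi m)⁻¹ ∈ D.Del
    rw [h4, mul_inv_cancel_right]
    exact ⟨h, rfl⟩
  rw [FinCoset, Subgroup.finiteIndex_iff, ← Subgroup.index_comap_of_surjective _ hsurj]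
  exact h1.index_ne_zero

end DiscriminantForm

/-! ### Factorisations in `SL₂(ℤ)` -/

lemma matV_zpow_apply (k : ℤ) (i j : Fin 2) :
    (matV ^ k) i j = (!![1, 0; k, 1] : Matrix (Fin 2) (Fin 2) ℤ) i j := by
  have h2 : (matV ^ k) = ModularGroup.S * ModularGroup.T ^ (-k) * ModularGroup.S⁻¹ := by
    rw [matV, conj_zpow, inv_zpow']
  have hS : ∀ i j, ModularGroup.S⁻¹ i j = (!![0, 1; -1, 0] : Matrix (Fin 2) (Fin 2) ℤ) i j := by
    intro i j; fin_cases i <;> fin_cases j <;> rfl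
  have hS' : ∀ i j, ModularGroup.S i j = (!![0, -1; 1, 0] : Matrix (Fin 2) (Fin 2) ℤ) i j := by
    intro i j; fin_cases i <;> fin_cases j <;> rfl
  have hTk : ∀ i j, (ModularGroup.T ^ (-k)) i j =
    (!![1, -k; 0, 1] : Matrix (Fin 2) (Fin 2) ℤ) i j := by
    intro i j; rw [← ModularGroup.coe_T_zpow]
  rw [h2]
  simp only [SL_mul_apply, hS, hS', hTk]
  fin_cases i <;> fin_cases j <;> simp

lemma matT_zpow_apply (k : ℤ) (i j : Fin 2) :
    (ModularGroup.T ^ k) i j = (!![1, k; 0, 1] : Matrix (Fin 2) (Fin 2) ℤ) i j := by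
  rw [← ModularGroup.coe_T_zpow]

lemma toSL_V_zpow (k : ℤ) : toSL (mpV ^ k) = matV ^ k := by rw [map_zpow, toSL_mpV]

lemma toSL_T_zpow (k : ℤ) : toSL (mpT ^ k) = ModularGroup.T ^ k := by rw [map_zpow, toSL_mpT]

lemma toSL_det (g : MpZ) : toSL g 0 0 * toSL g 1 1 - toSL g 0 1 * toSL g 1 0 = 1 := by
  have := (toSL g).2
  rwa [Matrix.det_fin_two] at this

lemma exists_add_mul_dvd {c d M : ℤ} (h : IsCoprime d M) : ∃ y, M ∣ c + y * d := by
  obtain ⟨u, v, huv⟩ := h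
  exact ⟨-c * u, ⟨c * v, by linear_combination (-c) * huv⟩⟩

lemma exists_eq_mul_V_zpow (g : MpZ) {M : ℤ} (hd : IsCoprime (toSL g 1 1) M) :
    ∃ (g₁ : MpZ) (y : ℤ), g = g₁ * mpV ^ y ∧ M ∣ toSL g₁ 1 0 := by
  obtain ⟨y, hy⟩ := exists_add_mul_dvd (c := toSL g 1 0) hd
  refine ⟨g * mpV ^ y, -y, by rw [zpow_neg, mul_inv_cancel_right], ?_⟩
  rw [map_mul, toSL_V_zpow, SL_mul_apply, matV_zpow_apply, matV_zpow_apply]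
  simpa [mul_comm] using hy

/-- This factorisation is what makes the Hecke operators of coprime indices multiplicative. -/
lemma exists_eq_mul_of_isCoprime (g : MpZ) {M N : ℕ} (hM : 0 < M) (hMN : M.Coprime N) :
    ∃ g₁ g₂ : MpZ, g = g₁ * g₂ ∧ (M : ℤ) ∣ toSL g₁ 1 0 ∧ (N : ℤ) ∣ toSL g₂ 0 1 := by
  have hdet := toSL_det g
  -- a translation by a multiple of `N` makes the lower right entry prime to `M`
  obtain ⟨k, hk⟩ : ∃ k : ℤ, IsCoprime (toSL g 1 1 + k * toSL g 1 0) M := by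
    rcases lt_trichotomy (toSL g 1 0) 0 with hc | hc | hc
    · have hco : IsCoprime (toSL g 1 1) (-toSL g 1 0) :=
        ⟨toSL g 0 0, toSL g 0 1, by linear_combination hdet⟩
      obtain ⟨k, -, hk⟩ := exists_add_mul_isCoprime (by omega) hM hco
      exact ⟨-k, by rwa [neg_mul, ← mul_neg]⟩
    · refine ⟨0, ⟨toSL g 0 0, 0, ?_⟩⟩
      rw [hc] at hdet ⊢
      linear_combination hdet
    · have hco : IsCoprime (toSL g 1 1) (toSL g 1 0) :=
        ⟨toSL g 0 0, -toSL g 0 1, by linear_combination hdet⟩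
      obtain ⟨k, -, hk⟩ := exists_add_mul_isCoprime hc hM hco
      exact ⟨k, hk⟩
  obtain ⟨x, hx⟩ := exists_add_mul_dvd (c := -k) (d := (N : ℤ)) (M := M)
    (Nat.isCoprime_iff_coprime.mpr hMN.symm)
  have e11 : toSL (g * mpT ^ (x * N)) 1 1 = toSL g 1 1 + (x * N) * toSL g 1 0 := by
    rw [map_mul, toSL_T_zpow, SL_mul_apply, matT_zpow_apply, matT_zpow_apply]
    simp; ring
  have hco : IsCoprime (toSL (g * mpT ^ (x * N)) 1 1) M := by
    rw [e11]
    obtain ⟨t, ht⟩ := hx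
    have : toSL g 1 1 + (x * N) * toSL g 1 0 =
        toSL g 1 1 + k * toSL g 1 0 + (t * toSL g 1 0) * M := by
      linear_combination toSL g 1 0 * ht
    rw [this]
    exact hk.add_mul_right_left _
  obtain ⟨g₁, y, h1, h2⟩ := exists_eq_mul_V_zpow _ hco
  refine ⟨g₁, mpV ^ y * mpT ^ (-(x * N)), ?_, h2, ?_⟩
  · rw [← mul_assoc, ← h1, zpow_neg, mul_inv_cancel_right]
  · rw [map_mul, toSL_T_zpow, toSL_V_zpow, SL_mul_apply]
    simp only [matT_zpow_apply, matV_zpow_apply]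
    simp

lemma exists_eq_mul_S_mul_T_zpow (g : MpZ) {M : ℤ} (hc : IsCoprime (toSL g 1 0) M) :
    ∃ (g₁ : MpZ) (j : ℤ), g = g₁ * (mpS * mpT ^ j) ∧ M ∣ toSL g₁ 1 0 ∧
      M ∣ toSL g 1 1 - j * toSL g 1 0 := by
  obtain ⟨y, hy⟩ := exists_add_mul_dvd (c := toSL g 1 1) hc
  have hy' : M ∣ toSL g 1 1 - -y * toSL g 1 0 := by rwa [neg_mul, sub_neg_eq_add]
  refine ⟨g * (mpS * mpT ^ (-y))⁻¹, -y, by rw [inv_mul_cancel_right], ?_, hy'⟩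
  have hS : ∀ i j, ModularGroup.S⁻¹ i j = (!![0, 1; -1, 0] : Matrix (Fin 2) (Fin 2) ℤ) i j := by
    intro i j; fin_cases i <;> fin_cases j <;> rfl
  rw [mul_inv_rev, ← mul_assoc, ← zpow_neg, neg_neg, map_mul, map_mul, map_inv, toSL_mpS,
    toSL_T_zpow]
  simp only [SL_mul_apply, hS, matT_zpow_apply]
  simpa [mul_comm, add_comm] using hy.neg_right

/-! ### Scalar matrices -/

/-- The scalar matrix `n` in `GL₂⁺(ℚ)`. -/
def scal (n : ℕ) (hn : 0 < n) : GL(2, ℚ)⁺ :=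
  ⟨Matrix.GeneralLinearGroup.mkOfDetNeZero !![(n : ℚ), 0; 0, n]
      (by simp [Matrix.det_fin_two, hn.ne']),
    by
      have h : (0 : ℚ) < Matrix.det !![(n : ℚ), 0; 0, n] := by
        have : (0 : ℚ) < n := by exact_mod_cast hn
        simpa [Matrix.det_fin_two] using mul_pos this this
      exact h⟩

lemma mat_scal {n : ℕ} (hn : 0 < n) : mat (scal n hn) = !![(n : ℚ), 0; 0, n] := rfl

lemma autJ_scal {n : ℕ} (hn : 0 < n) (τ : ℍ) : autJ (scal n hn) τ = n := by
  rw [autJ_eq, mat_scal]; simp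

lemma principal_scal_φ {n : ℕ} (hn : 0 < n) (τ : ℍ) :
    (Mp.principal (scal n hn)).φ τ = (n : ℂ) ^ (1 / 2 : ℂ) := by
  change autJ (scal n hn) τ ^ (1 / 2 : ℂ) = _
  rw [autJ_scal]

lemma moebius_scal {n : ℕ} (hn : 0 < n) (τ : ℍ) : moebius (scal n hn) τ = τ := by
  apply UpperHalfPlane.ext
  rw [moebius, UpperHalfPlane.coe_smul_of_det_pos (toGLReal_det_pos _)]
  have h1 : UpperHalfPlane.denom (toGLReal (scal n hn)) τ = n := autJ_scal hn τ
  have h2 : UpperHalfPlane.num (toGLReal (scal n hn)) τ = n * τ := by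
    have : ∀ i j, toGLReal (scal n hn) i j = ((mat (scal n hn) i j : ℚ) : ℝ) := fun _ _ => rfl
    rw [UpperHalfPlane.num, this, this, mat_scal]
    simp
  have h0 : (n : ℂ) ≠ 0 := by exact_mod_cast hn.ne'
  rw [h1, h2, mul_div_assoc, mul_comm, div_mul_cancel₀ _ h0]

lemma detQ_scal {n : ℕ} (hn : 0 < n) : detQ (scal n hn) = (n : ℚ) ^ 2 := by
  rw [detQ, mat_scal, Matrix.det_fin_two_of]; ring

lemma natCast_mul_cpow {n : ℕ} (hn : 0 < n) {z : ℂ} (hz : z ≠ 0) (w : ℂ) :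
    ((n : ℂ) * z) ^ w = (n : ℂ) ^ w * z ^ w := by
  have h0 : (n : ℂ) ≠ 0 := by exact_mod_cast hn.ne'
  have h1 := Complex.log_ofReal_mul (r := (n : ℝ)) (by exact_mod_cast hn) hz
  rw [Complex.ofReal_natCast] at h1
  rw [Complex.cpow_def_of_ne_zero (mul_ne_zero h0 hz), Complex.cpow_def_of_ne_zero h0,
    Complex.cpow_def_of_ne_zero hz, h1, ← Complex.exp_add, Complex.natCast_log]
  congr 1; ring

namespace DiscriminantForm

variable {A : Type*} [AddCommGroup A] [Fintype A] (D : DiscriminantForm A)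

/-- The scalar element `((n, √n), n, 1)` of the group of triples. -/
def zc (n : D.CoprimeIndex) : D.TripleGroup :=
  (Mp.principal (scal n.1 n.2.1), ZMod.unitOfCoprime n.1 n.2.2, 1)

lemma slashOdd_zc (κ : ℤ) (n : D.CoprimeIndex) (f : ℍ → A → ℂ) : D.slashOdd κ f (D.zc n) = f := by
  funext τ
  rw [slashOdd]
  change ((((detQ (scal n.1 n.2.1) : ℝ) ^ ((κ : ℝ) / 4) : ℝ) : ℂ) *
    (Mp.principal (scal n.1 n.2.1)).φ τ ^ (-κ)) •
    (((1 : LinearMap.GeneralLinearGroup ℂ (A → ℂ))⁻¹ : LinearMap.GeneralLinearGroup ℂ (A → ℂ)) :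
      Module.End ℂ (A → ℂ)) (f (moebius (scal n.1 n.2.1) τ)) = _
  rw [detQ_scal, principal_scal_φ, moebius_scal, inv_one, Units.val_one, Module.End.one_apply]
  have h0 : (0 : ℝ) < n.1 := by exact_mod_cast n.2.1
  have h1 : (((n.1 : ℚ) ^ 2 : ℚ) : ℝ) = (n.1 : ℝ) ^ (2 : ℝ) := by norm_num
  have h2 : ((n.1 : ℂ) ^ (1 / 2 : ℂ)) = (((n.1 : ℝ) ^ (1 / 2 : ℝ) : ℝ) : ℂ) := by
    rw [Complex.ofReal_cpow h0.le]; norm_num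
  rw [h1, h2, ← Real.rpow_mul h0.le, ← Complex.ofReal_zpow, ← Complex.ofReal_mul,
    ← Real.rpow_intCast, ← Real.rpow_mul h0.le, ← Real.rpow_add h0]
  have h3 : (2 : ℝ) * ((κ : ℝ) / 4) + 1 / 2 * ((-κ : ℤ) : ℝ) = 0 := by push_cast; ring
  rw [h3, Real.rpow_zero]; simp

lemma dil_mul_weil_S_mul_dil (m : D.CoprimeIndex) :
    dil m.1 * D.weilEnd mpS * dil m.1 = D.weilEnd mpS := by
  refine LinearMap.ext fun a => funext fun y => ?_
  rw [Module.End.mul_apply, Module.End.mul_apply, dil_apply, weilEnd_S, weilEnd_S]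
  beta_reduce
  congr 1
  rw [← Equiv.sum_comp (Equiv.ofBijective _ (D.mul_bijective m.2.2))
    fun x => e (-D.bil x y) * a x]
  refine Finset.sum_congr rfl fun x _ => ?_
  rw [Equiv.ofBijective_apply, dil_apply, ← natCast_zsmul, bil_zsmul_left, bil_zsmul_right]

lemma xi_mul_S_mul_xi (m : D.CoprimeIndex) :
    D.xi m * D.sectionL mpS * D.xi m = D.zc (m * m) * D.sectionL mpS := by
  refine Prod.ext ?_ (Prod.ext ?_ ?_)
  · change mpDiag m.1 m.2.1 * mpS.1 * mpDiag m.1 m.2.1 =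
      Mp.principal (scal (m.1 * m.1) (m * m).2.1) * mpS.1
    have hM : diagSq m.1 m.2.1 * mpS.1.M * diagSq m.1 m.2.1 =
        scal (m.1 * m.1) (m * m).2.1 * mpS.1.M := by
      rw [← ofSL_toSL, toSL_mpS, ← mat_injective.eq_iff, mat_mul, mat_mul, mat_mul, mat_diagSq,
        mat_scal]
      have hS : mat (ofSL ModularGroup.S) = !![0, -1; 1, 0] := by
        ext i j; rw [mat_ofSL]; fin_cases i <;> fin_cases j <;> simp [ModularGroup.S]
      rw [hS]
      ext i j
      fin_cases i <;> fin_cases j <;> simp [Matrix.mul_apply, Fin.sum_univ_two] <;> ring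
    refine Mp.ext hM (funext fun τ => ?_)
    rw [Mp.mul_φ, Mp.mul_φ, Mp.mul_φ, mpDiag_φ, mpDiag_φ, one_mul, mul_one, principal_scal_φ,
      mpS_φ, mpS_φ, ← natCast_mul_cpow (n := m.1 * m.1) (m * m).2.1 τ.ne_zero, mpDiag_M]
    congr 1
    rw [moebius, UpperHalfPlane.coe_smul_of_det_pos (toGLReal_det_pos _)]
    have h1 : UpperHalfPlane.denom (toGLReal (diagSq m.1 m.2.1)) τ = 1 := autJ_diagSq m.2.1 τ
    have h2 : UpperHalfPlane.num (toGLReal (diagSq m.1 m.2.1)) τ = (m.1 : ℂ) ^ 2 * τ := by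
      have : ∀ i j, toGLReal (diagSq m.1 m.2.1) i j = ((mat (diagSq m.1 m.2.1) i j : ℚ) : ℝ) :=
        fun _ _ => rfl
      rw [UpperHalfPlane.num, this, this, mat_diagSq]
      simp
    rw [h1, h2, div_one]
    push_cast; ring
  · refine Units.ext ?_
    change (m.1 : ZMod D.level) * 1 * (m.1 : ZMod D.level) = ((m.1 * m.1 : ℕ) : ZMod D.level) * 1
    push_cast; ring
  · refine Units.ext ?_
    change (D.dilation m.2.2 : Module.End ℂ (A → ℂ)) * D.weilEnd mpS *
      (D.dilation m.2.2 : Module.End ℂ (A → ℂ)) = 1 * D.weilEnd mpS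
    rw [dilation_val, dil_mul_weil_S_mul_dil, one_mul]

end DiscriminantForm

namespace DiscriminantForm

variable {A : Type*} [AddCommGroup A] [Fintype A] (D : DiscriminantForm A)

/-! ### Multiplication of the double cosets of the `ξ_m` -/

/-- The normalised Hecke operator attached to `ξ`. -/
abbrev heckeMean (κ : ℤ) (ξ : D.TripleGroup) (f : ℍ → A → ℂ) : ℍ → A → ℂ :=
  cosetMean (D.slash κ) D.Del ξ f

/-- The functions with the transformation behaviour of modular forms. -/
abbrev inv (κ : ℤ) : Submodule ℂ (ℍ → A → ℂ) := invariants (D.slash κ) D.Del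

lemma mul_mul_mem_doubleCoset (ζ : D.TripleGroup) (g h : MpZ) :
    D.sectionL g * ζ * D.sectionL h ∈
      DoubleCoset.doubleCoset ζ (D.Del : Set D.TripleGroup) D.Del := by
  rw [DoubleCoset.mem_doubleCoset]
  exact ⟨_, ⟨g, rfl⟩, _, ⟨h, rfl⟩, rfl⟩

/-- If `g₁` can be moved to the left past `ξ_m` and `g₂` to the right past `ξ_n`, the element `ξ_m L(g₁ g₂) ξ_n`
lies in the double coset of `ξ_{mn}`. -/
lemma xi_mul_mul_xi_mem (m n : D.CoprimeIndex) {g g₁ g₂ : MpZ} (hg : g = g₁ * g₂)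
    (h1 : (m.1 ^ 2 : ℤ) ∣ toSL g₁ 1 0) (h2 : (n.1 ^ 2 : ℤ) ∣ toSL g₂ 0 1) :
    D.xi m * D.sectionL g * D.xi n ∈
      DoubleCoset.doubleCoset (D.xi (m * n)) (D.Del : Set D.TripleGroup) D.Del := by
  obtain ⟨h₁, e1⟩ := exists_mpDiag_mul m.2.1 g₁ h1
  obtain ⟨h₂, e2⟩ := exists_mul_mpDiag n.2.1 g₂ h2
  have r1 := D.xi_mul_sectionL m e1
  have r2 := D.xi_mul_sectionL n e2
  have : D.xi m * D.sectionL g * D.xi n =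
      D.sectionL h₁ * D.xi (m * n) * D.sectionL h₂ := by
    rw [hg, map_mul, ← xi_mul_xi]
    calc D.xi m * (D.sectionL g₁ * D.sectionL g₂) * D.xi n
        = (D.xi m * D.sectionL g₁) * (D.sectionL g₂ * D.xi n) := by group
      _ = _ := by rw [r1, ← r2]; group
  rw [this]
  exact D.mul_mul_mem_doubleCoset _ _ _

/-- For coprime `m` and `n` the product of the double cosets of `ξ_m` and `ξ_n` is the double coset
of `ξ_{mn}`. -/
lemma heckeMean_mul_of_coprime {κ : ℤ} {m n : D.CoprimeIndex} (hmn : m.1.Coprime n.1)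
    {f : ℍ → A → ℂ} (hf : f ∈ D.inv κ) :
    D.heckeMean κ (D.xi n) (D.heckeMean κ (D.xi m) f) = D.heckeMean κ (D.xi (m * n)) f := by
  rw [heckeMean, heckeMean, cosetMean_cosetMean (D.finCoset_xi n) (D.finCoset_xi m) hf]
  have : ∀ x : D.Del, cosetMean (D.slash κ) D.Del (D.xi m * (x⁻¹ : D.Del) * D.xi n) f =
      cosetMean (D.slash κ) D.Del (D.xi (m * n)) f := by
    intro x
    obtain ⟨g, hg⟩ := (x⁻¹).2
    rw [← hg]
    obtain ⟨g₁, g₂, e, h1, h2⟩ := exists_eq_mul_of_isCoprime g (M := m.1 ^ 2) (N := n.1 ^ 2)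
      (pow_pos m.2.1 2) (hmn.pow 2 2)
    push_cast at h1 h2
    exact cosetMean_of_mem (D.finCoset_xi _) (D.xi_mul_mul_xi_mem m n e h1 h2) hf
  simp only [this]
  have := D.finCoset_xi m
  exact mean_const _ _

variable {D}

/-- Triples over the same matrix with proportional automorphisms have proportional slash operators. -/
lemma ract_eq_smul {κ : ℤ} {ζ ζ' : D.TripleGroup} (hM : ζ.1.M = ζ'.1.M) {c : ℂ}
    (hu : (ζ'.2.2 : Module.End ℂ (A → ℂ)) = c • (ζ.2.2 : Module.End ℂ (A → ℂ))) :
    ∃ c' : ℂ, ∀ f : ℍ → A → ℂ, D.slashOdd κ f ζ = c' • D.slashOdd κ f ζ' := by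
  have hinv : ((ζ.2.2⁻¹ : LinearMap.GeneralLinearGroup ℂ (A → ℂ)) : Module.End ℂ (A → ℂ)) =
      c • ((ζ'.2.2⁻¹ : LinearMap.GeneralLinearGroup ℂ (A → ℂ)) : Module.End ℂ (A → ℂ)) := by
    have h1 : ((ζ'.2.2⁻¹ : LinearMap.GeneralLinearGroup ℂ (A → ℂ)) : Module.End ℂ (A → ℂ)) *
        (ζ'.2.2 : Module.End ℂ (A → ℂ)) = 1 := Units.inv_mul _
    rw [hu] at h1
    have h2 := congrArg (· * ((ζ.2.2⁻¹ : LinearMap.GeneralLinearGroup ℂ (A → ℂ)) :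
      Module.End ℂ (A → ℂ))) h1
    simp only [mul_smul_comm, smul_mul_assoc, mul_assoc, Units.mul_inv, mul_one, one_mul] at h2
    exact h2.symm
  rcases Mp.eq_or_neg hM with h | h
  · refine ⟨c, fun f => funext fun τ => ?_⟩
    rw [Pi.smul_apply, slashOdd, slashOdd, hinv, hM, LinearMap.smul_apply, smul_comm]
    have : ζ.1.φ τ = ζ'.1.φ τ := h τ
    rw [this]
  · refine ⟨(-1) ^ (-κ) * c, fun f => funext fun τ => ?_⟩
    rw [Pi.smul_apply, slashOdd, slashOdd, hinv, hM, LinearMap.smul_apply]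
    have : ζ.1.φ τ = -1 * ζ'.1.φ τ := by rw [h τ]; ring
    rw [this, mul_zpow, smul_smul, smul_smul]
    congr 1
    ring

variable (D)

/-- Over `S` the double coset collapses: by the central relation `ξ_{mp} L(S) ξ_p` is `ξ_m L(S)` up to a
central element acting trivially. -/
lemma heckeMean_xi_S_xi {κ : ℤ} (m p : D.CoprimeIndex) {f : ℍ → A → ℂ} (hf : f ∈ D.inv κ) :
    D.heckeMean κ (D.xi (m * p) * D.sectionL mpS * D.xi p) f = D.heckeMean κ (D.xi m) f := by
  have hfin : FinCoset D.Del (D.xi (m * p) * D.sectionL mpS * D.xi p) :=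
    ((D.finCoset_xi _).mul (finCoset_of_mem ⟨_, rfl⟩)).mul (D.finCoset_xi _)
  have h1 : D.xi (m * p) * D.sectionL mpS * D.xi p =
      D.xi m * D.zc (p * p) * D.sectionL mpS := by
    rw [← xi_mul_xi, mul_assoc, mul_assoc, mul_assoc, ← mul_assoc (D.xi p), xi_mul_S_mul_xi]
  have h2 : D.xi m * D.zc (p * p) ∈ DoubleCoset.doubleCoset
      (D.xi (m * p) * D.sectionL mpS * D.xi p) (D.Del : Set D.TripleGroup) D.Del := by
    have := D.mul_mul_mem_doubleCoset (D.xi (m * p) * D.sectionL mpS * D.xi p) 1 mpS⁻¹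
    rwa [h1, map_one, one_mul, map_inv, mul_inv_cancel_right, ← h1] at this
  rw [heckeMean, heckeMean, ← cosetMean_of_mem hfin h2 hf]
  have h3 := cosetMean_of_ract_eq (D.finCoset_xi m) (hfin.of_mem h2) hf (c := 1)
    (by rw [ract_mul, one_smul]; exact D.slashOdd_zc κ _ _)
  rw [h3, one_smul]

/-- If `p ∤ j` and `p ∣ q` then `ξ_q S T^{pj} ξ_p` has the underlying matrix `p·M` with `M` primitive
of determinant `q²`, so it acts as a multiple of `ξ_q` up to left and right multiplication by `Δ`. -/
lemma heckeMean_xi_ST_xi {κ : ℤ} {p q : D.CoprimeIndex} {j' Q' : ℤ}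
    (hQ : (q.1 : ℤ) ^ 2 = p.1 * Q') (hj : IsCoprime j' ((q.1 : ℤ) ^ 2)) :
    ∃ c : ℂ, ∀ f ∈ D.inv κ,
      D.heckeMean κ (D.xi q * D.sectionL (mpS * mpT ^ (p.1 * j')) * D.xi p) f =
        c • D.heckeMean κ (D.xi q) f := by
  set ζ := D.xi q * D.sectionL (mpS * mpT ^ (p.1 * j')) * D.xi p with hζ
  have hfin : FinCoset D.Del ζ :=
    ((D.finCoset_xi _).mul (finCoset_of_mem ⟨_, rfl⟩)).mul (D.finCoset_xi _)
  obtain ⟨y', t, ht⟩ := exists_add_mul_dvd (c := 1) hj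
  let γ₁ : SL(2, ℤ) := ⟨!![-y', -Q'; p.1 * t, j'], by
    rw [Matrix.det_fin_two_of]
    linear_combination -ht - t * hQ⟩
  let g₁ := liftSL γ₁
  set ζ' := D.sectionL g₁⁻¹ * ζ * D.sectionL (mpV ^ (p.1 * y')) with hζ'
  have hmem : ζ' ∈ DoubleCoset.doubleCoset ζ (D.Del : Set D.TripleGroup) D.Del :=
    D.mul_mul_mem_doubleCoset _ _ _
  have hSe : ∀ i j, ModularGroup.S i j = (!![0, -1; 1, 0] : Matrix (Fin 2) (Fin 2) ℤ) i j := by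
    intro i j; fin_cases i <;> fin_cases j <;> rfl
  -- the matrix identity `diag(q², 1) S T^{pj'} diag(p², 1) V^{py'} = p γ₁ diag(q², 1)`
  have hM : ζ'.1.M = scal p.1 p.2.1 * diagSq q.1 q.2.1 := by
    have hQq : (q.1 : ℚ) ^ 2 = p.1 * Q' := by exact_mod_cast hQ
    have htq : (1 : ℚ) + y' * j' = q.1 ^ 2 * t := by exact_mod_cast ht
    have key : diagSq q.1 q.2.1 * ofSL (toSL (mpS * mpT ^ (p.1 * j'))) * diagSq p.1 p.2.1 *
        ofSL (toSL (mpV ^ (p.1 * y'))) = ofSL γ₁ * (scal p.1 p.2.1 * diagSq q.1 q.2.1) := by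
      rw [← mat_injective.eq_iff]
      simp only [mat_mul, mat_diagSq, mat_scal]
      have e1 : mat (ofSL (toSL (mpS * mpT ^ (p.1 * j')))) = !![0, -1; 1, (p.1 : ℚ) * j'] := by
        ext i j
        rw [mat_ofSL, map_mul, toSL_mpS, toSL_T_zpow, SL_mul_apply]
        simp only [hSe, matT_zpow_apply]
        fin_cases i <;> fin_cases j <;> simp
      have e2 : mat (ofSL (toSL (mpV ^ (p.1 * y')))) = !![1, 0; (p.1 : ℚ) * y', 1] := by
        ext i j
        rw [mat_ofSL, toSL_V_zpow, matV_zpow_apply]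
        fin_cases i <;> fin_cases j <;> simp
      have e3 : mat (ofSL γ₁) = !![-(y' : ℚ), -Q'; p.1 * t, j'] := by
        ext i j
        rw [mat_ofSL]
        fin_cases i <;> fin_cases j <;> simp [γ₁]
      rw [e1, e2, e3]
      ext i j
      fin_cases i <;> fin_cases j <;> simp [Matrix.mul_apply, Fin.sum_univ_two]
      · ring
      · linear_combination hQq
      · linear_combination (p.1 : ℚ) ^ 2 * htq
      · ring
    change (g₁⁻¹).1.M * (diagSq q.1 q.2.1 * (mpS * mpT ^ (p.1 * j')).1.M * diagSq p.1 p.2.1) *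
      (mpV ^ (p.1 * y')).1.M = _
    rw [← ofSL_toSL, ← ofSL_toSL, ← ofSL_toSL, mul_assoc, key, map_inv, toSL_liftSL, map_inv,
      inv_mul_cancel_left]
  have hM2 : ζ'.1.M = (D.zc p * D.xi q).1.M := hM
  obtain ⟨p', hp'⟩ := exists_inv_modEq p.2.2
  obtain ⟨q', hq'⟩ := exists_inv_modEq q.2.2
  have hN := D.killed_level
  have hu : ∃ c : ℂ, ((D.zc p * D.xi q).2.2 : Module.End ℂ (A → ℂ)) =
      c • (ζ'.2.2 : Module.End ℂ (A → ℂ)) := by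
    let w := mpS * mpT ^ (p.1 * j')
    let v := mpV ^ (p.1 * y')
    let U : LinearMap.GeneralLinearGroup ℂ (A → ℂ) :=
      hN.unitDil hq' * D.weil w * hN.unitDil hp' * D.weil v
    let K : LinearMap.GeneralLinearGroup ℂ (A → ℂ) := D.weil g₁ * hN.unitDil hq'
    have hU := (((hN.intertwines_dil hq').mul (D.intertwines_weil w)).mul
      (hN.intertwines_dil hp')).mul (D.intertwines_weil v)
    have hK := (D.intertwines_weil g₁).mul (hN.intertwines_dil hq')
    have hU' : D.Intertwines U ((toSL g₁).1 * !![(q.1 : ℤ), 0; 0, q']) := by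
      refine hN.intertwines_congr ?_ hU
      have e1 : (toSL w).1 = !![0, -1; 1, (p.1 : ℤ) * j'] := by
        ext i j
        rw [map_mul, toSL_mpS, toSL_T_zpow, SL_mul_apply]
        simp only [hSe, matT_zpow_apply]
        fin_cases i <;> fin_cases j <;> simp
      have e2 : (toSL v).1 = !![1, 0; (p.1 : ℤ) * y', 1] := by
        ext i j
        rw [toSL_V_zpow, matV_zpow_apply]
      have e3 : (toSL g₁).1 = !![-y', -Q'; p.1 * t, j'] := by rw [toSL_liftSL]
      rw [e1, e2, e3]
      have cp : (p.1 : ZMod D.level) * p' = 1 := by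
        have := (ZMod.intCast_eq_intCast_iff _ _ _).mpr hp'
        push_cast at this; exact this
      have cq : (q.1 : ZMod D.level) * q' = 1 := by
        have := (ZMod.intCast_eq_intCast_iff _ _ _).mpr hq'
        push_cast at this; exact this
      have cQ : (q.1 : ZMod D.level) ^ 2 = p.1 * Q' := by
        have := congrArg (Int.cast : ℤ → ZMod D.level) hQ
        push_cast at this; exact this
      have ct : (1 : ZMod D.level) + y' * j' = q.1 ^ 2 * t := by
        have := congrArg (Int.cast : ℤ → ZMod D.level) ht
        push_cast at this; exact this
      intro i j
      rw [← ZMod.intCast_eq_intCast_iff]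
      fin_cases i <;> fin_cases j <;> simp [Matrix.mul_apply, Fin.sum_univ_two]
      · linear_combination ((q.1 : ZMod D.level) * y') * cp
      · linear_combination (-(q.1 : ZMod D.level) * p') * cq + q' * p' * cQ + Q' * q' * cp
      · linear_combination (q' * y' * p.1 * j' : ZMod D.level) * cp + (q' * p.1 : ZMod D.level) * ct +
          (p.1 * t * q.1 : ZMod D.level) * cq
      · linear_combination (q' * j' : ZMod D.level) * cp
    obtain ⟨c, hc⟩ := Intertwines.exists_smul (U := K) (K := U) hK hU'
    refine ⟨c, ?_⟩
    have h1 : ((D.zc p * D.xi q).2.2 : Module.End ℂ (A → ℂ)) = dil q.1 := by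
      change (1 : Module.End ℂ (A → ℂ)) * (D.dilation q.2.2 : Module.End ℂ (A → ℂ)) = _
      rw [one_mul, dilation_val]
    have h2 : (ζ'.2.2 : Module.End ℂ (A → ℂ)) = D.weilEnd g₁⁻¹ * (U : Module.End ℂ (A → ℂ)) := by
      change D.weilEnd g₁⁻¹ * ((D.dilation q.2.2 : Module.End ℂ (A → ℂ)) * D.weilEnd w *
        (D.dilation p.2.2 : Module.End ℂ (A → ℂ))) * D.weilEnd v =
        D.weilEnd g₁⁻¹ * (dil q.1 * D.weilEnd w * dil p.1 * D.weilEnd v)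
      rw [dilation_val, dilation_val]
      simp only [mul_assoc]
    have h3 : (K : Module.End ℂ (A → ℂ)) = D.weilEnd g₁ * dil q.1 := rfl
    rw [h1, h2, ← mul_smul_comm, ← hc, h3, ← mul_assoc, ← weilEnd_mul, inv_mul_cancel, weilEnd,
      map_one, Units.val_one, one_mul]
  obtain ⟨c, hc⟩ := hu
  obtain ⟨c', hc'⟩ := ract_eq_smul (κ := κ) hM2 hc
  refine ⟨c', fun f hf => ?_⟩
  rw [heckeMean, heckeMean, ← cosetMean_of_mem hfin hmem hf]
  refine cosetMean_of_ract_eq (D.finCoset_xi q) (hfin.of_mem hmem) hf ?_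
  rw [ract_slash, hc' f, slashOdd_mul, slashOdd_zc]
  rfl

end DiscriminantForm

namespace DiscriminantForm

variable {A : Type*} [AddCommGroup A] [Fintype A] (D : DiscriminantForm A)

/-! ### The recursion at a prime and the Hecke algebra -/

/-- The powers of an index. -/
def ipow (p : D.CoprimeIndex) (k : ℕ) : D.CoprimeIndex :=
  ⟨p.1 ^ k, pow_pos p.2.1 k, Nat.Coprime.pow_left k p.2.2⟩

lemma ipow_succ (p : D.CoprimeIndex) (k : ℕ) : D.ipow p (k + 1) = D.ipow p k * p :=
  Subtype.ext (pow_succ p.1 k)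

lemma ipow_one (p : D.CoprimeIndex) : D.ipow p 1 = p := Subtype.ext (pow_one p.1)

variable {D} in
/-- The double cosets occurring in `Δ ξ_q Δ ξ_p Δ` for a prime `p` and `q = p^{k+1}`. -/
lemma exists_heckeMean_term (κ : ℤ) {p : D.CoprimeIndex} (hp : p.1.Prime) (k : ℕ) (x : D.Del) :
    ∃ (a : ℝ) (b c : ℂ), 0 ≤ a ∧ (x ∈ stab D.Del (D.xi (D.ipow p (k + 1))) → a = 1) ∧
      ∀ f ∈ D.inv κ,
        cosetMean (D.slash κ) D.Del (D.xi (D.ipow p (k + 1)) * (x⁻¹ : D.Del) * D.xi p) f =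
        (a : ℂ) • D.heckeMean κ (D.xi (D.ipow p (k + 2))) f +
          b • D.heckeMean κ (D.xi (D.ipow p (k + 1))) f +
          c • D.heckeMean κ (D.xi (D.ipow p k)) f := by
  set q := D.ipow p (k + 1) with hq
  obtain ⟨g, hg⟩ := (x⁻¹).2
  rw [← hg]
  have hpi : Prime (p.1 : ℤ) := Nat.prime_iff_prime_int.mp hp
  have hqv : (q.1 : ℤ) ^ 2 = (p.1 : ℤ) ^ (2 * (k + 1)) := by
    change ((p.1 ^ (k + 1) : ℕ) : ℤ) ^ 2 = _
    push_cast; rw [← pow_mul]; ring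
  have hcopq : ∀ d : ℤ, ¬ (p.1 : ℤ) ∣ d → IsCoprime d ((q.1 : ℤ) ^ 2) := fun d hd => by
    rw [hqv]; exact (hpi.coprime_iff_not_dvd.mpr hd).symm.pow_right
  have hpq : (p.1 : ℤ) ∣ (q.1 : ℤ) ^ 2 := by rw [hqv]; exact dvd_pow_self _ (by omega)
  have hdet := toSL_det g
  by_cases hd : (p.1 : ℤ) ∣ toSL g 1 1
  · have hc : ¬ (p.1 : ℤ) ∣ toSL g 1 0 := by
      intro hc
      apply hpi.not_dvd_one
      rw [← hdet]
      exact dvd_sub (hd.mul_left _) (hc.mul_left _)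
    have hst : ¬ x ∈ stab D.Del (D.xi q) := by
      intro hx
      have hx' := inv_mem hx
      rw [mem_stab, ← hg] at hx'
      obtain ⟨h, hh⟩ := hx'
      have h1 : mpDiag q.1 q.2.1 * g.1 = h.1 * mpDiag q.1 q.2.1 := by
        have := congrArg Prod.fst hh
        change h.1 = mpDiag q.1 q.2.1 * g.1 * (mpDiag q.1 q.2.1)⁻¹ at this
        rw [this, inv_mul_cancel_right]
      apply hc
      rw [(mpDiag_rel_entries h1).2.2.1]
      exact hpq.mul_right _
    obtain ⟨g₁, j, h1, h2, h3⟩ := exists_eq_mul_S_mul_T_zpow g (hcopq _ hc)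
    have hj : (p.1 : ℤ) ∣ j := by
      have h4 : (p.1 : ℤ) ∣ j * toSL g 1 0 := (dvd_sub_right hd).mp (hpq.trans h3)
      exact (hpi.dvd_or_dvd h4).resolve_right hc
    obtain ⟨j₁, rfl⟩ := hj
    obtain ⟨h₁, e1⟩ := exists_mpDiag_mul q.2.1 g₁ h2
    have r1 := D.xi_mul_sectionL q e1
    have hζ : ∀ w : MpZ, D.xi q * D.sectionL (g₁ * w) * D.xi p =
        D.sectionL h₁ * (D.xi q * D.sectionL w * D.xi p) * D.sectionL 1 := by
      intro w
      rw [map_mul, map_one, mul_one, ← mul_assoc (D.xi q), r1]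
      group
    have hfin : ∀ w : MpZ, FinCoset D.Del (D.xi q * D.sectionL w * D.xi p) := fun w =>
      ((D.finCoset_xi _).mul (finCoset_of_mem ⟨_, rfl⟩)).mul (D.finCoset_xi _)
    by_cases hj₁ : (p.1 : ℤ) ∣ j₁
    · obtain ⟨i, rfl⟩ := hj₁
      refine ⟨0, 0, 1, le_rfl, fun hx => absurd hx hst, fun f hf => ?_⟩
      have e2 : mpDiag p.1 p.2.1 * (mpT ^ i).1 =
          (mpT ^ ((p.1 : ℤ) * (p.1 * i))).1 * mpDiag p.1 p.2.1 := by
        rw [mpDiag_mul_T_zpow, pow_two, mul_assoc]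
      have r2 := D.xi_mul_sectionL p e2
      have h5 : D.xi q * D.sectionL g * D.xi p =
          D.sectionL h₁ * (D.xi q * D.sectionL mpS * D.xi p) * D.sectionL (mpT ^ i) := by
        rw [h1, hζ, map_mul D.sectionL mpS, map_one, mul_one]
        simp only [mul_assoc]
        rw [r2]
      rw [h5, cosetMean_of_mem (hfin mpS) (D.mul_mul_mem_doubleCoset _ _ _) hf]
      have h6 := D.heckeMean_xi_S_xi (D.ipow p k) p hf
      rw [← ipow_succ] at h6
      rw [heckeMean] at h6
      rw [h6]
      simp
    · have hQ : (q.1 : ℤ) ^ 2 = p.1 * (p.1 : ℤ) ^ (2 * k + 1) := by rw [hqv]; ring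
      obtain ⟨b, hb⟩ := D.heckeMean_xi_ST_xi (κ := κ) hQ (hcopq _ hj₁)
      refine ⟨0, b, 0, le_rfl, fun hx => absurd hx hst, fun f hf => ?_⟩
      rw [h1, hζ, cosetMean_of_mem (hfin _) (D.mul_mul_mem_doubleCoset _ _ _) hf]
      have h6 := hb f hf
      rw [heckeMean] at h6
      rw [h6]
      simp
  · obtain ⟨g₁, y, h1, h2⟩ := exists_eq_mul_V_zpow g (hcopq _ hd)
    refine ⟨1, 0, 0, zero_le_one, fun _ => rfl, fun f hf => ?_⟩
    have h3 := D.xi_mul_mul_xi_mem q p h1 h2 (by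
      rw [toSL_V_zpow, matV_zpow_apply]; simp)
    rw [hq, ← ipow_succ, ← hq] at h3
    rw [cosetMean_of_mem (D.finCoset_xi _) h3 hf]
    simp

/-- The recursion for the normalised Hecke operators at the powers of a prime. -/
lemma heckeMean_recursion (κ : ℤ) {p : D.CoprimeIndex} (hp : p.1.Prime) (k : ℕ) :
    ∃ a b c : ℂ, a ≠ 0 ∧ ∀ f ∈ D.inv κ,
      D.heckeMean κ (D.xi p) (D.heckeMean κ (D.xi (D.ipow p (k + 1))) f) =
        a • D.heckeMean κ (D.xi (D.ipow p (k + 2))) f +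
          b • D.heckeMean κ (D.xi (D.ipow p (k + 1))) f +
          c • D.heckeMean κ (D.xi (D.ipow p k)) f := by
  classical
  choose a b c ha hst H using exists_heckeMean_term (D := D) κ hp k
  set q := D.ipow p (k + 1)
  have hfin := D.finCoset_xi q
  have := Fintype.ofFinite (D.Del ⧸ stab D.Del (D.xi q))
  set I : ℂ := ((stab D.Del (D.xi q)).index : ℂ)⁻¹
  have hI : I ≠ 0 := inv_ne_zero (by exact_mod_cast hfin.index_ne_zero)
  refine ⟨I * ((∑ z : D.Del ⧸ stab D.Del (D.xi q), a z.out : ℝ) : ℂ),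
    I * ∑ z : D.Del ⧸ stab D.Del (D.xi q), b z.out,
    I * ∑ z : D.Del ⧸ stab D.Del (D.xi q), c z.out, ?_, fun f hf => ?_⟩
  · refine mul_ne_zero hI ?_
    have : 0 < ∑ z : D.Del ⧸ stab D.Del (D.xi q), a z.out := by
      refine Finset.sum_pos' (fun z _ => ha _)
        ⟨((1 : D.Del) : D.Del ⧸ stab D.Del (D.xi q)), Finset.mem_univ _, ?_⟩
      have h1 : (1 : D.Del)⁻¹ * Quotient.out ((1 : D.Del) : D.Del ⧸ stab D.Del (D.xi q)) ∈
          stab D.Del (D.xi q) := by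
        rw [← QuotientGroup.eq]; exact (Quotient.out_eq _).symm
      rw [inv_one, one_mul] at h1
      rw [hst _ h1]
      exact one_pos
    exact_mod_cast this.ne'
  · rw [heckeMean, heckeMean, cosetMean_cosetMean (D.finCoset_xi p) hfin hf, mean,
      finsum_eq_sum_of_fintype]
    simp only [H _ f hf]
    rw [Finset.sum_add_distrib, Finset.sum_add_distrib, ← Finset.sum_smul, ← Finset.sum_smul,
      ← Finset.sum_smul, smul_add, smul_add, smul_smul, smul_smul, smul_smul]
    push_cast
    rfl

/-- The index `1`. -/
def ione : D.CoprimeIndex := ⟨1, one_pos, Nat.coprime_one_left _⟩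

lemma ipow_zero (p : D.CoprimeIndex) : D.ipow p 0 = D.ione := Subtype.ext (pow_zero p.1)

lemma xi_ione : D.xi D.ione = 1 := by
  have h := D.xi_mul_xi D.ione D.ione
  have h1 : D.ione * D.ione = D.ione := Subtype.ext (one_mul 1)
  rw [h1] at h
  exact mul_eq_left.mp h

lemma heckeMean_ione {κ : ℤ} {f : ℍ → A → ℂ} (hf : f ∈ D.inv κ) :
    D.heckeMean κ (D.xi D.ione) f = f := by
  have hfin := D.finCoset_xi D.ione
  rw [heckeMean, cosetMean]
  have h1 : ∀ y : D.Del, ract (D.slash κ) (D.xi D.ione * (y⁻¹ : D.Del)) f = f := fun y => by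
    rw [xi_ione, one_mul]
    exact hf _ (y⁻¹).2
  simp only [h1]
  exact mean_const _ _

section Algebra

variable {R : Type*} [Ring R] [Algebra ℂ R] {N : D.CoprimeIndex → R}

variable {D}

/-- Operators that are multiplicative on coprime indices and satisfy a three-term recursion at the
powers of each prime lie in the algebra generated by those of prime index. -/
lemma mem_adjoin_of_recursion (h1 : N D.ione = 1)
    (hmul : ∀ m n : D.CoprimeIndex, m.1.Coprime n.1 → N n * N m = N (m * n))
    (hrec : ∀ p : D.CoprimeIndex, p.1.Prime → ∀ k, ∃ a b c : ℂ, a ≠ 0 ∧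
      N p * N (D.ipow p (k + 1)) =
        a • N (D.ipow p (k + 2)) + b • N (D.ipow p (k + 1)) + c • N (D.ipow p k))
    (m : D.CoprimeIndex) :
    N m ∈ Algebra.adjoin ℂ (N '' {p : D.CoprimeIndex | p.1.Prime}) := by
  set S := Algebra.adjoin ℂ (N '' {p : D.CoprimeIndex | p.1.Prime})
  have hprime : ∀ p : D.CoprimeIndex, p.1.Prime → N p ∈ S := fun p hp =>
    Algebra.subset_adjoin ⟨p, hp, rfl⟩
  have hpow : ∀ p : D.CoprimeIndex, p.1.Prime → ∀ k, N (D.ipow p k) ∈ S ∧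
      N (D.ipow p (k + 1)) ∈ S := by
    intro p hp k
    induction k with
    | zero =>
      rw [ipow_zero, zero_add, ipow_one, h1]
      exact ⟨one_mem _, hprime p hp⟩
    | succ k ih =>
      refine ⟨ih.2, ?_⟩
      obtain ⟨a, b, c, ha, h⟩ := hrec p hp k
      have h2 : N (D.ipow p (k + 2)) =
          a⁻¹ • (N p * N (D.ipow p (k + 1)) - b • N (D.ipow p (k + 1)) - c • N (D.ipow p k)) := by
        rw [h, eq_inv_smul_iff₀ ha]; abel
      rw [show k + 1 + 1 = k + 2 from rfl, h2]
      exact S.smul_mem (sub_mem (sub_mem (mul_mem (hprime p hp) ih.2) (S.smul_mem ih.2 _))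
        (S.smul_mem ih.1 _)) _
  obtain ⟨m, hm0, hm⟩ := m
  revert hm0 hm
  induction m using Nat.recOnPosPrimePosCoprime with
  | zero => intro h; omega
  | one => intro _ _; change N D.ione ∈ S; rw [h1]; exact one_mem _
  | prime_pow p k hp hk =>
    intro h0 hco
    have hpco : p.Coprime D.level := (Nat.coprime_pow_left_iff hk p _).mp hco
    exact (hpow ⟨p, hp.pos, hpco⟩ hp k).1
  | coprime a b ha hb hab iha ihb =>
    intro h0 hco
    have ca : a.Coprime D.level := hco.coprime_mul_right
    have cb : b.Coprime D.level := hco.coprime_mul_left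
    have h2 := hmul ⟨a, by omega, ca⟩ ⟨b, by omega, cb⟩ hab
    have h3 : (⟨a * b, h0, hco⟩ : D.CoprimeIndex) =
      (⟨a, by omega, ca⟩ : D.CoprimeIndex) * ⟨b, by omega, cb⟩ := rfl
    rw [h3, ← h2]
    exact mul_mem (ihb (by omega) cb) (iha (by omega) ca)

/-- The Hecke algebra is commutative and generated by the operators of prime index. -/
theorem adjoin_of_recursion {T : D.CoprimeIndex → R} {t : D.CoprimeIndex → ℂ} (ht : ∀ m, t m ≠ 0)
    (hT : ∀ m, T m = t m • N m) (h1 : N D.ione = 1)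
    (hmul : ∀ m n : D.CoprimeIndex, m.1.Coprime n.1 → N n * N m = N (m * n))
    (hrec : ∀ p : D.CoprimeIndex, p.1.Prime → ∀ k, ∃ a b c : ℂ, a ≠ 0 ∧
      N p * N (D.ipow p (k + 1)) =
        a • N (D.ipow p (k + 2)) + b • N (D.ipow p (k + 1)) + c • N (D.ipow p k)) :
    (∀ x ∈ Algebra.adjoin ℂ (Set.range T), ∀ y ∈ Algebra.adjoin ℂ (Set.range T),
      x * y = y * x) ∧
    Algebra.adjoin ℂ (T '' {p : D.CoprimeIndex | p.1.Prime}) =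
      Algebra.adjoin ℂ (Set.range T) := by
  have hN : ∀ m, N m = (t m)⁻¹ • T m := fun m => by rw [hT, inv_smul_smul₀ (ht m)]
  have hle : Algebra.adjoin ℂ (N '' {p : D.CoprimeIndex | p.1.Prime}) ≤
      Algebra.adjoin ℂ (T '' {p : D.CoprimeIndex | p.1.Prime}) := by
    rw [Algebra.adjoin_le_iff]
    rintro _ ⟨p, hp, rfl⟩
    rw [hN]
    exact Subalgebra.smul_mem _ (Algebra.subset_adjoin (Set.mem_image_of_mem T hp)) _
  have heq : Algebra.adjoin ℂ (T '' {p : D.CoprimeIndex | p.1.Prime}) =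
      Algebra.adjoin ℂ (Set.range T) := by
    refine le_antisymm (Algebra.adjoin_mono (Set.image_subset_range _ _)) ?_
    rw [Algebra.adjoin_le_iff]
    rintro _ ⟨m, rfl⟩
    rw [hT]
    exact Subalgebra.smul_mem _ (hle (mem_adjoin_of_recursion h1 hmul hrec m)) _
  refine ⟨?_, heq⟩
  rw [← heq]
  intro x hx y hy
  have hcomm : ∀ a ∈ T '' {p : D.CoprimeIndex | p.1.Prime},
      ∀ b ∈ T '' {p : D.CoprimeIndex | p.1.Prime}, a * b = b * a := by
    rintro _ ⟨p, hp, rfl⟩ _ ⟨q, hq, rfl⟩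
    by_cases hpq : p = q
    · rw [hpq]
    · have hne : p.1 ≠ q.1 := fun h => hpq (Subtype.ext h)
      have c1 : p.1.Coprime q.1 := (Nat.coprime_primes hp hq).mpr hne
      have c2 : p * q = q * p := Subtype.ext (mul_comm p.1 q.1)
      rw [hT, hT, smul_mul_smul_comm, smul_mul_smul_comm, hmul p q c1, hmul q p c1.symm, c2,
        mul_comm (t p)]
  exact congrArg Subtype.val ((Algebra.isMulCommutative_adjoin ℂ hcomm).is_comm.comm ⟨x, hx⟩ ⟨y, hy⟩)

end Algebra

end DiscriminantForm

/-! ### Behaviour at infinity -/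

/-- An integral primitive row orthogonal to the first column is completed to a matrix of determinant one. -/
lemma exists_upper_triangular (M : GL(2, ℚ)⁺) : ∃ γ : SL(2, ℤ), mat (ofSL γ * M) 1 0 = 0 := by
  obtain ⟨k, hk0, x, y, hx, hy⟩ : ∃ k : ℚ, k ≠ 0 ∧ ∃ x y : ℤ, mat M 0 0 = x * k ∧
      mat M 1 0 = y * k := by
    refine ⟨((mat M 0 0).den * (mat M 1 0).den : ℚ)⁻¹, ?_, (mat M 0 0).num * (mat M 1 0).den,
      (mat M 1 0).num * (mat M 0 0).den, ?_, ?_⟩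
    · have h1 := (mat M 0 0).den_nz
      have h2 := (mat M 1 0).den_nz
      positivity
    · have h1 : ((mat M 0 0).den : ℚ) ≠ 0 := by exact_mod_cast (mat M 0 0).den_nz
      have h2 : ((mat M 1 0).den : ℚ) ≠ 0 := by exact_mod_cast (mat M 1 0).den_nz
      push_cast
      field_simp
      rw [Rat.mul_den_eq_num]
    · have h1 : ((mat M 0 0).den : ℚ) ≠ 0 := by exact_mod_cast (mat M 0 0).den_nz
      have h2 : ((mat M 1 0).den : ℚ) ≠ 0 := by exact_mod_cast (mat M 1 0).den_nz
      push_cast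
      field_simp
      rw [Rat.mul_den_eq_num]
  have hxy : x ≠ 0 ∨ y ≠ 0 := by
    by_contra! h
    have hdet := detQ_pos M
    rw [detQ, Matrix.det_fin_two, hx, hy, h.1, h.2] at hdet
    simp at hdet
  obtain ⟨g, x', y', hco, hx', hy'⟩ : ∃ g x' y' : ℤ, IsCoprime x' y' ∧ x = x' * g ∧ y = y' * g := by
    have hg : x.gcd y ≠ 0 := by
      rw [Ne, Int.gcd_eq_zero_iff]; rintro ⟨h1, h2⟩; rcases hxy with h | h <;> contradiction
    obtain ⟨x', y', hco, h1, h2⟩ := Int.exists_gcd_one (Nat.pos_of_ne_zero hg)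
    exact ⟨x.gcd y, x', y', Int.isCoprime_iff_gcd_eq_one.mpr hco, h1, h2⟩
  obtain ⟨u, v, huv⟩ := hco
  let γ : SL(2, ℤ) := ⟨!![u, v; -y', x'], by rw [Matrix.det_fin_two_of]; linear_combination huv⟩
  have h0 : mat (ofSL γ) 1 0 = -(y' : ℚ) := by rw [mat_ofSL]; simp [γ]
  have h1 : mat (ofSL γ) 1 1 = (x' : ℚ) := by rw [mat_ofSL]; simp [γ]
  refine ⟨γ, ?_⟩
  rw [mat_mul, Matrix.mul_apply, Fin.sum_univ_two, h0, h1, hx, hy, hx', hy']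
  push_cast
  ring

namespace DiscriminantForm

variable {A : Type*} [AddCommGroup A] [Fintype A] (D : DiscriminantForm A)

lemma mdifferentiable_slashOdd {κ : ℤ} {f : ℍ → A → ℂ} (hf : MDifferentiable 𝓘(ℂ) 𝓘(ℂ, A → ℂ) f)
    (ξ : D.TripleGroup) : MDifferentiable 𝓘(ℂ) 𝓘(ℂ, A → ℂ) (D.slashOdd κ f ξ) := by
  have h1 : MDifferentiable 𝓘(ℂ) 𝓘(ℂ) fun τ => ξ.1.φ τ ^ (-κ) := by
    have h := ξ.1.holo
    rw [UpperHalfPlane.mdifferentiable_iff] at h ⊢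
    exact h.zpow (Or.inl fun z _ => ξ.1.φ_ne_zero _)
  have h2 : MDifferentiable 𝓘(ℂ) 𝓘(ℂ, A → ℂ) fun τ => f (moebius ξ.1.M τ) :=
    hf.comp (mdifferentiable_moebius _)
  let u : (A → ℂ) →L[ℂ] (A → ℂ) := LinearMap.toContinuousLinearMap
    ((ξ.2.2⁻¹ : LinearMap.GeneralLinearGroup ℂ (A → ℂ)) : Module.End ℂ (A → ℂ))
  have h3 : MDifferentiable 𝓘(ℂ) 𝓘(ℂ, A → ℂ) fun τ => u (f (moebius ξ.1.M τ)) :=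
    u.mdifferentiable.comp h2
  exact (h1.const_smul ((((detQ ξ.1.M : ℝ) ^ ((κ : ℝ) / 4) : ℝ) : ℂ))).smul h3

lemma tendsto_moebius {M : GL(2, ℚ)⁺} (hM : mat M 1 0 = 0) :
    Filter.Tendsto (moebius M) UpperHalfPlane.atImInfty UpperHalfPlane.atImInfty :=
  UpperHalfPlane.tendsto_smul_atImInfty (g := toGLReal M) (by
    change ((mat M 1 0 : ℚ) : ℝ) = 0
    rw [hM, Rat.cast_zero])

lemma norm_φ_eq {g : Mp} (hM : mat g.M 1 0 = 0) (τ : ℍ) :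
    ‖g.φ τ‖ = Real.sqrt ‖((mat g.M 1 1 : ℚ) : ℂ)‖ := by
  have h := g.sq τ
  rw [autJ_eq, hM, Rat.cast_zero, zero_mul, zero_add] at h
  rw [← h, norm_pow, Real.sqrt_sq (norm_nonneg _)]

lemma slashOdd_isBigO {κ : ℤ} (f : ℍ → A → ℂ) {ξ : D.TripleGroup} (hM : mat ξ.1.M 1 0 = 0) :
    D.slashOdd κ f ξ =O[UpperHalfPlane.atImInfty] fun τ => f (moebius ξ.1.M τ) := by
  let u : (A → ℂ) →L[ℂ] (A → ℂ) := LinearMap.toContinuousLinearMap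
    ((ξ.2.2⁻¹ : LinearMap.GeneralLinearGroup ℂ (A → ℂ)) : Module.End ℂ (A → ℂ))
  refine Asymptotics.IsBigO.of_bound
    (‖(((detQ ξ.1.M : ℝ) ^ ((κ : ℝ) / 4) : ℝ) : ℂ)‖ *
      Real.sqrt ‖((mat ξ.1.M 1 1 : ℚ) : ℂ)‖ ^ (-κ) * ‖u‖) (Filter.Eventually.of_forall fun τ => ?_)
  rw [slashOdd, norm_smul, norm_mul, norm_zpow, norm_φ_eq hM, mul_assoc _ ‖u‖]
  exact mul_le_mul_of_nonneg_left (u.le_opNorm _) (by positivity)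

/-- Left multiplication of `ξ` by `Δ`, which does not change `f ∣ ξ`, makes its matrix upper
triangular. -/
lemma exists_slashOdd_eq {κ : ℤ} {f : ℍ → A → ℂ} (hf : f ∈ D.inv κ) (ξ : D.TripleGroup) :
    ∃ ζ : D.TripleGroup, mat ζ.1.M 1 0 = 0 ∧ D.slashOdd κ f ξ = D.slashOdd κ f ζ := by
  obtain ⟨γ, hγ⟩ := exists_upper_triangular ξ.1.M
  refine ⟨D.sectionL (liftSL γ) * ξ, hγ, ?_⟩
  rw [slashOdd_mul]
  have := hf (D.sectionL (liftSL γ)) ⟨_, rfl⟩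
  rw [ract_slash] at this
  rw [this]

lemma isBoundedAtImInfty_slashOdd {κ : ℤ} {f : ℍ → A → ℂ} (hf : f ∈ D.inv κ)
    (hb : UpperHalfPlane.IsBoundedAtImInfty f) (ξ : D.TripleGroup) :
    UpperHalfPlane.IsBoundedAtImInfty (D.slashOdd κ f ξ) := by
  obtain ⟨ζ, hζ, h⟩ := D.exists_slashOdd_eq hf ξ
  rw [h]
  exact (D.slashOdd_isBigO f hζ).trans (hb.comp_tendsto (tendsto_moebius hζ))

lemma isZeroAtImInfty_slashOdd {κ : ℤ} {f : ℍ → A → ℂ} (hf : f ∈ D.inv κ)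
    (hb : UpperHalfPlane.IsZeroAtImInfty f) (ξ : D.TripleGroup) :
    UpperHalfPlane.IsZeroAtImInfty (D.slashOdd κ f ξ) := by
  obtain ⟨ζ, hζ, h⟩ := D.exists_slashOdd_eq hf ξ
  rw [h]
  exact (D.slashOdd_isBigO f hζ).trans_tendsto (hb.comp (tendsto_moebius hζ))

end DiscriminantForm

lemma mean_mem {Γ V : Type*} [Group Γ] [AddCommGroup V] [Module ℂ V] (W : Submodule ℂ V)
    (L : Subgroup Γ) {F : Γ → V} (h : ∀ y, F y ∈ W) : mean L F ∈ W :=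
  W.smul_mem _ (finsum_induction (· ∈ W) W.zero_mem (fun _ _ => W.add_mem) fun _ => h _)

namespace DiscriminantForm

variable {A : Type*} [AddCommGroup A] [Fintype A] (D : DiscriminantForm A)

lemma heckeMean_mem_modularForms {κ : ℤ} {ξ : D.TripleGroup} (hξ : FinCoset D.Del ξ) {f : ℍ → A → ℂ}
    (hf : f ∈ D.modularForms κ) : D.heckeMean κ ξ f ∈ D.modularForms κ := by
  obtain ⟨h1, h2, h3⟩ := D.mem_modularForms_iff.mp hf
  let W : Submodule ℂ (ℍ → A → ℂ) :=
    { carrier := {f | MDifferentiable 𝓘(ℂ) 𝓘(ℂ, A → ℂ) f ∧ UpperHalfPlane.IsBoundedAtImInfty f}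
      zero_mem' := ⟨mdifferentiable_const, Filter.const_boundedAtFilter _ (0 : A → ℂ)⟩
      add_mem' := fun h h' => ⟨h.1.add h'.1, Filter.BoundedAtFilter.add h.2 h'.2⟩
      smul_mem' := fun c f h => ⟨h.1.const_smul c, Filter.BoundedAtFilter.smul c h.2⟩ }
  have hW : D.heckeMean κ ξ f ∈ W := mean_mem W _ fun y =>
    ⟨D.mdifferentiable_slashOdd h1 _, D.isBoundedAtImInfty_slashOdd h2 h3 _⟩
  exact D.mem_modularForms_iff.mpr ⟨hW.1, cosetMean_mem hξ h2, hW.2⟩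

lemma isZeroAtImInfty_heckeMean {κ : ℤ} (ξ : D.TripleGroup) {f : ℍ → A → ℂ} (hf : f ∈ D.inv κ)
    (h0 : UpperHalfPlane.IsZeroAtImInfty f) :
    UpperHalfPlane.IsZeroAtImInfty (D.heckeMean κ ξ f) := by
  let W : Submodule ℂ (ℍ → A → ℂ) :=
    { carrier := {f | UpperHalfPlane.IsZeroAtImInfty f}
      zero_mem' := Filter.zero_zeroAtFilter _
      add_mem' := fun h h' => Filter.ZeroAtFilter.add h h'
      smul_mem' := fun c f h => Filter.ZeroAtFilter.smul c h }
  exact mean_mem W _ fun y => D.isZeroAtImInfty_slashOdd hf h0 _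

lemma cosetMean_linear {G V : Type*} [Group G] [AddCommGroup V] [Module ℂ V]
    (s : Gᵐᵒᵖ →* Module.End ℂ V) (Δ : Subgroup G) {ζ : G} (hζ : FinCoset Δ ζ) (c : ℂ) (f g : V) :
    cosetMean s Δ ζ (c • f + g) = c • cosetMean s Δ ζ f + cosetMean s Δ ζ g := by
  have := Fintype.ofFinite (Δ ⧸ stab Δ ζ)
  simp only [cosetMean, mean, finsum_eq_sum_of_fintype, map_add, map_smul, Finset.sum_add_distrib,
    ← Finset.smul_sum, smul_add]
  rw [smul_comm]

/-- The normalised Hecke operator as an endomorphism of the space of modular forms. -/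
def heckeEnd (κ : ℤ) (m : D.CoprimeIndex) : Module.End ℂ (D.modularForms κ) where
  toFun f := ⟨D.heckeMean κ (D.xi m) f, D.heckeMean_mem_modularForms (D.finCoset_xi m) f.2⟩
  map_add' f g := Subtype.ext (by
    have := cosetMean_linear (D.slash κ) D.Del (D.finCoset_xi m) 1 (f : ℍ → A → ℂ) g
    rwa [one_smul, one_smul] at this)
  map_smul' c f := Subtype.ext (by
    have h := cosetMean_linear (D.slash κ) D.Del (D.finCoset_xi m) c (f : ℍ → A → ℂ) 0
    have h0 : cosetMean (D.slash κ) D.Del (D.xi m) (0 : ℍ → A → ℂ) = 0 := by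
      simp [cosetMean, mean]
    rwa [h0, add_zero, add_zero] at h)

end DiscriminantForm

/-! ### Even signature -/

namespace DiscriminantForm

variable {A : Type*} [AddCommGroup A] [Fintype A] (D : DiscriminantForm A)

lemma weilEnd_one : D.weilEnd 1 = 1 := by rw [weilEnd, map_one, Units.val_one]

variable {D}

lemma EvenSig.weilEnd_mpNeg (h : D.EvenSig) : D.weilEnd mpNeg = 1 := by
  have hg := D.gz_one_ne_zero
  refine LinearMap.ext fun a => funext fun y => ?_
  have h1 : ∀ (a : A → ℂ) (y : A),
      D.weilEnd (mpS * mpS) a y = Fintype.card A / D.gz 1 ^ 2 * a (-y) := fun a y => by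
    rw [weilEnd_mul_apply, weilEnd, weil_mpS, weilS_sq_apply]
  rw [mpNeg, weilEnd_mul_apply, h1, h1, neg_neg, ← mul_assoc, div_mul_div_comm,
    show D.gz 1 ^ 2 * D.gz 1 ^ 2 = D.gz 1 ^ 4 by ring, h, sq, div_self, one_mul]
  · rfl
  · have : (Fintype.card A : ℂ) ≠ 0 := by exact_mod_cast Fintype.card_ne_zero
    exact mul_ne_zero this this

lemma EvenSig.weilEnd_congr (h : D.EvenSig) {g g' : MpZ} (hg : toSL g = toSL g') :
    D.weilEnd g = D.weilEnd g' := by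
  rcases eq_or_eq_mpNeg_mul hg with rfl | rfl
  · rfl
  · rw [weilEnd_mul, h.weilEnd_mpNeg, one_mul]

lemma Killed.weilEnd_T_zpow_mul {N : ℕ} (hN : D.Killed N) (k : ℤ) :
    D.weilEnd (mpT ^ (N * k)) = 1 := by
  refine LinearMap.ext fun a => ?_
  rw [weilEnd_T_zpow]
  funext x
  rw [mul_comm (N : ℤ), mul_smul, natCast_zsmul, hN x, smul_zero, e_zero, one_mul]
  rfl

lemma Killed.weilEnd_V_zpow_mul {N : ℕ} (hN : D.Killed N) (k : ℤ) :
    D.weilEnd (mpV ^ (N * k)) = 1 := by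
  rw [mpV_zpow, weilEnd_mul, weilEnd_mul, ← mul_neg, hN.weilEnd_T_zpow_mul, mul_one, ← weilEnd_mul,
    mul_inv_cancel, weilEnd_one]

/-- In even signature the character of `Γ₀(N)` attached to `ρ_A` is `ψ`. -/
lemma EvenSig.coef_eq (h : D.EvenSig) {N : ℕ} (hN : D.Killed N) (hpos : 0 < N) (g : MpZ)
    (hd : IsCoprime (toSL g 1 1) N) : D.coef g = D.psi (toSL g 1 1) := by
  have hN0 : (0 : ℤ) < N := by exact_mod_cast hpos
  have key : ∀ g : MpZ, 0 < toSL g 1 1 → IsCoprime (toSL g 1 1) N →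
      D.coef g = D.psi (toSL g 1 1) := by
    intro g h0 hd
    have h1 : D.weilEnd g = D.weilEnd (liftSL (toSL g)) :=
      h.weilEnd_congr (toSL_liftSL _).symm
    lift toSL g 1 1 to ℕ using h0.le with n hn
    rw [coef, h1]
    have := Killed.coef_liftSL N hN hpos (toSL g) n hn.symm (by exact_mod_cast h0) hd
    rw [h.jac, one_mul] at this
    exact this
  -- multiplication by powers of `V^N` and `T^N`, which act trivially, makes the entry positive
  obtain ⟨j, hj⟩ : ∃ j : ℤ, toSL g 1 0 + N * j * toSL g 1 1 ≠ 0 := by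
    by_cases hc : toSL g 1 0 = 0
    · refine ⟨1, ?_⟩
      have := toSL_det g
      rw [hc, mul_zero, sub_zero] at this
      rw [hc, zero_add, mul_one]
      exact mul_ne_zero hN0.ne' (right_ne_zero_of_mul_eq_one this)
    · exact ⟨0, by simpa using hc⟩
  set c := toSL g 1 0 + N * j * toSL g 1 1 with hc
  let k := c * (|toSL g 1 1| + 1)
  let g' := g * mpV ^ (N * j) * mpT ^ (N * k)
  have hd' : toSL g' 1 1 = toSL g 1 1 + N * k * c := by
    simp only [g']
    rw [map_mul, map_mul, SL_mul_apply, SL_mul_apply, SL_mul_apply, toSL_V_zpow, toSL_T_zpow]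
    simp only [matV_zpow_apply, matT_zpow_apply]
    simp [hc]
    ring
  have hw : D.weilEnd g' = D.weilEnd g := by
    simp only [g']
    rw [weilEnd_mul, weilEnd_mul, hN.weilEnd_T_zpow_mul, hN.weilEnd_V_zpow_mul, mul_one, mul_one]
  have hmod : toSL g 1 1 ≡ toSL g' 1 1 [ZMOD N] := by
    rw [hd', Int.modEq_iff_dvd]; exact ⟨k * c, by ring⟩
  have h0 : 0 < toSL g' 1 1 := by
    rw [hd']
    have h2 : 1 ≤ c * c := by nlinarith [Int.one_le_abs hj, abs_mul_abs_self c]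
    have h3 : 1 ≤ N * (c * c) := by nlinarith
    have h4 : 0 ≤ |toSL g 1 1| := abs_nonneg _
    have h5 : N * k * c = N * (c * c) * (|toSL g 1 1| + 1) := by simp only [k]; ring
    have h6 := neg_abs_le (toSL g 1 1)
    rw [h5]
    nlinarith
  have := key g' h0 (isCoprime_of_modEq hmod hd)
  rw [hN.psi_congr hmod, ← this, coef, coef, hw]

/-- In even signature `ρ_A` takes the value `ψ(m) dil m` on elements congruent to
`diag(m, m⁻¹)`. -/
lemma EvenSig.weilEnd_diag (h : D.EvenSig) {N : ℕ} (hN : D.Killed N) (hpos : 0 < N) {g : MpZ}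
    {m : ℤ} (hm : m * toSL g 1 1 ≡ 1 [ZMOD N]) (hb : toSL g 0 1 ≡ 0 [ZMOD N])
    (hc : toSL g 1 0 ≡ 0 [ZMOD N]) : D.weilEnd g = D.psi m • dil m := by
  have h1 : IsCoprime (m * toSL g 1 1) N := isCoprime_of_modEq hm.symm isCoprime_one_left
  have hm1 := h1.of_mul_left_left
  have hd1 := h1.of_mul_left_right
  rw [hN.weilEnd_eq g (d' := m) (y := 0) (z := 0) hm (by simpa using hb.symm)
    (by simpa using hc.symm), h.coef_eq hN hpos g hd1, zpow_zero, zpow_zero, weilEnd_one, one_mul,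
    mul_one]
  congr 1
  have h2 := h.psi_mul hN hpos hm1 hd1
  rw [hN.psi_congr hm, psi_one] at h2
  have h3 := h.psi_sq hN hpos hm1
  calc D.psi (toSL g 1 1) = D.psi m ^ 2 * D.psi (toSL g 1 1) := by rw [h3, one_mul]
    _ = D.psi m * (D.psi m * D.psi (toSL g 1 1)) := by ring
    _ = D.psi m := by rw [← h2, mul_one]

/-- In even signature a nonzero form has integral weight. -/
lemma EvenSig.eq_zero_of_odd (h : D.EvenSig) {κ : ℤ} (hκ : Odd κ) {f : ℍ → A → ℂ}
    (hf : f ∈ invariants (D.slash κ) D.Del) : f = 0 := by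
  funext τ
  have h1 := D.mem_invariants_iff.mp hf mpNeg τ
  change _ = _ • D.weilEnd mpNeg (f τ) at h1
  rw [h.weilEnd_mpNeg, mpNeg_φ, hκ.neg_one_zpow, ← ofSL_toSL, toSL_mpNeg, map_one, moebius_one] at h1
  have h2 : f τ = -f τ := by simpa using h1
  exact self_eq_neg.mp h2

end DiscriminantForm

lemma ratMod_intCast (N : ℕ) (n : ℤ) : ratMod N n = n := by
  simp [ratMod]

/-- The reduction of an integral matrix with determinant `1`. -/
abbrev redSL (N : ℕ) (γ : SL(2, ℤ)) : Matrix (Fin 2) (Fin 2) (ZMod N) :=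
  (γ : Matrix (Fin 2) (Fin 2) ℤ).map (Int.cast : ℤ → ZMod N)

lemma redSL_mul (N : ℕ) (γ δ : SL(2, ℤ)) : redSL N (γ * δ) = redSL N γ * redSL N δ := by
  rw [redSL, Matrix.SpecialLinearGroup.coe_mul]
  exact Matrix.map_mul (f := Int.castRingHom (ZMod N))

lemma redSL_one (N : ℕ) : redSL N 1 = 1 := by
  rw [redSL, Matrix.SpecialLinearGroup.coe_one]
  exact Matrix.map_one (Int.castRingHom (ZMod N)) (map_zero _) (map_one _)

lemma redMod_mul_diagSq_mul (N : ℕ) {m : ℕ} (hm : 0 < m) (δ₁ δ₂ : SL(2, ℤ)) :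
    redMod N (ofSL δ₁ * diagSq m hm * ofSL δ₂) =
      redSL N δ₁ * !![(m : ZMod N) ^ 2, 0; 0, 1] * redSL N δ₂ := by
  let W : Matrix (Fin 2) (Fin 2) ℤ := δ₁.1 * !![(m : ℤ) ^ 2, 0; 0, 1] * δ₂.1
  have key : ∀ {R : Type} [CommRing R] (f : ℤ →+* R),
      W.map f = δ₁.1.map f * !![(m : R) ^ 2, 0; 0, 1] * δ₂.1.map f := by
    intro R _ f
    have h0 : (!![(m : ℤ) ^ 2, 0; 0, 1] : Matrix (Fin 2) (Fin 2) ℤ).map f =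
        !![(m : R) ^ 2, 0; 0, 1] := by
      ext i j
      fin_cases i <;> fin_cases j <;> simp
    rw [← h0, ← Matrix.map_mul, ← Matrix.map_mul]
  have h1 : mat (ofSL δ₁ * diagSq m hm * ofSL δ₂) = W.map (Int.castRingHom ℚ) := by
    rw [key]; rfl
  have h2 := key (Int.castRingHom (ZMod N))
  change _ = redSL N δ₁ * _ * redSL N δ₂ at h2
  rw [redMod, h1, ← h2]
  ext i j
  exact ratMod_intCast N _

namespace DiscriminantForm

variable {A : Type*} [AddCommGroup A] [Fintype A] {D : DiscriminantForm A}

lemma exists_redSL_eq (m : D.CoprimeIndex) : ∃ γ : SL(2, ℤ), redSL D.level γ =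
    (((ZMod.unitOfCoprime m.1 m.2.2)⁻¹ : (ZMod D.level)ˣ) : ZMod D.level) •
      !![(m.1 : ZMod D.level) ^ 2, 0; 0, 1] := by
  set N := D.level
  have hco : IsCoprime (m.1 : ℤ) ((N : ℤ) * N) := by
    have := Nat.isCoprime_iff_coprime.mpr m.2.2
    exact this.mul_right this
  obtain ⟨d, k, hdk⟩ := hco
  refine ⟨⟨!![(m.1 : ℤ), N; -(N * k), d], by
    rw [Matrix.det_fin_two_of]; linear_combination hdk⟩, ?_⟩
  have hu : (m.1 : ZMod N) * ((ZMod.unitOfCoprime m.1 m.2.2)⁻¹ : (ZMod N)ˣ) = 1 := by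
    have := (ZMod.unitOfCoprime m.1 m.2.2).mul_inv
    exact this
  have hd : (d : ZMod N) = ((ZMod.unitOfCoprime m.1 m.2.2)⁻¹ : (ZMod N)ˣ) := by
    have h1 := congrArg (Int.cast : ℤ → ZMod N) hdk
    push_cast at h1
    rw [ZMod.natCast_self, mul_zero, mul_zero, add_zero] at h1
    exact left_inv_eq_right_inv h1 hu
  ext i j
  fin_cases i <;> fin_cases j
  · change ((m.1 : ℤ) : ZMod N) = _ * (m.1 : ZMod N) ^ 2
    push_cast
    linear_combination -(m.1 : ZMod N) * hu
  · change ((N : ℤ) : ZMod N) = _ * 0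
    simp
  · change ((-(N * k) : ℤ) : ZMod N) = _ * 0
    simp
  · change (d : ZMod N) = _ * 1
    rw [hd, mul_one]

/-- The extension of `ρ_A` to the double coset of `(diag(m², 1), m)`. -/
lemma EvenSig.weilQ_eq (h : D.EvenSig) (m : D.CoprimeIndex) (g₁ g₂ : MpZ) :
    D.weilQ (ofSL (toSL g₁) * diagSq m.1 m.2.1 * ofSL (toSL g₂)) (ZMod.unitOfCoprime m.1 m.2.2) =
      D.weilEnd g₁ * dil m.1 * D.weilEnd g₂ := by
  set N := D.level with hNdef
  have hN : D.Killed N := D.killed_level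
  have hpos : 0 < N := D.level_pos
  set r := ZMod.unitOfCoprime m.1 m.2.2 with hr
  have hex : ∃ γ : SL(2, ℤ), (γ : Matrix (Fin 2) (Fin 2) ℤ).map (Int.cast : ℤ → ZMod N) =
      ((r⁻¹ : (ZMod N)ˣ) : ZMod N) •
        redMod N (ofSL (toSL g₁) * diagSq m.1 m.2.1 * ofSL (toSL g₂)) := by
    obtain ⟨γ, hγ⟩ := exists_redSL_eq m
    refine ⟨toSL g₁ * γ * toSL g₂, ?_⟩
    rw [redMod_mul_diagSq_mul]
    change redSL N _ = _
    rw [redSL_mul, redSL_mul, hγ, Matrix.mul_smul, Matrix.smul_mul]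
  rw [weilQ, dif_pos hex]
  set γ := hex.choose
  have hγ : redSL N γ = ((r⁻¹ : (ZMod N)ˣ) : ZMod N) •
      redMod N (ofSL (toSL g₁) * diagSq m.1 m.2.1 * ofSL (toSL g₂)) := hex.choose_spec
  rw [redMod_mul_diagSq_mul] at hγ
  set g := g₁⁻¹ * liftSL γ * g₂⁻¹ with hg
  have hred : redSL N (toSL g) = ((r⁻¹ : (ZMod N)ˣ) : ZMod N) • !![(m.1 : ZMod N) ^ 2, 0; 0, 1] := by
    rw [hg, map_mul, map_mul, toSL_liftSL, redSL_mul, redSL_mul, hγ, Matrix.mul_smul,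
      Matrix.smul_mul]
    congr 1
    calc _ = redSL N (toSL g₁⁻¹) * redSL N (toSL g₁) * !![(m.1 : ZMod N) ^ 2, 0; 0, 1] *
        (redSL N (toSL g₂) * redSL N (toSL g₂⁻¹)) := by simp only [mul_assoc]
      _ = _ := by
        rw [← redSL_mul, ← redSL_mul, ← map_mul, ← map_mul, inv_mul_cancel, mul_inv_cancel,
          map_one, redSL_one, one_mul, mul_one]
  have h11 : ((m.1 : ℤ) * toSL g 1 1) ≡ 1 [ZMOD N] := by
    rw [← ZMod.intCast_eq_intCast_iff]
    have h1 : ((toSL g 1 1 : ℤ) : ZMod N) = ((r⁻¹ : (ZMod N)ˣ) : ZMod N) * 1 :=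
      congrFun (congrFun hred 1) 1
    push_cast
    rw [h1, mul_one]
    exact r.mul_inv
  have h01 : toSL g 0 1 ≡ 0 [ZMOD N] := by
    rw [← ZMod.intCast_eq_intCast_iff]
    have h1 : ((toSL g 0 1 : ℤ) : ZMod N) = ((r⁻¹ : (ZMod N)ˣ) : ZMod N) * 0 :=
      congrFun (congrFun hred 0) 1
    rw [h1]; simp
  have h10 : toSL g 1 0 ≡ 0 [ZMOD N] := by
    rw [← ZMod.intCast_eq_intCast_iff]
    have h1 : ((toSL g 1 0 : ℤ) : ZMod N) = ((r⁻¹ : (ZMod N)ˣ) : ZMod N) * 0 :=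
      congrFun (congrFun hred 1) 0
    rw [h1]; simp
  have hw := h.weilEnd_diag hN hpos h11 h01 h10
  have hlift : D.weilEnd (liftSL γ) = D.psi m.1 • (D.weilEnd g₁ * dil m.1 * D.weilEnd g₂) := by
    have : liftSL γ = g₁ * g * g₂ := by rw [hg]; group
    rw [this, weilEnd_mul, weilEnd_mul, hw, mul_smul_comm, smul_mul_assoc]
  have hval : D.gauss (r : ZMod N).val = D.gz m.1 := by
    rw [gauss_eq_gz]
    apply hN.gz_congr
    have : NeZero N := ⟨hpos.ne'⟩
    rw [← ZMod.intCast_eq_intCast_iff]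
    push_cast
    rw [ZMod.natCast_val, ZMod.cast_id]
    rfl
  have hmN : IsCoprime (m.1 : ℤ) N := Nat.isCoprime_iff_coprime.mpr m.2.2
  change (D.gauss 1 / D.gauss (r : ZMod N).val) • D.weilEnd (liftSL γ) = _
  rw [hlift, smul_smul, hval, gauss_eq_gz, psi]
  have h1 := D.gz_one_ne_zero
  have h2 := hN.gz_ne_zero hmN
  rw [Nat.cast_one, div_mul_div_cancel₀ h2, div_self h1, one_smul]

/-- In even signature the slash operators of both kinds of triples agree. -/
lemma EvenSig.slashEven_eq (h : D.EvenSig) (k : ℤ) (f : ℍ → A → ℂ) (m : D.CoprimeIndex)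
    (g₁ g₂ : MpZ) :
    D.slashEven k f (D.sectionL g₁ * D.xi m * D.sectionL g₂).1.M (ZMod.unitOfCoprime m.1 m.2.2) =
      D.slashOdd (2 * k) f (D.sectionL g₁ * D.xi m * D.sectionL g₂) := by
  set ζ := D.sectionL g₁ * D.xi m * D.sectionL g₂ with hζ
  have hM : ζ.1.M = ofSL (toSL g₁) * diagSq m.1 m.2.1 * ofSL (toSL g₂) := by
    rw [ofSL_toSL, ofSL_toSL]; rfl
  have hu : D.weilQ ζ.1.M (ZMod.unitOfCoprime m.1 m.2.2) = (ζ.2.2 : Module.End ℂ (A → ℂ)) := by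
    rw [hM, h.weilQ_eq m g₁ g₂, ← dilation_val]; rfl
  funext τ
  rw [slashEven, slashOdd, hu, Ring.inverse_unit, ← ζ.1.sq, ← zpow_natCast, ← zpow_mul]
  have he : (k : ℝ) / 2 = ((2 * k : ℤ) : ℝ) / 4 := by push_cast; ring
  have he' : ((2 : ℕ) : ℤ) * -k = -(2 * k) := by push_cast; ring
  rw [he, he']

/-- In even signature the operator of the double coset `Γ diag(m², 1) Γ` is the operator of the double
coset of `ξ_m`. -/
lemma EvenSig.heckeEven_eq (h : D.EvenSig) {k : ℤ} {f : ℍ → A → ℂ}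
    (hf : f ∈ invariants (D.slash (2 * k)) D.Del) (m : D.CoprimeIndex) :
    D.heckeEven k (diagSq m.1 m.2.1) (ZMod.unitOfCoprime m.1 m.2.2) f =
      D.heckeOdd (2 * k) (D.xi m) f := by
  set ξ := D.xi m with hξ
  -- representatives of the cosets in both double cosets are parametrised by the same set
  let ζ : D.Del ⧸ stab D.Del ξ → D.TripleGroup := fun c => ξ * ((Quotient.out c)⁻¹ : D.Del)
  let F : D.Del ⧸ stab D.Del ξ → Quotient (QuotientGroup.rightRel ofSL.range) :=
    fun c => Quotient.mk _ (ζ c).1.M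
  have hinj : Function.Injective F := by
    intro c c' hcc
    have h1 := Quotient.exact hcc
    change (QuotientGroup.rightRel ofSL.range) _ _ at h1
    rw [QuotientGroup.rightRel_apply] at h1
    rw [← Quotient.out_eq c, ← Quotient.out_eq c']
    apply QuotientGroup.eq.mpr
    rw [mem_stab]
    obtain ⟨y, hy⟩ := (c.out⁻¹ * c'.out).2
    have hy' : mpDiag m.1 m.2.1 * y.1 * (mpDiag m.1 m.2.1)⁻¹ ∈ MpZ := by
      have h2 := ofSL.range.inv_mem h1
      change (mpDiag m.1 m.2.1 * y.1 * (mpDiag m.1 m.2.1)⁻¹).M ∈ ofSL.range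
      have h3 : y.1 = ((c.out⁻¹ * c'.out : D.Del) : D.TripleGroup).1 := by rw [← hy]; rfl
      have h4 : (mpDiag m.1 m.2.1 * y.1 * (mpDiag m.1 m.2.1)⁻¹).M =
          ((ζ c').1.M * ((ζ c).1.M)⁻¹)⁻¹ := by
        change _ = (((ζ c') * (ζ c)⁻¹)⁻¹).1.M
        rw [h3]
        simp only [ζ]
        have : (ξ * ((c'.out)⁻¹ : D.Del) * (ξ * ((c.out)⁻¹ : D.Del))⁻¹)⁻¹ =
          ξ * ((c.out⁻¹ * c'.out : D.Del) : D.TripleGroup) * ξ⁻¹ := by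
            push_cast; group
        rw [this]; rfl
      rw [h4]; exact h2
    have hrel : mpDiag m.1 m.2.1 * y.1 = (⟨_, hy'⟩ : MpZ).1 * mpDiag m.1 m.2.1 := by
      rw [inv_mul_cancel_right]
    have h5 := D.xi_mul_sectionL m hrel
    rw [← hy, h5, mul_inv_cancel_right]
    exact ⟨_, rfl⟩
  have hrange : Set.range F = (Quotient.mk (QuotientGroup.rightRel ofSL.range)) ''
      DoubleCoset.doubleCoset (diagSq m.1 m.2.1) (ofSL.range : Set GL(2, ℚ)⁺) ofSL.range := by
    have h1 : Set.range (cosetMap D.Del ξ) = _ := range_cosetMap ξ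
    ext q
    constructor
    · rintro ⟨c, rfl⟩
      refine ⟨(ζ c).1.M, ?_, rfl⟩
      obtain ⟨y, hy⟩ := ((Quotient.out c)⁻¹ : D.Del).2
      rw [DoubleCoset.mem_doubleCoset]
      refine ⟨1, ofSL.range.one_mem, ofSL (toSL y), ⟨_, rfl⟩, ?_⟩
      simp only [ζ]
      rw [one_mul, ofSL_toSL, ← hy]; rfl
    · rintro ⟨x, hx, rfl⟩
      rw [DoubleCoset.mem_doubleCoset] at hx
      obtain ⟨_, ⟨a, rfl⟩, _, ⟨b, rfl⟩, rfl⟩ := hx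
      have h2 : (Quotient.mk (QuotientGroup.rightRel D.Del)
          (D.sectionL (liftSL a) * ξ * D.sectionL (liftSL b))) ∈ Set.range (cosetMap D.Del ξ) := by
        rw [h1]
        refine ⟨_, ?_, rfl⟩
        rw [DoubleCoset.mem_doubleCoset]
        exact ⟨_, ⟨_, rfl⟩, _, ⟨_, rfl⟩, rfl⟩
      obtain ⟨c, hc⟩ := h2
      refine ⟨c, ?_⟩
      have h3 := Quotient.exact hc
      change (QuotientGroup.rightRel D.Del) _ _ at h3
      rw [QuotientGroup.rightRel_apply] at h3
      obtain ⟨y, hy⟩ := h3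
      apply Quotient.sound
      change (QuotientGroup.rightRel ofSL.range) _ _
      rw [QuotientGroup.rightRel_apply]
      refine ⟨toSL y, ?_⟩
      rw [ofSL_toSL]
      exact congrArg (fun t : D.TripleGroup => t.1.M) hy
  have hterm : ∀ c, D.slashEven k f (Quotient.out (F c)) (ZMod.unitOfCoprime m.1 m.2.2) =
      D.slashOdd (2 * k) f (ζ c) := by
    intro c
    have h1 : (QuotientGroup.rightRel ofSL.range) (ζ c).1.M (Quotient.out (F c)) :=
      Quotient.exact (Quotient.out_eq (F c)).symm
    rw [QuotientGroup.rightRel_apply] at h1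
    obtain ⟨a, ha⟩ := h1
    obtain ⟨y, hy⟩ := ((Quotient.out c)⁻¹ : D.Del).2
    have hζ : ζ c = ξ * D.sectionL y := by simp only [ζ]; rw [hy]
    have h2 : Quotient.out (F c) = (D.sectionL (liftSL a) * ξ * D.sectionL y).1.M := by
      rw [mul_assoc, ← hζ]
      change _ = ofSL a * (ζ c).1.M
      rw [ha, inv_mul_cancel_right]
    rw [h2, h.slashEven_eq, mul_assoc, ← hζ, slashOdd_mul]
    have := hf (D.sectionL (liftSL a)) ⟨_, rfl⟩
    rw [ract_slash] at this
    rw [this]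
  have hcoe : (((k : ℝ) / 2 - 1)) = (((2 * k : ℤ) : ℝ) / 4 - 1) := by push_cast; ring
  rw [heckeEven, heckeOdd_eq, ← hrange, finsum_mem_range hinj, cosetSum, ← range_cosetMap,
    finsum_mem_range (cosetMap_injective ξ), hcoe]
  congr 1
  refine finsum_congr fun c => ?_
  rw [hterm, cosetMap, ract_out hf, ract_slash]

/-- The factor by which `T(m²)*` differs from the normalised operator. -/
def heckeFactor (D : DiscriminantForm A) (κ : ℤ) (m : D.CoprimeIndex) : ℝ :=
  ((m.1 : ℝ) ^ 2) ^ ((κ : ℝ) / 4 - 1) * (stab D.Del (D.xi m)).index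

lemma heckeFactor_ne_zero (κ : ℤ) (m : D.CoprimeIndex) : D.heckeFactor κ m ≠ 0 := by
  have h1 : (0 : ℝ) < m.1 := by exact_mod_cast m.2.1
  have h2 : ((stab D.Del (D.xi m)).index : ℝ) ≠ 0 := by
    exact_mod_cast (D.finCoset_xi m).index_ne_zero
  exact mul_ne_zero (Real.rpow_pos_of_pos (pow_pos h1 2) _).ne' h2

lemma heckeOdd_xi {κ : ℤ} {f : ℍ → A → ℂ} (hf : f ∈ invariants (D.slash κ) D.Del)
    (m : D.CoprimeIndex) :
    D.heckeOdd κ (D.xi m) f = (D.heckeFactor κ m : ℂ) • D.heckeMean κ (D.xi m) f := by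
  rw [heckeOdd_eq, cosetSum_eq (D.finCoset_xi m) hf, smul_smul, heckeFactor]
  have h1 : detQ (D.xi m).1.M = (m.1 : ℚ) ^ 2 := detQ_diagSq m.2.1
  rw [h1]
  push_cast
  rfl

lemma heckeSq_eq {κ : ℤ} {f : ℍ → A → ℂ} (hf : f ∈ invariants (D.slash κ) D.Del)
    (m : D.CoprimeIndex) :
    D.heckeSq κ m f = (D.heckeFactor κ m : ℂ) • D.heckeMean κ (D.xi m) f := by
  rw [heckeSq]
  split_ifs with h
  · have hE := D.evenSig_iff.mpr h
    rcases Int.even_or_odd κ with hκ | hκ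
    · obtain ⟨k, rfl⟩ := hκ
      rw [← two_mul] at hf ⊢
      rw [Int.mul_ediv_cancel_left _ two_ne_zero, hE.heckeEven_eq hf, heckeOdd_xi hf]
    · rw [hE.eq_zero_of_odd hκ hf]
      have h0 : ∀ M r, D.slashEven (κ / 2) (0 : ℍ → A → ℂ) M r = 0 := fun M r => by
        funext τ; simp [slashEven]
      simp [heckeEven, h0, cosetMean, mean]
  · exact heckeOdd_xi hf m

end DiscriminantForm

/-! ### Unfolding -/

section Unfolding

open MeasureTheory
open scoped ENNReal

variable {X : Type*} [m0 : MeasurableSpace X] (μ : Measure X)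

/-- Two weights with the same sum over the orbits of `K` give the same integral to every
`K`-invariant function. -/
lemma integral_withDensity_eq {K : Type*} [Group K] [Countable K] [MulAction K X]
    [MeasurableConstSMul K X] [SMulInvariantMeasure K X μ] {w v : X → ℝ≥0∞} (hw : Measurable w)
    (hv : Measurable v) {c : ℝ≥0∞} (hc0 : c ≠ 0) (hc : c ≠ ∞)
    (hwc : ∀ᵐ x ∂μ, ∑' k : K, w (k • x) = c) (hvc : ∀ᵐ x ∂μ, ∑' k : K, v (k • x) = c)
    {Φ : X → ℂ} (hΦ : Measurable Φ) (hinv : ∀ (k : K) (x : X), Φ (k • x) = Φ x) :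
    ∫ x, Φ x ∂(μ.withDensity w) = ∫ x, Φ x ∂(μ.withDensity v) := by
  have key : ∀ s, MeasurableSet s → (∀ (k : K) x, k • x ∈ s ↔ x ∈ s) →
      μ.withDensity w s = μ.withDensity v s := by
    intro s hs hsK
    have h1 : ∀ w v : X → ℝ≥0∞, Measurable w → Measurable v →
        (∀ᵐ x ∂μ, ∑' k : K, v (k • x) = c) →
        c * μ.withDensity w s = ∑' k : K, ∫⁻ x, s.indicator 1 x * (w x * v (k • x)) ∂μ := by
      intro w v hw hv hvc
      have hmeas : ∀ k : K, Measurable fun x => s.indicator 1 x * (w x * v (k • x)) := fun k =>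
        (measurable_one.indicator hs).mul (hw.mul (hv.comp (measurable_const_smul k)))
      rw [← lintegral_tsum fun k => (hmeas k).aemeasurable, withDensity_apply _ hs,
        ← lintegral_indicator hs, ← lintegral_const_mul _ (hw.indicator hs)]
      refine lintegral_congr_ae ?_
      filter_upwards [hvc] with x hx
      rw [ENNReal.tsum_mul_left, ENNReal.tsum_mul_left, hx]
      by_cases hxs : x ∈ s <;> simp [hxs, mul_comm]
    refine (ENNReal.mul_right_inj hc0 hc).mp ?_
    rw [h1 w v hw hv hvc, h1 v w hv hw hwc, ← (Equiv.inv K).tsum_eq]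
    refine tsum_congr fun k => ?_
    rw [← (measurePreserving_smul k μ).lintegral_comp_emb (measurableEmbedding_const_smul k)]
    refine lintegral_congr fun x => ?_
    have : s.indicator (1 : X → ℝ≥0∞) (k • x) = s.indicator 1 x := by
      by_cases hxs : x ∈ s
      · rw [Set.indicator_of_mem hxs, Set.indicator_of_mem ((hsK k x).mpr hxs)]; rfl
      · rw [Set.indicator_of_notMem hxs, Set.indicator_of_notMem fun h => hxs ((hsK k x).mp h)]
    rw [this, Equiv.inv_apply, inv_smul_smul, mul_comm (w _)]
  -- both measures agree on the σ-algebra of invariant sets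
  let m : MeasurableSpace X :=
    { MeasurableSet' := fun s => MeasurableSet[m0] s ∧ ∀ (k : K) x, k • x ∈ s ↔ x ∈ s
      measurableSet_empty := ⟨MeasurableSet.empty, fun _ _ => Iff.rfl⟩
      measurableSet_compl := fun s hs => ⟨hs.1.compl, fun k x => not_congr (hs.2 k x)⟩
      measurableSet_iUnion := fun s hs => ⟨MeasurableSet.iUnion fun i => (hs i).1, fun k x => by
        simp only [Set.mem_iUnion, (hs _).2]⟩ }
  have hm : m ≤ m0 := fun s hs => hs.1
  have hΦm : StronglyMeasurable[m] Φ := by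
    have : @Measurable X ℂ m _ Φ := fun t ht =>
      ⟨hΦ ht, fun k x => by rw [Set.mem_preimage, Set.mem_preimage, hinv]⟩
    exact this.stronglyMeasurable
  rw [integral_trim hm hΦm, integral_trim hm hΦm]
  congr 1
  refine @Measure.ext _ m _ _ fun s hs => ?_
  rw [trim_measurableSet_eq hm hs, trim_measurableSet_eq hm hs]
  exact key s hs.1 hs.2

variable {G : Type*} [Group G] [MulAction G X] [MeasurableConstSMul G X]
  [SMulInvariantMeasure G X μ]

/-- The weight `∑ 1_F(yx)`, with `y` running over representatives of `Δ / L`. -/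
def cosetWeight {Δ : Subgroup G} (L : Subgroup Δ) (F : Set X) (x : X) : ℝ≥0∞ :=
  ∑' c : Δ ⧸ L, F.indicator 1 (Quotient.out c • x)

lemma measurable_cosetWeight {Δ : Subgroup G} (L : Subgroup Δ) [L.FiniteIndex] {F : Set X}
    (hF : MeasurableSet F) : Measurable (cosetWeight L F) :=
  Measurable.tsum fun c =>
    (measurable_one.indicator hF).comp (measurable_const_smul (Quotient.out c))

lemma tsum_cosetWeight {Δ : Subgroup G} (L : Subgroup Δ) (F : Set X) (x : X) :
    ∑' l : L, cosetWeight L F (l • x) = ∑' δ : Δ, F.indicator (1 : X → ℝ≥0∞) (δ • x) := by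
  have hbij : Function.Bijective fun p : (Δ ⧸ L) × L => p.1.out * (p.2 : Δ) := by
    constructor
    · rintro ⟨c, l⟩ ⟨c', l'⟩ h
      have h1 : c = c' := by
        have := congrArg (QuotientGroup.mk (s := L)) h
        simpa [QuotientGroup.mk_mul_of_mem] using this
      subst h1
      exact Prod.ext rfl (Subtype.ext (mul_left_cancel h))
    · intro g
      have h1 : (Quotient.out (g : Δ ⧸ L))⁻¹ * g ∈ L := by
        rw [← QuotientGroup.eq]; exact Quotient.out_eq _
      exact ⟨(g, ⟨_, h1⟩), mul_inv_cancel_left _ _⟩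
  let E : (Δ ⧸ L) × L ≃ Δ := Equiv.ofBijective _ hbij
  have hE : ∀ p : (Δ ⧸ L) × L, E p = p.1.out * p.2 := fun p => rfl
  unfold cosetWeight
  rw [← E.tsum_eq fun δ : Δ => F.indicator (1 : X → ℝ≥0∞) (δ • x), ENNReal.tsum_comm,
    ENNReal.tsum_prod']
  refine tsum_congr fun c => tsum_congr fun l => ?_
  rw [hE, mul_smul]; rfl

lemma integral_cosetWeight {Δ : Subgroup G} (L : Subgroup Δ) [L.FiniteIndex] {F : Set X}
    (hF : MeasurableSet F) {Φ : X → ℂ}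
    (hint : ∀ y : Δ, IntegrableOn (fun x => Φ (y⁻¹ • x)) F μ) :
    ∫ x, Φ x ∂(μ.withDensity (cosetWeight L F)) =
      ∑ᶠ c : Δ ⧸ L, ∫ x in F, Φ ((Quotient.out c)⁻¹ • x) ∂μ := by
  have := Fintype.ofFinite (Δ ⧸ L)
  have h1 : ∀ c : Δ ⧸ L, Measurable fun x : X =>
      F.indicator (1 : X → ℝ≥0∞) (Quotient.out c • x) := fun c =>
    (measurable_one.indicator hF).comp (measurable_const_smul (Quotient.out c))
  have h2 : μ.withDensity (cosetWeight L F) =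
      ∑ c : Δ ⧸ L, μ.restrict ((fun x => Quotient.out c • x) ⁻¹' F) := by
    have : cosetWeight L F = ∑' c : Δ ⧸ L, fun x => F.indicator 1 (Quotient.out c • x) := by
      funext x
      rw [cosetWeight, ENNReal.tsum_apply]
    rw [this, withDensity_tsum h1, Measure.sum_fintype]
    refine Finset.sum_congr rfl fun c _ => ?_
    rw [← withDensity_indicator_one (hF.preimage (measurable_const_smul _))]
    rfl
  have h3 : ∀ c : Δ ⧸ L, ∀ g : X → ℂ,
      ∫ x in (fun x => Quotient.out c • x) ⁻¹' F, g (Quotient.out c • x) ∂μ = ∫ x in F, g x ∂μ :=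
    fun c g => (measurePreserving_smul (Quotient.out c) μ).setIntegral_preimage_emb
      (measurableEmbedding_const_smul _) g F
  have h4 : ∀ c : Δ ⧸ L, Integrable Φ (μ.restrict ((fun x => Quotient.out c • x) ⁻¹' F)) := by
    intro c
    have h := ((measurePreserving_smul (Quotient.out c) μ).integrableOn_comp_preimage
      (measurableEmbedding_const_smul _)).mpr (hint (Quotient.out c))
    refine h.congr_fun (fun x _ => ?_) (hF.preimage (measurable_const_smul _))
    simp
  rw [h2, integral_finsetSum_measure fun c _ => h4 c, finsum_eq_sum_of_fintype]
  refine Finset.sum_congr rfl fun c _ => ?_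
  rw [← h3 c]
  simp only [inv_smul_smul]

/-- Let `F` be a fundamental domain for `Δ`, in the sense that almost all `Δ`-orbits meet it the same
number of times. The integral over `F` of the sum of the translates of `Φ` by `Δ / (Δ ∩ ξ⁻¹Δξ)` does
not change when `Φ` is replaced by `Φ ∘ ξ⁻¹` and `ξ` by `ξ⁻¹`. -/
lemma finsum_integral_eq {Δ : Subgroup G} [Countable Δ] {F : Set X} (hF : MeasurableSet F)
    {c : ℝ≥0∞} (hc0 : c ≠ 0) (hc : c ≠ ∞)
    (hFc : ∀ᵐ x ∂μ, ∑' δ : Δ, F.indicator (1 : X → ℝ≥0∞) (δ • x) = c) {ξ : G}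
    (hξ : FinCoset Δ ξ) (hξ' : FinCoset Δ ξ⁻¹) {Φ : X → ℂ} (hΦ : Measurable Φ)
    (hinv : ∀ (k : stab Δ ξ) (x : X), Φ (k • x) = Φ x)
    (hint : ∀ y : Δ, IntegrableOn (fun x => Φ (y⁻¹ • x)) F μ)
    (hint' : ∀ y : Δ, IntegrableOn (fun x => Φ (ξ⁻¹ • y⁻¹ • x)) F μ) :
    ∑ᶠ c : Δ ⧸ stab Δ ξ, ∫ x in F, Φ ((Quotient.out c)⁻¹ • x) ∂μ =
      ∑ᶠ c : Δ ⧸ stab Δ ξ⁻¹, ∫ x in F, Φ (ξ⁻¹ • (Quotient.out c)⁻¹ • x) ∂μ := by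
  have hw := measurable_cosetWeight (X := X) (stab Δ ξ) hF
  have hw' := measurable_cosetWeight (X := X) (stab Δ ξ⁻¹) hF
  let conj : stab Δ ξ ≃ stab Δ ξ⁻¹ :=
    { toFun := fun y => ⟨⟨ξ * y.1 * ξ⁻¹, y.2⟩, by
        rw [mem_stab]; convert y.1.2 using 1; group⟩
      invFun := fun y => ⟨⟨ξ⁻¹ * y.1 * ξ⁻¹⁻¹, y.2⟩, by
        rw [mem_stab]; convert y.1.2 using 1; group⟩
      left_inv := fun y => by ext; simp [mul_assoc]
      right_inv := fun y => by ext; simp [mul_assoc] }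
  have hv : Measurable fun x => cosetWeight (stab Δ ξ⁻¹) F (ξ • x) :=
    hw'.comp (measurable_const_smul ξ)
  rw [← integral_cosetWeight μ (stab Δ ξ) hF hint,
    ← integral_cosetWeight μ (Φ := fun x => Φ (ξ⁻¹ • x)) (stab Δ ξ⁻¹) hF hint',
    integral_withDensity_eq μ (K := stab Δ ξ) hw hv hc0 hc ?_ ?_ hΦ hinv]
  · have h1 : MeasurePreserving (fun x => ξ • x)
        (μ.withDensity fun x => cosetWeight (stab Δ ξ⁻¹) F (ξ • x))
        (μ.withDensity (cosetWeight (stab Δ ξ⁻¹) F)) := by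
      refine ⟨measurable_const_smul ξ, Measure.ext fun s hs => ?_⟩
      rw [Measure.map_apply (measurable_const_smul ξ) hs,
        withDensity_apply _ (hs.preimage (measurable_const_smul ξ)), withDensity_apply _ hs]
      exact (measurePreserving_smul ξ μ).setLIntegral_comp_preimage hs hw'
    rw [← h1.integral_comp (measurableEmbedding_const_smul ξ)]
    simp
  · filter_upwards [hFc] with x hx
    rw [tsum_cosetWeight, hx]
  · have h2 := (measurePreserving_smul ξ μ).quasiMeasurePreserving.ae hFc
    filter_upwards [h2] with x hx
    rw [← hx, ← tsum_cosetWeight (stab Δ ξ⁻¹), ← conj.tsum_eq]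
    refine tsum_congr fun k => ?_
    congr 1
    change ξ • (k.1.1 • x) = (ξ * k.1.1 * ξ⁻¹) • (ξ • x)
    rw [smul_smul, smul_smul, inv_mul_cancel_right]

end Unfolding

/-! ### The action on the upper half plane -/

open MeasureTheory
open scoped ENNReal

lemma continuous_moebius (M : GL(2, ℚ)⁺) : Continuous (moebius M) :=
  (mdifferentiable_moebius M).continuous

lemma measurePreserving_moebius (M : GL(2, ℚ)⁺) :
    MeasurePreserving (moebius M) (volume : Measure ℍ) volume :=
  measurePreserving_smul (toGLReal M) volume

lemma countable_SL : Countable SL(2, ℤ) := by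
  have : Countable (Matrix (Fin 2) (Fin 2) ℤ) := inferInstanceAs (Countable (Fin 2 → Fin 2 → ℤ))
  exact Function.Injective.countable (f := fun γ : SL(2, ℤ) => γ.1) Subtype.val_injective

lemma countable_MpZ : Countable MpZ := by
  have := countable_SL
  have hs : Function.Surjective fun p : SL(2, ℤ) × Bool =>
      if p.2 then liftSL p.1 else mpNeg * liftSL p.1 := by
    intro g
    rcases eq_or_eq_mpNeg_mul (g := g) (h := liftSL (toSL g)) (toSL_liftSL _).symm with h | h
    · exact ⟨(toSL g, true), h.symm⟩
    · exact ⟨(toSL g, false), h.symm⟩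
  exact hs.countable

lemma measurableSet_fd : MeasurableSet ModularGroup.fd := ModularGroup.isClosed_fd.measurableSet

lemma volume_fd_diff_fdo : (volume : Measure ℍ) (ModularGroup.fd \ ModularGroup.fdo) = 0 := by
  rw [UpperHalfPlane.volume_eq_lintegral]
  refine setLIntegral_measure_zero _ _ ?_
  have h1 : ∀ a : ℝ, (volume : Measure ℂ) {z | z.re = a} = 0 := by
    intro a
    have h := Complex.volume_preserving_equiv_real_prod.measure_preimage_equiv ({a} ×ˢ Set.univ)
    have h2 : (volume : Measure (ℝ × ℝ)) ({a} ×ˢ Set.univ) = 0 := by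
      rw [Measure.volume_eq_prod, Measure.prod_prod]; simp
    rw [h2] at h
    refine measure_mono_null (fun z hz => ?_) h
    simpa using hz
  have h2 : (volume : Measure ℂ) (Metric.sphere 0 1) = 0 := Measure.addHaar_sphere _ _ _
  refine measure_mono_null ?_ (measure_union_null (measure_union_null (h1 (1 / 2)) (h1 (-(1 / 2)))) h2)
  rintro _ ⟨τ, ⟨hτ, hτ'⟩, rfl⟩
  have h3 : (τ : ℂ) ∈ ((↑) '' ModularGroup.fd : Set ℂ) := ⟨τ, hτ, rfl⟩
  have h4 : (τ : ℂ) ∉ ((↑) '' ModularGroup.fdo : Set ℂ) := by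
    rintro ⟨τ', h, h'⟩
    exact hτ' (UpperHalfPlane.ext h' ▸ h)
  rw [ModularGroup.coe_fd] at h3
  rw [ModularGroup.coe_fdo] at h4
  obtain ⟨h5, h6, h7⟩ := h3
  by_contra hcon
  simp only [Set.mem_union, Set.mem_ofPred_eq, not_or, mem_sphere_zero_iff_norm] at hcon
  refine h4 ⟨h5, lt_of_le_of_ne h6 (Ne.symm hcon.2), lt_of_le_of_ne h7 fun h => ?_⟩
  rcases (abs_eq (by norm_num)).mp h with h | h
  · exact hcon.1.1 h
  · exact hcon.1.2 h

lemma volume_fd_lt_top : (volume : Measure ℍ) ModularGroup.fd < ∞ := by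
  rw [UpperHalfPlane.volume_eq_lintegral]
  have hsub : ((↑) '' ModularGroup.fd : Set ℂ) ⊆
      Complex.measurableEquivRealProd ⁻¹' (Set.Icc (-(1 / 2)) (1 / 2) ×ˢ Set.Ioi (1 / 2)) := by
    rw [ModularGroup.coe_fd]
    rintro z ⟨h1, h2, h3⟩
    refine ⟨abs_le.mp h3, ?_⟩
    change 1 / 2 < z.im
    have h4 : 1 ≤ Complex.normSq z := by
      rw [Complex.normSq_eq_norm_sq]; nlinarith
    rw [Complex.normSq_apply] at h4
    have h5 := abs_le.mp h3
    nlinarith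
  refine (lintegral_mono_set hsub).trans_lt ?_
  let g : ℝ × ℝ → ℝ≥0∞ := fun p => ((1 / ‖p.2‖₊) ^ 2 : NNReal)
  have h1 := Complex.volume_preserving_equiv_real_prod.setLIntegral_comp_preimage_emb
    Complex.measurableEquivRealProd.measurableEmbedding g
    (Set.Icc (-(1 / 2)) (1 / 2) ×ˢ Set.Ioi (1 / 2))
  have h2 : ∫⁻ p in Set.Icc (-(1 / 2)) (1 / 2) ×ˢ Set.Ioi (1 / 2), g p =
      volume (Set.Icc (-(1 / 2) : ℝ) (1 / 2)) *
        ∫⁻ y in Set.Ioi (1 / 2 : ℝ), ((1 / ‖y‖₊) ^ 2 : NNReal) := by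
    rw [Measure.volume_eq_prod, ← Measure.prod_restrict]
    have := lintegral_prod_mul (μ := volume.restrict (Set.Icc (-(1 / 2) : ℝ) (1 / 2)))
      (ν := volume.restrict (Set.Ioi (1 / 2 : ℝ))) (f := fun _ => 1)
      (g := fun y => (((1 / ‖y‖₊) ^ 2 : NNReal) : ℝ≥0∞)) aemeasurable_const (by fun_prop)
    simpa [g] using this
  have h3 : ∫⁻ y in Set.Ioi (1 / 2 : ℝ), ((1 / ‖y‖₊) ^ 2 : NNReal) < ∞ := by
    have h := (integrableOn_Ioi_rpow_of_lt (a := -2) (by norm_num) (c := 1 / 2) (by norm_num)).2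
    refine lt_of_le_of_lt (le_of_eq ?_) h
    refine setLIntegral_congr_fun measurableSet_Ioi fun y hy => ?_
    have hy0 : 0 < y := lt_trans (by norm_num) hy
    change ((((1 / ‖y‖₊) ^ 2 : NNReal)) : ℝ≥0∞) = ‖y ^ (-2 : ℝ)‖ₑ
    rw [enorm_eq_nnnorm]
    congr 1
    ext
    simp [Real.rpow_neg hy0.le]
  change ∫⁻ z in _, g (Complex.measurableEquivRealProd z) < ∞
  rw [h1, h2]
  exact ENNReal.mul_lt_top (by simp) h3

/-- Almost every point of `ℍ` has all its translates outside the boundary of the fundamental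
domain. -/
lemma ae_smul_mem_fdo : ∀ᵐ τ : ℍ, ∀ γ : SL(2, ℤ), γ • τ ∈ ModularGroup.fd →
    γ • τ ∈ ModularGroup.fdo := by
  have := countable_SL
  rw [ae_all_iff]
  intro γ
  have h0 : ∀ᵐ τ : ℍ, τ ∉ ModularGroup.fd \ ModularGroup.fdo :=
    measure_eq_zero_iff_ae_notMem.mp volume_fd_diff_fdo
  have h1 := (measurePreserving_moebius (ofSL γ)).quasiMeasurePreserving.ae h0
  filter_upwards [h1] with τ hτ h
  rw [moebius_ofSL] at hτ
  by_contra h'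
  exact hτ ⟨h, h'⟩

/-- The number of elements of `Γ̃` over `±1`. -/
def kerCount : ℝ≥0∞ := ∑' g : MpZ, Set.indicator {g : MpZ | toSL g = 1 ∨ toSL g = -1} 1 g

lemma kerCount_ne_zero : kerCount ≠ 0 := by
  intro h
  rw [kerCount, ENNReal.tsum_eq_zero] at h
  have := h 1
  simp at this

lemma kerCount_ne_top : kerCount ≠ ∞ := by
  have hfin : {g : MpZ | toSL g = 1 ∨ toSL g = -1}.Finite := by
    refine Set.Finite.subset (s := {1, mpNeg * 1, mpS * mpS, mpNeg * (mpS * mpS)}) (by simp) ?_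
    rintro g (h | h)
    · rcases eq_or_eq_mpNeg_mul (g := g) (h := 1) (by rw [h, map_one]) with h | h <;> simp [h]
    · rcases eq_or_eq_mpNeg_mul (g := g) (h := mpS * mpS) (by rw [h, toSL_mpS_sq]) with h | h <;>
        simp [h]
  rw [kerCount, tsum_eq_sum (s := hfin.toFinset) fun g hg => by
    rw [Set.indicator_of_notMem]; simpa using hg]
  refine (ENNReal.sum_lt_top.mpr fun g _ => ?_).ne
  exact (Set.indicator_le_self' (fun _ _ => zero_le) g).trans_lt ENNReal.one_lt_top

/-- Almost all orbits of `Γ̃` meet the fundamental domain equally often. -/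
lemma tsum_indicator_fd : ∀ᵐ τ : ℍ,
    ∑' g : MpZ, ModularGroup.fd.indicator (1 : ℍ → ℝ≥0∞) (moebius g.1.M τ) = kerCount := by
  filter_upwards [ae_smul_mem_fdo] with τ hτ
  obtain ⟨γ, hγ⟩ := ModularGroup.exists_smul_mem_fd τ
  have hγ' := hτ γ hγ
  rw [kerCount, ← (Equiv.mulRight (liftSL γ)).tsum_eq]
  refine tsum_congr fun g => ?_
  have h1 : moebius ((Equiv.mulRight (liftSL γ) g : MpZ)).1.M τ = toSL g • γ • τ := by
    rw [← ofSL_toSL, moebius_ofSL, Equiv.coe_mulRight, map_mul, toSL_liftSL, mul_smul]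
  rw [h1]
  by_cases hg : toSL g = 1 ∨ toSL g = -1
  · have h2 : toSL g • γ • τ ∈ ModularGroup.fd := by
      rcases hg with h | h
      · rwa [h, one_smul]
      · rw [h, ModularGroup.SL_neg_smul, one_smul]; exact hγ
    rw [Set.indicator_of_mem h2, Set.indicator_of_mem (by exact hg)]; rfl
  · have h2 : toSL g • γ • τ ∉ ModularGroup.fd := fun h =>
      hg (ModularGroup.eq_one_or_neg_one_of_mem_fdo_mem_fd hγ' h)
    rw [Set.indicator_of_notMem h2, Set.indicator_of_notMem (by exact hg)]

open MeasureTheory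

namespace DiscriminantForm

variable {A : Type*} [AddCommGroup A] [Fintype A] (D : DiscriminantForm A)

/-! ### Unitarity of the Weil representation -/

/-- The standard Hermitian form on `ℂ[A]`. -/
def herm (a b : A → ℂ) : ℂ := ∑ x : A, a x * starRingEnd ℂ (b x)

variable (A) in
/-- The unitary group of `ℂ[A]`. -/
def unitaryGL : Subgroup (LinearMap.GeneralLinearGroup ℂ (A → ℂ)) where
  carrier := {u | ∀ a b, herm ((u : Module.End ℂ (A → ℂ)) a) ((u : Module.End ℂ (A → ℂ)) b) =
    herm a b}
  one_mem' := fun _ _ => rfl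
  mul_mem' := fun {u v} hu hv a b => (hu _ _).trans (hv a b)
  inv_mem' := fun {u} hu a b => by
    rw [← hu]
    have h : ∀ a : A → ℂ, (u : Module.End ℂ (A → ℂ))
        (((u⁻¹ : LinearMap.GeneralLinearGroup ℂ (A → ℂ)) : Module.End ℂ (A → ℂ)) a) = a := fun a => by
      rw [← Module.End.mul_apply, Units.mul_inv]; rfl
    rw [h, h]

lemma herm_smul_smul (c : ℂ) (a b : A → ℂ) : herm (c • a) (c • b) = c * starRingEnd ℂ c * herm a b := by
  simp only [herm, Pi.smul_apply, smul_eq_mul, map_mul, Finset.mul_sum]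
  exact Finset.sum_congr rfl fun x _ => by ring

lemma weil_mem_unitary (g : MpZ) : D.weil g ∈ unitaryGL A := by
  classical
  have hT : D.weil mpT ∈ unitaryGL A := by
    intro a b
    rw [weil_mpT]
    refine Finset.sum_congr rfl fun x _ => ?_
    change e (D.q x) * a x * starRingEnd ℂ (e (D.q x) * b x) = _
    rw [map_mul, conj_e, e_neg]
    field_simp [e_ne_zero (D.q x)]
  have hS : D.weil mpS ∈ unitaryGL A := by
    intro a b
    have hcard : (Fintype.card A : ℂ) ≠ 0 := by exact_mod_cast Fintype.card_ne_zero
    change herm (D.weilEnd mpS a) (D.weilEnd mpS b) = _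
    have h1 : ∀ a : A → ℂ, D.weilEnd mpS a = (D.gz 1)⁻¹ • fun y => ∑ x, e (-D.bil x y) * a x :=
      fun a => D.weilEnd_S a
    rw [h1, h1, herm_smul_smul, map_inv₀, conj_gz_one, ← mul_inv, D.gz_one_mul_conj]
    have h2 : ∀ x z : A, ∑ y, e (-D.bil x y) * starRingEnd ℂ (e (-D.bil z y)) =
        if x = z then (Fintype.card A : ℂ) else 0 := by
      intro x z
      have h3 : ∀ y, e (-D.bil x y) * starRingEnd ℂ (e (-D.bil z y)) = e (D.bil (z - x) y) := by
        intro y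
        rw [conj_e, ← e_add, sub_eq_add_neg, bil_add_left, bil_neg_left]
        congr 1; abel
      rw [Finset.sum_congr rfl fun y _ => h3 y, sum_e_bil]
      simp only [sub_eq_zero, eq_comm]
    have h4 : herm (fun y => ∑ x, e (-D.bil x y) * a x) (fun y => ∑ x, e (-D.bil x y) * b x) =
        ∑ x, ∑ z, a x * starRingEnd ℂ (b z) *
          ∑ y, e (-D.bil x y) * starRingEnd ℂ (e (-D.bil z y)) := by
      have h5 : ∀ y, (∑ x, e (-D.bil x y) * a x) * starRingEnd ℂ (∑ x, e (-D.bil x y) * b x) =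
          ∑ x, ∑ z, a x * starRingEnd ℂ (b z) *
            (e (-D.bil x y) * starRingEnd ℂ (e (-D.bil z y))) := fun y => by
        rw [map_sum, Finset.sum_mul_sum]
        refine Finset.sum_congr rfl fun x _ => Finset.sum_congr rfl fun z _ => ?_
        rw [map_mul]; ring
      rw [herm, Finset.sum_congr rfl fun y _ => h5 y, Finset.sum_comm]
      refine Finset.sum_congr rfl fun x _ => ?_
      rw [Finset.sum_comm]
      simp only [Finset.mul_sum]
    rw [h4]
    simp only [h2, mul_ite, mul_zero, Finset.sum_ite_eq, Finset.mem_univ, if_true]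
    rw [herm, Finset.mul_sum]
    refine Finset.sum_congr rfl fun x _ => ?_
    field_simp
  have h : Subgroup.closure {mpS, mpT} ≤ (unitaryGL A).comap D.weil := by
    rw [Subgroup.closure_le]
    rintro g (rfl | rfl)
    · exact hS
    · exact hT
  rw [closure_mpS_mpT] at h
  exact h (Subgroup.mem_top g)

lemma dilation_mem_unitary {m : ℕ} (hm : m.Coprime D.level) :
    D.dilation hm ∈ unitaryGL A := fun a b =>
  (Equiv.ofBijective _ (D.mul_bijective hm)).sum_comp fun x => a x * starRingEnd ℂ (b x)

/-! ### The Petersson integrand -/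

lemma im_moebius (M : GL(2, ℚ)⁺) (τ : ℍ) :
    (moebius M τ).im = detQ M * τ.im / Complex.normSq (autJ M τ) := by
  have h : ((toGLReal M).det : ℝˣ).val = ((detQ M : ℚ) : ℝ) := by
    simp [toGLReal, detQ, mat, Matrix.det_fin_two]
  have h0 : (0 : ℝ) < detQ M := by exact_mod_cast detQ_pos M
  rw [moebius, UpperHalfPlane.im_smul_eq_div_normSq, h, abs_of_pos h0]
  rfl

/-- The slash operator of a unitary triple moves the Petersson integrand by the Möbius action. -/
lemma peterssonIntegrand_slash {κ : ℤ} (f g : ℍ → A → ℂ) {ξ : D.TripleGroup}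
    (hξ : ξ.2.2 ∈ unitaryGL A) (τ : ℍ) :
    peterssonIntegrand κ (D.slashOdd κ f ξ) (D.slashOdd κ g ξ) τ =
      peterssonIntegrand κ f g (moebius ξ.1.M τ) := by
  have hu := (unitaryGL A).inv_mem hξ
  have h0 : (0 : ℝ) < detQ ξ.1.M := by exact_mod_cast detQ_pos _
  have hn : 0 < ‖ξ.1.φ τ‖ := norm_pos_iff.mpr (ξ.1.φ_ne_zero τ)
  change herm _ _ * _ = herm _ _ * _
  rw [slashOdd, slashOdd, herm_smul_smul, hu, Complex.mul_conj, Complex.normSq_eq_norm_sq, norm_mul,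
    norm_zpow, Complex.norm_real, Real.norm_of_nonneg (Real.rpow_nonneg h0.le _), im_moebius,
    ← ξ.1.sq, Complex.normSq_eq_norm_sq, norm_pow, mul_comm _ (herm _ _), mul_assoc]
  congr 1
  rw [← Complex.ofReal_mul]
  congr 1
  rw [Real.div_rpow (by have := τ.im_pos; positivity) (by positivity),
    Real.mul_rpow h0.le τ.im_pos.le, mul_pow, ← Real.rpow_intCast, ← Real.rpow_natCast (_ ^ (_ : ℝ)),
    ← Real.rpow_natCast (_ ^ (_ : ℝ)), ← Real.rpow_mul h0.le, ← Real.rpow_mul hn.le, ← pow_mul,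
    ← Real.rpow_natCast ‖_‖, ← Real.rpow_mul hn.le, div_eq_mul_inv (_ * _), ← Real.rpow_neg hn.le]
  push_cast
  rw [show (κ : ℝ) / 4 * 2 = κ / 2 by ring, show -(κ : ℝ) * 2 = -(4 * (κ / 2)) by ring]
  ring

/-! ### Convergence of the Petersson integral -/

/-- Exponential decay at infinity. -/
def ExpDecay (f : ℍ → A → ℂ) : Prop :=
  ∃ ε : ℝ, 0 < ε ∧ f =O[UpperHalfPlane.atImInfty] fun τ => Real.exp (-ε * τ.im)

lemma expDecay_of_isZeroAtImInfty {κ : ℤ} {f : ℍ → A → ℂ} (hf : f ∈ D.modularForms κ)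
    (h0 : UpperHalfPlane.IsZeroAtImInfty f) : ExpDecay f := by
  have hN : (0 : ℝ) < D.level := by exact_mod_cast D.level_pos
  have hper : ∀ τ : ℍ, f (moebius (mpT ^ (D.level : ℤ)).1.M τ) = f τ := by
    intro τ
    have h1 := hf.2.1 (mpT ^ (D.level : ℤ)) τ
    change _ = _ • D.weilEnd _ _ at h1
    have h2 := D.killed_level.weilEnd_T_zpow_mul 1
    rw [mul_one] at h2
    have h3 : ∀ n : ℕ, ∀ τ, (mpT ^ n).1.φ τ = 1 := by
      intro n
      induction n with
      | zero => intro τ; rfl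
      | succ n ih => intro τ; rw [pow_succ, MpZ_mul_φ, ih, mpT_φ, one_mul]
    rw [h1, h2, zpow_natCast, h3]
    simp
  refine ⟨2 * Real.pi / D.level, by positivity, ?_⟩
  rw [Asymptotics.isBigO_pi]
  intro x
  have hz : UpperHalfPlane.IsZeroAtImInfty fun τ => f τ x :=
    (tendsto_pi_nhds.mp h0) x
  have hb : UpperHalfPlane.IsBoundedAtImInfty fun τ => f τ x :=
    Filter.Tendsto.isBigO_one _ hz
  have hd : MDifferentiable 𝓘(ℂ) 𝓘(ℂ) fun τ => f τ x :=
    ((ContinuousLinearMap.proj (R := ℂ) (φ := fun _ : A => ℂ) x).mdifferentiable).comp hf.1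
  have hp : Function.Periodic ((fun τ => f τ x) ∘ UpperHalfPlane.ofComplex) (D.level : ℝ) := by
    intro z
    by_cases hz : 0 < z.im
    · have hz' : 0 < (z + ((D.level : ℝ) : ℂ)).im := by simpa using hz
      have h4 := hper ⟨z, hz⟩
      simp only [Function.comp]
      rw [UpperHalfPlane.ofComplex_apply_of_im_pos hz, UpperHalfPlane.ofComplex_apply_of_im_pos hz',
        ← h4]
      have h5 : moebius (mpT ^ (D.level : ℤ)).1.M ⟨z, hz⟩ = ⟨z + ((D.level : ℝ) : ℂ), hz'⟩ := by
        apply UpperHalfPlane.ext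
        rw [← ofSL_toSL, moebius_ofSL, toSL_T_zpow, ModularGroup.coe_T_zpow_smul_eq]
        simp
      rw [h5]
    · have hz' : (z + ((D.level : ℝ) : ℂ)).im ≤ 0 := by simpa using hz
      simp only [Function.comp]
      rw [UpperHalfPlane.ofComplex_apply_eq_of_im_nonpos (not_lt.mp hz) hz']
  have h5 := hz.exp_decay_atImInfty hN hp hd hb
  refine h5.congr_right fun τ => ?_
  congr 1
  ring

lemma ExpDecay.slashOdd {D : DiscriminantForm A} {κ : ℤ} {f : ℍ → A → ℂ} (hf : f ∈ D.inv κ)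
    (h : ExpDecay f) (ξ : D.TripleGroup) : ExpDecay (D.slashOdd κ f ξ) := by
  obtain ⟨ζ, hζ, hfζ⟩ := D.exists_slashOdd_eq hf ξ
  rw [hfζ]
  obtain ⟨ε, hε, hO⟩ := h
  have h0 : (0 : ℝ) < detQ ζ.1.M := by exact_mod_cast detQ_pos _
  have hJ : ∀ τ, autJ ζ.1.M τ = mat ζ.1.M 1 1 := fun τ => by rw [autJ_eq, hζ]; simp
  have hJ0 : 0 < Complex.normSq (mat ζ.1.M 1 1 : ℂ) := by
    rw [Complex.normSq_pos, ← hJ UpperHalfPlane.I]; exact autJ_ne_zero _ _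
  refine ⟨ε * (detQ ζ.1.M / Complex.normSq (mat ζ.1.M 1 1 : ℂ)), by positivity, ?_⟩
  refine ((D.slashOdd_isBigO f hζ).trans (hO.comp_tendsto (tendsto_moebius hζ))).congr_right
    fun τ => ?_
  simp only [Function.comp]
  rw [im_moebius, hJ]
  congr 1
  ring

lemma norm_herm_le (a b : A → ℂ) : ‖herm a b‖ ≤ Fintype.card A * (‖a‖ * ‖b‖) := by
  refine (norm_sum_le _ _).trans ?_
  rw [← nsmul_eq_mul, ← Finset.card_univ]
  refine Finset.sum_le_card_nsmul _ _ _ fun x _ => ?_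
  rw [norm_mul, RCLike.norm_conj]
  exact mul_le_mul (norm_le_pi_norm a x) (norm_le_pi_norm b x) (norm_nonneg _) (norm_nonneg _)

lemma continuous_peterssonIntegrand {κ : ℤ} {f g : ℍ → A → ℂ} (hf : Continuous f)
    (hg : Continuous g) : Continuous (peterssonIntegrand κ f g) := by
  have h1 : ∀ x, Continuous fun τ => f τ x := fun x => (continuous_apply x).comp hf
  have h2 : ∀ x, Continuous fun τ => g τ x := fun x => (continuous_apply x).comp hg
  refine Continuous.mul ?_ (Complex.continuous_ofReal.comp ?_)
  · exact continuous_finsetSum _ fun x _ => (h1 x).mul (Complex.continuous_conj.comp (h2 x))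
  · exact UpperHalfPlane.continuous_im.rpow_const fun τ => Or.inl τ.im_ne_zero

lemma integrableOn_of_isBigO {F : ℍ → ℂ} (hF : Continuous F)
    (hO : F =O[UpperHalfPlane.atImInfty] (1 : ℍ → ℝ)) : IntegrableOn F ModularGroup.fd := by
  obtain ⟨C, hC⟩ := hO.bound
  obtain ⟨Y, hY⟩ := (UpperHalfPlane.atImInfty_mem _).mp hC
  obtain ⟨E, hE⟩ := (ModularGroup.isCompact_truncatedFundamentalDomain Y).exists_bound_of_continuousOn
    hF.continuousOn
  refine IntegrableOn.of_bound volume_fd_lt_top hF.aestronglyMeasurable (max C E) ?_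
  refine ae_restrict_of_forall_mem measurableSet_fd fun τ hτ => ?_
  rcases le_total τ.im Y with h | h
  · exact (hE τ ⟨hτ, h⟩).trans (le_max_right _ _)
  · have := hY τ h
    simp only [Set.mem_ofPred_eq, Pi.one_apply, norm_one, mul_one] at this
    exact this.trans (le_max_left _ _)

/-- One exponentially decaying factor outweighs the polynomial growth at the cusp. -/
lemma integrableOn_peterssonIntegrand {κ : ℤ} {f g : ℍ → A → ℂ} (hf : Continuous f)
    (hg : Continuous g) (hfb : UpperHalfPlane.IsBoundedAtImInfty f)
    (hgb : UpperHalfPlane.IsBoundedAtImInfty g) (h : ExpDecay f ∨ ExpDecay g) :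
    IntegrableOn (peterssonIntegrand κ f g) ModularGroup.fd := by
  refine integrableOn_of_isBigO (continuous_peterssonIntegrand hf hg) ?_
  have h1 : peterssonIntegrand κ f g =O[UpperHalfPlane.atImInfty]
      fun τ => (‖f τ‖ * ‖g τ‖) * τ.im ^ ((κ : ℝ) / 2) := by
    refine Asymptotics.IsBigO.of_bound (Fintype.card A) (Filter.Eventually.of_forall fun τ => ?_)
    have hp : 0 ≤ τ.im ^ ((κ : ℝ) / 2) := Real.rpow_nonneg τ.im_pos.le _
    change ‖herm _ _ * _‖ ≤ _
    rw [norm_mul, Complex.norm_real, norm_mul (_ * _), ← mul_assoc]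
    refine mul_le_mul_of_nonneg_right ?_ (norm_nonneg _)
    rw [Real.norm_of_nonneg (by positivity)]
    exact norm_herm_le _ _
  obtain ⟨ε, hε, h2⟩ : ∃ ε : ℝ, 0 < ε ∧ (fun τ => ‖f τ‖ * ‖g τ‖) =O[UpperHalfPlane.atImInfty]
      fun τ => Real.exp (-ε * τ.im) := by
    rcases h with ⟨ε, hε, h⟩ | ⟨ε, hε, h⟩
    · exact ⟨ε, hε, by simpa using h.norm_left.mul hgb.norm_left⟩
    · exact ⟨ε, hε, by simpa using hfb.norm_left.mul h.norm_left⟩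
  have h3 : (fun τ : ℍ => Real.exp (-ε * τ.im)) =O[UpperHalfPlane.atImInfty]
      fun τ => τ.im ^ (-((κ : ℝ) / 2)) :=
    (isLittleO_exp_neg_mul_rpow_atTop hε (-((κ : ℝ) / 2))).isBigO.comp_tendsto
      (Filter.tendsto_comap (f := UpperHalfPlane.im))
  refine h1.trans (((h2.trans h3).mul (Asymptotics.isBigO_refl _ _)).congr_right fun τ => ?_)
  rw [← Real.rpow_add τ.im_pos, neg_add_cancel, Real.rpow_zero]
  rfl

end DiscriminantForm

open MeasureTheory

namespace DiscriminantForm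

variable {A : Type*} [AddCommGroup A] [Fintype A] (D : DiscriminantForm A)

/-! ### The adjoint of a Hecke operator -/

lemma zc_mul (n : D.CoprimeIndex) (η : D.TripleGroup) : D.zc n * η = η * D.zc n := by
  refine Prod.ext (Mp.ext ?_ (funext fun τ => ?_)) (Prod.ext ?_ ?_)
  · change scal n.1 n.2.1 * η.1.M = η.1.M * scal n.1 n.2.1
    rw [← mat_injective.eq_iff, mat_mul, mat_mul, mat_scal]
    ext i j
    fin_cases i <;> fin_cases j <;> simp [Matrix.mul_apply, Fin.sum_univ_two] <;> ring
  · change (Mp.principal (scal n.1 n.2.1)).φ (moebius η.1.M τ) * η.1.φ τ =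
      η.1.φ (moebius (scal n.1 n.2.1) τ) * (Mp.principal (scal n.1 n.2.1)).φ τ
    rw [principal_scal_φ, principal_scal_φ, moebius_scal, mul_comm]
  · exact mul_comm _ _
  · exact (one_mul _).trans (mul_one _).symm

lemma xi_inv (m : D.CoprimeIndex) : (D.xi m)⁻¹ =
    D.sectionL mpS * ((D.zc (m * m))⁻¹ * D.xi m) * D.sectionL mpS⁻¹ := by
  have h := D.xi_mul_S_mul_xi m
  have h1 : (D.xi m)⁻¹ = D.sectionL mpS * D.xi m * (D.zc (m * m) * D.sectionL mpS)⁻¹ := by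
    rw [← h]; group
  rw [h1, map_inv, mul_inv_rev, ← mul_assoc, mul_assoc (_ * _) _ (_ : D.TripleGroup)⁻¹]
  have h2 := D.zc_mul (m * m) (D.sectionL mpS * D.xi m * (D.sectionL mpS)⁻¹)
  have h3 := D.zc_mul (m * m) (D.sectionL mpS)
  rw [← mul_assoc, eq_comm, ← mul_assoc (D.sectionL mpS)]
  have h4 : D.sectionL mpS * (D.zc (m * m))⁻¹ = (D.zc (m * m))⁻¹ * D.sectionL mpS := by
    rw [mul_inv_eq_iff_eq_mul, mul_assoc, ← h3, inv_mul_cancel_left]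
  rw [h4, mul_assoc, mul_assoc, ← mul_assoc (D.sectionL mpS), inv_mul_eq_iff_eq_mul, ← mul_assoc,
    h2, mul_inv_cancel_right]

lemma stab_zc_inv_mul (m n : D.CoprimeIndex) :
    stab D.Del ((D.zc n)⁻¹ * D.xi m) = stab D.Del (D.xi m) := by
  ext y
  rw [mem_stab, mem_stab]
  have h : (D.zc n)⁻¹ * D.xi m * y * ((D.zc n)⁻¹ * D.xi m)⁻¹ = D.xi m * y * (D.xi m)⁻¹ := by
    have := D.zc_mul n (D.xi m * y * (D.xi m)⁻¹)
    rw [mul_inv_rev, inv_inv, ← mul_assoc, mul_assoc _ (D.xi m), mul_assoc _ _ (D.xi m)⁻¹, mul_assoc,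
      ← this, inv_mul_cancel_left]
  rw [h]

lemma xi_inv_mem_doubleCoset (m : D.CoprimeIndex) : (D.xi m)⁻¹ ∈
    DoubleCoset.doubleCoset ((D.zc (m * m))⁻¹ * D.xi m) (D.Del : Set D.TripleGroup) D.Del := by
  rw [xi_inv]
  exact D.mul_mul_mem_doubleCoset _ _ _

lemma stab_xi_inv_index (m : D.CoprimeIndex) :
    (stab D.Del (D.xi m)⁻¹).index = (stab D.Del (D.xi m)).index := by
  rw [stab_index_of_mem (D.xi_inv_mem_doubleCoset m), stab_zc_inv_mul]

lemma finCoset_xi_inv (m : D.CoprimeIndex) : FinCoset D.Del (D.xi m)⁻¹ := by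
  rw [FinCoset, Subgroup.finiteIndex_iff, stab_xi_inv_index]
  exact (D.finCoset_xi m).index_ne_zero

/-- The double cosets of `ξ_m` and `ξ_m⁻¹` define the same operator, since they agree up to a
central element that acts trivially. -/
lemma heckeMean_xi_inv {κ : ℤ} (m : D.CoprimeIndex) {f : ℍ → A → ℂ} (hf : f ∈ D.inv κ) :
    D.heckeMean κ (D.xi m)⁻¹ f = D.heckeMean κ (D.xi m) f := by
  have hfin : FinCoset D.Del ((D.zc (m * m))⁻¹ * D.xi m) := by
    rw [FinCoset, stab_zc_inv_mul]; exact D.finCoset_xi m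
  have h0 : D.slashOdd κ f (D.zc (m * m))⁻¹ = f := by
    conv_lhs => rw [← D.slashOdd_zc κ (m * m) f]
    rw [← slashOdd_mul, mul_inv_cancel, slashOdd_one]
  rw [heckeMean, cosetMean_of_mem hfin (D.xi_inv_mem_doubleCoset m) hf,
    cosetMean_of_ract_eq (D.finCoset_xi m) hfin hf (c := 1) ?_, one_smul]
  rw [one_smul, ract_slash, ract_slash, slashOdd_mul, h0]

/-- The group of triples acts on `ℍ` through the first component. -/
instance : MulAction D.TripleGroup ℍ where
  smul ξ τ := moebius ξ.1.M τ
  one_smul := moebius_one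
  mul_smul ξ η := moebius_mul ξ.1.M η.1.M

instance : MeasurableConstSMul D.TripleGroup ℍ where
  measurable_const_smul ξ := (continuous_moebius ξ.1.M).measurable

instance : SMulInvariantMeasure D.TripleGroup ℍ volume where
  measure_preimage_smul ξ _ hs := (measurePreserving_moebius ξ.1.M).measure_preimage hs.nullMeasurableSet

instance : Countable D.Del := by
  have := countable_MpZ
  exact D.sectionL.rangeRestrict_surjective.countable

lemma tsum_indicator_fd_Del : ∀ᵐ τ : ℍ, ∑' δ : D.Del,
    ModularGroup.fd.indicator (1 : ℍ → ENNReal) (δ • τ) = kerCount := by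
  have hinj : Function.Injective D.sectionL := fun g h hgh =>
    Subtype.ext (congrArg Prod.fst hgh)
  filter_upwards [tsum_indicator_fd] with τ hτ
  rw [← hτ, ← (MonoidHom.ofInjective hinj).toEquiv.tsum_eq]
  rfl

lemma continuous_slashOdd {κ : ℤ} {f : ℍ → A → ℂ} (hf : MDifferentiable 𝓘(ℂ) 𝓘(ℂ, A → ℂ) f)
    (ξ : D.TripleGroup) : Continuous (D.slashOdd κ f ξ) :=
  (D.mdifferentiable_slashOdd hf ξ).continuous

lemma peterssonIntegrand_mean_left {κ : ℤ} {Γ : Type*} [Group Γ] (L : Subgroup Γ) [L.FiniteIndex]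
    (F : Γ → ℍ → A → ℂ) (g : ℍ → A → ℂ) (τ : ℍ) : peterssonIntegrand κ (mean L F) g τ =
      (L.index : ℂ)⁻¹ * ∑ᶠ c : Γ ⧸ L, peterssonIntegrand κ (F (Quotient.out c)) g τ := by
  have := Fintype.ofFinite (Γ ⧸ L)
  simp only [peterssonIntegrand, mean, finsum_eq_sum_of_fintype]
  rw [← Finset.sum_mul, ← mul_assoc, Finset.sum_comm, Finset.mul_sum]
  congr 1
  refine Finset.sum_congr rfl fun x _ => ?_
  rw [Pi.smul_apply, Pi.smul_apply, Finset.sum_apply, Finset.sum_apply, smul_eq_mul, mul_assoc,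
    Finset.sum_mul]

lemma peterssonIntegrand_mean_right {κ : ℤ} {Γ : Type*} [Group Γ] (L : Subgroup Γ) [L.FiniteIndex]
    (f : ℍ → A → ℂ) (F : Γ → ℍ → A → ℂ) (τ : ℍ) : peterssonIntegrand κ f (mean L F) τ =
      (L.index : ℂ)⁻¹ * ∑ᶠ c : Γ ⧸ L, peterssonIntegrand κ f (F (Quotient.out c)) τ := by
  have := Fintype.ofFinite (Γ ⧸ L)
  simp only [peterssonIntegrand, mean, finsum_eq_sum_of_fintype]
  rw [← Finset.sum_mul, ← mul_assoc, Finset.sum_comm, Finset.mul_sum]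
  congr 1
  refine Finset.sum_congr rfl fun x _ => ?_
  rw [Pi.smul_apply, Pi.smul_apply, Finset.sum_apply, Finset.sum_apply, smul_eq_mul, map_mul,
    map_inv₀, Complex.conj_natCast, map_sum, mul_left_comm, Finset.mul_sum]

lemma unitary_xi (m : D.CoprimeIndex) : (D.xi m).2.2 ∈ unitaryGL A := D.dilation_mem_unitary m.2.2

lemma unitary_Del (δ : D.Del) : (δ : D.TripleGroup).2.2 ∈ unitaryGL A := by
  obtain ⟨_, g, rfl⟩ := δ
  exact D.weil_mem_unitary g

/-- The normalised Hecke operators are self-adjoint. -/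
theorem petersson_heckeMean {κ : ℤ} (m : D.CoprimeIndex) {f g : ℍ → A → ℂ}
    (hf : f ∈ D.modularForms κ) (hg : g ∈ D.modularForms κ)
    (hcusp : UpperHalfPlane.IsZeroAtImInfty f ∨ UpperHalfPlane.IsZeroAtImInfty g) :
    petersson κ (D.heckeMean κ (D.xi m) f) g = petersson κ f (D.heckeMean κ (D.xi m) g) := by
  obtain ⟨hf1, hf2, hf3⟩ := D.mem_modularForms_iff.mp hf
  obtain ⟨hg1, hg2, hg3⟩ := D.mem_modularForms_iff.mp hg
  have hexp : ExpDecay f ∨ ExpDecay g :=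
    hcusp.imp (D.expDecay_of_isZeroAtImInfty hf) (D.expDecay_of_isZeroAtImInfty hg)
  rw [← D.heckeMean_xi_inv m hg2]
  have hidx := D.stab_xi_inv_index m
  have hfin := D.finCoset_xi m
  have hfin' := D.finCoset_xi_inv m
  have hξ := D.unitary_xi m
  generalize D.xi m = ξ at *
  have hfδ : ∀ δ : D.Del, D.slashOdd κ f δ = f := fun δ => hf2 δ δ.2
  have hgδ : ∀ δ : D.Del, D.slashOdd κ g δ = g := fun δ => hg2 δ δ.2
  let Φ : ℍ → ℂ := peterssonIntegrand κ (D.slashOdd κ f ξ) g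
  have hΦ1 : ∀ (y : D.Del) (τ : ℍ), Φ (y⁻¹ • τ) =
      peterssonIntegrand κ (D.slashOdd κ f (ξ * (y⁻¹ : D.Del))) g τ := by
    intro y τ
    have := D.peterssonIntegrand_slash (κ := κ) (D.slashOdd κ f ξ) g (D.unitary_Del y⁻¹) τ
    rw [hgδ, ← slashOdd_mul] at this
    exact this.symm
  have hΦ2 : ∀ (y : D.Del) (τ : ℍ), Φ (ξ⁻¹ • y⁻¹ • τ) =
      peterssonIntegrand κ f (D.slashOdd κ g (ξ⁻¹ * (y⁻¹ : D.Del))) τ := by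
    intro y τ
    have hu : (ξ⁻¹ * (y⁻¹ : D.Del)).2.2 ∈ unitaryGL A :=
      (unitaryGL A).mul_mem ((unitaryGL A).inv_mem hξ) (D.unitary_Del y⁻¹)
    have := D.peterssonIntegrand_slash (κ := κ) (D.slashOdd κ f ξ) g hu τ
    rw [← slashOdd_mul, mul_inv_cancel_left, hfδ] at this
    rw [this]
    change Φ _ = Φ _
    congr 1
    exact (mul_smul _ _ _).symm
  have hcont : Continuous Φ := continuous_peterssonIntegrand (D.continuous_slashOdd hf1 ξ) hg1.continuous
  have hinv : ∀ (k : stab D.Del ξ) (τ : ℍ), Φ (k • τ) = Φ τ := by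
    intro k τ
    have h1 := hΦ1 (k : D.Del)⁻¹ τ
    rw [inv_inv] at h1
    refine h1.trans ?_
    have h2 : ξ * (k : D.Del) = (⟨ξ * (k : D.Del) * ξ⁻¹, k.2⟩ : D.Del) * ξ := by
      rw [inv_mul_cancel_right]
    rw [h2, slashOdd_mul, hfδ]
  have hi1 : ∀ y : D.Del, IntegrableOn (peterssonIntegrand κ
      (D.slashOdd κ f (ξ * (y⁻¹ : D.Del))) g) ModularGroup.fd := fun y =>
    integrableOn_peterssonIntegrand (D.continuous_slashOdd hf1 _) hg1.continuous
      (D.isBoundedAtImInfty_slashOdd hf2 hf3 _) hg3 (hexp.imp_left fun h => h.slashOdd hf2 _)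
  have hi2 : ∀ y : D.Del, IntegrableOn (peterssonIntegrand κ f
      (D.slashOdd κ g (ξ⁻¹ * (y⁻¹ : D.Del)))) ModularGroup.fd := fun y =>
    integrableOn_peterssonIntegrand hf1.continuous (D.continuous_slashOdd hg1 _) hf3
      (D.isBoundedAtImInfty_slashOdd hg2 hg3 _) (hexp.imp_right fun h => h.slashOdd hg2 _)
  have main := finsum_integral_eq (volume : Measure ℍ) measurableSet_fd kerCount_ne_zero
    kerCount_ne_top D.tsum_indicator_fd_Del hfin hfin' hcont.measurable hinv
    (fun y => (hi1 y).congr_fun (fun τ _ => (hΦ1 y τ).symm) measurableSet_fd)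
    (fun y => (hi2 y).congr_fun (fun τ _ => (hΦ2 y τ).symm) measurableSet_fd)
  rw [petersson, petersson]
  have := Fintype.ofFinite (D.Del ⧸ stab D.Del ξ)
  have := Fintype.ofFinite (D.Del ⧸ stab D.Del ξ⁻¹)
  have e1 : ∀ τ, peterssonIntegrand κ (D.heckeMean κ ξ f) g τ = ((stab D.Del ξ).index : ℂ)⁻¹ *
      ∑ c : D.Del ⧸ stab D.Del ξ, peterssonIntegrand κ
        (D.slashOdd κ f (ξ * ((Quotient.out c)⁻¹ : D.Del))) g τ := fun τ => by
    rw [heckeMean, cosetMean, peterssonIntegrand_mean_left, finsum_eq_sum_of_fintype]; rfl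
  have e2 : ∀ τ, peterssonIntegrand κ f (D.heckeMean κ ξ⁻¹ g) τ = ((stab D.Del ξ).index : ℂ)⁻¹ *
      ∑ c : D.Del ⧸ stab D.Del ξ⁻¹, peterssonIntegrand κ f
        (D.slashOdd κ g (ξ⁻¹ * ((Quotient.out c)⁻¹ : D.Del))) τ := fun τ => by
    rw [heckeMean, cosetMean, peterssonIntegrand_mean_right, finsum_eq_sum_of_fintype,
      hidx]; rfl
  simp only [e1, e2]
  rw [integral_const_mul, integral_const_mul, integral_finsetSum _ fun c _ => hi1 _,
    integral_finsetSum _ fun c _ => hi2 _]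
  rw [finsum_eq_sum_of_fintype, finsum_eq_sum_of_fintype] at main
  congr 1
  refine Eq.trans (Finset.sum_congr rfl fun c _ => ?_) (main.trans (Finset.sum_congr rfl fun c _ => ?_))
  · exact integral_congr_ae (Filter.Eventually.of_forall fun τ => (hΦ1 _ τ).symm)
  · exact integral_congr_ae (Filter.Eventually.of_forall fun τ => hΦ2 _ τ)

end DiscriminantForm

open MeasureTheory

namespace DiscriminantForm

variable {A : Type*} [AddCommGroup A] [Fintype A] (D : DiscriminantForm A)

/-! ### The algebra of Hecke operators -/

lemma mem_inv {κ : ℤ} (f : D.modularForms κ) : (f : ℍ → A → ℂ) ∈ D.inv κ :=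
  (D.mem_modularForms_iff.mp f.2).2.1

/-- The operator `T(m²)*` on the space of modular forms. -/
def heckeT (κ : ℤ) (m : D.CoprimeIndex) : Module.End ℂ (D.modularForms κ) :=
  (D.heckeFactor κ m : ℂ) • D.heckeEnd κ m

lemma heckeT_apply (κ : ℤ) (m : D.CoprimeIndex) (f : D.modularForms κ) :
    (D.heckeT κ m f : ℍ → A → ℂ) = (D.heckeFactor κ m : ℂ) • D.heckeMean κ (D.xi m) f := rfl

lemma heckeT_algebra (κ : ℤ) :
    (∀ x ∈ Algebra.adjoin ℂ (Set.range (D.heckeT κ)), ∀ y ∈ Algebra.adjoin ℂ (Set.range (D.heckeT κ)),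
      x * y = y * x) ∧
    Algebra.adjoin ℂ (D.heckeT κ '' {p : D.CoprimeIndex | p.1.Prime}) =
      Algebra.adjoin ℂ (Set.range (D.heckeT κ)) := by
  refine adjoin_of_recursion (N := D.heckeEnd κ) (t := fun m => (D.heckeFactor κ m : ℂ))
    (fun m => by exact_mod_cast heckeFactor_ne_zero κ m) (fun m => rfl) ?_ ?_ ?_
  · exact LinearMap.ext fun f => Subtype.ext (D.heckeMean_ione (D.mem_inv f))
  · exact fun m n hmn => LinearMap.ext fun f =>
      Subtype.ext (D.heckeMean_mul_of_coprime hmn (D.mem_inv f))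
  · intro p hp k
    obtain ⟨a, b, c, ha, h⟩ := D.heckeMean_recursion κ hp k
    exact ⟨a, b, c, ha, LinearMap.ext fun f => Subtype.ext (h f (D.mem_inv f))⟩

lemma petersson_smul_left (κ : ℤ) (c : ℂ) (f g : ℍ → A → ℂ) :
    petersson κ (c • f) g = c * petersson κ f g := by
  rw [petersson, petersson, ← integral_const_mul]
  congr 1
  funext τ
  simp only [peterssonIntegrand, Pi.smul_apply, smul_eq_mul, mul_assoc, ← Finset.mul_sum]

lemma petersson_smul_right (κ : ℤ) (c : ℂ) (f g : ℍ → A → ℂ) :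
    petersson κ f (c • g) = starRingEnd ℂ c * petersson κ f g := by
  rw [petersson, petersson, ← integral_const_mul]
  congr 1
  funext τ
  simp only [peterssonIntegrand, Pi.smul_apply, smul_eq_mul, map_mul, mul_left_comm _ (starRingEnd ℂ c),
    ← Finset.mul_sum, mul_assoc]

lemma integrableOn_of_isZeroAtImInfty {κ : ℤ} (f g : D.modularForms κ)
    (h : UpperHalfPlane.IsZeroAtImInfty (f : ℍ → A → ℂ) ∨
      UpperHalfPlane.IsZeroAtImInfty (g : ℍ → A → ℂ)) :
    IntegrableOn (peterssonIntegrand κ (f : ℍ → A → ℂ) g) ModularGroup.fd :=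
  integrableOn_peterssonIntegrand f.2.1.continuous g.2.1.continuous f.2.2.2 g.2.2.2
    (h.imp (D.expDecay_of_isZeroAtImInfty f.2) (D.expDecay_of_isZeroAtImInfty g.2))

lemma isZeroAtImInfty_heckeT {κ : ℤ} (m : D.CoprimeIndex) (f : D.modularForms κ)
    (h : UpperHalfPlane.IsZeroAtImInfty (f : ℍ → A → ℂ)) :
    UpperHalfPlane.IsZeroAtImInfty (D.heckeT κ m f : ℍ → A → ℂ) :=
  Filter.ZeroAtFilter.smul (D.heckeFactor κ m : ℂ)
    (D.isZeroAtImInfty_heckeMean (D.xi m) (D.mem_inv f) h)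

end DiscriminantForm

end VVHecke

end

theorem mainTheorem2 {A : Type*} [AddCommGroup A] [Fintype A]
    (D : VVHecke.DiscriminantForm A) (κ : ℤ) :
    ∃ T : D.CoprimeIndex → Module.End ℂ (D.modularForms κ),
      -- `T m` is the operator `f ↦ f ∣ T(m²)*` on `M_{k,A}`
      (∀ (m : D.CoprimeIndex) (f : D.modularForms κ),
        ((T m f : D.modularForms κ) : ℍ → A → ℂ) = D.heckeSq κ m f) ∧
      -- the generated algebra is commutative
      (∀ x ∈ Algebra.adjoin ℂ (Set.range T), ∀ y ∈ Algebra.adjoin ℂ (Set.range T),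
        x * y = y * x) ∧
      -- it is generated by the operators of prime index
      Algebra.adjoin ℂ (T '' {p : D.CoprimeIndex | p.1.Prime}) =
        Algebra.adjoin ℂ (Set.range T) ∧
      -- cusp forms are preserved
      (∀ (m : D.CoprimeIndex), ∀ f ∈ D.cuspForms κ, T m f ∈ D.cuspForms κ) ∧
      -- self-adjointness for the Petersson scalar product
      (∀ (m : D.CoprimeIndex) (f g : D.modularForms κ),
        (f ∈ D.cuspForms κ ∨ g ∈ D.cuspForms κ) →
        MeasureTheory.IntegrableOn
          (VVHecke.DiscriminantForm.peterssonIntegrand κ (T m f : ℍ → A → ℂ) g)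
          ModularGroup.fd ∧
        MeasureTheory.IntegrableOn
          (VVHecke.DiscriminantForm.peterssonIntegrand κ f (T m g : ℍ → A → ℂ))
          ModularGroup.fd ∧
        VVHecke.DiscriminantForm.petersson κ (T m f : ℍ → A → ℂ) g =
          VVHecke.DiscriminantForm.petersson κ f (T m g : ℍ → A → ℂ)) := by
  refine ⟨D.heckeT κ, fun m f => ?_, (D.heckeT_algebra κ).1, (D.heckeT_algebra κ).2,
    fun m f hf => D.isZeroAtImInfty_heckeT m f hf, fun m f g h => ⟨?_, ?_, ?_⟩⟩
  · rw [D.heckeT_apply, VVHecke.DiscriminantForm.heckeSq_eq (D.mem_inv f)]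
  · exact D.integrableOn_of_isZeroAtImInfty _ g (h.imp_left (D.isZeroAtImInfty_heckeT m f))
  · exact D.integrableOn_of_isZeroAtImInfty f _ (h.imp_right (D.isZeroAtImInfty_heckeT m g))
  · rw [D.heckeT_apply, D.heckeT_apply,
      VVHecke.DiscriminantForm.petersson_smul_left, VVHecke.DiscriminantForm.petersson_smul_right,
      Complex.conj_ofReal, D.petersson_heckeMean m f.2 g.2 h]
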